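/- Let $1\le \ell\le d-1$ and let $w=(w_1,\dots,w_d)$ be positive reals with $\sum_i w_i=1$ and $w_1=\cdots=w_\ell>w_{\ell+1}\ge\cdots\ge w_d$. Let $\mathrm{Sing}(w)$ be the set of $x\in\mathbb R^d$ such that for every $\varepsilon>0$ there is $T_0>1$ such that for all $T>T_0$ there is $(\mathbf p,q)\in\mathbb Z^d\times\mathbb Z$ with $\max_i|qx_i-p_i|^{1/w_i}<\varepsilon/T$ and $0<q<T$. Notation. Put $\xi=\max(1,\frac{d-\ell}{\ell})$. For $\varepsilon,r,t>0$ let $\varepsilon_n=\varepsilon/n$ $(n\ge1)$, $t_0=1$, $t_n=t_{n-1}+\xi nt$. Let $a_s=\mathrm{diag}(e^{w_1s},\dots,e^{w_ds},e^{-s})$, $h(x)=\begin{pmatrix}I_d&x\\0&1\end{pmatrix}$, and $b_n=\mathrm{diag}(e^{-\frac1\ell(w_{\ell+1}+\cdots+w_d)nt},\dots,e^{-\frac1\ell(w_{\ell+1}+\cdots+w_d)nt},e^{w_{\ell+1}nt},\dots,e^{w_dnt},1)$, where the first $\ell$ entries are equal. Let $\mathcal K^*_\eta$ be the set of unimodular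 lattices $\Lambda\subset\mathbb R^{d+1}$ such that every nonzero vector of the dual lattice $\Lambda^*$ has Euclidean norm at least $\eta$, and let $\mathcal L'_{d+1}$ be the set of unimodular lattices in $\mathbb R^{d+1}$ that have a primitive vector $s\,\mathbf e_{d+1}$ with $1/2<s\le1$. The fractal. Define a rooted tree $\mathcal T$ of vectors in $\mathbb R^d$ as follows. The root is $\tau_0=\mathbf 0$. For $n\ge1$, the sons of a vertex $\kappa$ of height $n-1$ are the $\tau\in\mathbb R^d$ (necessarily rational) with $|\kappa_i-\tau_i|<\varepsilon_ne^{-w_it_n-t_{n-1}}$ for all $i$, and with $a_{t_n}h(\tau)\mathbb Z^{d+1}\in\mathcal L'_{d+1}\cap\mathcal K^*_{\varepsilon_n^2}$ and $b_na_{t_n}h(\tau)\mathbb Z^{d+1}\in\mathcal K^*_r$. Let $\beta(\tau_0)=\{x:|x_i|\le e^{-w_it_1}\ \forall i\}$ and, for $\tau$ of height $n\ge1$, $\beta(\tau)=\{x:|\tau_i-x_i|\le\varepsilon_ne^{-w_it_{n+1}-t_n}\ \forall i\}$. Let $\mathcal F(\mathcal T,\beta)=\bigcup_{(\tau_n)}\bigcap_{n\ge0}\beta(\tau_n)$,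 the union being over all sequences $(\tau_n)_{n\ge0}$ that start at the root and in which $\tau_n$ is a son of $\tau_{n-1}$ for every $n\ge 1$. Claim. There is $r_0>0$, depending only on $w$, such that for all $0<\varepsilon<r<r_0$ there is $t_0^*\ge1$ such that for all $t\ge t_0^*$ $$\mathcal F(\mathcal T,\beta)\subset\mathrm{Sing}(w)\quad\text{and}\quad\dim_H\mathcal F(\mathcal T,\beta)\ge d-\frac1{1+w_1}.$$ Consequently $\dim_H\mathrm{Sing}(w)\ge d-\frac1{1+w_1}$. -/

import Mathlib

noncomputable section

namespace WeightedSingular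

/-! ### Unimodular lattices -/

section Lattices

variable {ι : Type} [Fintype ι] [DecidableEq ι]

/-- The lattice `g ℤ^ι` in the Euclidean space `ℝ^ι`. -/
def latticeOf (g : Matrix ι ι ℝ) : Set (EuclideanSpace ℝ ι) :=
  {v | ∃ z : ι → ℤ, v = WithLp.toLp 2 (g.mulVec fun i => (z i : ℝ))}

/-- The space of unimodular lattices in `ℝ^ι`: the lattices `g ℤ^ι` with `det g = 1`. -/
def unimodularLattices (ι : Type) [Fintype ι] [DecidableEq ι] :
    Set (Set (EuclideanSpace ℝ ι)) :=
  {Λ | ∃ g : Matrix ι ι ℝ, g.det = 1 ∧ Λ = latticeOf g}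

/-- The dual lattice, inside the dual space; the norm of the dual space (the operator norm)
is the Euclidean one. -/
def dualLattice (Λ : Set (EuclideanSpace ℝ ι)) : Set (StrongDual ℝ (EuclideanSpace ℝ ι)) :=
  {φ | ∀ v ∈ Λ, ∃ m : ℤ, φ v = m}

/-- The set `𝒦*_η` of unimodular lattices whose dual has no nonzero vector of norm `< η`. -/
def KStar (ι : Type) [Fintype ι] [DecidableEq ι] (η : ℝ) : Set (Set (EuclideanSpace ℝ ι)) :=
  {Λ | Λ ∈ unimodularLattices ι ∧ ∀ φ ∈ dualLattice Λ, φ ≠ 0 → η ≤ ‖φ‖}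

/-- Primitive vectors of a lattice. -/
def IsPrimitiveVector (Λ : Set (EuclideanSpace ℝ ι)) (v : EuclideanSpace ℝ ι) : Prop :=
  v ∈ Λ ∧ v ≠ 0 ∧ ∀ n : ℕ, 2 ≤ n → (n : ℝ)⁻¹ • v ∉ Λ

end Lattices

/-- The set `ℒ'` of unimodular lattices in `ℝ^{d+1}` having a primitive vector `s e_{d+1}` with
`1/2 < s ≤ 1`. Here `ℝ^{d+1}` is indexed by `Fin d ⊕ Unit`, and `e_{d+1}` is the basis vector of
the index `Sum.inr ()`. -/
def LPrime (d : ℕ) : Set (Set (EuclideanSpace ℝ (Fin d ⊕ Unit))) :=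
  {Λ | Λ ∈ unimodularLattices (Fin d ⊕ Unit) ∧
    ∃ s : ℝ, 1 / 2 < s ∧ s ≤ 1 ∧
      IsPrimitiveVector Λ (EuclideanSpace.single (Sum.inr ()) s)}

/-! ### Weighted singular vectors -/

/-- The set of `w`-singular vectors in `ℝ^d`. -/
def Sing {d : ℕ} (w : Fin d → ℝ) : Set (EuclideanSpace ℝ (Fin d)) :=
  {x | ∀ ε : ℝ, 0 < ε → ∃ T₀ : ℝ, 1 < T₀ ∧ ∀ T : ℝ, T₀ < T →
    ∃ (p : Fin d → ℤ) (q : ℤ),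
      (∀ i, |(q : ℝ) * x i - (p i : ℝ)| ^ (1 / w i) < ε / T) ∧ 0 < q ∧ (q : ℝ) < T}

/-! ### The flows -/

/-- `a_s = diag(e^{w_1 s}, …, e^{w_d s}, e^{-s})`. -/
def aMat {d : ℕ} (w : Fin d → ℝ) (s : ℝ) : Matrix (Fin d ⊕ Unit) (Fin d ⊕ Unit) ℝ :=
  Matrix.diagonal (Sum.elim (fun i => Real.exp (w i * s)) (fun _ => Real.exp (-s)))

/-- `h(x)`, the unipotent matrix with blocks `I_d`, `x`, `0`, `1`. -/
def hMat {d : ℕ} (x : EuclideanSpace ℝ (Fin d)) : Matrix (Fin d ⊕ Unit) (Fin d ⊕ Unit) ℝ :=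
  Matrix.fromBlocks 1 (Matrix.of fun i _ => x i) 0 1

/-- `b_n`: its first `ℓ` diagonal entries are `e^{-(w_{ℓ+1} + ⋯ + w_d) n t / ℓ}`, followed by
`e^{w_{ℓ+1} n t}, …, e^{w_d n t}, 1`. (The indices of `w` start at `0` here.) -/
def bMat {d : ℕ} (w : Fin d → ℝ) (ℓ : ℕ) (t : ℝ) (n : ℕ) :
    Matrix (Fin d ⊕ Unit) (Fin d ⊕ Unit) ℝ :=
  Matrix.diagonal (Sum.elim
    (fun i => if i.val < ℓ
      then Real.exp (-(1 / (ℓ : ℝ)) * (∑ j : Fin d with ℓ ≤ j.val, w j) * (n * t))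
      else Real.exp (w i * (n * t)))
    (fun _ => 1))

/-! ### The tree and the fractal -/

/-- `ξ = max(1, (d - ℓ)/ℓ)`. -/
def xi (d ℓ : ℕ) : ℝ := max 1 (((d : ℝ) - ℓ) / ℓ)

/-- The times `t_0 = 1`, `t_{n+1} = t_n + ξ (n+1) t`. -/
def tSeq (d ℓ : ℕ) (t : ℝ) : ℕ → ℝ
  | 0 => 1
  | n + 1 => tSeq d ℓ t n + xi d ℓ * ((n : ℝ) + 1) * t

/-- `ε_n = ε / n`, used for `n ≥ 1` only. -/
def epsSeq (ε : ℝ) (n : ℕ) : ℝ := ε / n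

/-- The box in which the sons of a vertex `τ` of height `n` lie. -/
def betaTilde {d : ℕ} (w : Fin d → ℝ) (ℓ : ℕ) (ε t : ℝ) (n : ℕ)
    (τ : EuclideanSpace ℝ (Fin d)) : Set (EuclideanSpace ℝ (Fin d)) :=
  {x | ∀ i, |τ i - x i| <
    epsSeq ε (n + 1) * Real.exp (-w i * tSeq d ℓ t (n + 1) - tSeq d ℓ t n)}

/-- The compact box attached to a vertex `τ` of height `n`. -/
def beta {d : ℕ} (w : Fin d → ℝ) (ℓ : ℕ) (ε t : ℝ) :
    ℕ → EuclideanSpace ℝ (Fin d) → Set (EuclideanSpace ℝ (Fin d))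
  | 0, τ => {x | ∀ i, |τ i - x i| ≤ Real.exp (-w i * tSeq d ℓ t 1)}
  | n + 1, τ => {x | ∀ i, |τ i - x i| ≤
      epsSeq ε (n + 1) * Real.exp (-w i * tSeq d ℓ t (n + 2) - tSeq d ℓ t (n + 1))}

/-- The set of sons of a vertex `κ` of height `n`; they have height `n + 1`. -/
def sons {d : ℕ} (w : Fin d → ℝ) (ℓ : ℕ) (ε r t : ℝ) (n : ℕ)
    (κ : EuclideanSpace ℝ (Fin d)) : Set (EuclideanSpace ℝ (Fin d)) :=
  {τ | τ ∈ betaTilde w ℓ ε t n κ ∧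
    latticeOf (aMat w (tSeq d ℓ t (n + 1)) * hMat τ) ∈ LPrime d ∧
    latticeOf (aMat w (tSeq d ℓ t (n + 1)) * hMat τ) ∈
      KStar (Fin d ⊕ Unit) (epsSeq ε (n + 1) ^ 2) ∧
    latticeOf (bMat w ℓ t (n + 1) * aMat w (tSeq d ℓ t (n + 1)) * hMat τ) ∈
      KStar (Fin d ⊕ Unit) r}

/-- The boundary of the tree with root `0`: the infinite descending sequences of vertices. -/
def treeBoundary {d : ℕ} (w : Fin d → ℝ) (ℓ : ℕ) (ε r t : ℝ) :
    Set (ℕ → EuclideanSpace ℝ (Fin d)) :=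
  {τ | τ 0 = 0 ∧ ∀ n, τ (n + 1) ∈ sons w ℓ ε r t n (τ n)}

/-- The fractal `ℱ(𝒯, β)`. -/
def fractal {d : ℕ} (w : Fin d → ℝ) (ℓ : ℕ) (ε r t : ℝ) : Set (EuclideanSpace ℝ (Fin d)) :=
  ⋃ τ ∈ treeBoundary w ℓ ε r t, ⋂ n : ℕ, beta w ℓ ε t n (τ n)

end WeightedSingular

end

/-! Vertices of height `n` are sought among rational vectors `P / Q` with `Q` of size `e^{t_n}`. For
such a vector the dual lattice conditions follow when the lattice `annLattice P Q`, of index `Q` in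
`ℤ^d` when `(P, Q)` is primitive, has no nonzero vector in certain boxes (`Avoid`, `mem_KStar`). A
point of the fractal is so close to its vertex of height `n ≥ 1` that this vertex serves as the
approximation for every `T` in `(e^{t_n}, e^{t_{n+1}}]`, with error governed by `ε_n → 0`; hence the
point is singular (`fractal_subset_sing`).

The main step is to give every suitable vertex at least `c ε_n^d e^{dξnt}` suitable sons
(`Good.exists_sons`, `exists_many_sons`). Take a reduced system `G j` of `annLattice P Q` and
integer vectors `(p j, q j)` dual to it modulo `(P, Q)`. The candidates are the combinations `∑ n_j
L (p j, q j) + n_none (P, Q)` with coefficients in a box adapted to the lengths of the `G j`. They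
have the right denominator, lie in the right box, and are numerous enough. A candidate fails an
avoidance condition exactly when it lies on a rational hyperplane `a · x = b` with `a ≠ 0` in the
forbidden box. The candidates on one hyperplane are the solutions of a linear equation in a box
(`card_solutions_le`), and the hyperplanes are counted by `card_mul_le_of_cover`. Summation treats
short normals (`card_le_cube`), hyperplanes through `P / Q` (`card_le_thin`) and the others
(`card_le_big_of_kk_ne`). The main term is the volume `r^d` of the box, all other terms are
exponentially small in `nt`, and common divisors are rare (`card_nonprim_le`). So for small `r` and
large `t` at least half of the expected number of candidates survives.

For the dimension, only sons obeying one more avoidance condition, at the scale `u = scaleU` close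
to `ξnt`, are used. That condition allows boundedly many vertices in a cell with sides
`e^{-(1+w_i)t_n - bet_i(u)}` (`card_le_multConst`). Give the paths of a subtree with prescribed
numbers of sons the product of uniform measures. A ball of radius `e^{-L}` meets few cells in each
coordinate whose cells are longer than the radius, and the resulting saving is about `e^{-κ_i L}`
with `κ_i = (1-θ)/(1+ω)` for `i ≤ ℓ` and `κ_i = 1` otherwise, where `ω = w_1` and `θ = theta`
(`coordDim_mul_le`). Since `ℓ(θ+ω) = 1`, the `κ_i` add up to `d - 1/(1+ω)`. The losses in the first
`m` levels are `e^{O(m log m)}`, whereas `t_m` grows quadratically, so they are negligible, and the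
mass distribution principle `le_dimH_range` finishes the proof. -/

noncomputable section
namespace WeightedSingular
open Matrix

/-! ### Minkowski's theorems for the lattice of vectors `a` with `Q ∣ a · P`. -/

/-- Minkowski's theorem for a parallelepiped given by linear forms. -/
theorem exists_int_of_det_lt {ι : Type*} [Fintype ι] [DecidableEq ι] (M : Matrix ι ι ℝ)
    (hM : M.det ≠ 0) (c : ι → ℝ) (hc : ∀ i, 0 < c i) (h : |M.det| < ∏ i, c i) :
    ∃ z : ι → ℤ, z ≠ 0 ∧ ∀ i, |(M *ᵥ fun j => (z j : ℝ)) i| < c i := by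
  classical
  set b := Pi.basisFun ℝ ι
  set s : Set (ι → ℝ) := (toLin' M) ⁻¹' (Set.univ.pi fun i => Set.Ioo (-c i) (c i)) with hs
  have hdet : LinearMap.det (toLin' M) ≠ 0 := by simpa using hM
  have hvol : MeasureTheory.volume s
      = ENNReal.ofReal (|M.det|⁻¹ * (2 ^ Fintype.card ι * ∏ i, c i)) := by
    rw [hs, MeasureTheory.Measure.addHaar_preimage_linearMap _ hdet,
      MeasureTheory.volume_pi, MeasureTheory.Measure.pi_pi]
    simp only [Real.volume_Ioo, LinearMap.det_toLin']
    rw [ENNReal.ofReal_mul (by positivity), abs_inv,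
      ← ENNReal.ofReal_prod_of_nonneg (fun i _ => by linarith [hc i])]
    congr 2
    rw [← Finset.card_univ, ← Finset.prod_const, ← Finset.prod_mul_distrib]
    exact Finset.prod_congr rfl fun i _ => by ring
  have hfund := ZSpan.isAddFundamentalDomain' b (MeasureTheory.volume)
  have : Countable (Submodule.span ℤ (Set.range b)).toAddSubgroup := by
    change Countable (Submodule.span ℤ (Set.range b))
    infer_instance
  obtain ⟨x, hx0, hx⟩ :=
    MeasureTheory.exists_ne_zero_mem_lattice_of_measure_mul_two_pow_lt_measure
      (s := s) hfund
      (by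
        intro x hx i _
        have := hx i trivial
        simp only [map_neg, Pi.neg_apply, Set.mem_Ioo] at this ⊢
        constructor <;> linarith [this.1, this.2])
      ((convex_pi fun i _ => convex_Ioo _ _).linear_preimage _)
      (by
        rw [ZSpan.volume_fundamentalDomain, hvol]
        have h1 : (Matrix.of b).det = 1 := by
          have : (Matrix.of b) = 1 := by
            ext i j; simp [b, Matrix.one_apply, Pi.single_apply, eq_comm]
          rw [this, det_one]
        rw [h1, abs_one, ENNReal.ofReal_one, one_mul]
        have h2 : (2 : ENNReal) ^ Module.finrank ℝ (ι → ℝ)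
            = ENNReal.ofReal (2 ^ Fintype.card ι) := by
          rw [ENNReal.ofReal_pow (by norm_num)]; simp
        rw [h2]
        apply (ENNReal.ofReal_lt_ofReal_iff_of_nonneg (by positivity)).2
        have h3 : 0 < |M.det| := abs_pos.2 hM
        rw [inv_mul_eq_div, lt_div_iff₀ h3]
        have : (0 : ℝ) < 2 ^ Fintype.card ι := by positivity
        nlinarith)
  have hmem := (Module.Basis.mem_span_iff_repr_mem ℤ b (x : ι → ℝ)).1 x.2
  choose z hz using hmem
  have hz' : (fun j => (z j : ℝ)) = (x : ι → ℝ) := by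
    ext j; simpa [b] using hz j
  refine ⟨z, ?_, ?_⟩
  · rintro rfl
    apply hx0
    apply Subtype.ext
    rw [← hz']; ext; simp
  · intro i
    have := hx i trivial
    rw [hz', abs_lt]
    simpa using this

/-- The lattice of integer vectors `a` with `Q ∣ a · P`. -/
def annLattice {d : ℕ} (P : Fin d → ℤ) (Q : ℤ) : Set (Fin d → ℤ) := {a | Q ∣ a ⬝ᵥ P}

/-- Minkowski's theorem is applied in dimension `d + 1` with the additional form `a · P - Q z`,
required to be less than `1`. Being an integer, it vanishes, which is the divisibility. -/
theorem exists_mem_annLattice {d : ℕ} (P : Fin d → ℤ) (Q : ℤ) (hQ : 0 < Q)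
    (M : Matrix (Fin d) (Fin d) ℝ) (hM : M.det ≠ 0) (c : Fin d → ℝ) (hc : ∀ i, 0 < c i)
    (h : |M.det| * Q < ∏ i, c i) :
    ∃ a ∈ annLattice P Q, a ≠ 0 ∧ ∀ i, |(M *ᵥ fun j => (a j : ℝ)) i| < c i := by
  set N : Matrix (Fin d ⊕ Unit) (Fin d ⊕ Unit) ℝ :=
    Matrix.fromBlocks M 0 (Matrix.of fun _ j => (P j : ℝ)) (Matrix.of fun _ _ => -(Q : ℝ)) with hN
  have hdet : N.det = M.det * (-(Q : ℝ)) := by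
    rw [hN, Matrix.det_fromBlocks_zero₁₂]; simp
  have hQ' : (0 : ℝ) < Q := by exact_mod_cast hQ
  obtain ⟨z, hz0, hz⟩ := exists_int_of_det_lt N (by rw [hdet]; exact mul_ne_zero hM (by simpa using hQ.ne'))
    (Sum.elim c fun _ => 1) (by rintro (i | i) <;> simp [hc])
    (by rw [hdet, abs_mul, abs_neg, abs_of_pos hQ']; simpa using h)
  have e : (fun j => (z j : ℝ)) = Sum.elim (fun j => (z (Sum.inl j) : ℝ)) (fun j => (z (Sum.inr j) : ℝ)) := by
    ext (j | j) <;> rfl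
  have h1 : ∀ i, |(M *ᵥ fun j => (z (Sum.inl j) : ℝ)) i| < c i := by
    intro i
    have := hz (Sum.inl i)
    rw [e, hN, Matrix.fromBlocks_mulVec] at this
    simpa using this
  have h2 : (fun j => z (Sum.inl j)) ⬝ᵥ P - Q * z (Sum.inr ()) = 0 := by
    have := hz (Sum.inr ())
    rw [e, hN, Matrix.fromBlocks_mulVec] at this
    simp only [Sum.elim_inr, Pi.add_apply, mulVec, dotProduct, of_apply, Function.comp] at this
    simp only [Sum.elim_inl, Finset.univ_unique, Finset.sum_singleton] at this
    rw [← Int.abs_lt_one_iff]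
    have e2 : (((fun j => z (Sum.inl j)) ⬝ᵥ P - Q * z (Sum.inr ()) : ℤ) : ℝ) =
      ∑ x, (P x : ℝ) * (z (Sum.inl x) : ℝ) + -(Q : ℝ) * z (Sum.inr default) := by
      simp only [dotProduct]; push_cast
      rw [Finset.sum_congr rfl fun x _ => mul_comm _ _]
      simp [sub_eq_add_neg]
    rw [← e2] at this
    exact_mod_cast this
  refine ⟨fun j => z (Sum.inl j), ⟨z (Sum.inr ()), by linarith⟩, ?_, h1⟩
  intro h0
  apply hz0
  have h3 : z (Sum.inr ()) = 0 := by
    rw [h0, zero_dotProduct] at h2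
    have : Q * z (Sum.inr ()) = 0 := by linarith
    exact (mul_eq_zero.1 this).resolve_left hQ.ne'
  ext (j | j)
  · exact congrFun h0 j
  · exact h3

/-- The sup norm of an integer vector, with weights on the coordinates. -/
def wnorm {d : ℕ} (T : Fin d → ℝ) (a : Fin d → ℤ) : ℝ := ‖fun i => T i * (a i : ℝ)‖

section wnorm
variable {d : ℕ} {T : Fin d → ℝ}

theorem wnorm_nonneg (a : Fin d → ℤ) : 0 ≤ wnorm T a := norm_nonneg _

theorem wnorm_le_iff (hT : ∀ i, 0 < T i) {a : Fin d → ℤ} {c : ℝ} (hc : 0 ≤ c) :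
    wnorm T a ≤ c ↔ ∀ i, T i * |(a i : ℝ)| ≤ c := by
  rw [wnorm, pi_norm_le_iff_of_nonneg hc]
  simp [abs_of_pos (hT _)]

theorem coord_le_wnorm (hT : ∀ i, 0 < T i) (a : Fin d → ℤ) (i : Fin d) :
    T i * |(a i : ℝ)| ≤ wnorm T a := (wnorm_le_iff hT (wnorm_nonneg a)).1 le_rfl i

theorem wnorm_pos (hT : ∀ i, 0 < T i) {a : Fin d → ℤ} (ha : a ≠ 0) : 0 < wnorm T a := by
  obtain ⟨i, hi⟩ := Function.ne_iff.1 ha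
  refine lt_of_lt_of_le ?_ (coord_le_wnorm hT a i)
  have : (a i : ℝ) ≠ 0 := by exact_mod_cast hi
  have := hT i
  positivity

end wnorm

/-- `d` independent vectors of the lattice `annLattice P Q` that are reduced for `wnorm T`. -/
structure IsReduced {d : ℕ} (P : Fin d → ℤ) (Q : ℤ) (T : Fin d → ℝ)
    (G : Matrix (Fin d) (Fin d) ℤ) : Prop where
  mem : ∀ j, G j ∈ annLattice P Q
  det_ne_zero : G.det ≠ 0
  min : ∀ j, ∀ a ∈ annLattice P Q, (G.updateRow j a).det ≠ 0 → wnorm T (G j) ≤ wnorm T a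

/-- Minimise the sum of the norms over independent systems. Only finitely many do at least as well
as `Q` times the standard basis, and at a minimum no replacement of a single row is an improvement.
-/
theorem exists_isReduced {d : ℕ} (P : Fin d → ℤ) (Q : ℤ) (hQ : 0 < Q) (T : Fin d → ℝ)
    (hT : ∀ i, 0 < T i) : ∃ G, IsReduced P Q T G := by
  classical
  set f : Matrix (Fin d) (Fin d) ℤ → ℝ := fun G => ∑ j, wnorm T (G j) with hf
  set G₀ : Matrix (Fin d) (Fin d) ℤ := Matrix.diagonal fun _ => Q
  have hG₀ : ∀ j, G₀ j ∈ annLattice P Q := fun j => by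
    refine ⟨P j, ?_⟩
    simp [G₀, dotProduct, Matrix.diagonal_apply]
  set S : Set (Matrix (Fin d) (Fin d) ℤ) :=
    {G | (∀ j, G j ∈ annLattice P Q) ∧ G.det ≠ 0 ∧ f G ≤ f G₀} with hS
  have hfin : S.Finite := by
    have hb : ∀ i, ∃ M : ℤ, f G₀ / T i ≤ M := fun i => ⟨⌈f G₀ / T i⌉, Int.le_ceil _⟩
    choose M hM using hb
    refine (Set.finite_Icc (fun _ j => -M j : Fin d → Fin d → ℤ) (fun _ j => M j)).subset ?_
    rintro G ⟨-, -, hG⟩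
    have key : ∀ i j, |G i j| ≤ M j := by
      intro i j
      have h1 := coord_le_wnorm hT (G i) j
      have h2 : wnorm T (G i) ≤ f G :=
        Finset.single_le_sum (f := fun i => wnorm T (G i)) (fun i _ => wnorm_nonneg _)
          (Finset.mem_univ i)
      have h3 : |(G i j : ℝ)| ≤ M j := by
        refine le_trans ?_ (hM j)
        rw [le_div_iff₀ (hT j)]
        linarith
      exact_mod_cast h3
    exact ⟨fun i j => (abs_le.1 (key i j)).1, fun i j => (abs_le.1 (key i j)).2⟩
  have hne : S.Nonempty := ⟨G₀, hG₀, by simp [G₀, hQ.ne'], le_rfl⟩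
  obtain ⟨G, ⟨hG1, hG2, hG3⟩, hG⟩ := Set.exists_min_image S f hfin hne
  refine ⟨G, hG1, hG2, fun j a ha hdet => ?_⟩
  by_contra! hlt
  have hsum : f (G.updateRow j a) = f G - wnorm T (G j) + wnorm T a := by
    simp only [hf]
    rw [← Finset.add_sum_erase _ _ (Finset.mem_univ j),
      ← Finset.add_sum_erase _ (fun j => wnorm T (G j)) (Finset.mem_univ j)]
    have : ∑ x ∈ Finset.univ.erase j, wnorm T ((G.updateRow j a) x)
        = ∑ x ∈ Finset.univ.erase j, wnorm T (G x) :=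
      Finset.sum_congr rfl fun x hx => by
        rw [Matrix.updateRow_ne (Finset.ne_of_mem_erase hx)]
    rw [this, Matrix.updateRow_self]; ring
  have := hG (G.updateRow j a) ⟨fun i => ?_, hdet, by linarith⟩
  · linarith
  · by_cases h : i = j
    · subst h; rwa [Matrix.updateRow_self]
    · rw [Matrix.updateRow_ne h]; exact hG1 i

theorem sum_det_updateRow_smul {d : ℕ} {R : Type*} [CommRing R] (G : Matrix (Fin d) (Fin d) R)
    (a : Fin d → R) (i : Fin d) : ∑ j, (G.updateRow j a).det * G j i = G.det * a i := by
  have := congrFun (Matrix.mulVec_cramer Gᵀ a) i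
  rw [det_transpose] at this
  simp only [mulVec, dotProduct, transpose_apply, cramer_transpose_apply, Pi.smul_apply,
    smul_eq_mul] at this
  rw [← this]
  exact Finset.sum_congr rfl fun j _ => mul_comm _ _

/-- This is Minkowski's second theorem with constant `d ^ d`. Sort the rows by length and
orthonormalise them. If the bound failed, Minkowski's theorem would give a lattice vector `a ≠ 0`
whose `i`-th orthonormal coordinate is less than `1 / d` times the `i`-th length. If `j` is the last
row occurring in `a`, the coordinates after `j` vanish, so `a` is shorter than row `j`; yet `a` may
replace that row. -/
theorem IsReduced.prod_wnorm_le {d : ℕ} {P : Fin d → ℤ} {Q : ℤ} (hQ : 0 < Q) {T : Fin d → ℝ}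
    (hT : ∀ i, 0 < T i) {G : Matrix (Fin d) (Fin d) ℤ} (hG : IsReduced P Q T G) :
    ∏ j, wnorm T (G j) ≤ d ^ d * (Q * ∏ i, T i) := by
  classical
  rcases Nat.eq_zero_or_pos d with rfl | hd
  · simp; exact_mod_cast hQ
  have hd' : (0 : ℝ) < d := by exact_mod_cast hd
  set lam : Fin d → ℝ := fun j => wnorm T (G j) with hlam
  have hrow : ∀ j, G j ≠ 0 := fun j h => hG.det_ne_zero (Matrix.det_eq_zero_of_row_eq_zero j
    fun i => congrFun h i)
  have hlampos : ∀ j, 0 < lam j := fun j => wnorm_pos hT (hrow j)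
  set σ := Tuple.sort lam
  have hσ : Monotone (lam ∘ σ) := Tuple.monotone_sort lam
  set v : (Fin d → ℤ) → EuclideanSpace ℝ (Fin d) := fun a => WithLp.toLp 2 fun i => T i * (a i : ℝ)
    with hv
  have hfr : Module.finrank ℝ (EuclideanSpace ℝ (Fin d)) = Fintype.card (Fin d) := by simp
  set u := InnerProductSpace.gramSchmidtOrthonormalBasis (𝕜 := ℝ) hfr (fun i => v (G (σ i))) with hu
  set U : Matrix (Fin d) (Fin d) ℝ := Matrix.of fun i k => u i k with hU
  have hUU : U * Uᵀ = 1 := by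
    ext i j
    have := u.inner_eq_ite j i
    rw [PiLp.inner_apply] at this
    simp only [RCLike.inner_apply, conj_trivial] at this
    simp only [Matrix.mul_apply, hU, transpose_apply, of_apply, Matrix.one_apply]
    rw [this]
    simp only [eq_comm]
  have hdetU : |U.det| = 1 := by
    have := congrArg Matrix.det hUU
    rw [det_mul, det_transpose, det_one] at this
    have h2 : |U.det| * |U.det| = 1 := by rw [← abs_mul, this, abs_one]
    nlinarith [abs_nonneg U.det]
  set M : Matrix (Fin d) (Fin d) ℝ := U * Matrix.diagonal T with hM
  have hdetM : |M.det| = ∏ i, T i := by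
    rw [hM, det_mul, abs_mul, hdetU, one_mul, det_diagonal,
      abs_of_pos (Finset.prod_pos fun i _ => hT i)]
  have hMa : ∀ a : Fin d → ℤ, ∀ i, (M *ᵥ fun j => (a j : ℝ)) i = inner ℝ (u i) (v a) := by
    intro a i
    rw [PiLp.inner_apply]
    simp only [RCLike.inner_apply, conj_trivial, mulVec, dotProduct, hM,
      Matrix.mul_diagonal, hU, of_apply, hv]
    exact Finset.sum_congr rfl fun x _ => by ring
  have hTpos : 0 < ∏ i, T i := Finset.prod_pos fun i _ => hT i
  have key : ∏ i, lam (σ i) / d ≤ |M.det| * Q := by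
    by_contra! hcon
    obtain ⟨a, ha, ha0, hMc⟩ := exists_mem_annLattice P Q hQ M
      (by rw [← abs_pos, hdetM]; exact hTpos) (fun i => lam (σ i) / d)
      (fun i => div_pos (hlampos _) hd') hcon
    -- By Cramer's rule, `J` is the set of rows with nonzero coefficient in the expansion of `a`.
    set J : Finset (Fin d) := Finset.univ.filter fun j => (G.updateRow (σ j) a).det ≠ 0 with hJ
    have hJne : J.Nonempty := by
      by_contra! hempty
      apply ha0
      ext i
      have := sum_det_updateRow_smul G a i
      rw [Finset.sum_eq_zero] at this
      · exact (mul_eq_zero.1 this.symm).resolve_left hG.det_ne_zero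
      · intro j _
        have hj : σ.symm j ∉ J := by rw [hempty]; simp
        simp [hJ] at hj
        rw [hj, zero_mul]
    set j := J.max' hJne
    have hj : (G.updateRow (σ j) a).det ≠ 0 := (Finset.mem_filter.1 (J.max'_mem hJne)).2
    have hmin := hG.min (σ j) a ha hj
    have hGd : (G.det : ℝ) ≠ 0 := by exact_mod_cast hG.det_ne_zero
    have hcomb : (G.det : ℝ) • v a = ∑ i, ((G.updateRow (σ i) a).det : ℝ) • v (G (σ i)) := by
      ext k
      have h1 := sum_det_updateRow_smul G a k
      rw [← Equiv.sum_comp σ] at h1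
      have h2 : ∑ i, ((G.updateRow (σ i) a).det : ℝ) * (G (σ i) k : ℝ) = G.det * a k := by
        exact_mod_cast h1
      simp only [hv, PiLp.smul_apply, smul_eq_mul, WithLp.ofLp_sum, Finset.sum_apply,
        WithLp.ofLp_smul, Pi.smul_apply]
      calc (G.det : ℝ) * (T k * a k) = T k * (G.det * a k) := by ring
        _ = _ := by rw [← h2, Finset.mul_sum]; exact Finset.sum_congr rfl fun x _ => by ring
    have hzero : ∀ i, j < i → inner ℝ (u i) (v a) = 0 := by
      intro i hi
      have h1 : inner ℝ (u i) ((G.det : ℝ) • v a) = 0 := by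
        rw [hcomb, inner_sum]
        refine Finset.sum_eq_zero fun k _ => ?_
        rw [inner_smul_right]
        by_cases hk : k < i
        · rw [InnerProductSpace.gramSchmidtOrthonormalBasis_inv_triangular hfr _ hk, mul_zero]
        · have : k ∉ J := fun hkJ => by
            have := J.le_max' k hkJ
            exact hk (lt_of_le_of_lt this hi)
          simp [hJ] at this
          rw [this]; simp
      rw [inner_smul_right] at h1
      exact (mul_eq_zero.1 h1).resolve_left hGd
    have hsmall : ∀ i, |inner ℝ (u i) (v a)| < lam (σ j) / d := by
      intro i
      rcases le_or_gt i j with h | h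
      · rw [← hMa]
        refine (hMc i).trans_le ?_
        exact div_le_div_of_nonneg_right (hσ h) hd'.le
      · rw [hzero i h, abs_zero]; exact div_pos (hlampos _) hd'
    have hle : wnorm T a ≤ ∑ i, |inner ℝ (u i) (v a)| := by
      rw [wnorm_le_iff hT (Finset.sum_nonneg fun i _ => abs_nonneg _)]
      intro k
      have h1 : T k * |(a k : ℝ)| = ‖v a k‖ := by simp [hv, abs_of_pos (hT k)]
      rw [h1]
      refine (PiLp.norm_apply_le (v a) k).trans ?_
      conv_lhs => rw [← u.sum_repr' (v a)]
      refine (norm_sum_le _ _).trans ?_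
      refine Finset.sum_le_sum fun i _ => ?_
      rw [norm_smul, u.norm_eq_one, mul_one, Real.norm_eq_abs]
    have hlt : ∑ i, |inner ℝ (u i) (v a)| < ∑ _i : Fin d, lam (σ j) / d :=
      Finset.sum_lt_sum_of_nonempty ⟨⟨0, hd⟩, Finset.mem_univ _⟩ fun i _ => hsmall i
    rw [Finset.sum_const, Finset.card_univ, Fintype.card_fin, nsmul_eq_mul,
      mul_div_cancel₀ _ hd'.ne'] at hlt
    linarith
  rw [Finset.prod_div_distrib, Finset.prod_const, Finset.card_univ, Fintype.card_fin,
    Equiv.prod_comp σ lam, hdetM, div_le_iff₀ (by positivity)] at key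
  linarith

end WeightedSingular
end

/-! ### The system of integer vectors dual to a reduced system. -/

noncomputable section
namespace WeightedSingular
open Matrix

/-- `(P, Q)` is a primitive integer vector. -/
def IsCoprimeVec {d : ℕ} (P : Fin d → ℤ) (Q : ℤ) : Prop := ∃ (x : Fin d → ℤ) (y : ℤ), x ⬝ᵥ P + y * Q = 1

theorem abs_det_le {d : ℕ} (M : Matrix (Fin d) (Fin d) ℝ) (c : Fin d → ℝ)
    (h : ∀ i j, |M i j| ≤ c i) : |M.det| ≤ d.factorial * ∏ i, c i := by
  rw [← det_transpose, det_apply]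
  refine (Finset.abs_sum_le_sum_abs _ _).trans ?_
  refine (Finset.sum_le_card_nsmul _ _ (∏ i, c i) fun σ _ => ?_).trans ?_
  · have hu : |Equiv.Perm.sign σ • ∏ i, Mᵀ (σ i) i| = |∏ i, Mᵀ (σ i) i| := by
      rcases Int.units_eq_one_or (Equiv.Perm.sign σ) with h1 | h1 <;> simp [h1]
    rw [hu, Finset.abs_prod]
    exact Finset.prod_le_prod (fun _ _ => abs_nonneg _) fun i _ => h _ _
  · simp [Finset.card_univ, Fintype.card_perm]

theorem abs_det_mul_prod_le {d : ℕ} {T : Fin d → ℝ} (hT : ∀ i, 0 < T i)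
    (A : Matrix (Fin d) (Fin d) ℤ) :
    |(A.det : ℝ)| * ∏ i, T i ≤ d.factorial * ∏ j, wnorm T (A j) := by
  have h := abs_det_le ((A.map (Int.cast : ℤ → ℝ)) * Matrix.diagonal T) (fun j => wnorm T (A j)) ?_
  · rw [det_mul, det_diagonal, abs_mul, abs_of_pos (Finset.prod_pos fun i _ => hT i)] at h
    have : (A.map (Int.cast : ℤ → ℝ)).det = A.det := by
      rw [Int.cast_det]
    rwa [this] at h
  · intro i j
    rw [Matrix.mul_diagonal, abs_mul, abs_of_pos (hT j), mul_comm]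
    simpa using coord_le_wnorm hT (A i) j

/-- The constant `d! d^d` of the reduction estimates. -/
def redConst (d : ℕ) : ℝ := d.factorial * d ^ d

theorem redConst_pos (d : ℕ) : 0 < redConst d := by
  rcases Nat.eq_zero_or_pos d with rfl | h
  · simp [redConst]
  · unfold redConst; positivity

theorem one_le_redConst (d : ℕ) : 1 ≤ redConst d := by
  rcases Nat.eq_zero_or_pos d with rfl | h
  · simp [redConst]
  · unfold redConst
    have : 1 ≤ d.factorial * d ^ d := Nat.one_le_iff_ne_zero.2 (by positivity)
    exact_mod_cast this

section
variable {d : ℕ} {P : Fin d → ℤ} {Q : ℤ} {T : Fin d → ℝ} {G : Matrix (Fin d) (Fin d) ℤ}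

theorem IsReduced.row_ne_zero (hG : IsReduced P Q T G) (j : Fin d) : G j ≠ 0 := fun h =>
  hG.det_ne_zero (Matrix.det_eq_zero_of_row_eq_zero j fun i => congrFun h i)

theorem IsReduced.wnorm_pos (hG : IsReduced P Q T G) (hT : ∀ i, 0 < T i) (j : Fin d) :
    0 < wnorm T (G j) := WeightedSingular.wnorm_pos hT (hG.row_ne_zero j)

/-- The determinant is at most `d!` times the product of the row norms divided by `∏ T i`, and
Minkowski's second theorem bounds the product of the reduced norms. By Cramer's rule this controls
the coefficients of `a` in the reduced system. -/
theorem IsReduced.abs_det_updateRow_mul_le (hQ : 0 < Q) (hT : ∀ i, 0 < T i)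
    (hG : IsReduced P Q T G) (a : Fin d → ℤ) (j : Fin d) :
    |((G.updateRow j a).det : ℝ)| * wnorm T (G j) ≤ redConst d * Q * wnorm T a := by
  have h1 := abs_det_mul_prod_le hT (G.updateRow j a)
  have hTp : 0 < ∏ i, T i := Finset.prod_pos fun i _ => hT i
  have h2 : (∏ i, wnorm T ((G.updateRow j a) i)) * wnorm T (G j)
      = wnorm T a * ∏ i, wnorm T (G i) := by
    rw [← Finset.mul_prod_erase _ _ (Finset.mem_univ j),
      ← Finset.mul_prod_erase _ (fun i => wnorm T (G i)) (Finset.mem_univ j)]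
    have : ∏ x ∈ Finset.univ.erase j, wnorm T ((G.updateRow j a) x)
        = ∏ x ∈ Finset.univ.erase j, wnorm T (G x) :=
      Finset.prod_congr rfl fun x hx => by
        rw [Matrix.updateRow_ne (Finset.ne_of_mem_erase hx)]
    rw [this, Matrix.updateRow_self]; ring
  have h3 := hG.prod_wnorm_le hQ hT
  have h4 : 0 ≤ wnorm T a := wnorm_nonneg a
  have h5 := hG.wnorm_pos hT j
  have : (|((G.updateRow j a).det : ℝ)| * wnorm T (G j)) * ∏ i, T i
      ≤ (redConst d * Q * wnorm T a) * ∏ i, T i := by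
    calc _ = (|((G.updateRow j a).det : ℝ)| * ∏ i, T i) * wnorm T (G j) := by ring
      _ ≤ (d.factorial * ∏ i, wnorm T ((G.updateRow j a) i)) * wnorm T (G j) := by gcongr
      _ = d.factorial * (wnorm T a * ∏ i, wnorm T (G i)) := by rw [← h2]; ring
      _ ≤ d.factorial * (wnorm T a * (d ^ d * (Q * ∏ i, T i))) := by gcongr
      _ = _ := by unfold redConst; ring
  exact le_of_mul_le_mul_right this hTp

theorem IsReduced.abs_det_le (hQ : 0 < Q) (hT : ∀ i, 0 < T i)
    (hG : IsReduced P Q T G) : |(G.det : ℝ)| ≤ redConst d * Q := by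
  have h1 := abs_det_mul_prod_le hT G
  have hTp : 0 < ∏ i, T i := Finset.prod_pos fun i _ => hT i
  have h3 := hG.prod_wnorm_le hQ hT
  have : |(G.det : ℝ)| * ∏ i, T i ≤ (redConst d * Q) * ∏ i, T i := by
    calc _ ≤ _ := h1
      _ ≤ d.factorial * (d ^ d * (Q * ∏ i, T i)) := by gcongr
      _ = _ := by unfold redConst; ring
  exact le_of_mul_le_mul_right this hTp

/-- If all nonzero vectors of the lattice are long, then the reduced vectors are not too long. -/
theorem IsReduced.wnorm_le (hQ : 0 < Q) (hT : ∀ i, 0 < T i) (hG : IsReduced P Q T G) {A : ℝ}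
    (hA : 0 < A) (h : ∀ a ∈ annLattice P Q, a ≠ 0 → A ≤ wnorm T a) (j : Fin d) :
    wnorm T (G j) ≤ d ^ d * (Q * ∏ i, T i) / A ^ (d - 1) := by
  rw [le_div_iff₀ (by positivity)]
  refine le_trans ?_ (hG.prod_wnorm_le hQ hT)
  rw [← Finset.mul_prod_erase _ _ (Finset.mem_univ j)]
  refine mul_le_mul_of_nonneg_left ?_ (wnorm_nonneg _)
  have : A ^ (d - 1) = ∏ _i ∈ Finset.univ.erase j, A := by
    rw [Finset.prod_const, Finset.card_erase_of_mem (Finset.mem_univ _), Finset.card_univ,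
      Fintype.card_fin]
  rw [this]
  exact Finset.prod_le_prod (fun _ _ => hA.le) fun i _ => h _ (hG.mem i) (hG.row_ne_zero i)

/-- A reduced vector is not longer than the longest of any `d` independent lattice vectors. -/
theorem IsReduced.wnorm_le_of_independent (hG : IsReduced P Q T G)
    {H : Matrix (Fin d) (Fin d) ℤ} (hH : H.det ≠ 0) (hmem : ∀ i, H i ∈ annLattice P Q) {B : ℝ}
    (hB : ∀ i, wnorm T (H i) ≤ B) (j : Fin d) : wnorm T (G j) ≤ B := by
  by_contra! hlt
  have h0 : ∀ i, (G.updateRow j (H i)).det = 0 := fun i => by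
    by_contra h
    have := hG.min j (H i) (hmem i) h
    linarith [hB i]
  -- Every row of `H` would lie in the span of the rows of `G` other than `j`. The cofactors of row
  -- `j` then pair to zero with `d` independent vectors, so they vanish, against `det G ≠ 0`.
  have h1 : H *ᵥ (fun i => G.adjugate i j) = 0 := by
    ext i
    have h2 := h0 i
    rw [← cramer_transpose_apply, cramer_eq_adjugate_mulVec, ← adjugate_transpose] at h2
    simp only [mulVec, dotProduct, transpose_apply] at h2
    simp only [mulVec, dotProduct, Pi.zero_apply]
    rw [← h2]
    exact Finset.sum_congr rfl fun k _ => mul_comm _ _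
  have h2 := Matrix.eq_zero_of_mulVec_eq_zero hH h1
  have h3 := congrFun (congrFun (Matrix.mul_adjugate G) j) j
  rw [Matrix.mul_apply] at h3
  simp only [Matrix.smul_apply, one_apply_eq, smul_eq_mul, mul_one] at h3
  apply hG.det_ne_zero
  rw [← h3]
  exact Finset.sum_eq_zero fun k _ => by rw [show G.adjugate k j = 0 from congrFun h2 k, mul_zero]

/-- A system of integer vectors `(p j, q j)` dual to the reduced vectors `G j`, modulo `(P, Q)`. -/
structure IsDual (P : Fin d → ℤ) (Q : ℤ) (G : Matrix (Fin d) (Fin d) ℤ) (N : ℤ)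
    (p : Fin d → Fin d → ℤ) (q : Fin d → ℤ) : Prop where
  det_eq : G.det = Q * N
  q_nonneg : ∀ j, 0 ≤ q j
  q_lt : ∀ j, q j < Q
  adj : ∀ i j, G.adjugate i j = Q * p j i - q j * P i
  dvd : ∀ (h : ℤ) (a : Fin d → ℤ) (b : ℤ), (∀ j, h ∣ a ⬝ᵥ p j - b * q j) → h ∣ a ⬝ᵥ P - b * Q →
    (∀ i, h ∣ N * a i) ∧ h ∣ N * b

/-- Border the rows `(G j, -b j)`, which annihilate `(P, Q)`, by a Bezout row `(x, y)`. The matrix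
`H` so obtained maps `(P, Q)` to the last basis vector and satisfies `det H * Q = det G`; put `N =
det H`. The first `d` columns of the adjugate are the dual vectors, up to multiples of `(P, Q)` that
bring `q j` into `[0, Q)`, and its last column is `N (P, Q)`. The values of a functional on these
columns determine `N` times the functional, which is the clause `dvd`. -/
theorem exists_isDual (hQ : 0 < Q) (hPQ : IsCoprimeVec P Q) (hG : ∀ j, G j ∈ annLattice P Q)
    (hdet : G.det ≠ 0) : ∃ N p q, IsDual P Q G N p q := by
  obtain ⟨x, y, hxy⟩ := hPQ
  choose b hb using hG
  set H : Matrix (Fin d ⊕ Unit) (Fin d ⊕ Unit) ℤ :=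
    fromBlocks G (of fun i _ => -b i) (of fun _ j => x j) (of fun _ _ => y) with hH
  set V : Fin d ⊕ Unit → ℤ := Sum.elim P fun _ => Q with hV
  have hHV : H *ᵥ V = Pi.single (Sum.inr ()) 1 := by
    rw [hH, hV, fromBlocks_mulVec]
    ext (i | i)
    · have := hb i
      simp [mulVec, dotProduct] at this ⊢
      rw [this]; ring
    · simp only [Sum.elim_inr, Pi.add_apply, mulVec, dotProduct, of_apply, Function.comp]
      simp only [dotProduct] at hxy
      simpa using hxy
  have hdetH : H.det * Q = G.det := by
    have h1 : H * fromBlocks 1 (of fun i _ => P i) 0 (of fun _ _ => Q)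
        = fromBlocks G 0 (of fun _ j => x j) 1 := by
      rw [hH, fromBlocks_multiply]
      congr 1
      · simp
      · ext i j
        have := congrFun hHV (Sum.inl i)
        rw [hH, hV, fromBlocks_mulVec] at this
        simp [mulVec, dotProduct] at this
        simp [Matrix.mul_apply]
        linarith
      · simp
      · ext i j
        have := congrFun hHV (Sum.inr ())
        rw [hH, hV, fromBlocks_mulVec] at this
        simp [mulVec, dotProduct] at this
        simp [Matrix.mul_apply]
        linarith
    have h2 := congrArg Matrix.det h1
    rw [det_mul, det_fromBlocks_zero₂₁, det_fromBlocks_zero₁₂] at h2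
    simpa using h2
  set N := H.det with hN
  set p₀ : Fin d → Fin d → ℤ := fun j i => H.adjugate (Sum.inl i) (Sum.inl j) with hp₀
  set q₀ : Fin d → ℤ := fun j => H.adjugate (Sum.inr ()) (Sum.inl j) with hq₀
  set p : Fin d → Fin d → ℤ := fun j i => p₀ j i - q₀ j / Q * P i with hp
  set q : Fin d → ℤ := fun j => q₀ j % Q with hq
  have hq' : ∀ j, q j = q₀ j - q₀ j / Q * Q := fun j => by
    have := Int.emod_add_ediv_mul (q₀ j) Q
    simp only [hq]; linarith
  have hdual : ∀ i j, G i ⬝ᵥ p₀ j - b i * q₀ j = if i = j then N else 0 := by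
    intro i j
    have := congrFun (congrFun (mul_adjugate H) (Sum.inl i)) (Sum.inl j)
    rw [Matrix.mul_apply, Fintype.sum_sum_type] at this
    simp [hH, Matrix.one_apply] at this
    rw [dotProduct, sub_eq_add_neg, hp₀, hq₀]
    simpa using this
  have hdual' : ∀ i j, Q * (G i ⬝ᵥ p j) - q j * (G i ⬝ᵥ P) = if i = j then G.det else 0 := by
    intro i j
    have h1 : G i ⬝ᵥ p j = G i ⬝ᵥ p₀ j - q₀ j / Q * (G i ⬝ᵥ P) := by
      simp only [dotProduct, hp, mul_sub, Finset.sum_sub_distrib, Finset.mul_sum]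
      congr 1; exact Finset.sum_congr rfl fun k _ => by ring
    have h2 := hdual i j
    have h3 : G i ⬝ᵥ P = Q * b i := hb i
    rw [h1, hq' j, h3]
    split_ifs at h2 ⊢
    · rw [← hdetH, ← h2]; ring
    · have : G i ⬝ᵥ p₀ j = b i * q₀ j := by linarith
      rw [this]; ring
  have hcol : ∀ k, H.adjugate k (Sum.inr ()) = N * V k := by
    intro k
    have h1 : H.adjugate *ᵥ (H *ᵥ V) = N • V := by
      rw [mulVec_mulVec, adjugate_mul, smul_mulVec, one_mulVec]
    rw [hHV] at h1
    have := congrFun h1 k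
    simpa using this
  refine ⟨N, p, q, ?_, fun j => Int.emod_nonneg _ hQ.ne', fun j => Int.emod_lt_of_pos _ hQ, ?_, ?_⟩
  · rw [← hdetH]; ring
  · intro i j
    have h1 : G *ᵥ (fun i => Q * p j i - q j * P i) = G.det • Pi.single j 1 := by
      ext i
      have := hdual' i j
      simp only [mulVec, dotProduct, Pi.smul_apply, Pi.single_apply, smul_eq_mul]
      simp only [dotProduct, Finset.mul_sum] at this
      rw [← Finset.sum_sub_distrib] at this
      rw [mul_ite, mul_one, mul_zero, ← this]
      exact Finset.sum_congr rfl fun k _ => by ring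
    have h2 : G.det • (fun i => Q * p j i - q j * P i) = G.det • fun i => G.adjugate i j := by
      have := congrArg (fun v => G.adjugate *ᵥ v) h1
      simp only [mulVec_mulVec, adjugate_mul, smul_mulVec, one_mulVec, mulVec_smul] at this
      rw [this]
      congr 1
      ext k; simp
    have := congrFun h2 i
    simp only [Pi.smul_apply, smul_eq_mul] at this
    exact (mul_left_cancel₀ hdet this).symm
  · intro h a b' h1 h2
    set ψ : Fin d ⊕ Unit → ℤ := Sum.elim a fun _ => -b' with hψ
    have hc : ∀ k, h ∣ (ψ ᵥ* H.adjugate) k := by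
      rintro (j | j)
      · have h3 : (ψ ᵥ* H.adjugate) (Sum.inl j)
            = (a ⬝ᵥ p j - b' * q j) + q₀ j / Q * (a ⬝ᵥ P - b' * Q) := by
          have e1 : a ⬝ᵥ p j = a ⬝ᵥ p₀ j - q₀ j / Q * (a ⬝ᵥ P) := by
            simp only [dotProduct, hp, mul_sub, Finset.sum_sub_distrib, Finset.mul_sum]
            congr 1; exact Finset.sum_congr rfl fun k _ => by ring
          rw [e1, hq' j]
          simp only [vecMul, dotProduct, Fintype.sum_sum_type, hψ, hp₀, hq₀]
          simp
          ring
        rw [h3]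
        exact dvd_add (h1 j) (Dvd.dvd.mul_left h2 _)
      · have h3 : (ψ ᵥ* H.adjugate) (Sum.inr j) = N * (a ⬝ᵥ P - b' * Q) := by
          simp only [vecMul, dotProduct, Fintype.sum_sum_type, hψ]
          simp only [Sum.elim_inl, Finset.univ_unique, Sum.elim_inr, Finset.sum_singleton]
          have e2 : H.adjugate (Sum.inr default) (Sum.inr j) = N * Q := hcol (Sum.inr ())
          have e1 : ∀ i, H.adjugate (Sum.inl i) (Sum.inr j) = N * P i := fun i => hcol (Sum.inl i)
          rw [e2]
          simp only [e1]
          rw [mul_sub, Finset.mul_sum]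
          rw [sub_eq_add_neg]
          congr 1
          · exact Finset.sum_congr rfl fun k _ => by ring
          · ring
        rw [h3]
        exact Dvd.dvd.mul_left h2 _
    have h4 : (ψ ᵥ* H.adjugate) ᵥ* H = N • ψ := by
      rw [vecMul_vecMul, adjugate_mul, vecMul_smul, vecMul_one]
    have h5 : ∀ k, h ∣ N * ψ k := by
      intro k
      have := congrFun h4 k
      simp only [Pi.smul_apply, smul_eq_mul] at this
      rw [← this]
      simp only [vecMul, dotProduct] at hc ⊢
      exact Finset.dvd_sum fun i _ => Dvd.dvd.mul_right (hc i) _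
    refine ⟨fun i => h5 (Sum.inl i), ?_⟩
    have := h5 (Sum.inr ())
    simpa [hψ] using this


namespace IsDual
variable {N : ℤ} {p : Fin d → Fin d → ℤ} {q : Fin d → ℤ}

theorem N_ne_zero (h : IsDual P Q G N p q) (hG : IsReduced P Q T G) : N ≠ 0 := by
  rintro rfl
  exact hG.det_ne_zero (by rw [h.det_eq, mul_zero])

/-- `|N|` is the index in `annLattice P Q` of the span of the reduced vectors. Its boundedness
allows one fixed factorial to absorb it. -/
theorem abs_N_le (h : IsDual P Q G N p q) (hQ : 0 < Q) (hT : ∀ i, 0 < T i)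
    (hG : IsReduced P Q T G) : |(N : ℝ)| ≤ redConst d := by
  have h1 := hG.abs_det_le hQ hT
  have hQ' : (0 : ℝ) < Q := by exact_mod_cast hQ
  rw [h.det_eq] at h1
  push_cast at h1
  rw [abs_mul, abs_of_pos hQ'] at h1
  nlinarith

theorem det_updateRow (h : IsDual P Q G N p q) (a : Fin d → ℤ) (b : ℤ) (j : Fin d) :
    (G.updateRow j a).det = Q * (a ⬝ᵥ p j - b * q j) - q j * (a ⬝ᵥ P - b * Q) := by
  rw [← cramer_transpose_apply, cramer_eq_adjugate_mulVec, ← adjugate_transpose]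
  simp only [mulVec, dotProduct, transpose_apply, h.adj, sub_mul, Finset.sum_sub_distrib, mul_sub,
    Finset.mul_sum]
  have e1 : ∑ x, Q * p j x * a x = ∑ x, Q * (a x * p j x) :=
    Finset.sum_congr rfl fun x _ => by ring
  have e2 : ∑ x, q j * P x * a x = ∑ x, q j * (a x * P x) :=
    Finset.sum_congr rfl fun x _ => by ring
  rw [e1, e2]
  ring

/-- Cramer's rule for the basis vector `e_i`: the direction of `(p j, q j)` deviates from that of
`(P, Q)` by an amount inversely proportional to the length of `G j`. So `(p j, q j)` may be used
with a coefficient proportional to that length. -/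
theorem abs_mul_wnorm_le (h : IsDual P Q G N p q) (hQ : 0 < Q) (hT : ∀ i, 0 < T i)
    (hG : IsReduced P Q T G) (i j : Fin d) :
    |(Q * p j i - q j * P i : ℝ)| * wnorm T (G j) ≤ redConst d * Q * T i := by
  have h1 := hG.abs_det_updateRow_mul_le hQ hT (Pi.single i 1) j
  rw [← adjugate_apply, h.adj] at h1
  push_cast at h1
  refine h1.trans (mul_le_mul_of_nonneg_left ?_ ?_)
  · rw [wnorm_le_iff hT (hT i).le]
    intro k
    by_cases hk : k = i
    · subst hk; simp
    · simp [hk, (hT i).le]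
  · have : (0 : ℝ) < Q := by exact_mod_cast hQ
    have := redConst_pos d
    positivity

theorem pairing (h : IsDual P Q G N p q) (i j : Fin d) :
    Q * (G i ⬝ᵥ p j) - q j * (G i ⬝ᵥ P) = if i = j then Q * N else 0 := by
  have h1 := congrFun (congrFun (Matrix.mul_adjugate G) i) j
  rw [Matrix.mul_apply, h.det_eq] at h1
  simp only [h.adj, Matrix.smul_apply, Matrix.one_apply, smul_eq_mul, mul_ite, mul_one,
    mul_zero] at h1
  rw [← h1]
  simp only [dotProduct, Finset.mul_sum]
  rw [← Finset.sum_sub_distrib]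
  exact Finset.sum_congr rfl fun x _ => by ring

theorem coord_eq (h : IsDual P Q G N p q) (a : Fin d → ℤ) (b : ℤ) (i : Fin d) :
    ∑ j, (Q * (a ⬝ᵥ p j - b * q j) - q j * (a ⬝ᵥ P - b * Q)) * G j i = Q * N * a i := by
  rw [← h.det_eq, ← sum_det_updateRow_smul]
  exact Finset.sum_congr rfl fun j _ => by rw [h.det_updateRow a b j]

/-- Cramer's rule expands `a` in the reduced vectors, with coefficients read off from the values of
`(a, -b)` at the dual vectors and at `(P, Q)`. The bounds `0 ≤ q j < Q` and `|N| ≥ 1` are used here.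
-/
theorem wnorm_le (h : IsDual P Q G N p q) (hQ : 0 < Q) (hT : ∀ i, 0 < T i)
    (hG : IsReduced P Q T G) (a : Fin d → ℤ) (b : ℤ) :
    wnorm T a ≤ ∑ j, (|((a ⬝ᵥ p j - b * q j : ℤ) : ℝ)| + |((a ⬝ᵥ P - b * Q : ℤ) : ℝ)|)
      * wnorm T (G j) := by
  have hQ' : (0 : ℝ) < Q := by exact_mod_cast hQ
  set c : Fin d → ℤ := fun j => a ⬝ᵥ p j - b * q j with hc
  set k : ℤ := a ⬝ᵥ P - b * Q with hk
  have hN : (1 : ℝ) ≤ |(N : ℝ)| := by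
    have := Int.one_le_abs (h.N_ne_zero hG)
    exact_mod_cast this
  refine (wnorm_le_iff hT
    (Finset.sum_nonneg fun j _ => mul_nonneg (by positivity) (wnorm_nonneg _))).2 fun i => ?_
  have h1 : ∑ j, ((Q : ℝ) * c j - q j * k) * (G j i : ℝ) = Q * N * a i := by
    exact_mod_cast h.coord_eq a b i
  have h2 : (Q : ℝ) * (|(N : ℝ)| * (T i * |(a i : ℝ)|))
      ≤ Q * ∑ j, (|(c j : ℝ)| + |(k : ℝ)|) * wnorm T (G j) := by
    calc (Q : ℝ) * (|(N : ℝ)| * (T i * |(a i : ℝ)|)) = T i * |Q * N * (a i : ℝ)| := by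
          rw [abs_mul, abs_mul, abs_of_pos hQ']; ring
      _ ≤ T i * ∑ j, |((Q : ℝ) * c j - q j * k) * (G j i : ℝ)| := by
          rw [← h1]
          exact mul_le_mul_of_nonneg_left (Finset.abs_sum_le_sum_abs _ _) (hT i).le
      _ = ∑ j, |(Q : ℝ) * c j - q j * k| * (T i * |(G j i : ℝ)|) := by
          rw [Finset.mul_sum]
          exact Finset.sum_congr rfl fun j _ => by rw [abs_mul]; ring
      _ ≤ ∑ j, (Q * (|(c j : ℝ)| + |(k : ℝ)|)) * wnorm T (G j) := by
          refine Finset.sum_le_sum fun j _ => mul_le_mul ?_ (coord_le_wnorm hT _ _)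
            (mul_nonneg (hT i).le (abs_nonneg _)) (by positivity)
          have hq0 : (0 : ℝ) ≤ q j := by exact_mod_cast h.q_nonneg j
          have hq1 : (q j : ℝ) ≤ Q := by exact_mod_cast (h.q_lt j).le
          calc |(Q : ℝ) * c j - q j * k| ≤ |(Q : ℝ) * c j| + |(q j : ℝ) * k| := abs_sub _ _
            _ = Q * |(c j : ℝ)| + q j * |(k : ℝ)| := by
                rw [abs_mul, abs_mul, abs_of_pos hQ', abs_of_nonneg hq0]
            _ ≤ _ := by nlinarith [abs_nonneg (k : ℝ)]
      _ = _ := by rw [Finset.mul_sum]; exact Finset.sum_congr rfl fun j _ => by ring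
  have h3 := le_of_mul_le_mul_left h2 hQ'
  refine le_trans ?_ h3
  have : 0 ≤ T i * |(a i : ℝ)| := mul_nonneg (hT i).le (abs_nonneg _)
  nlinarith

end IsDual

end

end WeightedSingular
end

noncomputable section
namespace WeightedSingular
open Matrix

/-! ### Counting lattice vectors in boxes -/

section cover
variable {d : ℕ} {P : Fin d → ℤ} {Q : ℤ} {H : Matrix (Fin d) (Fin d) ℤ}

/-- Start from a Bezout solution and subtract the integer combination of the rows of `H` obtained by
rounding its coefficients. The remainder is a combination of the rows with coefficients at most
`1/2`. -/
theorem exists_residue (hPQ : IsCoprimeVec P Q) (hH : H.det ≠ 0)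
    (hmem : ∀ i, H i ∈ annLattice P Q) {η : Fin d → ℝ} (hη : ∀ j i, |(H j i : ℝ)| ≤ η i) (ρ : ℤ) :
    ∃ z : Fin d → ℤ, Q ∣ z ⬝ᵥ P - ρ ∧ ∀ i, |(z i : ℝ)| ≤ d / 2 * η i := by
  obtain ⟨x, y, hxy⟩ := hPQ
  set v : Fin d → ℤ := ρ • x with hv
  have hvP : Q ∣ v ⬝ᵥ P - ρ := by
    refine ⟨-(ρ * y), ?_⟩
    rw [hv, smul_dotProduct, smul_eq_mul]
    linear_combination ρ * hxy
  set D : ℝ := (H.det : ℝ) with hD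
  have hD0 : D ≠ 0 := by rw [hD]; exact_mod_cast hH
  set m : Fin d → ℤ := fun j => round (((H.updateRow j v).det : ℝ) / D) with hm
  refine ⟨fun i => v i - ∑ j, m j * H j i, ?_, ?_⟩
  · have e : (fun i => v i - ∑ j, m j * H j i) ⬝ᵥ P = v ⬝ᵥ P - ∑ j, m j * (H j ⬝ᵥ P) := by
      simp only [dotProduct, sub_mul, Finset.sum_sub_distrib, Finset.sum_mul, Finset.mul_sum]
      rw [Finset.sum_comm]
      simp only [mul_assoc]
    rw [e, sub_right_comm]
    exact dvd_sub hvP (Finset.dvd_sum fun j _ => Dvd.dvd.mul_left (hmem j) _)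
  · intro i
    have h1 : D * v i = ∑ j, ((H.updateRow j v).det : ℝ) * H j i := by
      rw [hD]; exact_mod_cast (sum_det_updateRow_smul H v i).symm
    have h2 : (v i : ℝ) = ∑ j, (((H.updateRow j v).det : ℝ) / D) * H j i := by
      have : (v i : ℝ) = (D * v i) / D := by field_simp
      rw [this, h1, Finset.sum_div]
      exact Finset.sum_congr rfl fun j _ => by ring
    push_cast
    rw [h2, ← Finset.sum_sub_distrib]
    refine (Finset.abs_sum_le_sum_abs _ _).trans ?_
    refine (Finset.sum_le_card_nsmul _ _ (1 / 2 * η i) fun j _ => ?_).trans (le_of_eq ?_)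
    · rw [← sub_mul, abs_mul]
      exact mul_le_mul (abs_sub_round _) (hη j i) (abs_nonneg _) (by norm_num)
    · simp; ring

theorem one_le_of_abs_le (hH : H.det ≠ 0) {η : Fin d → ℝ} (hη : ∀ j i, |(H j i : ℝ)| ≤ η i)
    (i : Fin d) : 1 ≤ η i := by
  by_contra! h
  refine hH (det_eq_zero_of_column_eq_zero i fun j => ?_)
  have : |(H j i : ℝ)| < 1 := (hη j i).trans_lt h
  rw [← Int.abs_lt_one_iff]
  exact_mod_cast this

/-- Translate the first components by small representatives of all `Q` residues. The `Q` translates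
are disjoint, since `a + z ρ` and `k` determine `ρ` modulo `Q`. They lie in a box enlarged by the
factor `1 + d/2`, whose integer points are counted trivially. The independent vectors `H` provide
the small representatives; without them the box could be too thin for a volume bound. -/
theorem card_mul_le_of_cover (hQ : 0 < Q) (hPQ : IsCoprimeVec P Q) (hH : H.det ≠ 0)
    (hmem : ∀ i, H i ∈ annLattice P Q) {η : Fin d → ℝ} (hη : ∀ j i, |(H j i : ℝ)| ≤ η i)
    {Y : ℝ} (hY : 0 ≤ Y) (S : Finset ((Fin d → ℤ) × ℤ))
    (hS : ∀ x ∈ S, (∀ i, |(x.1 i : ℝ)| ≤ η i) ∧ |(x.2 : ℝ)| ≤ Y ∧ Q ∣ x.1 ⬝ᵥ P - x.2) :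
    (Q : ℝ) * S.card ≤ (2 * Y + 1) * ((d + 3) ^ d * ∏ i, η i) := by
  classical
  have hη1 := one_le_of_abs_le hH hη
  choose z hz1 hz2 using fun ρ : ℤ => exists_residue hPQ hH hmem hη ρ
  set B : Fin d → ℝ := fun i => (1 + d / 2) * η i with hB
  have hB0 : ∀ i, 0 ≤ B i := fun i => by
    have := hη1 i
    simp only [hB]; positivity
  set K : Finset ((Fin d → ℤ) × ℤ) :=
    (Fintype.piFinset fun i => Finset.Icc (-⌊B i⌋) ⌊B i⌋) ×ˢ Finset.Icc (-⌊Y⌋) ⌊Y⌋ with hK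
  have hcard : (S ×ˢ Finset.Ico 0 Q).card ≤ K.card := by
    refine Finset.card_le_card_of_injOn (fun u => (u.1.1 + z u.2, u.1.2)) ?_ ?_
    · rintro ⟨x, ρ⟩ hx
      simp only [Finset.coe_product, Set.mem_prod, Finset.mem_coe] at hx
      obtain ⟨h1, h2, -⟩ := hS x hx.1
      simp only [hK, Finset.coe_product, Set.mem_prod, Finset.mem_coe, Fintype.mem_piFinset,
        Finset.mem_Icc, ← abs_le]
      refine ⟨fun i => ?_, ?_⟩
      · rw [Int.le_floor]
        push_cast
        have h3 : |(x.1 i : ℝ)| ≤ η i := h1 i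
        have h4 := hz2 ρ i
        have h5 := abs_add_le (x.1 i : ℝ) (z ρ i)
        have h6 : |(((x.1 + z ρ) i : ℤ) : ℝ)| ≤ |(x.1 i : ℝ)| + |(z ρ i : ℝ)| := by
          simpa using h5
        simp only [hB]; linarith
      · rw [Int.le_floor]; exact_mod_cast h2
    · rintro ⟨⟨a, k⟩, ρ⟩ hx ⟨⟨a', k'⟩, ρ'⟩ hx' h
      simp only [Finset.coe_product, Set.mem_prod, Finset.mem_coe, Finset.mem_Ico] at hx hx'
      simp only [Prod.mk.injEq] at h
      obtain ⟨h1, rfl⟩ := h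
      have e1 := (hS _ hx.1).2.2
      have e2 := (hS _ hx'.1).2.2
      simp only at e1 e2
      have e3 : (a + z ρ) ⬝ᵥ P = (a' + z ρ') ⬝ᵥ P := by rw [h1]
      rw [add_dotProduct, add_dotProduct] at e3
      have e4 : Q ∣ ρ - ρ' := by
        have := dvd_sub (dvd_add e2 (hz1 ρ')) (dvd_add e1 (hz1 ρ))
        have e6 : ρ - ρ' = a' ⬝ᵥ P - k + (z ρ' ⬝ᵥ P - ρ') - (a ⬝ᵥ P - k + (z ρ ⬝ᵥ P - ρ)) := by
          linear_combination e3
        rwa [e6]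
      have e5 : ρ = ρ' := by
        have h5 : |ρ - ρ'| < Q := by
          rw [abs_lt]; constructor <;> linarith [hx.2.1, hx.2.2, hx'.2.1, hx'.2.2]
        have := Int.eq_zero_of_abs_lt_dvd e4 h5
        linarith
      subst e5
      have := add_right_cancel h1
      rw [this]
  have h1 : (Q : ℝ) * S.card = ((S ×ˢ Finset.Ico 0 Q).card : ℝ) := by
    rw [Finset.card_product]; push_cast
    rw [Int.card_Ico, sub_zero, mul_comm]
    congr 1
    have : ((Q.toNat : ℤ) : ℝ) = Q := by rw [Int.toNat_of_nonneg hQ.le]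
    exact_mod_cast this.symm
  rw [h1]
  have hIcc : ∀ y : ℝ, 0 ≤ y → ((Finset.Icc (-⌊y⌋) ⌊y⌋).card : ℝ) ≤ 2 * y + 1 := by
    intro y hy
    rw [Int.card_Icc]
    have h0 : 0 ≤ ⌊y⌋ := Int.floor_nonneg.2 hy
    have : (((⌊y⌋ + 1 - -⌊y⌋).toNat : ℤ) : ℝ) = 2 * ⌊y⌋ + 1 := by
      rw [Int.toNat_of_nonneg (by linarith)]; push_cast; ring
    have h2 : (((⌊y⌋ + 1 - -⌊y⌋).toNat : ℕ) : ℝ) = 2 * ⌊y⌋ + 1 := by exact_mod_cast this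
    rw [h2]
    linarith [Int.floor_le y]
  calc ((S ×ˢ Finset.Ico 0 Q).card : ℝ) ≤ K.card := by exact_mod_cast hcard
    _ = (∏ i, ((Finset.Icc (-⌊B i⌋) ⌊B i⌋).card : ℝ)) * (Finset.Icc (-⌊Y⌋) ⌊Y⌋).card := by
        rw [hK, Finset.card_product, Fintype.card_piFinset]; push_cast; rfl
    _ ≤ (∏ i, ((d + 3) * η i)) * (2 * Y + 1) := by
        refine mul_le_mul (Finset.prod_le_prod (fun _ _ => by positivity) fun i _ => ?_) (hIcc Y hY)
          (by positivity) (Finset.prod_nonneg fun i _ => ?_)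
        · refine (hIcc _ (hB0 i)).trans ?_
          have := hη1 i
          simp only [hB]; nlinarith
        · have := hη1 i
          positivity
    _ = _ := by
        rw [Finset.prod_mul_distrib, Finset.prod_const, Finset.card_univ, Fintype.card_fin]; ring

end cover

/-! ### Counting solutions of linear congruences in boxes -/

theorem card_Ico_modEq_le (s R v r : ℤ) (hr : 0 < r) (hR : 0 ≤ R) :
    (((Finset.Ico s (s + R)).filter fun x => x ≡ v [ZMOD r]).card : ℝ) ≤ R / r + 1 := by
  have h := Int.Ico_filter_modEq_card s (s + R) hr v
  have h2 : ((((Finset.Ico s (s + R)).filter fun x => x ≡ v [ZMOD r]).card : ℤ) : ℚ) ≤ R / r + 1 := by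
    rw [h]
    push_cast
    refine max_le ?_ ?_
    · have h3 := Int.ceil_lt_add_one (((s : ℚ) + R - v) / r)
      have h4 := Int.le_ceil (((s : ℚ) - v) / r)
      have : ((s : ℚ) + R - v) / r = ((s : ℚ) - v) / r + R / r := by ring
      rw [this] at h3
      rw [this]
      linarith
    · have : (0 : ℚ) < r := by exact_mod_cast hr
      have : (0 : ℚ) ≤ R := by exact_mod_cast hR
      positivity
  have h3 : (((((Finset.Ico s (s + R)).filter fun x => x ≡ v [ZMOD r]).card : ℤ) : ℚ) : ℝ)
    ≤ ((R / r + 1 : ℚ) : ℝ) := by exact_mod_cast h2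
  simpa using h3

theorem modEq_of_dvd_of_dvd {g : ℕ} (hg : 0 < g) {c b x y : ℤ} (hx : (g : ℤ) ∣ c * x + b)
    (hy : (g : ℤ) ∣ c * y + b) : x ≡ y [ZMOD ((g / Int.gcd g c : ℕ) : ℤ)] := by
  have h1 : (g : ℤ) ∣ c * (y - x) := by
    have := dvd_sub hy hx
    have e : c * (y - x) = c * y + b - (c * x + b) := by ring
    rwa [e]
  rw [Int.modEq_iff_dvd]
  have hg' : 0 < Int.gcd g c := Int.gcd_pos_of_ne_zero_left _ (by exact_mod_cast hg.ne')
  obtain ⟨u, hu⟩ : (Int.gcd g c : ℤ) ∣ c := Int.gcd_dvd_right _ _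
  have hgd : Int.gcd g c ∣ g := by exact_mod_cast Int.gcd_dvd_left (g : ℤ) c
  obtain ⟨e, he⟩ := hgd
  set g' := Int.gcd g c with hg'def
  have hge : g / g' = e := by rw [he, Nat.mul_div_cancel_left _ hg']
  have hcop : IsCoprime (e : ℤ) u := by
    rw [Int.isCoprime_iff_gcd_eq_one]
    have h5 : Int.gcd ((g' : ℤ) * e) ((g' : ℤ) * u) = g' * Int.gcd e u := by
      rw [Int.gcd_mul_left]; simp
    have h6 : ((g' : ℤ) * e) = g := by rw [he]; push_cast; ring
    rw [h6, ← hu, ← hg'def] at h5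
    have : g' * 1 = g' * Int.gcd e u := by rw [mul_one]; exact h5
    exact (Nat.eq_of_mul_eq_mul_left hg' this).symm
  rw [hge]
  have h2 : (g' : ℤ) * e ∣ (g' : ℤ) * (u * (y - x)) := by
    have h6 : ((g' : ℤ) * e) = g := by rw [he]; push_cast; ring
    rw [h6, ← mul_assoc, ← hu]; exact h1
  exact hcop.dvd_of_dvd_mul_left (Int.dvd_of_mul_dvd_mul_left (by exact_mod_cast hg'.ne') h2)

theorem card_Ico_dvd_le {g : ℕ} (hg : 0 < g) (c b s R : ℤ) (hR : 0 ≤ R) :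
    (((Finset.Ico s (s + R)).filter fun x => (g : ℤ) ∣ c * x + b).card : ℝ)
      ≤ R * Int.gcd g c / g + 1 := by
  have hg' : 0 < Int.gcd g c := Int.gcd_pos_of_ne_zero_left _ (by exact_mod_cast hg.ne')
  have hgd : Int.gcd g c ∣ g := by exact_mod_cast Int.gcd_dvd_left (g : ℤ) c
  rcases Finset.eq_empty_or_nonempty
    ((Finset.Ico s (s + R)).filter fun x => (g : ℤ) ∣ c * x + b) with h | ⟨y, hy⟩
  · rw [h]
    have : (0 : ℝ) ≤ R := by exact_mod_cast hR
    simp; positivity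
  · have hr : (0 : ℤ) < ((g / Int.gcd g c : ℕ) : ℤ) := by
      exact_mod_cast Nat.div_pos (Nat.le_of_dvd hg hgd) hg'
    have h1 := card_Ico_modEq_le s R y _ hr hR
    have h2 : ((Finset.Ico s (s + R)).filter fun x => (g : ℤ) ∣ c * x + b) ⊆
        (Finset.Ico s (s + R)).filter fun x => x ≡ y [ZMOD ((g / Int.gcd g c : ℕ) : ℤ)] := by
      intro x hx
      rw [Finset.mem_filter] at hx hy ⊢
      exact ⟨hx.1, modEq_of_dvd_of_dvd hg hx.2 hy.2⟩
    refine (by exact_mod_cast Finset.card_le_card h2 : (_ : ℝ) ≤ _).trans (h1.trans (le_of_eq ?_))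
    congr 1
    have : (((g / Int.gcd g c : ℕ) : ℤ) : ℝ) = (g : ℝ) / Int.gcd g c := by
      rw [Int.cast_natCast, Nat.cast_div hgd (Nat.cast_ne_zero.2 hg'.ne')]
    rw [this, div_div_eq_mul_div]

/-- The solutions are multiples of `g / gcd(g, c)`. A positive one in the interval forces this
spacing to be at most `8 R`, so the additive `1` of the general bound is absorbed. This is why the
coefficient boxes stay away from the origin. -/
theorem card_Ico_dvd_le' {g : ℕ} (hg : 0 < g) (c s R : ℤ) (hR : 0 ≤ R) (hs : 1 ≤ s)
    (hsR : s ≤ 7 * R) :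
    (((Finset.Ico s (s + R)).filter fun x => (g : ℤ) ∣ c * x).card : ℝ)
      ≤ 9 * (R * Int.gcd g c / g) := by
  have hR' : (0 : ℝ) ≤ R := by exact_mod_cast hR
  rcases Finset.eq_empty_or_nonempty
    ((Finset.Ico s (s + R)).filter fun x => (g : ℤ) ∣ c * x) with h | ⟨y, hy⟩
  · rw [h]
    simp; positivity
  · have h1 := card_Ico_dvd_le hg c 0 s R hR
    simp only [add_zero] at h1
    refine h1.trans ?_
    have hg' : 0 < Int.gcd g c := Int.gcd_pos_of_ne_zero_left _ (by exact_mod_cast hg.ne')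
    have hgd : Int.gcd g c ∣ g := by exact_mod_cast Int.gcd_dvd_left (g : ℤ) c
    rw [Finset.mem_filter, Finset.mem_Ico] at hy
    have h2 := modEq_of_dvd_of_dvd hg (c := c) (b := 0) (x := 0) (y := y) (by simp)
      (by simpa using hy.2)
    rw [Int.modEq_iff_dvd, sub_zero] at h2
    have h3 := Int.le_of_dvd (by linarith [hy.1.1]) h2
    have h4 : (((g / Int.gcd g c : ℕ) : ℤ) : ℝ) ≤ 8 * R := by
      have : ((g / Int.gcd g c : ℕ) : ℤ) ≤ 8 * R := by linarith [hy.1.2]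
      exact_mod_cast this
    have : (((g / Int.gcd g c : ℕ) : ℤ) : ℝ) = (g : ℝ) / Int.gcd g c := by
      rw [Int.cast_natCast, Nat.cast_div hgd (Nat.cast_ne_zero.2 hg'.ne')]
    rw [this, div_le_iff₀ (by exact_mod_cast hg')] at h4
    have hg0 : (0 : ℝ) < g := by exact_mod_cast hg
    have : 1 ≤ 8 * ((R : ℝ) * Int.gcd g c / g) := by
      rw [← mul_div_assoc, le_div_iff₀ hg0]; linarith
    linarith

section congr
variable {ι : Type*} [Fintype ι] [DecidableEq ι]

/-- The integer points of a box in the coordinate subspace given by `A`. -/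
def subBox (s R : ι → ℤ) (A : Finset ι) : Finset (ι → ℤ) :=
  Fintype.piFinset fun l => if l ∈ A then Finset.Ico (s l) (s l + R l) else {0}

/-- The number of points of `subBox s R A` at which the linear form `c` is divisible by `g`. -/
def congrCount (s R c : ι → ℤ) (A : Finset ι) (g : ℕ) : ℕ :=
  ((subBox s R A).filter fun n => (g : ℤ) ∣ ∑ l, c l * n l).card

theorem sum_update_zero (c n : ι → ℤ) (l : ι) :
    ∑ i, c i * n i = c l * n l + ∑ i, c i * Function.update n l 0 i := by
  rw [← Finset.add_sum_erase _ _ (Finset.mem_univ l),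
    ← Finset.add_sum_erase _ (fun i => c i * Function.update n l 0 i) (Finset.mem_univ l)]
  simp only [Function.update_self, mul_zero, zero_add]
  congr 1
  exact Finset.sum_congr rfl fun i hi => by rw [Function.update_of_ne (Finset.ne_of_mem_erase hi)]

/-- Fibre over the variables in `A`: these satisfy the congruence modulo `gcd(g, c l)`, and each
choice leaves a single congruence modulo `g` for the variable `l`. -/
theorem congrCount_insert_le (s R c : ι → ℤ) (hR : ∀ l, 0 ≤ R l) (A : Finset ι) {l : ι}
    (hl : l ∉ A) {g : ℕ} (hg : 0 < g) :
    (congrCount s R c (insert l A) g : ℝ)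
      ≤ (1 + R l * Int.gcd g (c l) / g) * congrCount s R c A (Int.gcd g (c l)) := by
  set S := (subBox s R (insert l A)).filter fun n => (g : ℤ) ∣ ∑ l, c l * n l with hS
  set S' := (subBox s R A).filter fun n => ((Int.gcd g (c l) : ℕ) : ℤ) ∣ ∑ l, c l * n l with hS'
  have hmaps : ∀ n ∈ S, Function.update n l 0 ∈ S' := by
    intro n hn
    rw [hS, Finset.mem_filter, subBox, Fintype.mem_piFinset] at hn
    rw [hS', Finset.mem_filter, subBox, Fintype.mem_piFinset]
    refine ⟨fun i => ?_, ?_⟩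
    · by_cases hi : i = l
      · subst hi; simp [hl]
      · rw [Function.update_of_ne hi]
        simpa [hi] using hn.1 i
    · have h1 := hn.2
      rw [sum_update_zero c n l] at h1
      exact (dvd_add_right (Dvd.dvd.mul_right (Int.gcd_dvd_right _ _) _)).1
        ((Int.gcd_dvd_left _ _).trans h1)
  have hcard : S.card = ∑ y ∈ S', (S.filter fun n => Function.update n l 0 = y).card :=
    Finset.card_eq_sum_card_fiberwise hmaps
  have hfib : ∀ y ∈ S', ((S.filter fun n => Function.update n l 0 = y).card : ℝ)
      ≤ 1 + R l * Int.gcd g (c l) / g := by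
    intro y _
    rw [add_comm]
    refine le_trans ?_ (card_Ico_dvd_le hg (c l) (∑ i, c i * y i) (s l) (R l) (hR l))
    norm_cast
    refine Finset.card_le_card_of_injOn (fun n => n l) ?_ ?_
    · intro n hn
      simp only [Finset.coe_filter, Set.mem_ofPred_eq, hS, Finset.mem_filter, subBox,
        Fintype.mem_piFinset] at hn
      obtain ⟨⟨h1, h2⟩, h3⟩ := hn
      simp only [Finset.coe_filter, Set.mem_ofPred_eq]
      refine ⟨by simpa using h1 l, ?_⟩
      rw [← h3, ← sum_update_zero]; exact h2
    · intro n hn n' hn' h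
      simp only [Finset.coe_filter, Set.mem_ofPred_eq] at hn hn'
      have h1 : Function.update n l 0 = Function.update n' l 0 := by rw [hn.2, hn'.2]
      ext i
      by_cases hi : i = l
      · subst hi; exact h
      · have := congrFun h1 i
        rwa [Function.update_of_ne hi, Function.update_of_ne hi] at this
  have : (congrCount s R c (insert l A) g : ℝ) = (S.card : ℝ) := rfl
  rw [this, hcard]
  push_cast
  refine (Finset.sum_le_card_nsmul _ _ _ hfib).trans (le_of_eq ?_)
  rw [nsmul_eq_mul, mul_comm]; rfl

theorem congrCount_singleton_le (s R c : ι → ℤ) (l : ι) (hs : 1 ≤ s l) (hsR : s l ≤ 7 * R l)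
    {g : ℕ} (hg : 0 < g) :
    (congrCount s R c {l} g : ℝ) ≤ 9 * (R l * Int.gcd g (c l) / g) := by
  refine le_trans ?_ (card_Ico_dvd_le' hg (c l) (s l) (R l) (by linarith) hs hsR)
  norm_cast
  have key : ∀ n ∈ subBox s R {l}, ∀ i, i ≠ l → n i = 0 := by
    intro n hn i hi
    rw [subBox, Fintype.mem_piFinset] at hn
    simpa [hi] using hn i
  refine Finset.card_le_card_of_injOn (fun n => n l) ?_ ?_
  · intro n hn
    simp only [Finset.coe_filter, Set.mem_ofPred_eq] at hn ⊢
    refine ⟨?_, ?_⟩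
    · have := hn.1
      rw [subBox, Fintype.mem_piFinset] at this
      simpa using this l
    · have h1 := hn.2
      rwa [Finset.sum_eq_single l (fun i _ hi => by rw [key n hn.1 i hi, mul_zero])
        (fun h => absurd (Finset.mem_univ _) h)] at h1
  · intro n hn n' hn' h
    simp only [Finset.coe_filter, Set.mem_ofPred_eq] at hn hn'
    ext i
    by_cases hi : i = l
    · subst hi; exact h
    · rw [key n hn.1 i hi, key n' hn'.1 i hi]

/-- Variables are eliminated one at a time, the modulus dropping from `g` to `g' = gcd(g, c l)` at
the cost `1 + R g'/g`; as `ζ R ≥ 1`, this factor turns `1/g' + ζ` into at most `3 R (1/g + ζ)`. For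
the last variable the gcd is a common divisor of all coefficients, hence at most `h`, and no
additive term occurs. -/
theorem congrCount_le (s R c : ι → ℤ) (hs : ∀ l, 1 ≤ s l) (hsR : ∀ l, s l ≤ 7 * R l)
    {h ζ : ℝ} (hζ : 0 ≤ ζ) (A : Finset ι) (hA : A.Nonempty) :
    ∀ g : ℕ, 0 < g → (∀ e : ℕ, e ∣ g → (∀ l ∈ A, (e : ℤ) ∣ c l) → (e : ℝ) ≤ h) →
    (∀ l ∈ A, (∃ l' ∈ A, l' ≠ l) → 1 ≤ ζ * R l) →
    (congrCount s R c A g : ℝ) ≤ 9 * 3 ^ A.card * h * (∏ l ∈ A, (R l : ℝ)) * (1 / g + ζ) := by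
  have hR : ∀ l, (1 : ℝ) ≤ R l := fun l => by
    have : 1 ≤ R l := by have := hs l; have := hsR l; omega
    exact_mod_cast this
  have hR0 : ∀ l, 0 ≤ R l := fun l => by have := hs l; have := hsR l; omega
  induction hA using Finset.Nonempty.cons_induction with
  | singleton l =>
    intro g hg hh _
    refine (congrCount_singleton_le s R c l (hs l) (hsR l) hg).trans ?_
    have hgd : Int.gcd g (c l) ∣ g := by exact_mod_cast Int.gcd_dvd_left (g : ℤ) (c l)
    have h1 := hh (Int.gcd g (c l)) hgd (by simpa using Int.gcd_dvd_right (g : ℤ) (c l))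
    have hh0 : 0 ≤ h := le_trans (by positivity) h1
    have := hR l
    have hg0 : (0 : ℝ) < g := by exact_mod_cast hg
    simp only [Finset.card_singleton, Finset.prod_singleton, pow_one]
    calc 9 * ((R l : ℝ) * Int.gcd g (c l) / g) ≤ 9 * ((R l : ℝ) * h / g) := by gcongr
      _ = 9 * h * R l * (1 / g) := by ring
      _ ≤ 9 * 3 * h * R l * (1 / g + ζ) := by
        have : 0 ≤ h * R l := by positivity
        have h3 : (0 : ℝ) ≤ 1 / g := by positivity
        nlinarith [mul_nonneg this h3, mul_nonneg this hζ]
  | cons l A hl hA ih =>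
    intro g hg hh hζR
    rw [Finset.cons_eq_insert] at hh hζR ⊢
    refine (congrCount_insert_le s R c hR0 A hl hg).trans ?_
    set g' := Int.gcd g (c l) with hg'def
    have hg' : 0 < g' := Int.gcd_pos_of_ne_zero_left _ (by exact_mod_cast hg.ne')
    have hgd : g' ∣ g := by exact_mod_cast Int.gcd_dvd_left (g : ℤ) (c l)
    have h1 := ih g' hg' (fun e he hec => hh e (he.trans hgd) (by
        intro l' hl'
        rcases Finset.mem_insert.1 hl' with rfl | h'
        · exact (Int.natCast_dvd_natCast.2 he).trans (Int.gcd_dvd_right _ _)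
        · exact hec l' h'))
      (fun l' hl' ⟨l'', h2, h3⟩ => hζR l' (Finset.mem_insert_of_mem hl')
        ⟨l'', Finset.mem_insert_of_mem h2, h3⟩)
    obtain ⟨l', hl'⟩ := hA
    have h2 : 1 ≤ ζ * R l := hζR l (Finset.mem_insert_self _ _)
      ⟨l', Finset.mem_insert_of_mem hl', fun h => hl (h ▸ hl')⟩
    have hh1 : 1 ≤ h := by simpa using hh 1 (one_dvd _) (fun _ _ => by simp)
    have hRl := hR l
    have hg0 : (0 : ℝ) < g := by exact_mod_cast hg
    have hg'0 : (1 : ℝ) ≤ g' := by exact_mod_cast hg'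
    have hg'g : (g' : ℝ) ≤ g := by exact_mod_cast Nat.le_of_dvd hg hgd
    have hprod : (0 : ℝ) ≤ ∏ l ∈ A, (R l : ℝ) :=
      Finset.prod_nonneg fun l _ => by linarith [hR l]
    rw [Finset.card_insert_of_notMem hl, Finset.prod_insert hl, pow_succ]
    have key : (1 + (R l : ℝ) * g' / g) * (1 / g' + ζ) ≤ 3 * R l * (1 / g + ζ) := by
      have e : (1 + (R l : ℝ) * g' / g) * (1 / g' + ζ)
          = 1 / g' + ζ + R l * (1 / g) + R l * ζ * (g' / g) := by
        field_simp
        ring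
      have e1 : (1 : ℝ) / g' ≤ 1 := by rw [div_le_one (by linarith)]; exact hg'0
      have e2 : (g' : ℝ) / g ≤ 1 := by rw [div_le_one hg0]; exact hg'g
      have e3 : (0 : ℝ) ≤ 1 / g := by positivity
      rw [e]
      nlinarith [mul_nonneg (by linarith : (0 : ℝ) ≤ R l) e3, mul_nonneg (by linarith : (0 : ℝ) ≤ R l) hζ,
        mul_le_mul_of_nonneg_left e2 (mul_nonneg (by linarith : (0 : ℝ) ≤ R l) hζ)]
    calc (1 + (R l : ℝ) * g' / g) * congrCount s R c A g'
        ≤ (1 + (R l : ℝ) * g' / g) * (9 * 3 ^ A.card * h * (∏ l ∈ A, (R l : ℝ)) * (1 / g' + ζ)) := by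
          gcongr
      _ = (9 * 3 ^ A.card * h * (∏ l ∈ A, (R l : ℝ))) *
          ((1 + (R l : ℝ) * g' / g) * (1 / g' + ζ)) := by ring
      _ ≤ (9 * 3 ^ A.card * h * (∏ l ∈ A, (R l : ℝ))) * (3 * R l * (1 / g + ζ)) := by gcongr
      _ = _ := by ring

/-- Number of solutions of a homogeneous linear equation in a box away from the origin, with one
variable `m` playing a special role. -/
theorem card_solutions_le (s R c : ι → ℤ) (hs : ∀ l, 1 ≤ s l) (hsR : ∀ l, s l ≤ 7 * R l)
    {h ζ ζ' : ℝ} (hζ : 0 ≤ ζ) (m i : ι) (hmi : m ≠ i) (hci : c i ≠ 0)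
    (hA : ((Finset.univ.erase i).erase m).Nonempty)
    (hh : ∀ e : ℕ, (∀ l, (e : ℤ) ∣ c l) → (e : ℝ) ≤ h)
    (hζR : ∀ l, l ≠ m → l ≠ i → (∃ l', l' ≠ m ∧ l' ≠ i ∧ l' ≠ l) → 1 ≤ ζ * R l)
    (hm0 : c m = 0 → ζ ≤ ζ') (hm1 : c m ≠ 0 → ζ * |(c m : ℝ)| ≤ 1 ∧ 1 ≤ ζ' * R m) :
    ((((subBox s R Finset.univ).filter fun n => ∑ l, c l * n l = 0).card : ℕ) : ℝ) * R i
      ≤ 18 * 3 ^ Fintype.card ι * h * (∏ l, (R l : ℝ)) * (1 / |(c i : ℝ)| + ζ') := by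
  have hR : ∀ l, (1 : ℝ) ≤ R l := fun l => by
    have : 1 ≤ R l := by have := hs l; have := hsR l; omega
    exact_mod_cast this
  have hR0 : ∀ l, 0 ≤ R l := fun l => by have := hs l; have := hsR l; omega
  set A := (Finset.univ.erase i).erase m with hAdef
  have hmA : m ∉ A := Finset.notMem_erase _ _
  have hiA : insert m A = Finset.univ.erase i := Finset.insert_erase
    (Finset.mem_erase.2 ⟨hmi, Finset.mem_univ _⟩)
  set g := (c i).natAbs with hgdef
  have hg : 0 < g := Int.natAbs_pos.2 hci
  have hgc : (g : ℝ) = |(c i : ℝ)| := by rw [hgdef, Nat.cast_natAbs]; push_cast; rfl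
  have hA0 : ∀ l ∈ A, l ≠ m ∧ l ≠ i := fun l hl => by
    rw [hAdef, Finset.mem_erase, Finset.mem_erase] at hl
    exact ⟨hl.1, hl.2.1⟩
  have hA1 : ∀ l, l ≠ m → l ≠ i → l ∈ A := fun l h1 h2 => by simp [hAdef, h1, h2]
  -- The variable `i` is determined by the others, which satisfy a congruence modulo `c i`.
  have h1 : ((subBox s R Finset.univ).filter fun n => ∑ l, c l * n l = 0).card
      ≤ congrCount s R c (insert m A) g := by
    refine Finset.card_le_card_of_injOn (fun n => Function.update n i 0) ?_ ?_
    · intro n hn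
      simp only [Finset.coe_filter, Set.mem_ofPred_eq, subBox, Fintype.mem_piFinset] at hn
      simp only [Finset.coe_filter, Set.mem_ofPred_eq, subBox, Fintype.mem_piFinset, hiA]
      refine ⟨fun l => ?_, ?_⟩
      · by_cases hl : l = i
        · subst hl; simp
        · rw [Function.update_of_ne hl]
          simpa [hl] using hn.1 l
      · have h2 := hn.2
        rw [sum_update_zero c n i] at h2
        have : ∑ l, c l * Function.update n i 0 l = -(c i * n i) := by linarith
        rw [this, hgdef, Int.natAbs_dvd]
        exact (dvd_mul_right _ _).neg_right
    · intro n hn n' hn' h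
      simp only [Finset.coe_filter, Set.mem_ofPred_eq] at hn hn'
      have h2 := hn.2
      have h3 := hn'.2
      rw [sum_update_zero c n i] at h2
      rw [sum_update_zero c n' i] at h3
      simp only at h
      rw [h] at h2
      have h4 : n i = n' i := mul_left_cancel₀ hci (by linarith)
      ext l
      by_cases hl : l = i
      · subst hl; exact h4
      · have := congrFun h l
        rwa [Function.update_of_ne hl, Function.update_of_ne hl] at this
  have h2 := congrCount_insert_le s R c hR0 A hmA hg
  set g' := Int.gcd g (c m) with hg'def
  have hg' : 0 < g' := Int.gcd_pos_of_ne_zero_left _ (by exact_mod_cast hg.ne')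
  have hgd : g' ∣ g := by exact_mod_cast Int.gcd_dvd_left (g : ℤ) (c m)
  have h3 := congrCount_le s R c hs hsR hζ A hA g' hg' (h := h)
    (fun e he hec => hh e fun l => by
      by_cases h4 : l = m
      · subst h4
        exact (Int.natCast_dvd_natCast.2 he).trans (Int.gcd_dvd_right _ _)
      by_cases h5 : l = i
      · subst h5
        have := Int.natCast_dvd_natCast.2 (he.trans hgd)
        rwa [hgdef, Int.dvd_natAbs] at this
      · exact hec l (hA1 l h4 h5))
    (fun l hl ⟨l', hl', h5⟩ => hζR l (hA0 l hl).1 (hA0 l hl).2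
      ⟨l', (hA0 l' hl').1, (hA0 l' hl').2, h5⟩)
  have hh1 : 1 ≤ h := by simpa using hh 1 (fun _ => by simp)
  have hRm := hR m
  have hg0 : (0 : ℝ) < g := by exact_mod_cast hg
  have hg'0 : (1 : ℝ) ≤ g' := by exact_mod_cast hg'
  have hg'g : (g' : ℝ) ≤ g := by exact_mod_cast Nat.le_of_dvd hg hgd
  have hprod : (0 : ℝ) ≤ ∏ l ∈ A, (R l : ℝ) :=
    Finset.prod_nonneg fun l _ => by linarith [hR l]
  -- For the special variable, either `c m = 0` and the modulus does not drop, or the new modulus is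
  -- at most `|c m|` and `ζ |c m| ≤ 1` replaces a lower bound on `ζ R m`.
  have key : (1 + (R m : ℝ) * g' / g) * (1 / g' + ζ) ≤ 2 * R m * (1 / g + ζ') := by
    have e : (1 + (R m : ℝ) * g' / g) * (1 / g' + ζ)
        = 1 / g' + ζ + R m * (1 / g) + R m * (ζ * g') * (1 / g) := by
      field_simp
      ring
    have e3 : (0 : ℝ) ≤ 1 / g := by positivity
    rw [e]
    by_cases hcm : c m = 0
    · have e4 : g' = g := by rw [hg'def, hcm]; simp
      rw [e4]
      have e5 := hm0 hcm
      have e6 : R m * (ζ * g) * (1 / g) = R m * ζ := by field_simp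
      rw [e6]
      nlinarith [mul_nonneg (by linarith : (0 : ℝ) ≤ R m) e3]
    · obtain ⟨e4, e5⟩ := hm1 hcm
      have e6 : (g' : ℝ) ≤ |(c m : ℝ)| := by
        have : g' ≤ (c m).natAbs := Nat.le_of_dvd (Int.natAbs_pos.2 hcm)
          (by have := Int.gcd_dvd_right (g : ℤ) (c m); rwa [← Int.dvd_natAbs, Int.natCast_dvd_natCast] at this)
        calc (g' : ℝ) ≤ ((c m).natAbs : ℝ) := by exact_mod_cast this
          _ = _ := by rw [Nat.cast_natAbs]; push_cast; rfl
      have e7 : ζ * g' ≤ 1 := (mul_le_mul_of_nonneg_left e6 hζ).trans e4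
      have e8 : ζ ≤ 1 := by nlinarith
      have e1 : (1 : ℝ) / g' ≤ 1 := by rw [div_le_one (by linarith)]; exact hg'0
      have e9 : R m * (ζ * g') * (1 / g) ≤ R m * (1 / g) := by
        have : R m * (ζ * g') ≤ R m := by nlinarith
        exact mul_le_mul_of_nonneg_right this e3
      nlinarith
  have hcardA : A.card ≤ Fintype.card ι := Finset.card_le_univ _
  have hpow : (3 : ℝ) ^ A.card ≤ 3 ^ Fintype.card ι := pow_le_pow_right₀ (by norm_num) hcardA
  have hprodall : (∏ l, (R l : ℝ)) = R i * (R m * ∏ l ∈ A, (R l : ℝ)) := by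
    rw [← Finset.mul_prod_erase _ _ (Finset.mem_univ i), ← hiA, Finset.prod_insert hmA]
  have hfac : 0 ≤ 1 / (g : ℝ) + ζ' := by
    have : 0 ≤ 2 * R m * (1 / g + ζ') := le_trans (by positivity) key
    nlinarith
  rw [← hgc]
  calc ((((subBox s R Finset.univ).filter fun n => ∑ l, c l * n l = 0).card : ℕ) : ℝ) * R i
      ≤ congrCount s R c (insert m A) g * R i := by
        have := hR i
        gcongr
    _ ≤ ((1 + (R m : ℝ) * g' / g) *
          (9 * 3 ^ A.card * h * (∏ l ∈ A, (R l : ℝ)) * (1 / g' + ζ))) * R i := by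
        have := hR i
        refine mul_le_mul_of_nonneg_right (h2.trans ?_) (by linarith)
        gcongr
    _ = (9 * 3 ^ A.card * h * (∏ l ∈ A, (R l : ℝ)) * R i) *
          ((1 + (R m : ℝ) * g' / g) * (1 / g' + ζ)) := by ring
    _ ≤ (9 * 3 ^ A.card * h * (∏ l ∈ A, (R l : ℝ)) * R i) * (2 * R m * (1 / g + ζ')) := by
        have := hR i
        gcongr
    _ ≤ (9 * 3 ^ Fintype.card ι * h * (∏ l ∈ A, (R l : ℝ)) * R i) * (2 * R m * (1 / g + ζ')) := by
        have := hR i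
        gcongr
    _ = _ := by rw [hprodall]; ring

end congr

end WeightedSingular
end

/-! ### The family of candidates near `P / Q`. -/

noncomputable section
namespace WeightedSingular
open Matrix

theorem exists_coprimeVec {d : ℕ} (a : Fin d → ℤ) (b : ℤ) (h : a ≠ 0 ∨ b ≠ 0) :
    ∃ (g : ℤ) (a' : Fin d → ℤ) (b' : ℤ), 0 < g ∧ a = g • a' ∧ b = g * b' ∧ IsCoprimeVec a' b' := by
  set f : Fin d ⊕ Unit → ℤ := Sum.elim a fun _ => b with hf
  obtain ⟨g, hg⟩ := (IsPrincipalIdealRing.principal (Ideal.span (Set.range f))).principal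
  have hg' : Ideal.span (Set.range f) = Ideal.span {g} := hg
  have hdvd : ∀ k, g ∣ f k := fun k => by
    rw [← Ideal.mem_span_singleton, ← hg']
    exact Ideal.subset_span ⟨k, rfl⟩
  have hmem : g ∈ Ideal.span (Set.range f) := by rw [hg']; exact Ideal.mem_span_singleton_self g
  obtain ⟨c, hc⟩ := (Submodule.mem_span_range_iff_exists_fun ℤ).1 hmem
  have hc' : (fun i => c (Sum.inl i)) ⬝ᵥ a + c (Sum.inr ()) * b = g := by
    rw [← hc, Fintype.sum_sum_type]
    simp [dotProduct, hf]
  have hg0 : g ≠ 0 := by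
    rintro rfl
    rcases h with h | h
    · exact h (funext fun i => by simpa [hf] using hdvd (Sum.inl i))
    · exact h (by simpa [hf] using hdvd (Sum.inr ()))
  choose u hu using hdvd
  have hs : g.sign * |g| = g := Int.sign_mul_abs g
  have hss : g.sign * g.sign = 1 := by
    rcases lt_or_gt_of_ne hg0 with h | h
    · rw [Int.sign_eq_neg_one_of_neg h]; norm_num
    · rw [Int.sign_eq_one_of_pos h]; norm_num
  have habs : |g| = g.sign * g := (Int.sign_mul_self_eq_abs g).symm
  have hua : a = g • fun i => u (Sum.inl i) := funext fun i => by simpa [hf] using hu (Sum.inl i)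
  have hub : b = g * u (Sum.inr ()) := by simpa [hf] using hu (Sum.inr ())
  refine ⟨|g|, fun i => g.sign * u (Sum.inl i), g.sign * u (Sum.inr ()), abs_pos.2 hg0, ?_, ?_, ?_⟩
  · ext i
    have := congrFun hua i
    simp only [Pi.smul_apply, smul_eq_mul] at this ⊢
    rw [this, habs]
    linear_combination (-(g * u (Sum.inl i))) * hss
  · rw [habs]
    linear_combination hub - (g * u (Sum.inr ())) * hss
  · refine ⟨fun i => g.sign * c (Sum.inl i), g.sign * c (Sum.inr ()), ?_⟩
    have h1 : (fun i => c (Sum.inl i)) ⬝ᵥ (fun i => u (Sum.inl i)) + c (Sum.inr ()) * u (Sum.inr ()) = 1 := by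
      refine mul_left_cancel₀ hg0 ?_
      rw [hua, dotProduct_smul, smul_eq_mul] at hc'
      rw [mul_one]
      rw [hub] at hc'
      linear_combination hc'
    have h2 : (fun i => g.sign * c (Sum.inl i)) ⬝ᵥ (fun i => g.sign * u (Sum.inl i))
        = (g.sign * g.sign) * ((fun i => c (Sum.inl i)) ⬝ᵥ fun i => u (Sum.inl i)) := by
      simp only [dotProduct, Finset.mul_sum]
      exact Finset.sum_congr rfl fun i _ => by ring
    rw [h2]
    linear_combination h1 + (((fun i => c (Sum.inl i)) ⬝ᵥ fun i => u (Sum.inl i)) + c (Sum.inr ()) * u (Sum.inr ())) * hss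

/-- The small constant in the size of the family of candidate rationals. -/
def famConst (d K : ℕ) : ℝ := 1 / (16 * d * K.factorial * redConst d)

/-- A rational vector `P / Q`, reduced vectors of its lattice with the dual system, and the
parameters of the construction of rational vectors of denominator about `X` close to `P / Q`. -/
structure StepData (d : ℕ) where
  P : Fin d → ℤ
  Q : ℤ
  T : Fin d → ℝ
  X : ℝ
  E : ℝ
  δ : ℝ
  lmin : ℝ
  lmax : ℝ
  K : ℕ
  G : Matrix (Fin d) (Fin d) ℤ
  N : ℤ
  p : Fin d → Fin d → ℤ
  q : Fin d → ℤ
  two_le : 2 ≤ d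
  Q_pos : 0 < Q
  coprime : IsCoprimeVec P Q
  T_pos : ∀ i, 0 < T i
  X_pos : 0 < X
  prod_T : ∏ i, T i = X⁻¹
  -- `E` is the factor by which denominators grow in one step, up to the constant `3`.
  Q_mul_le : Q * E ≤ X
  le_Q_mul : X ≤ 3 * E * Q
  reduced : IsReduced P Q T G
  dual : IsDual P Q G N p q
  -- `lmin` and `lmax` enclose the lengths of the reduced vectors, measured at the new time.
  lmin_pos : 0 < lmin
  lmin_le : ∀ j, lmin ≤ wnorm T (G j)
  le_lmax : ∀ j, wnorm T (G j) ≤ lmax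
  δ_pos : 0 < δ
  δ_le : δ ≤ 1
  K_ge : redConst d ≤ K
  lmax_le : lmax * (10 * d ^ 2) ≤ 1
  -- The sides of the coefficient box are at least `1` before rounding, so rounding up at most
  -- doubles them.
  one_le_mul : 1 ≤ famConst d K * δ * E * lmin
  E_ge : 60 * K.factorial ≤ E

namespace StepData
variable {d : ℕ} (S : StepData d)

/-- The common multiple of all small integers. -/
def L : ℤ := (S.K.factorial : ℤ)

/-- The length of the `j`-th side of the box of coefficients. -/
def R (j : Fin d) : ℤ := ⌈famConst d S.K * S.δ * S.E * wnorm S.T (S.G j)⌉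

/-- The number of admissible multiples of `(P, Q)`. -/
def M : ℤ := ⌊S.X / (10 * S.L * S.Q)⌋

/-- Lower ends of the box of coefficients. -/
def lo : Option (Fin d) → ℤ
  | none => 6 * (S.L * S.M) + 1
  | some j => S.R j

/-- Side lengths of the box of coefficients. -/
def len : Option (Fin d) → ℤ
  | none => S.L * S.M
  | some j => S.R j

/-- The coefficient vectors. -/
def Ω : Finset (Option (Fin d) → ℤ) :=
  -- The dual vectors enter multiplied by `L` and `(P, Q)` with a coefficient prime to `L`, which
  -- excludes small common divisors of the coordinates of a candidate.
  (subBox S.lo S.len Finset.univ).filter fun n => n none ≡ 1 [ZMOD S.L]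

/-- The numerators of the candidate with given coefficients. -/
def num (n : Option (Fin d) → ℤ) : Fin d → ℤ :=
  fun i => ∑ j, n (some j) * (S.L * S.p j i) + n none * S.P i

/-- The denominator of the candidate with given coefficients. -/
def den (n : Option (Fin d) → ℤ) : ℤ :=
  ∑ j, n (some j) * (S.L * S.q j) + n none * S.Q

/-- The size of the family of candidates. -/
def tot : ℝ := (∏ j, (S.R j : ℝ)) * S.M

theorem d_pos (S : StepData d) : (0 : ℝ) < d := by
  have := S.two_le
  positivity
theorem two_le_d (S : StepData d) : (2 : ℝ) ≤ d := by exact_mod_cast S.two_le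
theorem L_pos : 0 < S.L := by unfold L; positivity
theorem L_pos' : (0 : ℝ) < S.L := by exact_mod_cast S.L_pos
theorem one_le_L : (1 : ℝ) ≤ S.L := by exact_mod_cast S.L_pos
theorem Q_pos' : (0 : ℝ) < S.Q := by exact_mod_cast S.Q_pos
theorem cast_L : (S.L : ℝ) = S.K.factorial := by simp [L]
theorem E_pos : 0 < S.E := lt_of_lt_of_le (by positivity) S.E_ge
theorem famConst_eq : famConst d S.K = 1 / (16 * d * S.L * redConst d) := by
  rw [famConst, cast_L]
theorem famConst_pos : 0 < famConst d S.K := by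
  have := S.d_pos; have := S.L_pos'; have := redConst_pos d
  rw [famConst_eq]; positivity
theorem lam_pos (j : Fin d) : 0 < wnorm S.T (S.G j) := S.reduced.wnorm_pos S.T_pos j
theorem lmax_pos : 0 < S.lmax := by
  have := S.two_le
  exact (S.lam_pos ⟨0, by omega⟩).trans_le (S.le_lmax _)
theorem lmax_le_one : S.lmax ≤ 1 := by
  have := S.lmax_le; have := S.two_le_d; have := S.lmax_pos
  nlinarith [mul_pos this this]

theorem forty_lmax : S.lmax * 40 ≤ 1 := by
  have h1 := S.lmax_le
  have h2 := S.two_le_d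
  have h3 := S.lmax_pos
  have h4 : (4 : ℝ) ≤ d ^ 2 := by nlinarith
  nlinarith

theorem one_le_raw (j : Fin d) : 1 ≤ famConst d S.K * S.δ * S.E * wnorm S.T (S.G j) :=
  S.one_le_mul.trans (mul_le_mul_of_nonneg_left (S.lmin_le j)
    (mul_nonneg (mul_nonneg S.famConst_pos.le S.δ_pos.le) S.E_pos.le))

theorem le_R (j : Fin d) : famConst d S.K * S.δ * S.E * wnorm S.T (S.G j) ≤ S.R j := Int.le_ceil _

theorem R_le (j : Fin d) : (S.R j : ℝ) ≤ 2 * (famConst d S.K * S.δ * S.E * wnorm S.T (S.G j)) := by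
  have := Int.ceil_lt_add_one (famConst d S.K * S.δ * S.E * wnorm S.T (S.G j))
  have := S.one_le_raw j
  unfold R; linarith

theorem one_le_R (j : Fin d) : 1 ≤ S.R j := by
  have : (1 : ℝ) ≤ S.R j := (S.one_le_raw j).trans (S.le_R j)
  exact_mod_cast this

theorem M_le : (S.M : ℝ) * (10 * S.L * S.Q) ≤ S.X := by
  have h := Int.floor_le (S.X / (10 * S.L * S.Q))
  have : 0 < 10 * (S.L : ℝ) * S.Q := by have := S.L_pos'; have := S.Q_pos'; positivity
  rwa [le_div_iff₀ this] at h

theorem lt_M : S.X < ((S.M : ℝ) + 1) * (10 * S.L * S.Q) := by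
  have h := Int.lt_floor_add_one (S.X / (10 * S.L * S.Q))
  have : 0 < 10 * (S.L : ℝ) * S.Q := by have := S.L_pos'; have := S.Q_pos'; positivity
  rwa [div_lt_iff₀ this] at h

theorem LQ_le : 60 * ((S.L : ℝ) * S.Q) ≤ S.X := by
  have h1 := S.E_ge
  rw [← cast_L] at h1
  have := S.Q_mul_le
  nlinarith [S.Q_pos']

theorem E_le_M : S.E ≤ 20 * S.L * S.M := by
  have h1 := S.lt_M
  have h2 := S.Q_mul_le
  have h3 := S.E_ge
  rw [← cast_L] at h3
  have hL := S.L_pos'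
  have hQ := S.Q_pos'
  have h4 : (S.Q : ℝ) * S.E < S.Q * (((S.M : ℝ) + 1) * (10 * S.L)) := by nlinarith
  have h5 := lt_of_mul_lt_mul_left h4 hQ.le
  nlinarith

theorem one_le_M : 1 ≤ S.M := by
  have h1 := S.E_le_M
  have h3 := S.E_ge
  rw [← cast_L] at h3
  have hL := S.L_pos'
  have : (0 : ℝ) < S.M := by
    by_contra! h
    nlinarith
  exact_mod_cast this

theorem one_le_M' : (1 : ℝ) ≤ S.M := by exact_mod_cast S.one_le_M

/-- Ensures that a divisor of `n (some j)`, which is at most `2 * R j`, does not exceed `M`. -/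
theorem R_le_M (j : Fin d) : 2 * S.R j ≤ S.M := by
  have h1 := S.R_le j
  have h2 := S.E_le_M
  have h3 := S.le_lmax j
  have h4 := S.lmax_le
  have hL := S.L_pos'
  have hE := S.E_pos
  have hd := S.two_le_d
  have hC := one_le_redConst d
  have hlam := S.lam_pos j
  have h5 : famConst d S.K * (80 * S.L * wnorm S.T (S.G j)) ≤ 1 := by
    rw [famConst_eq, one_div, inv_mul_eq_div, div_le_one (by positivity)]
    have e2 : wnorm S.T (S.G j) * 40 ≤ 1 := by linarith [S.forty_lmax]
    have e3 : (2 : ℝ) ≤ d * redConst d := by nlinarith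
    nlinarith
  have h6 : famConst d S.K * S.δ * S.E * wnorm S.T (S.G j) * (80 * S.L) ≤ S.E := by
    have hc := S.famConst_pos
    calc _ = (famConst d S.K * (80 * S.L * wnorm S.T (S.G j))) * (S.δ * S.E) := by ring
      _ ≤ 1 * (1 * S.E) := by
        have := S.δ_le
        have := S.δ_pos
        gcongr
      _ = S.E := by ring
  have h7 : (2 : ℝ) * S.R j * (20 * S.L) ≤ S.M * (20 * S.L) := by nlinarith
  have h8 := le_of_mul_le_mul_right h7 (by positivity)
  exact_mod_cast h8

theorem one_le_lo : ∀ l, 1 ≤ S.lo l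
  | none => by have := S.one_le_M; have := S.L_pos; simp only [lo]; nlinarith
  | some j => S.one_le_R j

theorem one_le_len : ∀ l, 1 ≤ S.len l
  | none => by have := S.one_le_M; have := S.L_pos; simp only [len]; nlinarith
  | some j => S.one_le_R j

theorem lo_le : ∀ l, S.lo l ≤ 7 * S.len l
  | none => by have := S.one_le_len none; simp only [len, lo] at this ⊢; linarith
  | some j => by have := S.one_le_R j; simp only [len, lo]; linarith

theorem tot_pos : 0 < S.tot := by
  have := S.one_le_M'
  refine mul_pos (Finset.prod_pos fun j _ => ?_) (by linarith)
  have := S.one_le_R j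
  exact_mod_cast (by linarith : 0 < S.R j)

theorem prod_len : ∏ l, (S.len l : ℝ) = S.L * S.tot := by
  rw [Fintype.prod_option]
  simp only [len, tot]
  push_cast; ring

theorem mem_Ω {n : Option (Fin d) → ℤ} : n ∈ S.Ω ↔
    (∀ j, S.R j ≤ n (some j) ∧ n (some j) < 2 * S.R j) ∧
    (6 * (S.L * S.M) + 1 ≤ n none ∧ n none < 7 * (S.L * S.M) + 1) ∧ n none ≡ 1 [ZMOD S.L] := by
  simp only [Ω, subBox, Finset.mem_filter, Fintype.mem_piFinset, Finset.mem_univ, if_true,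
    Finset.mem_Ico, Option.forall, lo, len]
  constructor
  · rintro ⟨⟨h1, h2⟩, h3⟩
    exact ⟨fun j => ⟨(h2 j).1, by linarith [(h2 j).2]⟩, ⟨h1.1, by linarith [h1.2]⟩, h3⟩
  · rintro ⟨h1, h2, h3⟩
    exact ⟨⟨⟨h2.1, by linarith [h2.2]⟩, fun j => ⟨(h1 j).1, by linarith [(h1 j).2]⟩⟩, h3⟩

theorem tot_le_card : S.tot ≤ S.Ω.card := by
  have h : (Fintype.piFinset fun l : Option (Fin d) => (l.elim (Finset.Ico (6 * S.M) (7 * S.M))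
      fun j => Finset.Ico (S.R j) (2 * S.R j))).card ≤ S.Ω.card := by
    refine Finset.card_le_card_of_injOn
      (fun n l => l.elim (S.L * n none + 1) fun j => n (some j)) ?_ ?_
    · intro n hn
      simp only [Finset.mem_coe, Fintype.mem_piFinset, Option.forall, Option.elim,
        Finset.mem_Ico] at hn
      rw [Finset.mem_coe, mem_Ω]
      refine ⟨fun j => hn.2 j, ⟨?_, ?_⟩, ?_⟩
      · simp only [Option.elim]; nlinarith [S.L_pos, hn.1.1]
      · simp only [Option.elim]; nlinarith [S.L_pos, hn.1.2]
      · simp only [Option.elim]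
        exact (Int.modEq_iff_dvd.2 ⟨-n none, by ring⟩)
    · intro n _ n' _ h
      ext l
      have := congrFun h l
      rcases l with _ | j
      · simp only [Option.elim] at this
        exact mul_left_cancel₀ S.L_pos.ne' (by linarith)
      · exact this
  have h2 : ((Fintype.piFinset fun l : Option (Fin d) => (l.elim (Finset.Ico (6 * S.M) (7 * S.M))
      fun j => Finset.Ico (S.R j) (2 * S.R j))).card : ℝ) = S.tot := by
    rw [Fintype.card_piFinset, Fintype.prod_option]
    simp only [Option.elim, Int.card_Ico]
    push_cast
    have e1 : (((7 * S.M - 6 * S.M).toNat : ℕ) : ℝ) = S.M := by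
      have : (((7 * S.M - 6 * S.M).toNat : ℤ) : ℝ) = S.M := by
        rw [Int.toNat_of_nonneg (by linarith [S.one_le_M])]; push_cast; ring
      exact_mod_cast this
    have e2 : ∀ j, (((2 * S.R j - S.R j).toNat : ℕ) : ℝ) = S.R j := fun j => by
      have : (((2 * S.R j - S.R j).toNat : ℤ) : ℝ) = S.R j := by
        rw [Int.toNat_of_nonneg (by linarith [S.one_le_R j])]; push_cast; ring
      exact_mod_cast this
    rw [e1]
    simp only [e2, tot]
    ring
  rw [← h2]
  exact_mod_cast h

theorem dvd_L_of_le {e : ℕ} (he : 0 < e) (h : e ≤ S.K) : (e : ℤ) ∣ S.L := by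
  unfold L
  exact_mod_cast Nat.dvd_factorial he h

/-- The constant `60` in `LQ_le` gives `X/12 ≤ L M Q ≤ X/10`, so `n none * Q` lies between `X/2` and
`7X/10`. The dual vectors add between `0` and `X/5`. -/
theorem den_bounds {n : Option (Fin d) → ℤ} (hn : n ∈ S.Ω) :
    S.X / 2 < S.den n ∧ (S.den n : ℝ) ≤ S.X := by
  rw [mem_Ω] at hn
  obtain ⟨h1, h2, -⟩ := hn
  have hL := S.L_pos'
  have hQ := S.Q_pos'
  have hLQ := S.LQ_le
  have hd := S.d_pos
  have h0 : 0 ≤ ∑ j, n (some j) * (S.L * S.q j) := Finset.sum_nonneg fun j _ =>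
    mul_nonneg (by linarith [h1 j, S.one_le_R j]) (mul_nonneg S.L_pos.le (S.dual.q_nonneg j))
  have h0' : (0 : ℝ) ≤ ∑ j, (n (some j) : ℝ) * (S.L * S.q j) := by exact_mod_cast h0
  have h3 : ∑ j, (n (some j) : ℝ) * (S.L * S.q j) ≤ S.X / 5 := by
    have : ∀ j ∈ Finset.univ, (n (some j) : ℝ) * (S.L * S.q j) ≤ S.X / (5 * d) := by
      intro j _
      have e1 : (n (some j) : ℝ) ≤ 2 * S.R j := by exact_mod_cast (h1 j).2.le
      have e0 : (0 : ℝ) ≤ n (some j) := by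
        have := (h1 j).1; have := S.one_le_R j
        exact_mod_cast (by linarith : 0 ≤ n (some j))
      have e2 : (S.q j : ℝ) ≤ S.Q := by exact_mod_cast (S.dual.q_lt j).le
      have e2' : (0 : ℝ) ≤ S.q j := by exact_mod_cast S.dual.q_nonneg j
      have e3 := S.R_le j
      have e4 := S.le_lmax j
      have e5 := S.lmax_le_one
      have e6 := S.Q_mul_le
      have e7 : famConst d S.K * (20 * d * S.L) ≤ 2 := by
        have hC := one_le_redConst d
        rw [famConst_eq, one_div, inv_mul_eq_div, div_le_iff₀ (by positivity)]
        have : 0 < d * (S.L : ℝ) := by positivity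
        nlinarith
      have hc := S.famConst_pos
      have hE := S.E_pos
      have hl := S.lam_pos j
      have e8 : S.δ * wnorm S.T (S.G j) ≤ 1 / 40 := by
        have h40 := S.forty_lmax
        have := S.δ_le
        have := S.δ_pos
        nlinarith
      rw [le_div_iff₀ (by positivity)]
      have e9 : (n (some j) : ℝ) ≤ 2 * (2 * (famConst d S.K * S.δ * S.E * wnorm S.T (S.G j))) := by
        linarith
      have hδ := S.δ_pos
      calc (n (some j) : ℝ) * (S.L * S.q j) * (5 * d)
          ≤ (2 * (2 * (famConst d S.K * S.δ * S.E * wnorm S.T (S.G j)))) * (S.L * S.Q) * (5 * d) := by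
            gcongr
        _ = (famConst d S.K * (20 * d * S.L)) * (S.δ * wnorm S.T (S.G j)) * (S.Q * S.E) := by ring
        _ ≤ 2 * (1 / 40) * S.X := by
            have := S.δ_pos
            gcongr
        _ ≤ S.X := by linarith [S.X_pos]
    refine (Finset.sum_le_card_nsmul _ _ _ this).trans (le_of_eq ?_)
    rw [Finset.card_univ, Fintype.card_fin, nsmul_eq_mul]
    field_simp
  have h4 : (6 * ((S.L : ℝ) * S.M) + 1) ≤ n none := by exact_mod_cast h2.1
  have h5 : (n none : ℝ) ≤ 7 * ((S.L : ℝ) * S.M) := by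
    have : n none ≤ 7 * (S.L * S.M) := by linarith [h2.2]
    exact_mod_cast this
  have h6 := S.M_le
  have h7 := S.lt_M
  have e : (S.den n : ℝ) = ∑ j, (n (some j) : ℝ) * (S.L * S.q j) + n none * S.Q := by
    unfold den; push_cast; rfl
  rw [e]
  constructor
  · nlinarith
  · nlinarith [S.X_pos]

theorem den_pos {n : Option (Fin d) → ℤ} (hn : n ∈ S.Ω) : 0 < S.den n := by
  have := (S.den_bounds hn).1
  have h := S.X_pos
  have : (0 : ℝ) < S.den n := by linarith
  exact_mod_cast this

/-- The candidates are close to `P / Q`. -/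
theorem abs_sub_le {n : Option (Fin d) → ℤ} (hn : n ∈ S.Ω) (i : Fin d) :
    |(S.P i : ℝ) / S.Q - S.num n i / S.den n| < S.δ * S.E * S.T i / (2 * S.X) := by
  have hden := (S.den_bounds hn).1
  have hX := S.X_pos
  have hden0 : (0 : ℝ) < S.den n := by linarith
  have hQ := S.Q_pos'
  have hT := S.T_pos i
  have hE := S.E_pos
  have hd := S.d_pos
  have hC := redConst_pos d
  have hL := S.L_pos'
  rw [mem_Ω] at hn
  have h1 : (S.P i : ℝ) * S.den n - S.Q * S.num n i
      = -∑ j, (n (some j) : ℝ) * (S.L * (S.Q * S.p j i - S.q j * S.P i)) := by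
    unfold den num
    push_cast
    rw [mul_add, mul_add, Finset.mul_sum, Finset.mul_sum]
    have : ∑ j, (n (some j) : ℝ) * (S.L * (S.Q * S.p j i - S.q j * S.P i))
        = ∑ j, (S.Q : ℝ) * (n (some j) * (S.L * S.p j i))
          - ∑ j, (S.P i : ℝ) * (n (some j) * (S.L * S.q j)) := by
      rw [← Finset.sum_sub_distrib]
      exact Finset.sum_congr rfl fun j _ => by ring
    rw [this]; ring
  have h2 : |(S.P i : ℝ) * S.den n - S.Q * S.num n i| ≤ S.δ * S.E * S.T i * S.Q / 4 := by
    rw [h1, abs_neg]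
    refine (Finset.abs_sum_le_sum_abs _ _).trans ?_
    have : ∀ j ∈ Finset.univ, |(n (some j) : ℝ) * (S.L * (S.Q * S.p j i - S.q j * S.P i))|
        ≤ S.δ * S.E * S.T i * S.Q / (4 * d) := by
      intro j _
      have e0 : (0 : ℝ) ≤ n (some j) := by
        have := (hn.1 j).1; have := S.one_le_R j
        exact_mod_cast (by linarith : 0 ≤ n (some j))
      have e1 : (n (some j) : ℝ) ≤ 2 * S.R j := by exact_mod_cast (hn.1 j).2.le
      have e3 := S.R_le j
      have e4 := S.dual.abs_mul_wnorm_le S.Q_pos S.T_pos S.reduced i j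
      rw [abs_mul, abs_mul, abs_of_nonneg e0, abs_of_pos hL]
      have hc := S.famConst_pos
      have hδ := S.δ_pos
      calc (n (some j) : ℝ) * (S.L * |(S.Q * S.p j i - S.q j * S.P i : ℝ)|)
          ≤ (2 * (2 * (famConst d S.K * S.δ * S.E * wnorm S.T (S.G j)))) *
            (S.L * |(S.Q * S.p j i - S.q j * S.P i : ℝ)|) := by gcongr; linarith
        _ = (4 * famConst d S.K * S.δ * S.E * S.L) *
            (|(S.Q * S.p j i - S.q j * S.P i : ℝ)| * wnorm S.T (S.G j)) := by ring
        _ ≤ (4 * famConst d S.K * S.δ * S.E * S.L) * (redConst d * S.Q * S.T i) := by gcongr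
        _ = _ := by rw [famConst_eq]; field_simp; ring
    refine (Finset.sum_le_card_nsmul _ _ _ this).trans (le_of_eq ?_)
    rw [Finset.card_univ, Fintype.card_fin, nsmul_eq_mul]
    field_simp
  have h3 : (S.P i : ℝ) / S.Q - S.num n i / S.den n
      = (S.P i * S.den n - S.Q * S.num n i) / (S.Q * S.den n) := by
    field_simp
  rw [h3, abs_div, abs_of_pos (by positivity : (0 : ℝ) < S.Q * S.den n),
    div_lt_div_iff₀ (by positivity) (by positivity)]
  have hδ := S.δ_pos
  have h4 : 0 < S.δ * S.E * S.T i * S.Q := by positivity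
  nlinarith

end StepData
end WeightedSingular
end

/-! ### Candidates on a single rational hyperplane. -/

noncomputable section
namespace WeightedSingular
open Matrix

/-- Constant in the bound for the number of candidates on a rational hyperplane. -/
def solConst (d K : ℕ) : ℝ := 18 * 3 ^ (d + 1) * (K.factorial * redConst d) * K.factorial

/-- Combined constant in the bound for the number of candidates on a rational hyperplane. -/
def hypConst (d K : ℕ) : ℝ :=
  solConst d K * (2 * d / famConst d K + 3 * d.factorial / famConst d K ^ 2 + 20 / famConst d K)

theorem solConst_pos (d K : ℕ) : 0 < solConst d K := by
  have := redConst_pos d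
  unfold solConst; positivity

namespace StepData
variable {d : ℕ} (S : StepData d)

/-- The value of the hyperplane `(a, -b)` at `(P, Q)`. -/
def kk (a : Fin d → ℤ) (b : ℤ) : ℤ := a ⬝ᵥ S.P - b * S.Q

/-- The values of the hyperplane `(a, -b)` at the dual system. -/
def cc (a : Fin d → ℤ) (b : ℤ) (j : Fin d) : ℤ := a ⬝ᵥ S.p j - b * S.q j

/-- The candidates lying on the rational hyperplane `a · x = b`. -/
def sol (a : Fin d → ℤ) (b : ℤ) : Finset (Option (Fin d) → ℤ) :=
  S.Ω.filter fun n => a ⬝ᵥ S.num n = b * S.den n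

theorem eval_eq (a : Fin d → ℤ) (b : ℤ) (n : Option (Fin d) → ℤ) :
    a ⬝ᵥ S.num n - b * S.den n = ∑ j, n (some j) * (S.L * S.cc a b j) + n none * S.kk a b := by
  have h1 : a ⬝ᵥ S.num n = ∑ j, n (some j) * (S.L * (a ⬝ᵥ S.p j)) + n none * (a ⬝ᵥ S.P) := by
    simp only [dotProduct, num, mul_add, Finset.sum_add_distrib, Finset.mul_sum]
    congr 1
    · rw [Finset.sum_comm]
      exact Finset.sum_congr rfl fun j _ => Finset.sum_congr rfl fun i _ => by ring
    · exact Finset.sum_congr rfl fun i _ => by ring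
  rw [h1, den, mul_add, Finset.mul_sum]
  have h2 : ∑ j, n (some j) * (S.L * S.cc a b j) = ∑ j, n (some j) * (S.L * (a ⬝ᵥ S.p j))
      - ∑ j, b * (n (some j) * (S.L * S.q j)) := by
    rw [← Finset.sum_sub_distrib]
    exact Finset.sum_congr rfl fun j _ => by unfold cc; ring
  rw [h2]; unfold kk; ring

/-- A candidate is close to `P / Q`, so a hyperplane through the candidate has a small value at `(P,
Q)`. When the bound is below `1`, the hyperplane passes through `P / Q`. -/
theorem abs_kk_le {a : Fin d → ℤ} {b : ℤ} {n : Option (Fin d) → ℤ} (hn : n ∈ S.sol a b) :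
    |(S.kk a b : ℝ)| ≤ d * S.δ * wnorm S.T a := by
  rw [sol, Finset.mem_filter] at hn
  obtain ⟨hn, h⟩ := hn
  have hden : (0 : ℝ) < S.den n := by exact_mod_cast S.den_pos hn
  have hQ := S.Q_pos'
  have hX := S.X_pos
  have hE := S.E_pos
  have hδ := S.δ_pos
  have h1 : (S.kk a b : ℝ) = S.Q * ∑ i, (a i : ℝ) * ((S.P i : ℝ) / S.Q - S.num n i / S.den n) := by
    have e1 : ∑ i, (a i : ℝ) * ((S.P i : ℝ) / S.Q - S.num n i / S.den n)
        = (∑ i, (a i : ℝ) * S.P i) / S.Q - (∑ i, (a i : ℝ) * S.num n i) / S.den n := by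
      rw [Finset.sum_div, Finset.sum_div, ← Finset.sum_sub_distrib]
      exact Finset.sum_congr rfl fun i _ => by ring
    have e2 : ∑ i, (a i : ℝ) * S.num n i = b * S.den n := by
      rw [dotProduct] at h; exact_mod_cast h
    rw [e1, e2, kk, dotProduct]
    push_cast
    field_simp
  rw [h1, abs_mul, abs_of_pos hQ]
  have h2 : |∑ i, (a i : ℝ) * ((S.P i : ℝ) / S.Q - S.num n i / S.den n)|
      ≤ d * (wnorm S.T a * (S.δ * S.E / (2 * S.X))) := by
    refine (Finset.abs_sum_le_sum_abs _ _).trans ?_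
    refine (Finset.sum_le_card_nsmul _ _ (wnorm S.T a * (S.δ * S.E / (2 * S.X))) fun i _ => ?_).trans
      (le_of_eq (by simp))
    rw [abs_mul]
    calc |(a i : ℝ)| * |(S.P i : ℝ) / S.Q - S.num n i / S.den n|
        ≤ |(a i : ℝ)| * (S.δ * S.E * S.T i / (2 * S.X)) := by
          gcongr; exact (S.abs_sub_le hn i).le
      _ = (S.T i * |(a i : ℝ)|) * (S.δ * S.E / (2 * S.X)) := by ring
      _ ≤ _ := by
          gcongr; exact coord_le_wnorm S.T_pos a i
  have hw : 0 ≤ wnorm S.T a := wnorm_nonneg a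
  have hd := S.d_pos
  calc (S.Q : ℝ) * |∑ i, (a i : ℝ) * ((S.P i : ℝ) / S.Q - S.num n i / S.den n)|
      ≤ S.Q * (d * (wnorm S.T a * (S.δ * S.E / (2 * S.X)))) := by gcongr
    _ = (d * S.δ * wnorm S.T a) * ((S.Q * S.E) / (2 * S.X)) := by ring
    _ ≤ (d * S.δ * wnorm S.T a) * 1 := by
        gcongr
        rw [div_le_one (by positivity)]
        linarith [S.Q_mul_le]
    _ = _ := mul_one _

theorem natAbs_N_dvd : (S.N : ℤ) ∣ S.L := by
  have h1 := S.dual.abs_N_le S.Q_pos S.T_pos S.reduced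
  have h2 := h1.trans S.K_ge
  have h3 : S.N.natAbs ≤ S.K := by
    have : (S.N.natAbs : ℝ) ≤ S.K := by rw [Nat.cast_natAbs]; push_cast; exact h2
    exact_mod_cast this
  rw [← Int.natAbs_dvd]
  exact S.dvd_L_of_le (Int.natAbs_pos.2 (S.dual.N_ne_zero S.reduced)) h3

/-- The equation has coefficients `kk` and `L * cc j`. Since `(a, b)` is primitive, the clause `dvd`
of the dual system shows that a common divisor of them divides `N * L`, which yields the bound `L *
redConst d` for common divisors. -/
theorem card_sol_mul_le {a : Fin d → ℤ} {b : ℤ} (hab : IsCoprimeVec a b) {i : Fin d}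
    (hi : S.cc a b i ≠ 0) {ζ ζ' : ℝ} (hζ : 0 ≤ ζ)
    (hζR : ∀ l, l ≠ i → (∃ l', l' ≠ i ∧ l' ≠ l) → 1 ≤ ζ * S.R l)
    (hm0 : S.kk a b = 0 → ζ ≤ ζ')
    (hm1 : S.kk a b ≠ 0 → ζ * |(S.kk a b : ℝ)| ≤ 1 ∧ 1 ≤ ζ' * (S.L * S.M)) :
    ((S.sol a b).card : ℝ) * S.R i
      ≤ solConst d S.K * S.tot * (1 / |(S.cc a b i : ℝ)| + ζ') := by
  set c : Option (Fin d) → ℤ := fun l => l.elim (S.kk a b) fun j => S.L * S.cc a b j with hc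
  have hL := S.L_pos
  have hL' := S.L_pos'
  have hζ'0 : 0 ≤ ζ' := by
    by_cases h : S.kk a b = 0
    · exact hζ.trans (hm0 h)
    · have h1 := (hm1 h).2
      by_contra! h2
      have := S.one_le_M'
      have : 0 < S.L * (S.M : ℝ) := by positivity
      nlinarith
  have h := card_solutions_le S.lo S.len c S.one_le_lo S.lo_le (h := S.L * redConst d) (ζ' := ζ')
    hζ none (some i) (by simp) (by simpa [hc] using ⟨hL.ne', hi⟩)
    (by
      have := S.two_le
      obtain ⟨j, hj⟩ : ∃ j : Fin d, j ≠ i := by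
        have : Nontrivial (Fin d) := Fin.nontrivial_iff_two_le.2 this
        exact exists_ne i
      exact ⟨some j, by simp [hj]⟩)
    (by
      intro e he
      have h1 : ∀ j, (e : ℤ) ∣ (S.L • a) ⬝ᵥ S.p j - (S.L * b) * S.q j := fun j => by
        have := he (some j)
        simp only [hc, Option.elim, cc] at this
        rw [smul_dotProduct, smul_eq_mul]
        convert this using 1; ring
      have h2 : (e : ℤ) ∣ (S.L • a) ⬝ᵥ S.P - (S.L * b) * S.Q := by
        have := he none
        simp only [hc, Option.elim, kk] at this
        rw [smul_dotProduct, smul_eq_mul]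
        have e1 := Dvd.dvd.mul_left this S.L
        rw [mul_sub, ← mul_assoc] at e1
        exact e1
      obtain ⟨h3, h4⟩ := S.dual.dvd e _ _ h1 h2
      obtain ⟨x, y, hxy⟩ := hab
      have h5 : (e : ℤ) ∣ S.N * S.L := by
        have h6 : S.N * S.L = ∑ i, x i * (S.N * (S.L • a) i) + y * (S.N * (S.L * b)) := by
          have e2 : ∑ i, x i * (S.N * (S.L • a) i) = S.N * S.L * (x ⬝ᵥ a) := by
            rw [dotProduct, Finset.mul_sum]
            exact Finset.sum_congr rfl fun i _ => by simp only [Pi.smul_apply, smul_eq_mul]; ring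
          rw [e2]
          linear_combination (-(S.N * S.L)) * hxy
        rw [h6]
        exact dvd_add (Finset.dvd_sum fun i _ => Dvd.dvd.mul_left (h3 i) _)
          (Dvd.dvd.mul_left h4 _)
      have h7 : (e : ℤ) ≤ |S.N * S.L| := by
        refine Int.le_of_dvd (abs_pos.2 (mul_ne_zero (S.dual.N_ne_zero S.reduced) hL.ne')) ?_
        exact (dvd_abs _ _).2 h5
      have h8 : (e : ℝ) ≤ |(S.N : ℝ)| * S.L := by
        rw [abs_mul, abs_of_pos hL] at h7
        exact_mod_cast h7
      refine h8.trans ?_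
      rw [mul_comm]
      exact mul_le_mul_of_nonneg_left (S.dual.abs_N_le S.Q_pos S.T_pos S.reduced) hL'.le)
    (by
      intro l hl1 hl2 ⟨l', h1, h2, h3⟩
      rcases l with _ | l
      · exact absurd rfl hl1
      rcases l' with _ | l'
      · exact absurd rfl h1
      exact hζR l (fun h => hl2 (by rw [h])) ⟨l', fun h => h2 (by rw [h]), fun h => h3 (by rw [h])⟩)
    (by simpa [hc] using hm0)
    (by simpa [hc, len] using hm1)
  have hsub : S.sol a b ⊆ (subBox S.lo S.len Finset.univ).filter fun n => ∑ l, c l * n l = 0 := by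
    intro n hn
    rw [sol, Finset.mem_filter, Ω, Finset.mem_filter] at hn
    rw [Finset.mem_filter]
    refine ⟨hn.1.1, ?_⟩
    have h1 := S.eval_eq a b n
    rw [hn.2, sub_self] at h1
    rw [Fintype.sum_option, h1]
    simp only [hc, Option.elim]
    rw [add_comm, mul_comm]
    congr 1
    exact Finset.sum_congr rfl fun j _ => by ring
  have hR1 : (0 : ℝ) ≤ S.R i := by
    have := S.one_le_R i
    exact_mod_cast (by linarith : 0 ≤ S.R i)
  have hcard : ((S.sol a b).card : ℝ)
      ≤ ((subBox S.lo S.len Finset.univ).filter fun n => ∑ l, c l * n l = 0).card := by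
    exact_mod_cast Finset.card_le_card hsub
  have hci : (1 : ℝ) / |(c (some i) : ℝ)| ≤ 1 / |(S.cc a b i : ℝ)| := by
    have : 0 < |(S.cc a b i : ℝ)| := abs_pos.2 (by exact_mod_cast hi)
    apply one_div_le_one_div_of_le this
    simp only [hc, Option.elim]
    push_cast
    rw [abs_mul, abs_of_pos hL']
    have := S.one_le_L
    nlinarith
  have htot := S.tot_pos
  have hC := redConst_pos d
  calc ((S.sol a b).card : ℝ) * S.R i
      ≤ _ * S.R i := mul_le_mul_of_nonneg_right hcard hR1
    _ ≤ 18 * 3 ^ Fintype.card (Option (Fin d)) * (S.L * redConst d) * (∏ l, (S.len l : ℝ)) *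
        (1 / |(c (some i) : ℝ)| + ζ') := h
    _ ≤ 18 * 3 ^ (d + 1) * (S.L * redConst d) * (S.L * S.tot) *
        (1 / |(S.cc a b i : ℝ)| + ζ') := by
        rw [S.prod_len, Fintype.card_option, Fintype.card_fin]
        gcongr
    _ = _ := by rw [solConst, cast_L]; ring

/-- The reduced vectors span a lattice of covolume `Q |N| ≥ Q`, and `Q ≥ X / (3E)`. -/
theorem prod_lam_ge : 1 ≤ 3 * d.factorial * S.E * ∏ j, wnorm S.T (S.G j) := by
  have h1 := abs_det_mul_prod_le S.T_pos S.G
  rw [S.prod_T, S.dual.det_eq] at h1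
  have hN : (1 : ℝ) ≤ |(S.N : ℝ)| := by
    have := Int.one_le_abs (S.dual.N_ne_zero S.reduced)
    exact_mod_cast this
  push_cast at h1
  have hQ := S.Q_pos'
  have hX := S.X_pos
  have hE := S.E_pos
  rw [abs_mul, abs_of_pos hQ, ← div_eq_mul_inv, div_le_iff₀ hX] at h1
  have h2 := S.le_Q_mul
  have h3 : S.Q * 1 ≤ S.Q * |(S.N : ℝ)| := by gcongr
  have hprod : 0 ≤ ∏ j, wnorm S.T (S.G j) := Finset.prod_nonneg fun j _ => wnorm_nonneg _
  have h4 : S.X * 1 ≤ S.X * (3 * d.factorial * S.E * ∏ j, wnorm S.T (S.G j)) := by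
    have h5 : S.Q * 1 ≤ d.factorial * (∏ j, wnorm S.T (S.G j)) * S.X := h3.trans h1
    nlinarith
  exact le_of_mul_le_mul_left h4 hX

/-- Error term in the counting estimates for hyperplanes through `P / Q`. -/
def zc : ℝ := 3 * d.factorial * S.lmax / (famConst d S.K ^ 2 * S.δ ^ 2 * S.E)

theorem zc_pos : 0 < S.zc := by
  have := S.famConst_pos; have := S.δ_pos; have := S.E_pos; have := S.lmax_pos
  unfold zc; positivity

/-- The lengths other than those of `G i` and `G l` are at most `1`, and one of them contributes a
factor `lmax`; so `prod_lam_ge` bounds the product of the two lengths from below by `1 / (3 d! E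
lmax)`. The definition of `zc` matches this. -/
theorem one_le_zc_mul {i l : Fin d} (hil : l ≠ i) (h3 : ∃ l', l' ≠ i ∧ l' ≠ l) :
    1 ≤ S.zc * S.R i * S.R l := by
  obtain ⟨l', h1, h2⟩ := h3
  have hp := S.prod_lam_ge
  have h4 : ∏ j, wnorm S.T (S.G j) ≤ wnorm S.T (S.G i) * wnorm S.T (S.G l) * S.lmax := by
    rw [← Finset.mul_prod_erase _ _ (Finset.mem_univ i),
      ← Finset.mul_prod_erase _ _ (Finset.mem_erase.2 ⟨hil, Finset.mem_univ l⟩),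
      ← Finset.mul_prod_erase _ _ (Finset.mem_erase.2 ⟨h2, Finset.mem_erase.2 ⟨h1, Finset.mem_univ l'⟩⟩),
      ← mul_assoc]
    have e1 := S.lam_pos i
    have e2 := S.lam_pos l
    have e3 := S.lam_pos l'
    refine mul_le_mul_of_nonneg_left ?_ (by positivity)
    have e4 : ∏ x ∈ ((Finset.univ.erase i).erase l).erase l', wnorm S.T (S.G x) ≤ 1 :=
      Finset.prod_le_one (fun j _ => wnorm_nonneg _) fun j _ => (S.le_lmax j).trans S.lmax_le_one
    calc _ ≤ wnorm S.T (S.G l') * 1 := by gcongr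
      _ ≤ _ := by rw [mul_one]; exact S.le_lmax l'
  have hR1 := S.le_R i
  have hR2 := S.le_R l
  have hc := S.famConst_pos; have hδ := S.δ_pos; have hE := S.E_pos; have hl := S.lmax_pos
  have e1 := S.lam_pos i
  have e2 := S.lam_pos l
  have hz := S.zc_pos
  calc (1 : ℝ) ≤ 3 * d.factorial * S.E * (wnorm S.T (S.G i) * wnorm S.T (S.G l) * S.lmax) := by
        refine hp.trans ?_
        gcongr
    _ = S.zc * (famConst d S.K * S.δ * S.E * wnorm S.T (S.G i)) *
        (famConst d S.K * S.δ * S.E * wnorm S.T (S.G l)) := by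
        unfold zc; field_simp
    _ ≤ _ := by
        have e3 : (0 : ℝ) ≤ S.R i := le_trans (by positivity) hR1
        gcongr

theorem card_sol_le_of_kk_eq_zero {a : Fin d → ℤ} {b : ℤ} (hab : IsCoprimeVec a b)
    (hk : S.kk a b = 0) {i : Fin d} (hi : S.cc a b i ≠ 0) :
    ((S.sol a b).card : ℝ) ≤ solConst d S.K * S.tot * (1 / (|(S.cc a b i : ℝ)| * S.R i) + S.zc) := by
  have hRi : (0 : ℝ) < S.R i := by
    have := S.one_le_R i
    exact_mod_cast (by linarith : 0 < S.R i)
  have hz := S.zc_pos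
  have h := S.card_sol_mul_le hab hi (ζ := S.zc * S.R i) (ζ' := S.zc * S.R i) (by positivity)
    (fun l hl h3 => S.one_le_zc_mul hl h3) (fun _ => le_rfl) (fun h => absurd hk h)
  rw [← le_div_iff₀ hRi] at h
  refine h.trans (le_of_eq ?_)
  have : 0 < |(S.cc a b i : ℝ)| := abs_pos.2 (by exact_mod_cast hi)
  field_simp

theorem card_sol_le_of_kk_ne_zero {a : Fin d → ℤ} {b : ℤ} (hab : IsCoprimeVec a b)
    (hk : S.kk a b ≠ 0)
    (hk' : d = 2 ∨ |(S.kk a b : ℝ)| ≤ famConst d S.K * S.δ * S.E * S.lmin)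
    {i : Fin d} (hi : S.cc a b i ≠ 0) :
    ((S.sol a b).card : ℝ) ≤ solConst d S.K * S.tot *
      (1 / (|(S.cc a b i : ℝ)| * S.R i) + 1 / (S.L * S.M * S.R i)) := by
  have hRi : (0 : ℝ) < S.R i := by
    have := S.one_le_R i
    exact_mod_cast (by linarith : 0 < S.R i)
  have hLM : 0 < (S.L : ℝ) * S.M := mul_pos S.L_pos' (by linarith [S.one_le_M'])
  have hB : 0 < famConst d S.K * S.δ * S.E * S.lmin := by linarith [S.one_le_mul]
  have h : ((S.sol a b).card : ℝ) * S.R i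
      ≤ solConst d S.K * S.tot * (1 / |(S.cc a b i : ℝ)| + 1 / (S.L * S.M)) := by
    rcases hk' with hd | hk'
    -- In dimension `2` only one variable remains besides `none` and `i`, so nothing is required of
    -- `ζ` from below.
    · refine S.card_sol_mul_le hab hi (ζ := 0) le_rfl ?_ (fun h => absurd h hk) (fun _ => ?_)
      · rintro l hl ⟨l', h1, h2⟩
        subst hd
        exfalso
        omega
      · exact ⟨by simp, by rw [one_div_mul_cancel hLM.ne']⟩
    · refine S.card_sol_mul_le hab hi (ζ := 1 / (famConst d S.K * S.δ * S.E * S.lmin))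
        (by positivity) ?_ (fun h => absurd h hk) (fun _ => ?_)
      · rintro l hl -
        rw [one_div, inv_mul_eq_div, le_div_iff₀ hB, one_mul]
        refine le_trans ?_ (S.le_R l)
        have := S.famConst_pos; have := S.δ_pos; have := S.E_pos
        have := S.lmin_le l
        gcongr
      · refine ⟨?_, by rw [one_div_mul_cancel hLM.ne']⟩
        rw [one_div, inv_mul_eq_div, div_le_one hB]
        exact hk'
  rw [← le_div_iff₀ hRi] at h
  refine h.trans (le_of_eq ?_)
  have : 0 < |(S.cc a b i : ℝ)| := abs_pos.2 (by exact_mod_cast hi)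
  field_simp

/-- In the expansion of `a` in the reduced vectors the terms with `kk` contribute at most a tenth of
the norm, because `lmax` is at most `1 / (10 d²)`. Hence one of the `d` other terms is large. -/
theorem exists_large_cc {a : Fin d → ℤ} {b : ℤ} (ha : a ≠ 0)
    (hk : |(S.kk a b : ℝ)| ≤ d * S.δ * wnorm S.T a) :
    ∃ i, S.cc a b i ≠ 0 ∧ wnorm S.T a ≤ 2 * d * (|(S.cc a b i : ℝ)| * wnorm S.T (S.G i)) := by
  have hw := wnorm_pos S.T_pos ha
  have h1 := S.dual.wnorm_le S.Q_pos S.T_pos S.reduced a b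
  have hd := S.d_pos
  by_contra! hcon
  have h2 : ∀ i, |(S.cc a b i : ℝ)| * wnorm S.T (S.G i) ≤ wnorm S.T a / (2 * d) := by
    intro i
    by_cases h : S.cc a b i = 0
    · rw [h]; simp; positivity
    · rw [le_div_iff₀ (by positivity)]
      linarith [hcon i h]
  have h3 : ∀ j ∈ Finset.univ, (|((a ⬝ᵥ S.p j - b * S.q j : ℤ) : ℝ)|
      + |((a ⬝ᵥ S.P - b * S.Q : ℤ) : ℝ)|) * wnorm S.T (S.G j)
      ≤ wnorm S.T a / (2 * d) + wnorm S.T a / (10 * d) := by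
    intro j _
    rw [add_mul]
    refine add_le_add (h2 j) ?_
    have e1 : |((a ⬝ᵥ S.P - b * S.Q : ℤ) : ℝ)| ≤ d * S.δ * wnorm S.T a := hk
    have e2 := S.le_lmax j
    have e3 := S.lmax_le
    have e4 := S.δ_le
    have e5 := S.δ_pos
    have e6 := S.lam_pos j
    rw [le_div_iff₀ (by positivity)]
    calc |((a ⬝ᵥ S.P - b * S.Q : ℤ) : ℝ)| * wnorm S.T (S.G j) * (10 * d)
        ≤ (d * S.δ * wnorm S.T a) * S.lmax * (10 * d) := by gcongr
      _ = S.δ * wnorm S.T a * (S.lmax * (10 * d ^ 2)) := by ring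
      _ ≤ 1 * wnorm S.T a * 1 := by
        have := S.lmax_pos
        gcongr
      _ = _ := by ring
  have h4 := h1.trans (Finset.sum_le_card_nsmul _ _ _ h3)
  rw [Finset.card_univ, Fintype.card_fin, nsmul_eq_mul] at h4
  have h5 : (d : ℝ) * (wnorm S.T a / (2 * d) + wnorm S.T a / (10 * d)) = 3 / 5 * wnorm S.T a := by
    field_simp; norm_num
  rw [h5] at h4
  linarith

theorem inv_mul_R_le {a : Fin d → ℤ} {b : ℤ} (ha : a ≠ 0) {i : Fin d} (hi : S.cc a b i ≠ 0)
    (h : wnorm S.T a ≤ 2 * d * (|(S.cc a b i : ℝ)| * wnorm S.T (S.G i))) :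
    1 / (|(S.cc a b i : ℝ)| * S.R i) ≤ 2 * d / famConst d S.K * (1 / (S.δ * S.E * wnorm S.T a)) := by
  have hw := wnorm_pos S.T_pos ha
  have hc := S.famConst_pos; have hδ := S.δ_pos; have hE := S.E_pos
  have hci : 0 < |(S.cc a b i : ℝ)| := abs_pos.2 (by exact_mod_cast hi)
  have hR := S.le_R i
  have hl := S.lam_pos i
  have hd := S.d_pos
  rw [← div_eq_mul_one_div, div_div, div_le_div_iff₀ (by
    have : 0 < famConst d S.K * S.δ * S.E * wnorm S.T (S.G i) := by positivity
    nlinarith) (by positivity), one_mul]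
  calc famConst d S.K * (S.δ * S.E * wnorm S.T a)
      ≤ famConst d S.K * (S.δ * S.E * (2 * d * (|(S.cc a b i : ℝ)| * wnorm S.T (S.G i)))) := by
        gcongr
    _ = 2 * d * (|(S.cc a b i : ℝ)| * (famConst d S.K * S.δ * S.E * wnorm S.T (S.G i))) := by ring
    _ ≤ _ := by gcongr

theorem hypConst_eq : hypConst d S.K = solConst d S.K * (2 * d / famConst d S.K)
    + solConst d S.K * (3 * d.factorial / famConst d S.K ^ 2)
    + solConst d S.K * (20 / famConst d S.K) := by unfold hypConst; ring

theorem hypConst_pos : 0 < hypConst d S.K := by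
  have := S.famConst_pos; have := solConst_pos d S.K; have := S.d_pos
  rw [hypConst_eq]; positivity

theorem card_sol_le₀ {a : Fin d → ℤ} {b : ℤ} (hab : IsCoprimeVec a b) (ha : a ≠ 0)
    (hk : S.kk a b = 0) :
    ((S.sol a b).card : ℝ) ≤ hypConst d S.K * S.tot *
      (1 / (S.δ * S.E * wnorm S.T a) + S.lmax / (S.δ ^ 2 * S.E)) := by
  have hw := wnorm_pos S.T_pos ha
  have hc := S.famConst_pos; have hδ := S.δ_pos; have hE := S.E_pos; have hd := S.d_pos
  have hs := solConst_pos d S.K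
  have hl := S.lmax_pos
  have ht := S.tot_pos
  obtain ⟨i, hi, h⟩ := S.exists_large_cc (a := a) (b := b) ha (by rw [hk]; simp; positivity)
  refine (S.card_sol_le_of_kk_eq_zero hab hk hi).trans ?_
  have h1 := S.inv_mul_R_le ha hi h
  have h2 : S.zc = 3 * d.factorial / famConst d S.K ^ 2 * (S.lmax / (S.δ ^ 2 * S.E)) := by
    unfold zc; field_simp
  rw [h2]
  set u := 1 / (S.δ * S.E * wnorm S.T a)
  set v := S.lmax / (S.δ ^ 2 * S.E)
  have hu : 0 < u := by positivity
  have hv : 0 < v := by positivity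
  calc _ ≤ solConst d S.K * S.tot * (2 * d / famConst d S.K * u
        + 3 * d.factorial / famConst d S.K ^ 2 * v) := by gcongr
    _ ≤ solConst d S.K * S.tot * ((2 * d / famConst d S.K + 3 * d.factorial / famConst d S.K ^ 2
        + 20 / famConst d S.K) * (u + v)) := by
        gcongr
        have e1 : 0 < 2 * d / famConst d S.K := by positivity
        have e2 : 0 < 3 * d.factorial / famConst d S.K ^ 2 := by positivity
        have e3 : 0 < 20 / famConst d S.K := by positivity
        nlinarith [mul_pos e1 hv, mul_pos e2 hu, mul_pos e3 hu, mul_pos e3 hv]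
    _ = _ := by unfold hypConst; ring

theorem card_sol_le₁ {a : Fin d → ℤ} {b : ℤ} (hab : IsCoprimeVec a b) (ha : a ≠ 0)
    (hk : S.kk a b ≠ 0) (hd2 : d = 2 ∨ d * wnorm S.T a ≤ famConst d S.K * S.E * S.lmin) :
    ((S.sol a b).card : ℝ) ≤ hypConst d S.K * S.tot *
      (1 / (S.δ * S.E * wnorm S.T a) + 1 / (S.δ * S.E ^ 2 * S.lmin)) := by
  have hw := wnorm_pos S.T_pos ha
  have hc := S.famConst_pos; have hδ := S.δ_pos; have hE := S.E_pos; have hd := S.d_pos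
  have hs := solConst_pos d S.K
  have hl := S.lmin_pos
  have ht := S.tot_pos
  rcases (S.sol a b).eq_empty_or_nonempty with he | ⟨n, hn⟩
  · rw [he]
    have := S.hypConst_pos
    simp; positivity
  have hkk := S.abs_kk_le hn
  obtain ⟨i, hi, h⟩ := S.exists_large_cc ha hkk
  refine (S.card_sol_le_of_kk_ne_zero hab hk ?_ hi).trans ?_
  · refine hd2.imp_right fun h2 => hkk.trans ?_
    calc d * S.δ * wnorm S.T a = S.δ * (d * wnorm S.T a) := by ring
      _ ≤ S.δ * (famConst d S.K * S.E * S.lmin) := by gcongr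
      _ = _ := by ring
  have h1 := S.inv_mul_R_le ha hi h
  have h2 : 1 / (S.L * S.M * S.R i) ≤ 20 / famConst d S.K * (1 / (S.δ * S.E ^ 2 * S.lmin)) := by
    have e1 := S.E_le_M
    have e2 := S.le_R i
    have e3 := S.lmin_le i
    have e4 := S.one_le_M'
    have e5 := S.L_pos'
    have e6 := S.lam_pos i
    have e7 : 0 < famConst d S.K * S.δ * S.E * wnorm S.T (S.G i) := by positivity
    have e8 : (0 : ℝ) < S.R i := by linarith
    rw [← div_eq_mul_one_div, div_div, div_le_div_iff₀ (by positivity) (by positivity), one_mul]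
    calc famConst d S.K * (S.δ * S.E ^ 2 * S.lmin)
        = S.E * (famConst d S.K * S.δ * S.E * S.lmin) := by ring
      _ ≤ (20 * S.L * S.M) * (famConst d S.K * S.δ * S.E * wnorm S.T (S.G i)) := by gcongr
      _ ≤ (20 * S.L * S.M) * S.R i := by gcongr
      _ = _ := by ring
  set u := 1 / (S.δ * S.E * wnorm S.T a)
  set v := 1 / (S.δ * S.E ^ 2 * S.lmin)
  have hu : 0 < u := by positivity
  have hv : 0 < v := by positivity
  calc _ ≤ solConst d S.K * S.tot * (2 * d / famConst d S.K * u + 20 / famConst d S.K * v) := by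
        gcongr
    _ ≤ solConst d S.K * S.tot * ((2 * d / famConst d S.K + 3 * d.factorial / famConst d S.K ^ 2
        + 20 / famConst d S.K) * (u + v)) := by
        gcongr
        have e1 : 0 < 2 * d / famConst d S.K := by positivity
        have e2 : 0 < 3 * d.factorial / famConst d S.K ^ 2 := by positivity
        have e3 : 0 < 20 / famConst d S.K := by positivity
        nlinarith [mul_pos e1 hv, mul_pos e2 hu, mul_pos e2 hv, mul_pos e3 hu, mul_pos e3 hv]
    _ = _ := by unfold hypConst; ring

end StepData
end WeightedSingular
end

/-! ### Candidates whose coordinates have a common divisor. -/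

noncomputable section
namespace WeightedSingular
open Matrix

/-- Constant in the bound for the number of lattice vectors in a box. -/
def boxConst (d : ℕ) : ℝ := 3 * (d + 3) ^ d

theorem boxConst_pos (d : ℕ) : 0 < boxConst d := by unfold boxConst; positivity

namespace StepData
variable {d : ℕ} (S : StepData d)

/-- The candidates whose coordinates have a common divisor. -/
def nonprim : Finset (Option (Fin d) → ℤ) := by
  classical exact S.Ω.filter fun n => ¬ IsCoprimeVec (S.num n) (S.den n)

/-- The functional `(G j, -b)` vanishes at `(P, Q)` and at every dual vector except the `j`-th. So a
candidate determines its coefficients. -/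
theorem row_eval (n : Option (Fin d) → ℤ) {j : Fin d} {b : ℤ} (hb : S.G j ⬝ᵥ S.P = S.Q * b) :
    S.G j ⬝ᵥ S.num n - b * S.den n = n (some j) * (S.L * S.N) := by
  refine mul_left_cancel₀ S.Q_pos.ne' ?_
  have h1 : S.G j ⬝ᵥ S.num n
      = ∑ k, n (some k) * S.L * (S.G j ⬝ᵥ S.p k) + n none * (S.G j ⬝ᵥ S.P) := by
    simp only [num, dotProduct, mul_add, Finset.sum_add_distrib, Finset.mul_sum]
    rw [Finset.sum_comm]
    congr 1
    · exact Finset.sum_congr rfl fun k _ => Finset.sum_congr rfl fun i _ => by ring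
    · exact Finset.sum_congr rfl fun i _ => by ring
  have h2 : ∑ k, n (some k) * S.L * (S.Q * (S.G j ⬝ᵥ S.p k) - S.q k * (S.G j ⬝ᵥ S.P))
      = n (some j) * S.L * (S.Q * S.N) := by
    rw [Finset.sum_eq_single j]
    · rw [S.dual.pairing, if_pos rfl]
    · intro k _ hk
      rw [S.dual.pairing, if_neg hk.symm, mul_zero]
    · simp
  have h3 : S.Q * ∑ k, n (some k) * S.L * (S.G j ⬝ᵥ S.p k)
      - (∑ k, n (some k) * (S.L * S.q k)) * (S.G j ⬝ᵥ S.P) = n (some j) * S.L * (S.Q * S.N) := by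
    rw [← h2, Finset.mul_sum, Finset.sum_mul, ← Finset.sum_sub_distrib]
    exact Finset.sum_congr rfl fun k _ => by ring
  rw [h1, den]
  linear_combination h3 + (∑ k, n (some k) * (S.L * S.q k) + S.Q * n none) * hb

/-- A common prime `e` of the coordinates cannot divide `L`: it would divide `n none (P, Q)`, hence
`n none`, which is `1` modulo `L`. Thus `e > K`, and `e` does not divide `N`, a divisor of `L`. Then
`row_eval` shows that `e` divides each `n (some j)`, and consequently `n none`. -/
theorem exists_dvd_of_mem_nonprim {n : Option (Fin d) → ℤ} (hn : n ∈ S.nonprim) :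
    ∃ e : ℕ, S.K < e ∧ Nat.Coprime e S.K.factorial ∧ (∀ j, (e : ℤ) ∣ n (some j)) ∧ (e : ℤ) ∣ n none := by
  classical
  rw [nonprim, Finset.mem_filter] at hn
  obtain ⟨hn, hprim⟩ := hn
  obtain ⟨g, a', b', hg, ha, hb, hab⟩ := exists_coprimeVec (S.num n) (S.den n) (Or.inr (S.den_pos hn).ne')
  have hg1 : g.natAbs ≠ 1 := by
    intro h
    have : g = 1 := by omega
    subst this
    apply hprim
    rw [ha, hb, one_smul, one_mul]; exact hab
  obtain ⟨e, he, heg⟩ := Nat.exists_prime_and_dvd hg1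
  have heg' : (e : ℤ) ∣ g := by rwa [← Int.natCast_dvd] at heg
  have h1 : ∀ i, (e : ℤ) ∣ S.num n i := fun i => by
    rw [ha]; exact Dvd.dvd.mul_right heg' _
  have h2 : (e : ℤ) ∣ S.den n := by rw [hb]; exact Dvd.dvd.mul_right heg' _
  obtain ⟨x, y, hxy⟩ := S.coprime
  have heprime : Prime (e : ℤ) := Nat.prime_iff_prime_int.1 he
  have key : ∀ m : ℤ, (∀ i, (e : ℤ) ∣ m * S.P i) → (e : ℤ) ∣ m * S.Q → (e : ℤ) ∣ m := by
    intro m h3 h4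
    have : m = ∑ i, x i * (m * S.P i) + y * (m * S.Q) := by
      have e1 : ∑ i, x i * (m * S.P i) = m * (x ⬝ᵥ S.P) := by
        rw [dotProduct, Finset.mul_sum]
        exact Finset.sum_congr rfl fun i _ => by ring
      rw [e1]; linear_combination (-m) * hxy
    rw [this]
    exact dvd_add (Finset.dvd_sum fun i _ => Dvd.dvd.mul_left (h3 i) _) (Dvd.dvd.mul_left h4 _)
  have hmod := ((S.mem_Ω).1 hn).2.2
  have key2 : (∀ j, (e : ℤ) ∣ n (some j) * S.L) → (e : ℤ) ∣ n none := by
    intro h3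
    refine key _ (fun i => ?_) ?_
    · have h4 := h1 i
      unfold num at h4
      exact (dvd_add_right (Finset.dvd_sum fun j _ => by
        rw [← mul_assoc]; exact Dvd.dvd.mul_right (h3 j) _)).1 h4
    · unfold den at h2
      exact (dvd_add_right (Finset.dvd_sum fun j _ => by
        rw [← mul_assoc]; exact Dvd.dvd.mul_right (h3 j) _)).1 h2
  have heL : ¬ (e : ℤ) ∣ S.L := by
    intro h
    have h3 := key2 fun j => Dvd.dvd.mul_left h _
    have h4 : (e : ℤ) ∣ 1 := by
      have h5 := (Int.modEq_iff_dvd.1 hmod)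
      have h6 := dvd_add (h.trans h5) h3
      simpa using h6
    exact heprime.not_isUnit (isUnit_of_dvd_one h4)
  have heK : S.K < e := by
    by_contra! h
    exact heL (S.dvd_L_of_le he.pos h)
  have hj : ∀ j, (e : ℤ) ∣ n (some j) := by
    intro j
    obtain ⟨bb, hbb⟩ := S.reduced.mem j
    have h4 := S.row_eval n hbb
    have h5 : (e : ℤ) ∣ n (some j) * (S.L * S.N) := by
      rw [← h4]
      exact dvd_sub (Finset.dvd_sum fun i _ => Dvd.dvd.mul_left (h1 i) _) (Dvd.dvd.mul_left h2 _)
    rcases heprime.dvd_or_dvd h5 with h | h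
    · exact h
    · rcases heprime.dvd_or_dvd h with h | h
      · exact absurd h heL
      · exact absurd (h.trans S.natAbs_N_dvd) heL
  refine ⟨e, heK, ?_, hj, key2 fun j => Dvd.dvd.mul_right (hj j) _⟩
  rw [Nat.Prime.coprime_iff_not_dvd he]
  intro h
  exact heL (by unfold L; exact_mod_cast h)

/-- Divisibility of two of the coefficients by `e` already has proportion at most `6 / e²`, and the
sum over `e > K` is at most `6 / K`. -/
theorem card_nonprim_le : (S.nonprim.card : ℝ) ≤ 6 / S.K * S.tot := by
  classical
  have hd := S.two_le
  set o : Fin d := ⟨0, by omega⟩ with ho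
  have hM := S.one_le_M'
  have hL := S.L_pos'
  have hR1 : ∀ j, (1 : ℝ) ≤ S.R j := fun j => by exact_mod_cast S.one_le_R j
  set I : Finset ℕ := (Finset.Ioc S.K (2 * S.R o).toNat).filter fun e => Nat.Coprime e S.K.factorial
    with hI
  set B : ℕ → Finset (Option (Fin d) → ℤ) := fun e =>
    S.Ω.filter fun n => (e : ℤ) ∣ n (some o) ∧ (e : ℤ) ∣ n none with hB
  have hsub : S.nonprim ⊆ I.biUnion B := by
    intro n hn
    obtain ⟨e, h1, h2, h3, h4⟩ := S.exists_dvd_of_mem_nonprim hn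
    have hnΩ : n ∈ S.Ω := by
      unfold nonprim at hn
      exact (Finset.mem_filter.1 hn).1
    rw [Finset.mem_biUnion]
    refine ⟨e, ?_, Finset.mem_filter.2 ⟨hnΩ, h3 o, h4⟩⟩
    rw [hI, Finset.mem_filter, Finset.mem_Ioc]
    refine ⟨⟨h1, ?_⟩, h2⟩
    have h5 := (S.mem_Ω.1 hnΩ).1 o
    have h6 := Int.le_of_dvd (by linarith [S.one_le_R o]) (h3 o)
    omega
  have hcard : ∀ e ∈ I, ((B e).card : ℝ) ≤ 6 * S.tot * ((e : ℝ) ^ 2)⁻¹ := by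
    intro e he
    rw [hI, Finset.mem_filter, Finset.mem_Ioc] at he
    obtain ⟨⟨he1, he2⟩, hcop⟩ := he
    have he0 : 0 < e := by omega
    have he0' : (0 : ℝ) < e := by exact_mod_cast he0
    have heR : (e : ℝ) ≤ 2 * S.R o := by
      have : (e : ℤ) ≤ 2 * S.R o := by omega
      exact_mod_cast this
    have heM : (e : ℝ) ≤ S.M := heR.trans (by exact_mod_cast S.R_le_M o)
    set f : Option (Fin d) → Finset ℤ := fun l => l.elim
      ((Finset.Ico (6 * (S.L * S.M) + 1) (6 * (S.L * S.M) + 1 + S.L * S.M)).filter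
        fun x => x ≡ 1 [ZMOD S.L] ∧ (e : ℤ) ∣ x)
      (fun j => (Finset.Ico (S.R j) (S.R j + S.R j)).filter fun x => j = o → (e : ℤ) ∣ x) with hf
    have h1 : (B e).card ≤ (Fintype.piFinset f).card := by
      refine Finset.card_le_card fun n hn => ?_
      rw [hB, Finset.mem_filter, mem_Ω] at hn
      obtain ⟨⟨h1, h2, h3⟩, h4, h5⟩ := hn
      rw [Fintype.mem_piFinset]
      rintro (_ | j)
      · simp only [hf, Option.elim, Finset.mem_filter, Finset.mem_Ico]
        exact ⟨⟨h2.1, by linarith [h2.2]⟩, h3, h5⟩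
      · simp only [hf, Option.elim, Finset.mem_filter, Finset.mem_Ico]
        exact ⟨⟨(h1 j).1, by linarith [(h1 j).2]⟩, fun h => h ▸ h4⟩
    have hnone : ((f none).card : ℝ) ≤ 2 * S.M / e := by
      simp only [hf, Option.elim]
      rcases Finset.eq_empty_or_nonempty
        ((Finset.Ico (6 * (S.L * S.M) + 1) (6 * (S.L * S.M) + 1 + S.L * S.M)).filter
        fun x => x ≡ 1 [ZMOD S.L] ∧ (e : ℤ) ∣ x) with h | ⟨y, hy⟩
      · rw [h]; simp; positivity
      · rw [Finset.mem_filter] at hy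
        have h2 : ((Finset.Ico (6 * (S.L * S.M) + 1) (6 * (S.L * S.M) + 1 + S.L * S.M)).filter
            fun x => x ≡ 1 [ZMOD S.L] ∧ (e : ℤ) ∣ x) ⊆
            ((Finset.Ico (6 * (S.L * S.M) + 1) (6 * (S.L * S.M) + 1 + S.L * S.M)).filter
            fun x => x ≡ y [ZMOD (S.L * e)]) := by
          intro x hx
          rw [Finset.mem_filter] at hx ⊢
          refine ⟨hx.1, ?_⟩
          -- As `e` is prime to `L`, the two congruences on `n none` combine into one modulo `L *
          -- e`.
          have hc : S.L.natAbs.Coprime (e : ℤ).natAbs := by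
            unfold L; simpa using hcop.symm
          rw [← Int.modEq_and_modEq_iff_modEq_mul hc]
          exact ⟨hx.2.1.trans hy.2.1.symm,
            ((Int.modEq_zero_iff_dvd.2 hx.2.2).trans (Int.modEq_zero_iff_dvd.2 hy.2.2).symm)⟩
        have h3 := card_Ico_modEq_le (6 * (S.L * S.M) + 1) (S.L * S.M) y (S.L * e)
          (mul_pos S.L_pos (by exact_mod_cast he0)) (mul_nonneg S.L_pos.le (by linarith [S.one_le_M]))
        refine (by exact_mod_cast Finset.card_le_card h2 : (_ : ℝ) ≤ _).trans (h3.trans ?_)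
        push_cast
        rw [mul_div_mul_left _ _ hL.ne', mul_div_assoc, two_mul]
        have : 1 ≤ (S.M : ℝ) / e := by rw [le_div_iff₀ he0']; linarith
        linarith
    have hcardIco : ∀ j, ((Finset.Ico (S.R j) (S.R j + S.R j)).card : ℝ) = S.R j := by
      intro j
      rw [Int.card_Ico]
      have : (((S.R j + S.R j - S.R j).toNat : ℤ) : ℝ) = S.R j := by
        rw [Int.toNat_of_nonneg (by linarith [S.one_le_R j])]; push_cast; ring
      exact_mod_cast this
    have hsome : ∀ j, ((f (some j)).card : ℝ) ≤ S.R j * (if j = o then 3 / (e : ℝ) else 1) := by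
      intro j
      simp only [hf, Option.elim]
      split_ifs with hj
      · subst hj
        have h3 := card_Ico_modEq_le (S.R o) (S.R o) 0 e (by exact_mod_cast he0)
          (by linarith [S.one_le_R o])
        have h4 : ((Finset.Ico (S.R o) (S.R o + S.R o)).filter fun x => o = o → (e : ℤ) ∣ x)
          = ((Finset.Ico (S.R o) (S.R o + S.R o)).filter fun x => x ≡ 0 [ZMOD e]) := by
          refine Finset.filter_congr fun x _ => ?_
          rw [Int.modEq_zero_iff_dvd]; simp
        rw [h4]
        refine h3.trans ?_
        have : 1 ≤ 2 * ((S.R o : ℝ) / e) := by rw [← mul_div_assoc, le_div_iff₀ he0']; linarith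
        push_cast
        have e1 : (S.R o : ℝ) * (3 / e) = 3 * (S.R o / e) := by ring
        rw [e1]; linarith
      · rw [mul_one, ← hcardIco j]
        exact_mod_cast Finset.card_filter_le _ _
    calc ((B e).card : ℝ) ≤ ((Fintype.piFinset f).card : ℝ) := by exact_mod_cast h1
      _ = (f none).card * ∏ j, ((f (some j)).card : ℝ) := by
          rw [Fintype.card_piFinset, Fintype.prod_option]; push_cast; rfl
      _ ≤ (2 * S.M / e) * ∏ j, (S.R j * (if j = o then 3 / (e : ℝ) else 1)) := by
          refine mul_le_mul hnone (Finset.prod_le_prod (fun _ _ => by positivity) fun j _ => hsome j)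
            (Finset.prod_nonneg fun _ _ => by positivity) (by positivity)
      _ = _ := by
          rw [Finset.prod_mul_distrib, Finset.prod_ite_eq' Finset.univ o, if_pos (Finset.mem_univ _),
            tot]
          field_simp
          ring
  have hK : S.K ≠ 0 := by
    have h1 := S.K_ge
    have h2 := one_le_redConst d
    rintro h
    rw [h] at h1
    norm_num at h1
    linarith
  have hKpos : (0 : ℝ) < S.K := by positivity
  have ht := S.tot_pos
  calc (S.nonprim.card : ℝ) ≤ ((I.biUnion B).card : ℝ) := by exact_mod_cast Finset.card_le_card hsub
    _ ≤ ∑ e ∈ I, ((B e).card : ℝ) := by exact_mod_cast Finset.card_biUnion_le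
    _ ≤ ∑ e ∈ I, 6 * S.tot * ((e : ℝ) ^ 2)⁻¹ := Finset.sum_le_sum hcard
    _ ≤ ∑ e ∈ Finset.Ioc S.K (2 * S.R o).toNat, 6 * S.tot * ((e : ℝ) ^ 2)⁻¹ :=
        Finset.sum_le_sum_of_subset_of_nonneg (Finset.filter_subset _ _) fun _ _ _ => by positivity
    _ ≤ 6 * S.tot * (S.K : ℝ)⁻¹ := by
        rw [← Finset.mul_sum]
        gcongr
        rcases le_or_gt S.K (2 * S.R o).toNat with h | h
        · refine (sum_Ioc_inv_sq_le_sub hK h).trans ?_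
          have : (0 : ℝ) ≤ ((2 * S.R o).toNat : ℝ)⁻¹ := by positivity
          linarith
        · rw [Finset.Ioc_eq_empty (by omega)]; simp
    _ = _ := by field_simp

/-! ### Unions over hyperplanes -/

/-- A hyperplane is determined by `a` and `kk`, and `a · P` is congruent to `kk` modulo `Q`. The
factor `E` comes from `∏ T i = 1 / X` and `X ≤ 3 E Q`. -/
theorem card_hyp_le {H : Matrix (Fin d) (Fin d) ℤ} (hH : H.det ≠ 0)
    (hmem : ∀ i, H i ∈ annLattice S.P S.Q) {η : Fin d → ℝ}
    (hη : ∀ j i, S.T i * |(H j i : ℝ)| ≤ η i) {Y : ℝ} (hY : 0 ≤ Y)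
    (Ψ : Finset ((Fin d → ℤ) × ℤ))
    (hΨ : ∀ x ∈ Ψ, (∀ i, S.T i * |(x.1 i : ℝ)| ≤ η i) ∧ |(S.kk x.1 x.2 : ℝ)| ≤ Y) :
    (Ψ.card : ℝ) ≤ (2 * Y + 1) * (boxConst d * S.E * ∏ i, η i) := by
  classical
  have hinj : Set.InjOn (fun x : (Fin d → ℤ) × ℤ => (x.1, S.kk x.1 x.2)) Ψ := by
    rintro ⟨a, b⟩ _ ⟨a', b'⟩ _ h
    simp only [Prod.mk.injEq] at h
    obtain ⟨rfl, h⟩ := h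
    simp only [kk] at h
    have : b * S.Q = b' * S.Q := by linarith
    rw [mul_right_cancel₀ S.Q_pos.ne' this]
  have h := card_mul_le_of_cover S.Q_pos S.coprime hH hmem (η := fun i => η i / S.T i)
    (fun j i => by rw [le_div_iff₀ (S.T_pos i), mul_comm]; exact hη j i) hY
    (Ψ.image fun x => (x.1, S.kk x.1 x.2)) (by
      intro y hy
      obtain ⟨x, hx, rfl⟩ := Finset.mem_image.1 hy
      obtain ⟨h1, h2⟩ := hΨ x hx
      refine ⟨fun i => by rw [le_div_iff₀ (S.T_pos i), mul_comm]; exact h1 i, h2, ⟨x.2, ?_⟩⟩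
      simp only [kk]; ring)
  rw [Finset.card_image_of_injOn hinj, Finset.prod_div_distrib, S.prod_T, div_inv_eq_mul] at h
  have hQ := S.Q_pos'
  have h2 := S.le_Q_mul
  have hηp : 0 ≤ ∏ i, η i := Finset.prod_nonneg fun i _ =>
    le_trans (mul_nonneg (S.T_pos i).le (abs_nonneg _)) (hη i i)
  have h3 : (S.Q : ℝ) * Ψ.card ≤ S.Q * ((2 * Y + 1) * (boxConst d * S.E * ∏ i, η i)) := by
    refine h.trans ?_
    calc (2 * Y + 1) * ((d + 3) ^ d * ((∏ i, η i) * S.X))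
        ≤ (2 * Y + 1) * ((d + 3) ^ d * ((∏ i, η i) * (3 * S.E * S.Q))) := by gcongr
      _ = _ := by unfold boxConst; ring
  exact le_of_mul_le_mul_left h3 hQ

theorem card_le_of_hyp {H : Matrix (Fin d) (Fin d) ℤ} (hH : H.det ≠ 0)
    (hmem : ∀ i, H i ∈ annLattice S.P S.Q) {η : Fin d → ℝ}
    (hη : ∀ j i, S.T i * |(H j i : ℝ)| ≤ η i) {Y W : ℝ} (hY : 0 ≤ Y) (hW : 0 ≤ W)
    (B : Finset (Option (Fin d) → ℤ))
    (hB : ∀ n ∈ B, ∃ a b, (∀ i, S.T i * |(a i : ℝ)| ≤ η i) ∧ |(S.kk a b : ℝ)| ≤ Y ∧ n ∈ S.sol a b ∧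
      ((S.sol a b).card : ℝ) ≤ W) :
    (B.card : ℝ) ≤ (2 * Y + 1) * (boxConst d * S.E * ∏ i, η i) * W := by
  classical
  choose! f g hf using hB
  set Ψ : Finset ((Fin d → ℤ) × ℤ) := B.image fun n => (f n, g n) with hΨ
  have h1 : B ⊆ Ψ.biUnion fun x => S.sol x.1 x.2 := by
    intro n hn
    rw [Finset.mem_biUnion]
    exact ⟨(f n, g n), Finset.mem_image_of_mem _ hn, (hf n hn).2.2.1⟩
  have h2 := S.card_hyp_le hH hmem hη hY Ψ (by
    intro x hx
    obtain ⟨n, hn, rfl⟩ := Finset.mem_image.1 hx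
    exact ⟨(hf n hn).1, (hf n hn).2.1⟩)
  calc (B.card : ℝ) ≤ ∑ x ∈ Ψ, ((S.sol x.1 x.2).card : ℝ) := by
        exact_mod_cast (Finset.card_le_card h1).trans Finset.card_biUnion_le
    _ ≤ ∑ x ∈ Ψ, W := Finset.sum_le_sum fun x hx => by
        obtain ⟨n, hn, rfl⟩ := Finset.mem_image.1 hx
        exact (hf n hn).2.2.2
    _ = Ψ.card * W := by rw [Finset.sum_const, nsmul_eq_mul]
    _ ≤ _ := by gcongr

end StepData
end WeightedSingular
end

/-! ### Candidates on a family of hyperplanes. -/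

noncomputable section
namespace WeightedSingular
open Matrix

theorem sum_inv_sqrt_le (n : ℕ) : ∑ k ∈ Finset.range n, 1 / √((k : ℝ) + 1) ≤ 2 * √n := by
  induction n with
  | zero => simp
  | succ n ih =>
    rw [Finset.sum_range_succ]
    have h1 : 0 < √((n : ℝ) + 1) := Real.sqrt_pos.2 (by positivity)
    have h2 : √((n : ℝ) + 1) * √((n : ℝ) + 1) = n + 1 := Real.mul_self_sqrt (by positivity)
    have h3 : √(n : ℝ) * √n = n := Real.mul_self_sqrt (by positivity)
    have h4 : 2 * √(n : ℝ) * √((n : ℝ) + 1) ≤ 2 * n + 1 := by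
      nlinarith [sq_nonneg (√(n : ℝ) - √((n : ℝ) + 1))]
    have h5 : 1 / √((n : ℝ) + 1) ≤ 2 * √((n : ℝ) + 1) - 2 * √n := by
      rw [div_le_iff₀ h1]; nlinarith
    push_cast
    linarith

/-- The term `c = 0` is `0` by the convention for division by zero. -/
theorem sum_Icc_inv_sqrt_le (m : ℕ) :
    ∑ c ∈ Finset.Icc (-(m : ℤ)) m, 1 / √|(c : ℝ)| ≤ 4 * √m := by
  have h0 : ∀ k : ℕ, ∑ c ∈ Finset.Icc (-(k : ℤ)) k, 1 / √|(c : ℝ)|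
      = 2 * ∑ j ∈ Finset.range k, 1 / √((j : ℝ) + 1) := by
    intro k
    induction k with
    | zero => simp
    | succ k ih =>
      have e : Finset.Icc (-((k + 1 : ℕ) : ℤ)) ((k + 1 : ℕ) : ℤ)
          = insert (-((k : ℤ) + 1)) (insert ((k : ℤ) + 1) (Finset.Icc (-(k : ℤ)) k)) := by
        ext x; simp only [Finset.mem_Icc, Finset.mem_insert]; push_cast; omega
      rw [e, Finset.sum_insert, Finset.sum_insert, ih, Finset.sum_range_succ]
      · have e1 : |((-((k : ℤ) + 1) : ℤ) : ℝ)| = k + 1 := by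
          push_cast; rw [abs_neg, abs_of_pos (by positivity)]
        have e2 : |((((k : ℤ) + 1) : ℤ) : ℝ)| = k + 1 := by
          push_cast; rw [abs_of_pos (by positivity)]
        rw [e1, e2]; ring
      · simp
      · simp only [Finset.mem_insert, Finset.mem_Icc]; omega
  rw [h0]
  linarith [sum_inv_sqrt_le m]

namespace StepData
variable {d : ℕ} (S : StepData d)

/-- Candidates on hyperplanes through `P / Q` whose normal vector lies in a box and is not short. -/
theorem card_le_thin {H : Matrix (Fin d) (Fin d) ℤ} (hH : H.det ≠ 0)
    (hmem : ∀ i, H i ∈ annLattice S.P S.Q) {η : Fin d → ℝ}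
    (hη : ∀ j i, S.T i * |(H j i : ℝ)| ≤ η i) {A : ℝ} (hA : 0 < A)
    (B : Finset (Option (Fin d) → ℤ))
    (hB : ∀ n ∈ B, ∃ a b, IsCoprimeVec a b ∧ a ≠ 0 ∧ (∀ i, S.T i * |(a i : ℝ)| ≤ η i) ∧
      S.kk a b = 0 ∧ A ≤ wnorm S.T a ∧ n ∈ S.sol a b) :
    (B.card : ℝ) ≤ boxConst d * hypConst d S.K * S.tot * (∏ i, η i)
      * (1 / (S.δ * A) + S.lmax / S.δ ^ 2) := by
  have hh := S.hypConst_pos; have hδ := S.δ_pos; have hE := S.E_pos; have ht := S.tot_pos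
  have hl := S.lmax_pos
  have h := S.card_le_of_hyp hH hmem hη (Y := 0)
    (W := hypConst d S.K * S.tot * (1 / (S.δ * S.E * A) + S.lmax / (S.δ ^ 2 * S.E))) le_rfl
    (by positivity) B (by
      intro n hn
      obtain ⟨a, b, h1, h2, h3, h4, h5, h6⟩ := hB n hn
      refine ⟨a, b, h3, by simp [h4], h6, (S.card_sol_le₀ h1 h2 h4).trans ?_⟩
      gcongr)
  refine h.trans (le_of_eq ?_)
  field_simp
  ring

/-- Split dyadically according to the norm of `a`. For norms about `v` there are `O(δ v)` values of
`kk`, the box has volume `v ∏_{i ≠ m} s i`, and each hyperplane carries a proportion `O(1 / (δ E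
v))` of the candidates. The contributions `v ∏_{i ≠ m} s i` form a geometric series dominated by `v`
about `s m`, the longest side. -/
theorem card_le_big_of_kk_ne {H : Matrix (Fin d) (Fin d) ℤ} (hH : H.det ≠ 0)
    (hmem : ∀ i, H i ∈ annLattice S.P S.Q) {s : Fin d → ℝ} (m : Fin d)
    (hs : ∀ j i, S.T i * |(H j i : ℝ)| ≤ s i) (hHm : ∀ j, S.T m * |(H j m : ℝ)| ≤ 1)
    (hsm : ∀ i, s i ≤ s m) (hdδ : d * S.δ ≤ 1)
    (hbig : s m ≤ S.E * S.lmin) (hd2 : d = 2 ∨ d * s m ≤ famConst d S.K * S.E * S.lmin)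
    (B : Finset (Option (Fin d) → ℤ))
    (hB : ∀ n ∈ B, ∃ a b, IsCoprimeVec a b ∧ a ≠ 0 ∧ (∀ i, S.T i * |(a i : ℝ)| ≤ s i) ∧
      S.kk a b ≠ 0 ∧ 1 ≤ d * S.δ * wnorm S.T a ∧ n ∈ S.sol a b) :
    (B.card : ℝ) ≤ 40 * d * boxConst d * hypConst d S.K * S.tot * ∏ i, s i := by
  classical
  have hh := S.hypConst_pos; have hδ := S.δ_pos; have hE := S.E_pos; have ht := S.tot_pos
  have hl := S.lmin_pos; have hd := S.d_pos; have hb := boxConst_pos d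
  have hs0 : ∀ i, 0 ≤ s i := fun i =>
    le_trans (mul_nonneg (S.T_pos i).le (abs_nonneg _)) (hs i i)
  have hprod0 : 0 ≤ ∏ i, s i := Finset.prod_nonneg fun i _ => hs0 i
  rcases B.eq_empty_or_nonempty with rfl | ⟨n₀, hn₀⟩
  · simp; positivity
  have hw : ∀ a : Fin d → ℤ, (∀ i, S.T i * |(a i : ℝ)| ≤ s i) → wnorm S.T a ≤ s m := fun a ha =>
    (wnorm_le_iff S.T_pos (hs0 m)).2 fun i => (ha i).trans (hsm i)
  have hdm : 1 ≤ d * S.δ * s m := by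
    obtain ⟨a, b, -, -, h3, -, h5, -⟩ := hB n₀ hn₀
    exact h5.trans (mul_le_mul_of_nonneg_left (hw a h3) (by positivity))
  obtain ⟨J, hJ1, hJ2⟩ := exists_nat_pow_near hdm (one_lt_two)
  choose! f g hf using hB
  have hj : ∀ n ∈ B, ∃ j, (2 : ℝ) ^ j ≤ d * S.δ * wnorm S.T (f n) ∧
      d * S.δ * wnorm S.T (f n) < 2 ^ (j + 1) := fun n hn =>
    exists_nat_pow_near (hf n hn).2.2.2.2.1 one_lt_two
  choose! jj hjj using hj
  set Bj : ℕ → Finset (Option (Fin d) → ℤ) := fun j => B.filter fun n => jj n = j with hBj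
  have hcover : B = (Finset.range (J + 1)).biUnion Bj := by
    ext n
    simp only [Finset.mem_biUnion, Finset.mem_range, hBj, Finset.mem_filter]
    constructor
    · intro hn
      refine ⟨jj n, ?_, hn, rfl⟩
      have h1 : (2 : ℝ) ^ jj n < 2 ^ (J + 1) := (hjj n hn).1.trans_lt
        (lt_of_le_of_lt (mul_le_mul_of_nonneg_left (hw _ (hf n hn).2.2.1) (by positivity)) hJ2)
      exact (pow_lt_pow_iff_right₀ one_lt_two).1 h1
    · rintro ⟨j, -, hn, -⟩; exact hn
  set Pm := ∏ i ∈ Finset.univ.erase m, s i with hPm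
  have hPm0 : 0 ≤ Pm := Finset.prod_nonneg fun i _ => hs0 i
  have hprod : ∏ i, s i = s m * Pm := (Finset.mul_prod_erase _ _ (Finset.mem_univ m)).symm
  have hcardj : ∀ j ∈ Finset.range (J + 1), ((Bj j).card : ℝ)
      ≤ 20 * boxConst d * hypConst d S.K * S.tot * Pm / S.δ * 2 ^ j := by
    intro j hjr
    have hjJ : j ≤ J := by simpa [Nat.lt_succ_iff] using hjr
    have h2j : (2 : ℝ) ^ j ≤ d * S.δ * s m := (pow_le_pow_right₀ one_le_two hjJ).trans hJ1
    have hp : (0 : ℝ) < 2 ^ j := by positivity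
    set w : ℝ := 2 ^ j / (d * S.δ) with hwdef
    have hw0 : 0 < w := by positivity
    have hw1 : d * S.δ * w = 2 ^ j := by rw [hwdef]; field_simp
    have hwE : w ≤ S.E * S.lmin := by
      refine le_trans ?_ hbig
      rw [hwdef, div_le_iff₀ (by positivity)]; linarith
    set η : Fin d → ℝ := Function.update s m (2 * w) with hη
    have h2w : 1 ≤ 2 * w := by
      have : (1 : ℝ) ≤ 2 ^ j := one_le_pow₀ one_le_two
      nlinarith
    have h := S.card_le_of_hyp hH hmem (η := η) (by
        intro l i
        by_cases hi : i = m
        · subst hi; rw [hη, Function.update_self]; exact (hHm l).trans h2w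
        · rw [hη, Function.update_of_ne hi]; exact hs l i) (Y := 2 * 2 ^ j)
      (W := hypConst d S.K * S.tot * (2 / (S.δ * S.E * w))) (by positivity) (by positivity) (Bj j)
      (by
        intro n hn
        rw [hBj, Finset.mem_filter] at hn
        obtain ⟨hn, rfl⟩ := hn
        obtain ⟨h1, h2, h3, h4, h5, h6⟩ := hf n hn
        obtain ⟨h7, h8⟩ := hjj n hn
        rw [← hw1] at h7
        have h7' : w ≤ wnorm S.T (f n) := le_of_mul_le_mul_left h7 (by positivity)
        have h8' : wnorm S.T (f n) ≤ 2 * w := by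
          have : d * S.δ * wnorm S.T (f n) ≤ d * S.δ * (2 * w) := by
            rw [pow_succ, ← hw1] at h8; linarith
          exact le_of_mul_le_mul_left this (by positivity)
        refine ⟨f n, g n, ?_, ?_, h6, ?_⟩
        · intro i
          by_cases hi : i = m
          · subst hi; rw [hη, Function.update_self]
            exact (coord_le_wnorm S.T_pos _ _).trans h8'
          · rw [hη, Function.update_of_ne hi]; exact h3 i
        · refine (S.abs_kk_le h6).trans (h8.le.trans (le_of_eq ?_))
          rw [pow_succ]; ring
        · refine (S.card_sol_le₁ h1 h2 h4 (hd2.imp_right fun h => le_trans ?_ h)).trans ?_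
          · exact mul_le_mul_of_nonneg_left (hw _ h3) hd.le
          · have e1 : 1 / (S.δ * S.E * wnorm S.T (f n)) ≤ 1 / (S.δ * S.E * w) := by gcongr
            have e2 : 1 / (S.δ * S.E ^ 2 * S.lmin) ≤ 1 / (S.δ * S.E * w) := by
              apply one_div_le_one_div_of_le (by positivity)
              calc S.δ * S.E * w ≤ S.δ * S.E * (S.E * S.lmin) := by gcongr
                _ = _ := by ring
            have e3 : 2 / (S.δ * S.E * w) = 1 / (S.δ * S.E * w) + 1 / (S.δ * S.E * w) := by ring
            rw [e3]
            gcongr)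
    have hprodη : ∏ i, η i = 2 * w * Pm := by
      rw [← Finset.mul_prod_erase _ _ (Finset.mem_univ m), hη, Function.update_self]
      congr 1
      exact Finset.prod_congr rfl fun i hi => by rw [Function.update_of_ne (Finset.ne_of_mem_erase hi)]
    rw [hprodη] at h
    refine h.trans ?_
    have h1p : (1 : ℝ) ≤ 2 ^ j := one_le_pow₀ one_le_two
    calc (2 * (2 * (2 : ℝ) ^ j) + 1) * (boxConst d * S.E * (2 * w * Pm))
          * (hypConst d S.K * S.tot * (2 / (S.δ * S.E * w)))
        ≤ (5 * (2 : ℝ) ^ j) * (boxConst d * S.E * (2 * w * Pm))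
          * (hypConst d S.K * S.tot * (2 / (S.δ * S.E * w))) := by gcongr; linarith
      _ = _ := by field_simp; ring
  have hgeom : ∑ j ∈ Finset.range (J + 1), (2 : ℝ) ^ j ≤ 2 * (d * S.δ * s m) := by
    have h1 := geom_sum_eq (one_lt_two.ne' : (2 : ℝ) ≠ 1) (J + 1)
    rw [h1, pow_succ]
    linarith
  calc (B.card : ℝ) = (((Finset.range (J + 1)).biUnion Bj).card : ℝ) := by rw [← hcover]
    _ ≤ ∑ j ∈ Finset.range (J + 1), ((Bj j).card : ℝ) := by exact_mod_cast Finset.card_biUnion_le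
    _ ≤ ∑ j ∈ Finset.range (J + 1), 20 * boxConst d * hypConst d S.K * S.tot * Pm / S.δ * 2 ^ j :=
        Finset.sum_le_sum hcardj
    _ ≤ 20 * boxConst d * hypConst d S.K * S.tot * Pm / S.δ * (2 * (d * S.δ * s m)) := by
        rw [← Finset.mul_sum]; gcongr
    _ = _ := by rw [hprod]; field_simp; ring

/-- All coefficients of a candidate are positive, so a sum with a single nonzero `cc` cannot vanish.
-/
theorem exists_two_cc_ne_zero {a : Fin d → ℤ} {b : ℤ} (ha : a ≠ 0) (hk : S.kk a b = 0)
    {n : Option (Fin d) → ℤ} (hn : n ∈ S.sol a b) :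
    ∃ i j, i ≠ j ∧ S.cc a b i ≠ 0 ∧ S.cc a b j ≠ 0 := by
  have hw : 0 ≤ d * S.δ * wnorm S.T a :=
    mul_nonneg (mul_nonneg S.d_pos.le S.δ_pos.le) (wnorm_nonneg _)
  obtain ⟨i, hi, -⟩ := S.exists_large_cc (a := a) (b := b) ha (by rw [hk]; simpa using hw)
  by_contra! hcon
  have h0 : ∀ j, j ≠ i → S.cc a b j = 0 := fun j hj => hcon i j hj.symm hi
  rw [sol, Finset.mem_filter] at hn
  have h1 := S.eval_eq a b n
  rw [hn.2, sub_self, hk, mul_zero, add_zero, Finset.sum_eq_single i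
    (fun j _ hj => by rw [h0 j hj]; ring) (fun h => absurd (Finset.mem_univ _) h)] at h1
  have h2 := ((S.mem_Ω).1 hn.1).1 i
  have h3 := S.one_le_R i
  rcases mul_eq_zero.1 h1.symm with h | h
  · linarith
  · rcases mul_eq_zero.1 h with h | h
    · exact S.L_pos.ne' h
    · exact hi h

/-- The better of the bounds for `i` and `j` is at most their geometric mean. Summed over `cc`,
inverse square roots lose no logarithm, unlike the sum of `1 / |c|`. -/
theorem card_sol_le_sqrt {a : Fin d → ℤ} {b : ℤ} (hab : IsCoprimeVec a b)
    (hk : S.kk a b = 0) {i j : Fin d} (hi : S.cc a b i ≠ 0) (hj : S.cc a b j ≠ 0) :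
    ((S.sol a b).card : ℝ) ≤ solConst d S.K * S.tot *
      ((1 / √|(S.cc a b i : ℝ)| * (1 / √(S.R i : ℝ))) * (1 / √|(S.cc a b j : ℝ)| * (1 / √(S.R j : ℝ)))
        + S.zc) := by
  have hpos : ∀ l, S.cc a b l ≠ 0 → 0 < |(S.cc a b l : ℝ)| * S.R l := fun l hl => by
    have h1 : 0 < |(S.cc a b l : ℝ)| := abs_pos.2 (by exact_mod_cast hl)
    have h2 : (0 : ℝ) < S.R l := by
      have := S.one_le_R l
      exact_mod_cast (by linarith : 0 < S.R l)
    positivity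
  have hsplit : ∀ l, 1 / √|(S.cc a b l : ℝ)| * (1 / √(S.R l : ℝ))
      = 1 / √(|(S.cc a b l : ℝ)| * S.R l) := fun l => by
    rw [Real.sqrt_mul (abs_nonneg _), one_div_mul_one_div]
  rw [hsplit, hsplit]
  set x := |(S.cc a b i : ℝ)| * S.R i with hx
  set y := |(S.cc a b j : ℝ)| * S.R j with hy
  have hs := solConst_pos d S.K
  have ht := S.tot_pos
  have hx0 : 0 < x := hpos i hi
  have hy0 : 0 < y := hpos j hj
  have hsx := Real.sqrt_pos.2 hx0
  have hsy := Real.sqrt_pos.2 hy0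
  rw [one_div_mul_one_div]
  rcases le_total x y with h | h
  · refine (S.card_sol_le_of_kk_eq_zero hab hk hj).trans ?_
    have e : 1 / y ≤ 1 / (√x * √y) := one_div_le_one_div_of_le (by positivity) (by
      calc √x * √y ≤ √y * √y := by gcongr
        _ = y := Real.mul_self_sqrt hy0.le)
    exact mul_le_mul_of_nonneg_left (add_le_add_left e _) (by positivity)
  · refine (S.card_sol_le_of_kk_eq_zero hab hk hi).trans ?_
    have e : 1 / x ≤ 1 / (√x * √y) := one_div_le_one_div_of_le (by positivity) (by
      calc √x * √y ≤ √x * √x := by gcongr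
        _ = x := Real.mul_self_sqrt hx0.le)
    exact mul_le_mul_of_nonneg_left (add_le_add_left e _) (by positivity)

end StepData

/-- Constant in the bound for the candidates on hyperplanes with short normal vector. -/
def cubeConst (d K : ℕ) : ℝ :=
  d ^ 2 * (solConst d K * 4 ^ d * redConst d ^ d * (3 * d.factorial) *
    (1 / famConst d K + 3 * d.factorial / famConst d K ^ 2))

namespace StepData
variable {d : ℕ} (S : StepData d)

theorem cc_injOn {a a' : Fin d → ℤ} {b b' : ℤ} (hk : S.kk a b = 0) (hk' : S.kk a' b' = 0)
    (h : S.cc a b = S.cc a' b') : a = a' ∧ b = b' := by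
  have hN := S.dual.N_ne_zero S.reduced
  have haa : a = a' := by
    ext i
    have h1 := S.dual.coord_eq a b i
    have h2 := S.dual.coord_eq a' b' i
    have e1 : ∀ j, a ⬝ᵥ S.p j - b * S.q j = a' ⬝ᵥ S.p j - b' * S.q j := fun j => congrFun h j
    have e2 : a ⬝ᵥ S.P - b * S.Q = 0 := hk
    have e3 : a' ⬝ᵥ S.P - b' * S.Q = 0 := hk'
    simp only [e1, e2] at h1
    simp only [e3] at h2
    rw [h2] at h1
    exact (mul_left_cancel₀ (mul_ne_zero S.Q_pos.ne' hN) h1).symm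
  subst haa
  refine ⟨rfl, mul_right_cancel₀ S.Q_pos.ne' (?_ : b * S.Q = b' * S.Q)⟩
  unfold kk at hk hk'
  linarith

/-- Such hyperplanes pass through `P / Q`, since `|kk| ≤ d δ A < 1`. They are parametrised by their
values `cc`, with `|cc l| ≤ h l`, a bound inversely proportional to the length of `G l`. This avoids
asking for independent lattice vectors in the small cube. The bounds `card_sol_le_sqrt` are summed
over the box of all `cc`, separately for each pair of nonzero entries. -/
theorem card_le_cube {A : ℝ} (hA : 0 < A) (hA1 : A ≤ 1) (hlA : S.lmax ≤ A)
    (hdδA : d * S.δ * A < 1) (B : Finset (Option (Fin d) → ℤ))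
    (hB : ∀ n ∈ B, ∃ a b, IsCoprimeVec a b ∧ a ≠ 0 ∧ wnorm S.T a ≤ A ∧ n ∈ S.sol a b) :
    (B.card : ℝ) ≤ cubeConst d S.K * S.tot * (A / S.δ + S.lmax / S.δ ^ 2) := by
  classical
  have hδ := S.δ_pos; have hE := S.E_pos; have ht := S.tot_pos
  have hl := S.lmax_pos; have hd := S.d_pos; have hc := S.famConst_pos
  have hs := solConst_pos d S.K; have hC := redConst_pos d; have hC1 := one_le_redConst d
  have hz := S.zc_pos
  choose! f g hf using hB
  have hkk : ∀ n ∈ B, S.kk (f n) (g n) = 0 := fun n hn => by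
    obtain ⟨h1, h2, h3, h4⟩ := hf n hn
    have h5 := S.abs_kk_le h4
    have h6 : |(S.kk (f n) (g n) : ℝ)| < 1 :=
      (h5.trans (mul_le_mul_of_nonneg_left h3 (by positivity))).trans_lt hdδA
    rw [← Int.abs_lt_one_iff]
    exact_mod_cast h6
  have hij : ∀ n ∈ B, ∃ i j, i ≠ j ∧ S.cc (f n) (g n) i ≠ 0 ∧ S.cc (f n) (g n) j ≠ 0 :=
    fun n hn => S.exists_two_cc_ne_zero (hf n hn).2.1 (hkk n hn) (hf n hn).2.2.2
  have : Nonempty (Fin d) := ⟨⟨0, by have := S.two_le; omega⟩⟩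
  choose! ii jj hij using hij
  set h : Fin d → ℝ := fun l => redConst d * A / wnorm S.T (S.G l) with hh
  have hh1 : ∀ l, 1 ≤ h l := fun l => by
    have := S.lam_pos l
    have := S.le_lmax l
    rw [hh, le_div_iff₀ (S.lam_pos l)]
    nlinarith
  have hcc : ∀ n ∈ B, ∀ l, |(S.cc (f n) (g n) l : ℝ)| ≤ h l := fun n hn l => by
    have h1 := S.reduced.abs_det_updateRow_mul_le S.Q_pos S.T_pos (f n) l
    have h2 : f n ⬝ᵥ S.P - g n * S.Q = 0 := hkk n hn
    rw [S.dual.det_updateRow (f n) (g n) l, h2, mul_zero, sub_zero] at h1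
    push_cast at h1
    have hQ := S.Q_pos'
    rw [abs_mul, abs_of_pos hQ] at h1
    rw [hh, le_div_iff₀ (S.lam_pos l)]
    have h3 : S.Q * (|(S.cc (f n) (g n) l : ℝ)| * wnorm S.T (S.G l)) ≤ S.Q * (redConst d * A) := by
      have h4 := (hf n hn).2.2.1
      calc _ = S.Q * |(S.cc (f n) (g n) l : ℝ)| * wnorm S.T (S.G l) := by ring
        _ ≤ redConst d * S.Q * wnorm S.T (f n) := by unfold cc; push_cast; exact h1
        _ ≤ redConst d * S.Q * A := by gcongr
        _ = _ := by ring
    exact le_of_mul_le_mul_left h3 hQ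
  -- The lengths of the `G l` cancel in `h l * R l`, so one lower bound `v` serves all indices.
  set v : ℝ := redConst d * A * (famConst d S.K * S.δ * S.E) with hv
  have hv0 : 0 < v := by positivity
  have hhR : ∀ l, v ≤ h l * S.R l := fun l => by
    have h1 := S.le_R l
    have h2 := S.lam_pos l
    calc v = h l * (famConst d S.K * S.δ * S.E * wnorm S.T (S.G l)) := by
          rw [hh, hv]; field_simp
      _ ≤ _ := by have := hh1 l; gcongr
  set box : Finset (Fin d → ℤ) :=
    Fintype.piFinset fun l => Finset.Icc (-((⌊h l⌋₊ : ℕ) : ℤ)) (⌊h l⌋₊ : ℕ) with hbox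
  have hIcc : ∀ l, ((Finset.Icc (-((⌊h l⌋₊ : ℕ) : ℤ)) (⌊h l⌋₊ : ℕ)).card : ℝ) ≤ 4 * h l := fun l => by
    rw [Int.card_Icc]
    have e1 : ((⌊h l⌋₊ : ℕ) + 1 - -((⌊h l⌋₊ : ℕ) : ℤ)).toNat = 2 * ⌊h l⌋₊ + 1 := by omega
    rw [e1]
    have e2 := Nat.floor_le (by linarith [hh1 l] : 0 ≤ h l)
    push_cast
    linarith [hh1 l]
  have hprodh : ∏ l, h l ≤ redConst d ^ d * (3 * d.factorial) * (A ^ d * S.E) := by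
    rw [hh, Finset.prod_div_distrib, Finset.prod_const, Finset.card_univ, Fintype.card_fin,
      div_le_iff₀ (Finset.prod_pos fun l _ => S.lam_pos l), mul_pow]
    have := S.prod_lam_ge
    calc redConst d ^ d * A ^ d = (redConst d ^ d * A ^ d) * 1 := by ring
      _ ≤ (redConst d ^ d * A ^ d) * (3 * d.factorial * S.E * ∏ j, wnorm S.T (S.G j)) := by gcongr
      _ = _ := by ring
  have hprodh0 : 0 ≤ ∏ l, h l := Finset.prod_nonneg fun l _ => by linarith [hh1 l]
  set W : ℝ := solConst d S.K * S.tot * (4 ^ d * (∏ l, h l) * (1 / v + S.zc)) with hW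
  have hpair : ∀ i j : Fin d, i ≠ j →
      ((B.filter fun n => ii n = i ∧ jj n = j).card : ℝ) ≤ W := by
    intro i j hne
    set B' := B.filter fun n => ii n = i ∧ jj n = j with hB'
    have hB'mem : ∀ n ∈ B', n ∈ B ∧ S.cc (f n) (g n) i ≠ 0 ∧ S.cc (f n) (g n) j ≠ 0 := fun n hn => by
      rw [hB', Finset.mem_filter] at hn
      obtain ⟨hn, rfl, rfl⟩ := hn
      exact ⟨hn, (hij n hn).2.1, (hij n hn).2.2⟩
    set Ψ : Finset ((Fin d → ℤ) × ℤ) := B'.image fun n => (f n, g n) with hΨ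
    set F : (Fin d → ℤ) → ℝ := fun c =>
      (1 / √|(c i : ℝ)| * (1 / √(S.R i : ℝ))) * (1 / √|(c j : ℝ)| * (1 / √(S.R j : ℝ))) + S.zc with hF
    have hF0 : ∀ c, 0 ≤ F c := fun c => by simp only [hF]; positivity
    have hsub : B' ⊆ Ψ.biUnion fun x => S.sol x.1 x.2 := by
      intro n hn
      rw [Finset.mem_biUnion]
      exact ⟨(f n, g n), Finset.mem_image_of_mem _ hn, (hf n (hB'mem n hn).1).2.2.2⟩
    have hinj : Set.InjOn (fun x : (Fin d → ℤ) × ℤ => S.cc x.1 x.2) Ψ := by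
      rintro x hx y hy hxy
      obtain ⟨n, hn, rfl⟩ := Finset.mem_image.1 (Finset.mem_coe.1 hx)
      obtain ⟨n', hn', rfl⟩ := Finset.mem_image.1 (Finset.mem_coe.1 hy)
      obtain ⟨e1, e2⟩ := S.cc_injOn (hkk n (hB'mem n hn).1) (hkk n' (hB'mem n' hn').1) hxy
      simp only [e1, e2]
    have hsumF : ∑ c ∈ box, F c ≤ 4 ^ d * (∏ l, h l) * (1 / v + S.zc) := by
      simp only [hF]
      rw [Finset.sum_add_distrib]
      have e1 : ∑ c ∈ box, (1 / √|(c i : ℝ)| * (1 / √(S.R i : ℝ))) *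
          (1 / √|(c j : ℝ)| * (1 / √(S.R j : ℝ)))
          = (∑ c ∈ box, ∏ l, ((if l = i then 1 / √|(c l : ℝ)| else 1) *
            (if l = j then 1 / √|(c l : ℝ)| else 1))) * (1 / √(S.R i : ℝ) * (1 / √(S.R j : ℝ))) := by
        rw [Finset.sum_mul]
        refine Finset.sum_congr rfl fun c _ => ?_
        rw [Finset.prod_mul_distrib, Finset.prod_ite_eq' Finset.univ i,
          Finset.prod_ite_eq' Finset.univ j, if_pos (Finset.mem_univ _), if_pos (Finset.mem_univ _)]
        ring
      have e2 : ∑ c ∈ box, ∏ l, ((if l = i then 1 / √|(c l : ℝ)| else 1) *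
            (if l = j then 1 / √|(c l : ℝ)| else 1))
          = ∏ l, ∑ x ∈ Finset.Icc (-((⌊h l⌋₊ : ℕ) : ℤ)) (⌊h l⌋₊ : ℕ),
            ((if l = i then 1 / √|(x : ℝ)| else 1) * (if l = j then 1 / √|(x : ℝ)| else 1)) := by
        rw [Finset.prod_univ_sum]
      have e3 : ∀ l, ∑ x ∈ Finset.Icc (-((⌊h l⌋₊ : ℕ) : ℤ)) (⌊h l⌋₊ : ℕ),
            ((if l = i then 1 / √|(x : ℝ)| else 1) * (if l = j then 1 / √|(x : ℝ)| else 1))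
          ≤ (4 * h l) * ((if l = i then 1 / √(h l) else 1) * (if l = j then 1 / √(h l) else 1)) := by
        intro l
        have e4 : ∑ x ∈ Finset.Icc (-((⌊h l⌋₊ : ℕ) : ℤ)) (⌊h l⌋₊ : ℕ), 1 / √|(x : ℝ)|
            ≤ (4 * h l) * (1 / √(h l)) := by
          refine (sum_Icc_inv_sqrt_le _).trans ?_
          have e5 : 0 < √(h l) := Real.sqrt_pos.2 (by linarith [hh1 l])
          have e6 : √(h l) * √(h l) = h l := Real.mul_self_sqrt (by linarith [hh1 l])
          have e7 : (4 * h l) * (1 / √(h l)) = 4 * √(h l) := by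
            rw [mul_one_div, div_eq_iff e5.ne']; linarith
          rw [e7]
          gcongr
          exact Nat.floor_le (by linarith [hh1 l])
        by_cases h1 : l = i
        · subst h1
          simp only [if_true, hne, if_false, mul_one]
          exact e4
        · by_cases h2 : l = j
          · subst h2
            simp only [if_true, h1, if_false, one_mul]
            exact e4
          · simp only [h1, h2, if_false, mul_one, Finset.sum_const, nsmul_eq_mul]
            exact hIcc l
      have e4 : ∏ l, ((4 * h l) * ((if l = i then 1 / √(h l) else 1) * (if l = j then 1 / √(h l) else 1)))
          = 4 ^ d * (∏ l, h l) * (1 / √(h i) * (1 / √(h j))) := by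
        rw [Finset.prod_mul_distrib, Finset.prod_mul_distrib, Finset.prod_mul_distrib,
          Finset.prod_ite_eq' Finset.univ i, Finset.prod_ite_eq' Finset.univ j,
          if_pos (Finset.mem_univ _), if_pos (Finset.mem_univ _), Finset.prod_const,
          Finset.card_univ, Fintype.card_fin]
      have e5 : ∀ l, 1 / √(h l) * (1 / √(S.R l : ℝ)) ≤ 1 / √v := fun l => by
        rw [one_div_mul_one_div, ← Real.sqrt_mul (by linarith [hh1 l])]
        exact one_div_le_one_div_of_le (Real.sqrt_pos.2 hv0) (Real.sqrt_le_sqrt (hhR l))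
      have e6 : (1 / √(h i) * (1 / √(h j))) * (1 / √(S.R i : ℝ) * (1 / √(S.R j : ℝ))) ≤ 1 / v := by
        calc _ = (1 / √(h i) * (1 / √(S.R i : ℝ))) * (1 / √(h j) * (1 / √(S.R j : ℝ))) := by ring
          _ ≤ 1 / √v * (1 / √v) := mul_le_mul (e5 i) (e5 j) (by positivity) (by positivity)
          _ = 1 / v := by rw [one_div_mul_one_div, Real.mul_self_sqrt hv0.le]
      rw [mul_add]
      refine add_le_add ?_ ?_
      · rw [e1, e2]
        calc _ ≤ (4 ^ d * (∏ l, h l) * (1 / √(h i) * (1 / √(h j)))) *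
              (1 / √(S.R i : ℝ) * (1 / √(S.R j : ℝ))) := by
              rw [← e4]
              refine mul_le_mul_of_nonneg_right (Finset.prod_le_prod (fun l _ =>
                Finset.sum_nonneg fun x _ => ?_) fun l _ => e3 l) (by positivity)
              split_ifs <;> positivity
          _ = 4 ^ d * (∏ l, h l) * ((1 / √(h i) * (1 / √(h j))) *
              (1 / √(S.R i : ℝ) * (1 / √(S.R j : ℝ)))) := by ring
          _ ≤ _ := by gcongr
      · rw [Finset.sum_const, nsmul_eq_mul, hbox, Fintype.card_piFinset]
        push_cast
        refine mul_le_mul_of_nonneg_right ?_ hz.le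
        calc _ ≤ ∏ l, (4 * h l) := Finset.prod_le_prod (fun _ _ => by positivity) fun l _ => hIcc l
          _ = _ := by rw [Finset.prod_mul_distrib, Finset.prod_const, Finset.card_univ,
                        Fintype.card_fin]
    calc (B'.card : ℝ) ≤ ∑ x ∈ Ψ, ((S.sol x.1 x.2).card : ℝ) := by
          exact_mod_cast (Finset.card_le_card hsub).trans Finset.card_biUnion_le
      _ ≤ ∑ x ∈ Ψ, solConst d S.K * S.tot * F (S.cc x.1 x.2) := Finset.sum_le_sum fun x hx => by
          obtain ⟨n, hn, rfl⟩ := Finset.mem_image.1 hx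
          obtain ⟨h1, h2, h3⟩ := hB'mem n hn
          exact S.card_sol_le_sqrt (hf n h1).1 (hkk n h1) h2 h3
      _ = solConst d S.K * S.tot * ∑ c ∈ Ψ.image fun x => S.cc x.1 x.2, F c := by
          rw [Finset.sum_image hinj, Finset.mul_sum]
      _ ≤ solConst d S.K * S.tot * ∑ c ∈ box, F c := by
          refine mul_le_mul_of_nonneg_left
            (Finset.sum_le_sum_of_subset_of_nonneg ?_ fun _ _ _ => hF0 _) (by positivity)
          intro c hc
          obtain ⟨x, hx, rfl⟩ := Finset.mem_image.1 hc
          obtain ⟨n, hn, rfl⟩ := Finset.mem_image.1 hx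
          rw [hbox, Fintype.mem_piFinset]
          intro l
          rw [Finset.mem_Icc, ← abs_le]
          have h1 := hcc n (hB'mem n hn).1 l
          have h2 : ((S.cc (f n) (g n) l).natAbs : ℝ) ≤ h l := by
            rw [Nat.cast_natAbs]; push_cast; exact h1
          have h3 := Nat.le_floor h2
          rw [Int.abs_eq_natAbs]
          exact_mod_cast h3
      _ ≤ W := by rw [hW]; gcongr
  have hcov : B ⊆ (Finset.univ : Finset (Fin d × Fin d)).biUnion fun x =>
      B.filter fun n => ii n = x.1 ∧ jj n = x.2 := by
    intro n hn
    rw [Finset.mem_biUnion]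
    exact ⟨(ii n, jj n), Finset.mem_univ _, Finset.mem_filter.2 ⟨hn, rfl, rfl⟩⟩
  have hW0 : 0 ≤ W := by positivity
  have h1 : (B.card : ℝ) ≤ d ^ 2 * W := by
    calc (B.card : ℝ) ≤ ∑ x : Fin d × Fin d,
          ((B.filter fun n => ii n = x.1 ∧ jj n = x.2).card : ℝ) := by
          exact_mod_cast (Finset.card_le_card hcov).trans Finset.card_biUnion_le
      _ ≤ ∑ x : Fin d × Fin d, W := Finset.sum_le_sum fun x _ => by
          by_cases hne : x.1 = x.2
          · rw [Finset.filter_eq_empty_iff.2]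
            · simpa using hW0
            · rintro n hn ⟨e1, e2⟩
              exact (hij n hn).1 (by rw [e1, e2, hne])
          · exact hpair _ _ hne
      _ = _ := by
          rw [Finset.sum_const, Finset.card_univ, Fintype.card_prod, Fintype.card_fin, nsmul_eq_mul]
          push_cast; ring
  -- `E` cancels against `v`; what remains is `A ^ (d - 1) / δ ≤ A / δ`, because `d ≥ 2` and `A ≤
  -- 1`.
  have h2 : A ^ d * S.E * (1 / v + S.zc) ≤ (1 / famConst d S.K + 3 * d.factorial / famConst d S.K ^ 2)
      * (A / S.δ + S.lmax / S.δ ^ 2) := by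
    have e0 : A ^ d ≤ A ^ 2 := pow_le_pow_of_le_one hA.le hA1 S.two_le
    have e1 : A ^ d * S.E * (1 / v) ≤ 1 / famConst d S.K * (A / S.δ) := by
      calc A ^ d * S.E * (1 / v) ≤ A ^ 2 * S.E * (1 / v) := by gcongr
        _ = 1 / redConst d * (1 / famConst d S.K * (A / S.δ)) := by rw [hv]; field_simp
        _ ≤ 1 * (1 / famConst d S.K * (A / S.δ)) := by
            gcongr
            rw [div_le_one hC]; exact hC1
        _ = _ := one_mul _
    have e2 : A ^ d * S.E * S.zc ≤ 3 * d.factorial / famConst d S.K ^ 2 * (S.lmax / S.δ ^ 2) := by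
      calc A ^ d * S.E * S.zc ≤ 1 * S.E * S.zc := by
            gcongr; exact pow_le_one₀ hA.le hA1
        _ = _ := by unfold zc; field_simp
    rw [mul_add]
    refine (add_le_add e1 e2).trans ?_
    have e3 : 0 < 1 / famConst d S.K := by positivity
    have e4 : 0 < 3 * d.factorial / famConst d S.K ^ 2 := by positivity
    have e5 : 0 < A / S.δ := by positivity
    have e6 : 0 < S.lmax / S.δ ^ 2 := by positivity
    nlinarith [mul_pos e3 e6, mul_pos e4 e5]
  refine h1.trans ?_
  calc d ^ 2 * W = d ^ 2 * (solConst d S.K * S.tot * 4 ^ d) * ((∏ l, h l) * (1 / v + S.zc)) := by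
        rw [hW]; ring
    _ ≤ d ^ 2 * (solConst d S.K * S.tot * 4 ^ d) *
        ((redConst d ^ d * (3 * d.factorial) * (A ^ d * S.E)) * (1 / v + S.zc)) := by gcongr
    _ = d ^ 2 * (solConst d S.K * S.tot * 4 ^ d) * (redConst d ^ d * (3 * d.factorial)) *
        (A ^ d * S.E * (1 / v + S.zc)) := by ring
    _ ≤ d ^ 2 * (solConst d S.K * S.tot * 4 ^ d) * (redConst d ^ d * (3 * d.factorial)) *
        ((1 / famConst d S.K + 3 * d.factorial / famConst d S.K ^ 2)
          * (A / S.δ + S.lmax / S.δ ^ 2)) := by gcongr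
    _ = _ := by unfold cubeConst; ring

end StepData
end WeightedSingular
end

/-! ### Candidates that fail to avoid a box. -/

noncomputable section
namespace WeightedSingular
open Matrix

/-- No nonzero vector `a` with `Q ∣ a · P` lies in the box with half sides `s`. -/
def Avoid {d : ℕ} (P : Fin d → ℤ) (Q : ℤ) (s : Fin d → ℝ) : Prop :=
  ∀ a ∈ annLattice P Q, a ≠ 0 → ∃ i, s i < |(a i : ℝ)|

theorem Avoid.mono {d : ℕ} {P : Fin d → ℤ} {Q : ℤ} {s s' : Fin d → ℝ} (h : Avoid P Q s)
    (hs : ∀ i, s' i ≤ s i) : Avoid P Q s' := fun a ha ha0 =>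
  (h a ha ha0).imp fun i hi => (hs i).trans_lt hi

theorem Avoid.le_wnorm {d : ℕ} {P : Fin d → ℤ} {Q : ℤ} {T s : Fin d → ℝ} (hT : ∀ i, 0 < T i)
    (h : Avoid P Q s) {A : ℝ} (hA : ∀ i, A ≤ T i * s i) {a : Fin d → ℤ} (ha : a ∈ annLattice P Q)
    (ha0 : a ≠ 0) : A ≤ wnorm T a := by
  obtain ⟨i, hi⟩ := h a ha ha0
  exact (hA i).trans ((mul_le_mul_of_nonneg_left hi.le (hT i).le).trans (coord_le_wnorm hT a i))

namespace StepData
variable {d : ℕ} (S : StepData d)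

theorem exists_of_not_avoid {n : Option (Fin d) → ℤ} (hn : n ∈ S.Ω) {s : Fin d → ℝ}
    (h : ¬ Avoid (S.num n) (S.den n) fun i => s i / S.T i) :
    ∃ a b, IsCoprimeVec a b ∧ a ≠ 0 ∧ (∀ i, S.T i * |(a i : ℝ)| ≤ s i) ∧ n ∈ S.sol a b := by
  unfold Avoid at h
  push Not at h
  obtain ⟨a, ⟨b, hb⟩, ha0, ha⟩ := h
  obtain ⟨g, a', b', hg, rfl, rfl, hab⟩ := exists_coprimeVec a b (Or.inl ha0)
  have hg' : (1 : ℝ) ≤ g := by exact_mod_cast hg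
  refine ⟨a', b', hab, fun h => ha0 (by rw [h, smul_zero]), fun i => ?_, ?_⟩
  · have h1 := ha i
    rw [le_div_iff₀ (S.T_pos i)] at h1
    refine le_trans ?_ h1
    simp only [Pi.smul_apply, smul_eq_mul]
    push_cast
    rw [abs_mul, abs_of_pos (by linarith : (0 : ℝ) < g), mul_comm]
    have h2 := abs_nonneg (a' i : ℝ)
    exact mul_le_mul_of_nonneg_right (by nlinarith) (S.T_pos i).le
  · rw [sol, Finset.mem_filter]
    refine ⟨hn, ?_⟩
    rw [smul_dotProduct, smul_eq_mul] at hb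
    refine mul_left_cancel₀ hg.ne' ?_
    rw [hb]; ring

theorem le_wnorm_of_avoid {n : Option (Fin d) → ℤ} {A : ℝ}
    (h : Avoid (S.num n) (S.den n) fun i => A / S.T i) {a : Fin d → ℤ} {b : ℤ} (ha0 : a ≠ 0)
    (hab : n ∈ S.sol a b) : A ≤ wnorm S.T a := by
  rw [sol, Finset.mem_filter] at hab
  exact h.le_wnorm S.T_pos (fun i => by rw [mul_div_cancel₀ _ (S.T_pos i).ne'])
    ⟨b, by rw [hab.2, mul_comm]⟩ ha0

/-- The candidates that do not avoid a box. -/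
def bad (s : Fin d → ℝ) : Finset (Option (Fin d) → ℤ) := by
  classical exact S.Ω.filter fun n => ¬ Avoid (S.num n) (S.den n) fun i => s i / S.T i

theorem mem_bad {s : Fin d → ℝ} {n : Option (Fin d) → ℤ} :
    n ∈ S.bad s ↔ n ∈ S.Ω ∧ ¬ Avoid (S.num n) (S.den n) fun i => s i / S.T i := by
  classical
  unfold bad; exact Finset.mem_filter

theorem card_bad_cube {A : ℝ} (hA : 0 < A) (hA1 : A ≤ 1) (hlA : S.lmax ≤ A)
    (hdδA : d * S.δ * A < 1) :
    ((S.bad fun _ => A).card : ℝ) ≤ cubeConst d S.K * S.tot * (A / S.δ + S.lmax / S.δ ^ 2) := by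
  refine S.card_le_cube hA hA1 hlA hdδA _ fun n hn => ?_
  obtain ⟨h1, h2⟩ := S.mem_bad.1 hn
  obtain ⟨a, b, h3, h4, h5, h6⟩ := S.exists_of_not_avoid h1 h2
  exact ⟨a, b, h3, h4, (wnorm_le_iff S.T_pos hA.le).2 h5, h6⟩

/-- All normals in the box have norm at most `c`, so `d δ c < 1` forces the hyperplanes to pass
through `P / Q`. -/
theorem card_bad_sdiff_thin {A : ℝ} (hA : 0 < A) {H : Matrix (Fin d) (Fin d) ℤ} (hH : H.det ≠ 0)
    (hmem : ∀ i, H i ∈ annLattice S.P S.Q) {s η : Fin d → ℝ} {c : ℝ} (hc : 0 ≤ c)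
    (hη : ∀ j i, S.T i * |(H j i : ℝ)| ≤ η i) (hs : ∀ i, s i ≤ η i) (hsc : ∀ i, s i ≤ c)
    (hdδ : d * S.δ * c < 1) :
    ((S.bad s \ S.bad fun _ => A).card : ℝ) ≤ boxConst d * hypConst d S.K * S.tot * (∏ i, η i)
      * (1 / (S.δ * A) + S.lmax / S.δ ^ 2) := by
  refine S.card_le_thin hH hmem hη hA _ fun n hn => ?_
  rw [Finset.mem_sdiff, mem_bad, mem_bad] at hn
  obtain ⟨⟨h1, h2⟩, h0⟩ := hn
  have h0 : Avoid (S.num n) (S.den n) fun i => A / S.T i := by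
    by_contra h; exact h0 ⟨h1, h⟩
  obtain ⟨a, b, h3, h4, h5, h6⟩ := S.exists_of_not_avoid h1 h2
  refine ⟨a, b, h3, h4, fun i => (h5 i).trans (hs i), ?_, S.le_wnorm_of_avoid h0 h4 h6, h6⟩
  have h7 : wnorm S.T a ≤ c := (wnorm_le_iff S.T_pos hc).2 fun i => (h5 i).trans (hsc i)
  have h8 : |(S.kk a b : ℝ)| < 1 := ((S.abs_kk_le h6).trans (mul_le_mul_of_nonneg_left h7
    (mul_nonneg S.d_pos.le S.δ_pos.le))).trans_lt hdδ
  rw [← Int.abs_lt_one_iff]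
  exact_mod_cast h8

/-- Three kinds of hyperplanes occur. Those through `P / Q` with normal shorter than `1 / (d δ)` lie
in the truncated box `η`; those through `P / Q` with longer normal gain from their length; for the
others `kk ≠ 0`, which forces the norm to be at least `1 / (d δ)`. -/
theorem card_bad_sdiff_big {A : ℝ} (hA : 0 < A) {H : Matrix (Fin d) (Fin d) ℤ} (hH : H.det ≠ 0)
    (hmem : ∀ i, H i ∈ annLattice S.P S.Q) {s η : Fin d → ℝ} (m : Fin d)
    (hs : ∀ j i, S.T i * |(H j i : ℝ)| ≤ s i) (hHm : ∀ j, S.T m * |(H j m : ℝ)| ≤ 1)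
    (hsm : ∀ i, s i ≤ s m) (hdδ : d * S.δ ≤ 1)
    (hη : ∀ j i, S.T i * |(H j i : ℝ)| ≤ η i) (hsη : ∀ i, min (s i) (1 / (d * S.δ)) ≤ η i)
    (hbig : s m ≤ S.E * S.lmin) (hd2 : d = 2 ∨ d * s m ≤ famConst d S.K * S.E * S.lmin) :
    ((S.bad s \ S.bad fun _ => A).card : ℝ) ≤ boxConst d * hypConst d S.K * S.tot *
      ((∏ i, η i) * (1 / (S.δ * A) + S.lmax / S.δ ^ 2)
        + (∏ i, s i) * (41 * d + S.lmax / S.δ ^ 2)) := by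
  classical
  set B := S.bad s \ S.bad fun _ => A with hB
  have hd := S.d_pos
  have hδ := S.δ_pos
  set B₁ := B.filter fun n => ∃ a b, IsCoprimeVec a b ∧ a ≠ 0 ∧ (∀ i, S.T i * |(a i : ℝ)| ≤ η i) ∧
      S.kk a b = 0 ∧ A ≤ wnorm S.T a ∧ n ∈ S.sol a b with hB₁
  set B₂ := B.filter fun n => ∃ a b, IsCoprimeVec a b ∧ a ≠ 0 ∧ (∀ i, S.T i * |(a i : ℝ)| ≤ s i) ∧
      S.kk a b = 0 ∧ 1 / (d * S.δ) ≤ wnorm S.T a ∧ n ∈ S.sol a b with hB₂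
  set B₃ := B.filter fun n => ∃ a b, IsCoprimeVec a b ∧ a ≠ 0 ∧ (∀ i, S.T i * |(a i : ℝ)| ≤ s i) ∧
      S.kk a b ≠ 0 ∧ 1 ≤ d * S.δ * wnorm S.T a ∧ n ∈ S.sol a b with hB₃
  have hsub : B ⊆ B₁ ∪ (B₂ ∪ B₃) := by
    intro n hn
    have hn' := hn
    rw [hB, Finset.mem_sdiff, mem_bad, mem_bad] at hn
    obtain ⟨⟨h1, h2⟩, h0⟩ := hn
    have h0 : Avoid (S.num n) (S.den n) fun i => A / S.T i := by
      by_contra h; exact h0 ⟨h1, h⟩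
    obtain ⟨a, b, h3, h4, h5, h6⟩ := S.exists_of_not_avoid h1 h2
    simp only [Finset.mem_union]
    by_cases hk : S.kk a b = 0
    · rcases lt_or_ge (wnorm S.T a) (1 / (d * S.δ)) with h | h
      · left
        rw [hB₁, Finset.mem_filter]
        exact ⟨hn', a, b, h3, h4, fun i => (le_min (h5 i) ((coord_le_wnorm S.T_pos a i).trans
          h.le)).trans (hsη i), hk, S.le_wnorm_of_avoid h0 h4 h6, h6⟩
      · right; left
        rw [hB₂, Finset.mem_filter]
        exact ⟨hn', a, b, h3, h4, h5, hk, h, h6⟩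
    · right; right
      rw [hB₃, Finset.mem_filter]
      refine ⟨hn', a, b, h3, h4, h5, hk, ?_, h6⟩
      refine le_trans ?_ (S.abs_kk_le h6)
      exact_mod_cast Int.one_le_abs hk
  have e1 := S.card_le_thin hH hmem hη hA B₁ fun n hn => (Finset.mem_filter.1 hn).2
  have e2 := S.card_le_thin hH hmem hs (A := 1 / (d * S.δ)) (by positivity) B₂
    fun n hn => (Finset.mem_filter.1 hn).2
  have e3 := S.card_le_big_of_kk_ne hH hmem m hs hHm hsm hdδ hbig hd2 B₃
    fun n hn => (Finset.mem_filter.1 hn).2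
  have e4 : (B.card : ℝ) ≤ B₁.card + (B₂.card + B₃.card) := by
    have := (Finset.card_le_card hsub).trans ((Finset.card_union_le _ _).trans
      (Nat.add_le_add_left (Finset.card_union_le _ _) _))
    exact_mod_cast this
  -- The long normals through `P / Q` contribute `d`, the hyperplanes off `P / Q` contribute `40 d`,
  -- whence `41 d`.
  have e5 : 1 / (S.δ * (1 / (d * S.δ))) = d := by field_simp
  rw [e5] at e2
  refine e4.trans ((add_le_add e1 (add_le_add e2 e3)).trans (le_of_eq ?_))
  ring

end StepData
end WeightedSingular
end

/-! ### Short independent vectors, the size of the family, and the arithmetic of weights. -/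

noncomputable section
namespace WeightedSingular
open Matrix

/-- If no nonzero lattice vector is short, Minkowski's second theorem prevents the reduced vectors
from being long. -/
theorem exists_frame {d : ℕ} {P : Fin d → ℤ} {Q : ℤ} (hQ : 0 < Q) {T s : Fin d → ℝ}
    (hT : ∀ i, 0 < T i) (hQT : Q * ∏ i, T i ≤ 1) (hs : Avoid P Q s) {A : ℝ} (hA : 0 < A)
    (hAs : ∀ i, A ≤ T i * s i) :
    ∃ H : Matrix (Fin d) (Fin d) ℤ, H.det ≠ 0 ∧ (∀ j, H j ∈ annLattice P Q) ∧
      ∀ j i, T i * |(H j i : ℝ)| ≤ d ^ d / A ^ (d - 1) := by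
  obtain ⟨H, hH⟩ := exists_isReduced P Q hQ T hT
  refine ⟨H, hH.det_ne_zero, hH.mem, fun j i => (coord_le_wnorm hT (H j) i).trans ?_⟩
  refine (hH.wnorm_le hQ hT hA (fun a ha ha0 => hs.le_wnorm hT hAs ha ha0) j).trans ?_
  gcongr
  exact mul_le_of_le_one_right (by positivity) hQT

namespace StepData
variable {d : ℕ} (S : StepData d)

theorem num_den_injective : Function.Injective fun n => (S.num n, S.den n) := by
  intro n n' h
  simp only [Prod.mk.injEq] at h
  obtain ⟨h1, h2⟩ := h
  have hj : ∀ j, n (some j) = n' (some j) := fun j => by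
    obtain ⟨b, hb⟩ := S.reduced.mem j
    have e1 := S.row_eval n hb
    rw [h1, h2, S.row_eval n' hb] at e1
    exact (mul_right_cancel₀ (mul_ne_zero S.L_pos.ne' (S.dual.N_ne_zero S.reduced)) e1).symm
  funext l
  cases l with
  | some j => exact hj j
  | none =>
    unfold den at h2
    simp only [hj] at h2
    exact mul_right_cancel₀ S.Q_pos.ne' (add_left_cancel h2)

/-- `∏ R j` is at least `(famConst δ E)^d` times the product of the reduced lengths. That product is
at least `1 / (3 d! E)`, and the lost factor `E` is restored by `M ≥ E / (20 L)`. -/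
theorem tot_ge : famConst d S.K ^ d / (60 * d.factorial * S.K.factorial) * S.δ ^ d * S.E ^ d
    ≤ S.tot := by
  have hL := S.L_pos'
  have hE := S.E_pos
  have hδ := S.δ_pos
  have hc := S.famConst_pos
  have h1 : ∏ j, (famConst d S.K * S.δ * S.E * wnorm S.T (S.G j)) ≤ ∏ j, (S.R j : ℝ) :=
    Finset.prod_le_prod (fun j _ => by have := S.lam_pos j; positivity) fun j _ => S.le_R j
  rw [Finset.prod_mul_distrib, Finset.prod_const, Finset.card_univ, Fintype.card_fin] at h1
  have h2 : S.E / (20 * S.L) ≤ S.M := by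
    rw [div_le_iff₀ (by positivity)]; linarith [S.E_le_M]
  have h3 := S.prod_lam_ge
  have h4 : 1 / (3 * d.factorial) ≤ S.E * ∏ j, wnorm S.T (S.G j) := by
    rw [div_le_iff₀ (by positivity)]; linarith
  have h5 : 0 ≤ ∏ j, wnorm S.T (S.G j) := Finset.prod_nonneg fun j _ => (S.lam_pos j).le
  unfold tot
  refine le_trans ?_ (mul_le_mul h1 h2 (by positivity) (by exact le_trans (by positivity) h1))
  rw [← cast_L]
  calc famConst d S.K ^ d / (60 * d.factorial * S.L) * S.δ ^ d * S.E ^ d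
      = (famConst d S.K * S.δ * S.E) ^ d * (1 / (3 * d.factorial)) / (20 * S.L) := by
        field_simp; ring
    _ ≤ (famConst d S.K * S.δ * S.E) ^ d * (S.E * ∏ j, wnorm S.T (S.G j)) / (20 * S.L) := by
        gcongr
    _ = _ := by ring

end StepData

/-- Weights `w` whose largest value `ω` is taken exactly at the first `ℓ` indices. -/
structure IsWeight {d : ℕ} (ℓ : ℕ) (w : Fin d → ℝ) (ω : ℝ) : Prop where
  one_le : 1 ≤ ℓ
  lt_dim : ℓ < d
  pos : ∀ i, 0 < w i
  sum_eq : ∑ i, w i = 1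
  anti : Antitone w
  eq_top : ∀ i : Fin d, i.val < ℓ → w i = ω
  lt_top : ∀ i : Fin d, ℓ ≤ i.val → w i < ω

/-- The contraction rate of the flow `b` in the first `ℓ` coordinates. -/
def theta {d : ℕ} (ℓ : ℕ) (w : Fin d → ℝ) : ℝ := 1 / (ℓ : ℝ) * ∑ j : Fin d with ℓ ≤ j.val, w j

/-- The exponents of the flow `b` at time `u`. -/
def bet {d : ℕ} (ℓ : ℕ) (w : Fin d → ℝ) (u : ℝ) (i : Fin d) : ℝ :=
  if i.val < ℓ then -(theta ℓ w * u) else w i * u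

namespace IsWeight
variable {d ℓ : ℕ} {w : Fin d → ℝ} {ω : ℝ}

theorem ell_pos (h : IsWeight ℓ w ω) : (0 : ℝ) < ℓ := by
  have := h.one_le; positivity

theorem two_le (h : IsWeight ℓ w ω) : 2 ≤ d := by
  have := h.one_le; have := h.lt_dim; omega

/-- The first index. -/
def i₀ (h : IsWeight ℓ w ω) : Fin d := ⟨0, by have := h.lt_dim; omega⟩

/-- The first index at which the weight is not maximal. -/
def i₁ (h : IsWeight ℓ w ω) : Fin d := ⟨ℓ, h.lt_dim⟩

theorem i₁_not_lt (h : IsWeight ℓ w ω) : ¬ (h.i₁.val < ℓ) := by simp [i₁]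

theorem i₀_lt (h : IsWeight ℓ w ω) : h.i₀.val < ℓ := h.one_le

theorem w_i₀ (h : IsWeight ℓ w ω) : w h.i₀ = ω := h.eq_top _ h.one_le

theorem omega_pos (h : IsWeight ℓ w ω) : 0 < ω := h.w_i₀ ▸ h.pos _

theorem le_omega (h : IsWeight ℓ w ω) (i : Fin d) : w i ≤ ω := by
  rcases lt_or_ge i.val ℓ with h1 | h1
  · exact (h.eq_top i h1).le
  · exact (h.lt_top i h1).le

theorem add_le_one (h : IsWeight ℓ w ω) {i j : Fin d} (hij : i ≠ j) : w i + w j ≤ 1 := by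
  rw [← h.sum_eq, ← Finset.sum_pair hij]
  exact Finset.sum_le_sum_of_subset_of_nonneg (Finset.subset_univ _) fun k _ _ => (h.pos k).le

theorem add_lt_one (h : IsWeight ℓ w ω) (hd : 2 < d) {i j : Fin d} (hij : i ≠ j) :
    w i + w j < 1 := by
  obtain ⟨k, hk⟩ : ∃ k : Fin d, k ∉ ({i, j} : Finset (Fin d)) := by
    by_contra! hc
    have h1 := Finset.card_le_card (fun x _ => hc x : Finset.univ ⊆ ({i, j} : Finset (Fin d)))
    have h2 := Finset.card_le_two (a := i) (b := j)
    rw [Finset.card_univ, Fintype.card_fin] at h1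
    omega
  rw [← h.sum_eq, ← Finset.sum_pair hij]
  exact Finset.sum_lt_sum_of_subset (Finset.subset_univ _) (Finset.mem_univ k) hk (h.pos k)
    fun k _ _ => (h.pos k).le

theorem ne_of_lt_of_ge {i j : Fin d} (hi : i.val < ℓ) (hj : ¬ j.val < ℓ) : i ≠ j := by
  rintro rfl; exact hj hi

theorem omega_lt_one (h : IsWeight ℓ w ω) : ω < 1 := by
  have := h.add_le_one (ne_of_lt_of_ge h.i₀_lt h.i₁_not_lt)
  rw [h.w_i₀] at this
  linarith [h.pos h.i₁]

theorem theta_pos (h : IsWeight ℓ w ω) : 0 < theta ℓ w := by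
  have := h.ell_pos
  refine mul_pos (by positivity) (Finset.sum_pos (fun i _ => h.pos i) ⟨h.i₁, ?_⟩)
  simp [i₁]

theorem card_lt (h : IsWeight ℓ w ω) : (Finset.univ.filter fun i : Fin d => i.val < ℓ).card = ℓ := by
  rw [Fin.card_filter_val_lt]; exact min_eq_right h.lt_dim.le

theorem sum_ge (h : IsWeight ℓ w ω) : ∑ j : Fin d with ℓ ≤ j.val, w j = ℓ * theta ℓ w := by
  have := h.ell_pos
  unfold theta; field_simp

theorem filter_not_lt : (Finset.univ.filter fun i : Fin d => ¬ i.val < ℓ) =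
    Finset.univ.filter fun i : Fin d => ℓ ≤ i.val := Finset.filter_congr fun i _ => by simp

theorem theta_eq (h : IsWeight ℓ w ω) : ℓ * theta ℓ w = 1 - ℓ * ω := by
  have h1 := Finset.sum_filter_add_sum_filter_not Finset.univ (fun i : Fin d => i.val < ℓ) w
  rw [filter_not_lt, h.sum_ge, h.sum_eq, Finset.sum_congr rfl fun i hi =>
    h.eq_top i (Finset.mem_filter.1 hi).2, Finset.sum_const, h.card_lt, nsmul_eq_mul] at h1
  linarith

theorem theta_lt_one (h : IsWeight ℓ w ω) : theta ℓ w < 1 := by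
  have h1 := h.theta_eq
  have h2 := h.omega_pos
  have h3 : (1 : ℝ) ≤ ℓ := by exact_mod_cast h.one_le
  have h4 := h.theta_pos
  nlinarith

/-- The flow `b` preserves volume, so the boxes of all scales have the same volume `r^d` in
normalised coordinates. -/
theorem sum_bet (h : IsWeight ℓ w ω) (u : ℝ) : ∑ i, bet ℓ w u i = 0 := by
  unfold bet
  rw [Finset.sum_ite, filter_not_lt, Finset.sum_const, h.card_lt, ← Finset.sum_mul, h.sum_ge,
    nsmul_eq_mul]
  ring

/-- The excess of expansion over contraction in the first coordinates. -/
theorem theta_lt_mul_xi (h : IsWeight ℓ w ω) : theta ℓ w < ω * xi d ℓ := by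
  have h0 := h.ell_pos
  have h1 : ℓ * theta ℓ w < (d - ℓ) * ω := by
    rw [← h.sum_ge]
    have h2 : ∑ j : Fin d with ℓ ≤ j.val, w j < ∑ j : Fin d with ℓ ≤ j.val, ω :=
      Finset.sum_lt_sum_of_nonempty ⟨h.i₁, by simp [i₁]⟩ fun i hi =>
        h.lt_top i (Finset.mem_filter.1 hi).2
    refine h2.trans_eq ?_
    have h3 := Finset.card_filter_add_card_filter_not (s := (Finset.univ : Finset (Fin d))) (fun i : Fin d => i.val < ℓ)
    rw [h.card_lt, filter_not_lt, Finset.card_univ, Fintype.card_fin] at h3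
    rw [Finset.sum_const, nsmul_eq_mul]
    have h4 : (ℓ : ℝ) + (Finset.univ.filter fun i : Fin d => ℓ ≤ i.val).card = d := by
      exact_mod_cast h3
    rw [← h4]; ring
  have h2 : ((d : ℝ) - ℓ) / ℓ ≤ xi d ℓ := le_max_right _ _
  refine lt_of_lt_of_le ?_ (mul_le_mul_of_nonneg_left h2 h.omega_pos.le)
  rw [mul_div_assoc', lt_div_iff₀ h0]
  linarith

end IsWeight
end WeightedSingular
end

/-! ### Conditions on a vertex and on the parameters of one step. -/

noncomputable section
namespace WeightedSingular
open Matrix Real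

/-- The conditions on a rational vector `P / Q` at time `t` that allow to continue the
construction for the duration `D`. -/
structure Good {d : ℕ} (ℓ : ℕ) (w : Fin d → ℝ) (ω r t δ u D : ℝ) (P : Fin d → ℤ) (Q : ℤ) :
    Prop where
  Q_pos : 0 < Q
  coprime : IsCoprimeVec P Q
  le_Q : exp t ≤ 3 * Q
  Q_le : (Q : ℝ) ≤ exp t
  -- The first box gives the `𝒦*` condition with `η = δ²`. The second, at scale `u`, bounds the
  -- number of vertices in a cell and prepares the next scale. The third becomes, in the coordinates
  -- of time `t + D`, a cube of half side `r e^{-ωD}`: it bounds the reduced vectors of the next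
  -- step from below.
  avoid_cube : Avoid P Q fun i => δ ^ 2 * exp (w i * t)
  avoid_scale : Avoid P Q fun i => r * exp (w i * t + bet ℓ w u i)
  avoid_next : Avoid P Q fun i => r * exp (w i * t - (ω - w i) * D)

theorem Good.mono {d ℓ : ℕ} {w : Fin d → ℝ} {ω r t δ δ' u D : ℝ} {P : Fin d → ℤ} {Q : ℤ}
    (h : Good ℓ w ω r t δ u D P Q) (h0 : 0 ≤ δ') (hδ : δ' ≤ δ) : Good ℓ w ω r t δ' u D P Q :=
  { h with avoid_cube := h.avoid_cube.mono fun i => by gcongr }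

/-- Bound for the successive minima of the lattice of a vertex. -/
def rho (d : ℕ) (δ : ℝ) : ℝ := d ^ d / (δ ^ 2) ^ (d - 1)

theorem one_le_rho {d : ℕ} (hd : 2 ≤ d) {δ : ℝ} (hδ : 0 < δ) (hδ1 : δ ≤ 1) : 1 ≤ rho d δ := by
  unfold rho
  rw [le_div_iff₀ (by positivity), one_mul]
  have h1 : (δ ^ 2) ^ (d - 1) ≤ 1 := pow_le_one₀ (by positivity) (pow_le_one₀ hδ.le hδ1)
  have h2 : (1 : ℝ) ≤ d := by exact_mod_cast (by omega : 1 ≤ d)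
  exact h1.trans (one_le_pow₀ h2)

/-- The comparison of the exponents of a scale `y`, with `y'` the scale at which the previous
vertex is controlled. -/
structure ScaleCond {d : ℕ} (ℓ : ℕ) (w : Fin d → ℝ) (ω D x y y' : ℝ) : Prop where
  le_theta : x ≤ theta ℓ w * y
  le_w : ∀ i : Fin d, ¬ i.val < ℓ → x ≤ w i * y
  le_dur : y ≤ D
  -- In the first coordinates a frame adapted to the scale `y'` shrinks by `e^{-ωD}` during the
  -- step, while the box of scale `y` is smaller than that of scale `y'` by `e^{-θ(y - y')}` only.
  le_diff : x ≤ ω * D - theta ℓ w * (y - y')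

/-- The comparison of the exponents in one step of the construction. -/
structure StepExponents {d : ℕ} (ℓ : ℕ) (w : Fin d → ℝ) (ω D D' x : ℝ) : Prop where
  nonneg : 0 ≤ x
  le_dur : x ≤ D
  le_w : ∀ i, x ≤ w i * D
  le_one_sub : x ≤ (1 - ω) * D
  le_gap : ∀ i : Fin d, ¬ i.val < ℓ → x ≤ (ω - w i) * D'
  -- For `d = 2` one has `1 - ω - w_2 = 0`, so no such gap exists; the counting does not need it
  -- there.
  le_two : 2 < d → ∀ i : Fin d, ¬ i.val < ℓ → x ≤ (1 - ω - w i) * D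

/-- The smallness of the parameters in one step of the construction. -/
structure StepSmall (d K : ℕ) (δ r z : ℝ) : Prop where
  δ_pos : 0 < δ
  δ_le : d * δ ≤ 1
  r_pos : 0 < r
  dr_lt : d * r ≤ 1
  K_ge : redConst d ≤ K
  six_div : 6 / (K : ℝ) ≤ 1 / 16
  cube : cubeConst d K * δ ≤ 1 / 16
  hyp : boxConst d * hypConst d K * (r ^ d * (42 * d)) ≤ 1 / 32
  lmax : rho d δ * z * (10 * d ^ 2) ≤ 1
  lmin : z ≤ famConst d K * δ * r
  fact : 60 * K.factorial * z ≤ 1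
  sq : rho d δ * z ≤ δ ^ 2
  scale : rho d δ * z ≤ r
  scale' : d ^ d / r ^ (d - 1) * z ≤ r
  fam : d * z ≤ famConst d K
  cube' : cubeConst d K * (rho d δ * z / δ ^ 2) ≤ 1 / 16
  thin : boxConst d * hypConst d K * (rho d δ ^ (d + 1) * z * (2 / δ ^ 3)) ≤ 1 / 16
  thin' : boxConst d * hypConst d K * (z * (1 / δ) ^ d * (2 / δ ^ 3)) ≤ 1 / 32

theorem prod_le_mul_pow {d : ℕ} {f : Fin d → ℝ} (hf : ∀ i, 0 ≤ f i) {B c : ℝ} (hB : 1 ≤ B)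
    (h : ∀ i, f i ≤ B) (i : Fin d) (hi : f i ≤ c) : ∏ j, f j ≤ c * B ^ d := by
  rw [← Finset.mul_prod_erase _ _ (Finset.mem_univ i)]
  have h1 : ∏ j ∈ Finset.univ.erase i, f j ≤ B ^ d := by
    refine (Finset.prod_le_prod (fun j _ => hf j) fun j _ => h j).trans ?_
    rw [Finset.prod_const]
    refine pow_le_pow_right₀ hB ((Finset.card_le_univ _).trans ?_)
    simp
  exact mul_le_mul hi h1 (Finset.prod_nonneg fun j _ => hf j) ((hf i).trans hi)

namespace StepData
variable {d : ℕ} (S : StepData d)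

theorem one_div_add_le (h : S.lmax ≤ S.δ ^ 2) :
    1 / (S.δ * S.δ ^ 2) + S.lmax / S.δ ^ 2 ≤ 2 / S.δ ^ 3 := by
  have hδ := S.δ_pos
  have h1 : S.lmax / S.δ ^ 2 ≤ 1 := (div_le_one (by positivity)).2 h
  have h2 : 1 ≤ 1 / S.δ ^ 3 := (one_le_div (by positivity)).2 (pow_le_one₀ hδ.le S.δ_le)
  have h3 : S.δ * S.δ ^ 2 = S.δ ^ 3 := by ring
  have h4 : 2 / S.δ ^ 3 = 1 / S.δ ^ 3 + 1 / S.δ ^ 3 := by ring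
  rw [h3, h4]; linarith

/-- Since the exponents `bet` sum to zero the box has volume `r^d`, which gives the main term. For
short normals through `P / Q` only the truncated box counts; its first side is at most `z`, so that
term is negligible. -/
theorem card_bad_scale {ℓ : ℕ} {w : Fin d → ℝ} {ω : ℝ} (hw : IsWeight ℓ w ω) {r y z : ℝ}
    (hr : 0 < r) (hr1 : r ≤ 1) (hy : 0 ≤ y) {H : Matrix (Fin d) (Fin d) ℤ} (hH : H.det ≠ 0)
    (hmem : ∀ i, H i ∈ annLattice S.P S.Q)
    (h0 : ∀ j (i : Fin d), i.val < ℓ → S.T i * |(H j i : ℝ)| ≤ r * exp (-(theta ℓ w * y)))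
    (h1 : ∀ j (i : Fin d), ¬ i.val < ℓ → S.T i * |(H j i : ℝ)| ≤ 1)
    (hz : r * exp (-(theta ℓ w * y)) ≤ z) (hr2 : ∀ i : Fin d, ¬ i.val < ℓ → 1 ≤ r * exp (w i * y))
    (hbig : r * exp (w hw.i₁ * y) ≤ S.E * S.lmin)
    (hd2 : d = 2 ∨ d * (r * exp (w hw.i₁ * y)) ≤ famConst d S.K * S.E * S.lmin)
    (hdδ : d * S.δ ≤ 1) (hsq : S.lmax ≤ S.δ ^ 2) :
    ((S.bad (fun i => r * exp (bet ℓ w y i)) \ S.bad fun _ => S.δ ^ 2).card : ℝ) ≤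
      boxConst d * hypConst d S.K * S.tot *
        (z * (1 / S.δ) ^ d * (2 / S.δ ^ 3) + r ^ d * (42 * d)) := by
  have hδ := S.δ_pos
  have hd := S.d_pos
  have hd1 : (1 : ℝ) ≤ d := by linarith [S.two_le_d]
  have hθ := hw.theta_pos
  have hdδ' : 1 ≤ 1 / (d * S.δ) := (one_le_div (by positivity)).2 hdδ
  have hrθ : r * exp (-(theta ℓ w * y)) ≤ 1 := by
    have : exp (-(theta ℓ w * y)) ≤ 1 := exp_le_one_iff.2 (by nlinarith)
    nlinarith [exp_pos (-(theta ℓ w * y))]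
  set η : Fin d → ℝ := fun i => if i.val < ℓ then r * exp (-(theta ℓ w * y)) else 1 / (d * S.δ)
    with hη
  have hs : ∀ i : Fin d, r * exp (bet ℓ w y i) =
      if i.val < ℓ then r * exp (-(theta ℓ w * y)) else r * exp (w i * y) := fun i => by
    unfold bet; split_ifs <;> rfl
  have h2 := S.card_bad_sdiff_big (A := S.δ ^ 2) (by positivity) hH hmem
    (s := fun i => r * exp (bet ℓ w y i)) (η := η) hw.i₁
    (fun j i => by
      simp only [hs]
      split_ifs with h
      · exact h0 j i h
      · exact (h1 j i h).trans (hr2 i h))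
    (fun j => h1 j _ hw.i₁_not_lt)
    (fun i => by
      simp only [hs, if_neg hw.i₁_not_lt]
      split_ifs with h
      · exact hrθ.trans (hr2 _ hw.i₁_not_lt)
      · have h3 : w i ≤ w hw.i₁ := hw.anti (by
          rw [Fin.le_def]; exact not_lt.1 h)
        gcongr)
    hdδ
    (fun j i => by
      simp only [hη]
      split_ifs with h
      · exact h0 j i h
      · exact (h1 j i h).trans hdδ')
    (fun i => by
      simp only [hη, hs]
      split_ifs with h
      · exact min_le_left _ _
      · exact min_le_right _ _)
    (by simp only [hs, if_neg hw.i₁_not_lt]; exact hbig)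
    (by simp only [hs, if_neg hw.i₁_not_lt]; exact hd2)
  refine h2.trans ?_
  have hη0 : ∀ i, 0 ≤ η i := fun i => by
    simp only [hη]; split_ifs <;> positivity
  have h3 : ∏ i, η i ≤ z * (1 / S.δ) ^ d := by
    refine prod_le_mul_pow hη0 ((one_le_div hδ).2 S.δ_le) (fun i => ?_) hw.i₀ ?_
    · simp only [hη]
      split_ifs
      · exact hrθ.trans ((one_le_div hδ).2 S.δ_le)
      · exact one_div_le_one_div_of_le hδ (by nlinarith)
    · simp only [hη, if_pos hw.i₀_lt]; exact hz
  have h4 : ∏ i, r * exp (bet ℓ w y i) = r ^ d := by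
    rw [Finset.prod_mul_distrib, ← exp_sum, hw.sum_bet, exp_zero, mul_one, Finset.prod_const,
      Finset.card_univ, Fintype.card_fin]
  rw [h4]
  have hb := boxConst_pos d
  have hh := S.hypConst_pos
  have ht := S.tot_pos
  have h5 : S.lmax / S.δ ^ 2 ≤ 1 := (div_le_one (by positivity)).2 hsq
  have h6 := S.one_div_add_le hsq
  refine mul_le_mul_of_nonneg_left (add_le_add ?_ ?_) (by positivity)
  · exact mul_le_mul h3 h6 (by have := S.lmax_pos; positivity)
      ((Finset.prod_nonneg fun i _ => hη0 i).trans h3)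
  · exact mul_le_mul_of_nonneg_left (by linarith) (by positivity)

end StepData
end WeightedSingular
end

/-! ### Frames of a good vertex and the data of a step. -/

noncomputable section
namespace WeightedSingular
open Matrix Real

variable {d ℓ : ℕ} {w : Fin d → ℝ} {ω : ℝ}

theorem IsWeight.prod_exp_neg (hw : IsWeight ℓ w ω) (s : ℝ) : ∏ i, exp (-(w i * s)) = exp (-s) := by
  rw [← exp_sum, Finset.sum_neg_distrib, ← Finset.sum_mul, hw.sum_eq, one_mul]

theorem IsWeight.prod_exp_neg_sub (hw : IsWeight ℓ w ω) (s u : ℝ) :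
    ∏ i, exp (-(w i * s) - bet ℓ w u i) = exp (-s) := by
  simp only [sub_eq_add_neg, exp_add]
  rw [Finset.prod_mul_distrib, hw.prod_exp_neg, ← exp_sum, Finset.sum_neg_distrib, hw.sum_bet]
  simp

namespace Good
variable {r t δ u D : ℝ} {P : Fin d → ℤ} {Q : ℤ}

theorem Q_mul_exp_le (hg : Good ℓ w ω r t δ u D P Q) : (Q : ℝ) * exp (-t) ≤ 1 := by
  rw [exp_neg, ← div_eq_mul_inv, div_le_one (exp_pos _)]; exact hg.Q_le

/-- A basis of a sublattice that is small at the time of the vertex. -/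
theorem exists_frame_cube (hw : IsWeight ℓ w ω) (hδ : 0 < δ) (hg : Good ℓ w ω r t δ u D P Q) :
    ∃ H : Matrix (Fin d) (Fin d) ℤ, H.det ≠ 0 ∧ (∀ j, H j ∈ annLattice P Q) ∧
      ∀ j i, ∀ D', exp (-(w i * (t + D'))) * |(H j i : ℝ)| ≤ rho d δ * exp (-(w i * D')) := by
  obtain ⟨H, h1, h2, h3⟩ := exists_frame hg.Q_pos (T := fun i => exp (-(w i * t)))
    (fun i => exp_pos _) (by rw [hw.prod_exp_neg]; exact hg.Q_mul_exp_le) hg.avoid_cube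
    (A := δ ^ 2) (by positivity) (fun i => by
      rw [mul_left_comm, ← exp_add]; simp)
  refine ⟨H, h1, h2, fun j i D' => ?_⟩
  have h4 : exp (-(w i * (t + D'))) = exp (-(w i * t)) * exp (-(w i * D')) := by
    rw [← exp_add]; ring_nf
  have h5 := h3 j i
  rw [h4, mul_right_comm]
  exact mul_le_mul_of_nonneg_right h5 (exp_pos _).le

/-- A basis of a sublattice that is small after applying the flow `b`. -/
theorem exists_frame_scale (hw : IsWeight ℓ w ω) (hr : 0 < r) (hg : Good ℓ w ω r t δ u D P Q) :
    ∃ H : Matrix (Fin d) (Fin d) ℤ, H.det ≠ 0 ∧ (∀ j, H j ∈ annLattice P Q) ∧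
      ∀ j i, ∀ D', exp (-(w i * (t + D'))) * |(H j i : ℝ)|
        ≤ d ^ d / r ^ (d - 1) * exp (bet ℓ w u i - w i * D') := by
  obtain ⟨H, h1, h2, h3⟩ := exists_frame hg.Q_pos (T := fun i => exp (-(w i * t) - bet ℓ w u i))
    (fun i => exp_pos _) (by rw [hw.prod_exp_neg_sub]; exact hg.Q_mul_exp_le) hg.avoid_scale
    (A := r) hr (fun i => by
      rw [mul_left_comm, ← exp_add]; ring_nf; simp)
  refine ⟨H, h1, h2, fun j i D' => ?_⟩
  have h4 : exp (-(w i * (t + D'))) = exp (-(w i * t) - bet ℓ w u i)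
      * exp (bet ℓ w u i - w i * D') := by
    rw [← exp_add]; ring_nf
  have h5 := h3 j i
  rw [h4, mul_right_comm]
  exact mul_le_mul_of_nonneg_right h5 (exp_pos _).le

/-- The lower bound `lmin` for the reduced vectors is `avoid_next`. The upper bound `lmax` comes
from the frame given by `avoid_cube`, contracted by the flow during the time `D`. -/
theorem exists_stepData (hw : IsWeight ℓ w ω) (hg : Good ℓ w ω r t δ u D P Q) {K : ℕ} {x D' : ℝ}
    (hx : StepExponents ℓ w ω D D' x) (hs : StepSmall d K δ r (exp (-x))) :
    ∃ S : StepData d, S.P = P ∧ S.Q = Q ∧ (S.T = fun i => exp (-(w i * (t + D)))) ∧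
      S.X = exp (t + D) ∧ S.E = exp D ∧ S.δ = δ ∧ S.lmin = r * exp (-(ω * D)) ∧
      S.lmax = rho d δ * exp (-x) ∧ S.K = K := by
  set T : Fin d → ℝ := fun i => exp (-(w i * (t + D))) with hTdef
  have hT : ∀ i, 0 < T i := fun i => exp_pos _
  have hd : (2 : ℝ) ≤ d := by exact_mod_cast hw.two_le
  have hδ := hs.δ_pos
  have hδ1 : δ ≤ 1 := by nlinarith [hs.δ_le]
  have hρ := one_le_rho hw.two_le hδ hδ1
  obtain ⟨G, hG⟩ := exists_isReduced P Q hg.Q_pos T hT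
  obtain ⟨N, p, q, hdual⟩ := exists_isDual hg.Q_pos hg.coprime hG.mem hG.det_ne_zero
  obtain ⟨H, hH1, hH2, hH3⟩ := hg.exists_frame_cube hw hδ
  have hc := exp_pos D
  refine ⟨{
    P := P, Q := Q, T := T, X := exp (t + D), E := exp D, δ := δ, lmin := r * exp (-(ω * D)),
    lmax := rho d δ * exp (-x), K := K, G := G, N := N, p := p, q := q
    two_le := hw.two_le
    Q_pos := hg.Q_pos
    coprime := hg.coprime
    T_pos := hT
    X_pos := exp_pos _
    prod_T := by rw [hTdef, hw.prod_exp_neg, exp_neg]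
    Q_mul_le := by
      rw [exp_add]; exact mul_le_mul_of_nonneg_right hg.Q_le hc.le
    le_Q_mul := by
      rw [exp_add]; nlinarith [hg.le_Q]
    reduced := hG
    dual := hdual
    lmin_pos := mul_pos hs.r_pos (exp_pos _)
    lmin_le := fun j => by
      refine hg.avoid_next.le_wnorm hT (fun i => ?_) (hG.mem j) (hG.row_ne_zero j)
      rw [mul_left_comm, ← exp_add]
      ring_nf
      exact le_rfl
    le_lmax := fun j => by
      refine hG.wnorm_le_of_independent hH1 hH2 (fun k => ?_) j
      rw [wnorm_le_iff hT (by positivity)]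
      intro i
      refine (hH3 k i D).trans ?_
      have := hx.le_w i
      gcongr
    δ_pos := hδ
    δ_le := hδ1
    K_ge := hs.K_ge
    lmax_le := hs.lmax
    one_le_mul := by
      have h1 : exp (-x) * (exp D * exp (-(ω * D))) ≥ 1 := by
        rw [← exp_add, ← exp_add]
        refine one_le_exp ?_
        have := hx.le_one_sub
        linarith
      have h2 := hs.lmin
      have h3 : exp (-x) * (exp D * exp (-(ω * D)))
          ≤ famConst d K * δ * r * (exp D * exp (-(ω * D))) :=
        mul_le_mul_of_nonneg_right h2 (by positivity)
      linarith
    E_ge := by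
      have h1 : 1 ≤ exp (-x) * exp D := by
        rw [← exp_add]; exact one_le_exp (by linarith [hx.le_dur])
      have h2 := hs.fact
      have h3 : 60 * (K.factorial : ℝ) * exp (-x) * exp D ≤ 1 * exp D :=
        mul_le_mul_of_nonneg_right h2 hc.le
      have h4 : 60 * (K.factorial : ℝ) * 1 ≤ 60 * (K.factorial : ℝ) * (exp (-x) * exp D) :=
        mul_le_mul_of_nonneg_left h1 (by positivity)
      linarith
      }, rfl, rfl, rfl, rfl, rfl, rfl, rfl, rfl, rfl⟩

end Good
end WeightedSingular
end

/-! ### A good vertex has many good sons. -/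

noncomputable section
namespace WeightedSingular
open Matrix Real

variable {d ℓ : ℕ} {w : Fin d → ℝ} {ω : ℝ}

/-- The constant in the lower bound for the number of continuations of a vertex. -/
def sonConst (d K : ℕ) : ℝ := famConst d K ^ d / (120 * d.factorial * K.factorial)

namespace StepData
variable (S : StepData d)

theorem one_le_mul_exp {r z a x : ℝ} (hr : exp (-x) ≤ r) (ha : x ≤ a) (hz : z = exp a) :
    1 ≤ r * z := by
  rw [hz]
  calc (1 : ℝ) ≤ exp (-x) * exp a := by rw [← exp_add]; exact one_le_exp (by linarith)
    _ ≤ r * exp a := by gcongr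

/-- The bound for the candidates failing a scale condition, from the comparison of exponents. -/
theorem card_bad_scale_le (hw : IsWeight ℓ w ω) {r t D D' x y y' δ B : ℝ} {K : ℕ}
    (hx : StepExponents ℓ w ω D D' x) (hs : StepSmall d K δ r (exp (-x)))
    (hy : ScaleCond ℓ w ω D x y y') (hy0 : 0 ≤ y)
    (hT : S.T = fun i => exp (-(w i * (t + D)))) (hE : S.E = exp D) (hδ : S.δ = δ)
    (hlmin : S.lmin = r * exp (-(ω * D))) (hlmax : S.lmax = rho d δ * exp (-x)) (hK : S.K = K)
    {H : Matrix (Fin d) (Fin d) ℤ} (hH : H.det ≠ 0) (hmem : ∀ i, H i ∈ annLattice S.P S.Q)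
    (hB : B * exp (-x) ≤ r) (hB0 : 0 ≤ B)
    (h0 : ∀ j (i : Fin d), i.val < ℓ →
      exp (-(w i * (t + D))) * |(H j i : ℝ)| ≤ B * exp (-(theta ℓ w * y') - ω * D))
    (h1 : ∀ j (i : Fin d), ¬ i.val < ℓ → exp (-(w i * (t + D))) * |(H j i : ℝ)| ≤ 1) :
    ((S.bad (fun i => r * exp (bet ℓ w y i)) \ S.bad fun _ => S.δ ^ 2).card : ℝ)
      ≤ 1 / 16 * S.tot := by
  have hδ0 := hs.δ_pos
  have hd : (2 : ℝ) ≤ d := by exact_mod_cast hw.two_le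
  have hr := hs.r_pos
  have hr1 : r ≤ 1 := by nlinarith [hs.dr_lt]
  have hδ1 : δ ≤ 1 := by nlinarith [hs.δ_le]
  have hρ := one_le_rho hw.two_le hδ0 hδ1
  have hzr : exp (-x) ≤ r := by
    have := hs.scale
    nlinarith [exp_pos (-x)]
  have hω1 : w hw.i₁ ≤ 1 - ω := by
    have := hw.add_le_one (IsWeight.ne_of_lt_of_ge hw.i₀_lt hw.i₁_not_lt)
    rw [hw.w_i₀] at this
    linarith
  have key := S.card_bad_scale hw (r := r) (y := y) (z := exp (-x)) hr hr1 hy0 hH hmem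
    (fun j i hi => by
      rw [hT]
      refine (h0 j i hi).trans ?_
      calc B * exp (-(theta ℓ w * y') - ω * D) ≤ B * (exp (-x) * exp (-(theta ℓ w * y))) := by
            rw [← exp_add]
            have := hy.le_diff
            gcongr
            linarith
        _ = B * exp (-x) * exp (-(theta ℓ w * y)) := by ring
        _ ≤ r * exp (-(theta ℓ w * y)) := by gcongr)
    (fun j i hi => by rw [hT]; exact h1 j i hi)
    (by
      have h2 : exp (-(theta ℓ w * y)) ≤ exp (-x) := exp_le_exp.2 (by linarith [hy.le_theta])
      nlinarith [exp_pos (-(theta ℓ w * y))])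
    (fun i hi => one_le_mul_exp hzr (hy.le_w i hi) rfl)
    (by
      rw [hE, hlmin, mul_left_comm, ← exp_add]
      refine mul_le_mul_of_nonneg_left (exp_le_exp.2 ?_) hr.le
      have h2 := hy.le_dur
      have h3 := hw.pos hw.i₁
      nlinarith)
    (by
      -- For `d > 2` the longest side of the box must be small compared with `E * lmin`, which is
      -- where the gap `1 - ω - w i > 0` enters.
      rcases hw.two_le.lt_or_eq with h2 | h2
      · right
        rw [hE, hlmin, hK]
        have h3 := hx.le_two h2 _ hw.i₁_not_lt
        calc d * (r * exp (w hw.i₁ * y)) ≤ d * (r * (exp (-x) * exp ((1 - ω) * D))) := by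
              rw [← exp_add]
              have h4 := hy.le_dur
              have h5 := hw.pos hw.i₁
              gcongr
              nlinarith
          _ = (d * exp (-x)) * (r * exp ((1 - ω) * D)) := by ring
          _ ≤ famConst d K * (r * exp ((1 - ω) * D)) := by
              gcongr
              exact hs.fam
          _ = famConst d K * exp D * (r * exp (-(ω * D))) := by
              rw [show (1 - ω) * D = D + -(ω * D) by ring, exp_add]; ring
      · exact Or.inl h2.symm)
    (by rw [hδ]; exact hs.δ_le) (by rw [hlmax, hδ]; exact hs.sq)
  refine key.trans ?_
  rw [hδ, hK]
  have h2 := hs.thin'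
  have h3 := hs.hyp
  have h4 := S.tot_pos
  calc boxConst d * hypConst d K * S.tot *
        (exp (-x) * (1 / δ) ^ d * (2 / δ ^ 3) + r ^ d * (42 * d))
      = (boxConst d * hypConst d K * (exp (-x) * (1 / δ) ^ d * (2 / δ ^ 3))
        + boxConst d * hypConst d K * (r ^ d * (42 * d))) * S.tot := by ring
    _ ≤ (1 / 32 + 1 / 32) * S.tot := by gcongr
    _ = 1 / 16 * S.tot := by ring

end StepData

theorem avoid_of_not_mem_bad {S : StepData d} {n : Option (Fin d) → ℤ} (hn : n ∈ S.Ω)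
    {s : Fin d → ℝ} (h : n ∉ S.bad s) : Avoid (S.num n) (S.den n) fun i => s i / S.T i := by
  by_contra hc
  exact h (S.mem_bad.2 ⟨hn, hc⟩)

theorem card_le_card_sdiff_add {α : Type*} [DecidableEq α] (Ω P A B C D : Finset α) :
    Ω.card ≤ (Ω \ (P ∪ (A ∪ (B ∪ (C ∪ D))))).card + (P.card + (A.card + ((B \ A).card
      + ((C \ A).card + (D \ A).card)))) := by
  have h1 : Ω ⊆ (Ω \ (P ∪ (A ∪ (B ∪ (C ∪ D))))) ∪
      (P ∪ (A ∪ ((B \ A) ∪ ((C \ A) ∪ (D \ A))))) := by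
    intro n hn
    simp only [Finset.mem_union, Finset.mem_sdiff]
    tauto
  refine (Finset.card_le_card h1).trans ((Finset.card_union_le _ _).trans ?_)
  refine Nat.add_le_add_left ((Finset.card_union_le _ _).trans ?_) _
  refine Nat.add_le_add_left ((Finset.card_union_le _ _).trans ?_) _
  refine Nat.add_le_add_left ((Finset.card_union_le _ _).trans ?_) _
  exact Nat.add_le_add_left (Finset.card_union_le _ _) _

set_option maxHeartbeats 400000 in
/-- A good vertex has many good continuations. -/
theorem Good.exists_sons (hw : IsWeight ℓ w ω) {r t δ u u' v D D' x : ℝ} {P : Fin d → ℤ} {Q : ℤ}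
    (hg : Good ℓ w ω r t δ u' D P Q) {K : ℕ}
    (hx : StepExponents ℓ w ω D D' x) (hs : StepSmall d K δ r (exp (-x)))
    (hu0 : 0 ≤ u) (hv0 : 0 ≤ v)
    (hu : ScaleCond ℓ w ω D x u u') (hv : ScaleCond ℓ w ω D x v 0)
    (hr : ∀ i : Fin d, ¬ i.val < ℓ → d ^ d / r ^ (d - 1) * exp (-(w i * (D - u'))) ≤ 1) :
    ∃ F : Finset ((Fin d → ℤ) × ℤ), sonConst d K * δ ^ d * exp D ^ d ≤ F.card ∧ ∀ V ∈ F,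
      Good ℓ w ω r (t + D) δ u D' V.1 V.2 ∧ exp (t + D) / 2 < V.2 ∧
      (∀ i, |(P i : ℝ) / Q - V.1 i / V.2| < δ * exp (-w i * (t + D) - t)) ∧
      Avoid V.1 V.2 fun i => r * exp (w i * (t + D) + bet ℓ w v i) := by
  classical
  obtain ⟨S, hP, hQ, hT, hX, hE, hδ, hlmin, hlmax, hK⟩ := hg.exists_stepData hw hx hs
  have hδ0 := hs.δ_pos
  have hd : (2 : ℝ) ≤ d := by exact_mod_cast hw.two_le
  have hr0 := hs.r_pos
  have hr1 : r ≤ 1 := by nlinarith [hs.dr_lt]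
  have hδ1 : δ ≤ 1 := by nlinarith [hs.δ_le]
  have hρ := one_le_rho hw.two_le hδ0 hδ1
  have htot := S.tot_pos
  have hz := exp_pos (-x)
  have hz1 : exp (-x) ≤ 1 := exp_le_one_iff.2 (by linarith [hx.nonneg])
  have hsq : S.lmax ≤ S.δ ^ 2 := by rw [hlmax, hδ]; exact hs.sq
  obtain ⟨H, hH1, hH2, hH3⟩ := hg.exists_frame_cube hw hδ0
  obtain ⟨H', hH1', hH2', hH3'⟩ := hg.exists_frame_scale hw hr0
  have hH2P : ∀ i, H i ∈ annLattice S.P S.Q := by rw [hP, hQ]; exact hH2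
  have hH2P' : ∀ i, H' i ∈ annLattice S.P S.Q := by rw [hP, hQ]; exact hH2'
  -- The four sets violate, in this order, the cube condition of the new vertex, its condition for
  -- the following step, the scale `u`, and the scale `v`. The last three are counted outside `B0`,
  -- where normals are not short.
  set B0 := S.bad fun _ => S.δ ^ 2 with hB0
  set BN := S.bad fun i => r * exp (-((ω - w i) * D')) with hBN
  set BU := S.bad fun i => r * exp (bet ℓ w u i) with hBU
  set BV := S.bad fun i => r * exp (bet ℓ w v i) with hBV
  have c0 : (B0.card : ℝ) ≤ 1 / 8 * S.tot := by
    refine (S.card_bad_cube (A := S.δ ^ 2) (by rw [hδ]; positivity)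
      (by rw [hδ]; exact pow_le_one₀ hδ0.le hδ1) hsq (by
        rw [hδ]
        have := hs.δ_le
        have h2 : δ ^ 2 ≤ 1 / 4 := by nlinarith
        nlinarith)).trans ?_
    rw [hδ, hlmax, hK]
    have h1 := hs.cube
    have h2 := hs.cube'
    have h3 : δ ^ 2 / δ = δ := by field_simp
    rw [h3]
    calc cubeConst d K * S.tot * (δ + rho d δ * exp (-x) / δ ^ 2)
        = (cubeConst d K * δ + cubeConst d K * (rho d δ * exp (-x) / δ ^ 2)) * S.tot := by ring
      _ ≤ (1 / 16 + 1 / 16) * S.tot := by gcongr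
      _ = 1 / 8 * S.tot := by ring
  have cN : ((BN \ B0).card : ℝ) ≤ 1 / 16 * S.tot := by
    set η : Fin d → ℝ := fun i => max (r * exp (-((ω - w i) * D'))) (rho d δ * exp (-(w i * D)))
      with hη
    have hrexp : ∀ i, r * exp (-((ω - w i) * D')) ≤ r := fun i => by
      refine mul_le_of_le_one_right hr0.le (exp_le_one_iff.2 ?_)
      by_cases hi : i.val < ℓ
      · rw [hw.eq_top i hi]; simp
      · have := hx.le_gap i hi
        linarith [hx.nonneg]
    have hρexp : ∀ i, rho d δ * exp (-(w i * D)) ≤ rho d δ * exp (-x) := fun i => by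
      have := hx.le_w i
      gcongr
    have h1 := S.card_bad_sdiff_thin (A := S.δ ^ 2) (by rw [hδ]; positivity) hH1 hH2P
      (s := fun i => r * exp (-((ω - w i) * D'))) (η := η) hr0.le
      (fun j i => by rw [hT]; exact (hH3 j i D).trans (le_max_right _ _))
      (fun i => le_max_left _ _) hrexp (by
        rw [hδ]
        have h2 := hs.dr_lt
        have h3 := hs.δ_le
        nlinarith)
    refine h1.trans ?_
    have h2 : ∏ i, η i ≤ rho d δ * exp (-x) * rho d δ ^ d := by
      refine prod_le_mul_pow (fun i => le_max_of_le_left (by positivity)) hρ (fun i => ?_) hw.i₁ ?_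
      · refine max_le ((hrexp i).trans (hr1.trans hρ)) ((hρexp i).trans ?_)
        exact mul_le_of_le_one_right (by positivity) hz1
      · refine max_le ?_ (hρexp _)
        have h3 := hx.le_gap _ hw.i₁_not_lt
        have h4 : exp (-((ω - w hw.i₁) * D')) ≤ exp (-x) := exp_le_exp.2 (by linarith)
        exact mul_le_mul (hr1.trans hρ) h4 (exp_pos _).le (by positivity)
    have hb := boxConst_pos d
    have hh := S.hypConst_pos
    have h6 := S.one_div_add_le hsq
    rw [hδ, hlmax] at h6 ⊢
    rw [hK] at hh ⊢
    have h7 := hs.thin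
    calc boxConst d * hypConst d K * S.tot * (∏ i, η i)
          * (1 / (δ * δ ^ 2) + rho d δ * exp (-x) / δ ^ 2)
        ≤ boxConst d * hypConst d K * S.tot * (rho d δ * exp (-x) * rho d δ ^ d) * (2 / δ ^ 3) := by
          gcongr
      _ = boxConst d * hypConst d K * (rho d δ ^ (d + 1) * exp (-x) * (2 / δ ^ 3)) * S.tot := by
          ring
      _ ≤ 1 / 16 * S.tot := by gcongr
  have cV : ((BV \ B0).card : ℝ) ≤ 1 / 16 * S.tot := by
    refine S.card_bad_scale_le hw hx hs hv hv0 hT hE hδ hlmin hlmax hK hH1 hH2P (B := rho d δ)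
      hs.scale (by positivity) (fun j i hi => ?_) fun j i hi => ?_
    · refine (hH3 j i D).trans (le_of_eq ?_)
      rw [hw.eq_top i hi]; ring_nf
    · refine (hH3 j i D).trans ?_
      have h2 : exp (-(w i * D)) ≤ exp (-x) := exp_le_exp.2 (by linarith [hx.le_w i])
      have h3 := hs.scale
      nlinarith
  -- The frame is adapted to the previous scale `u'`, so only the increment `u - u'` has to be
  -- compensated by `ω D`. For `v` the cube frame, of scale `0`, suffices.
  have cU : ((BU \ B0).card : ℝ) ≤ 1 / 16 * S.tot := by
    refine S.card_bad_scale_le hw hx hs hu hu0 hT hE hδ hlmin hlmax hK hH1' hH2P'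
      (B := d ^ d / r ^ (d - 1)) hs.scale' (by positivity) (fun j i hi => ?_) fun j i hi => ?_
    · refine (hH3' j i D).trans (le_of_eq ?_)
      rw [hw.eq_top i hi, bet, if_pos hi]
    · refine (hH3' j i D).trans ?_
      rw [bet, if_neg hi]
      have h2 := hr i hi
      rw [show -(w i * (D - u')) = w i * u' - w i * D by ring] at h2
      exact h2
  have cP : (S.nonprim.card : ℝ) ≤ 1 / 16 * S.tot := by
    refine S.card_nonprim_le.trans ?_
    rw [hK]
    exact mul_le_mul_of_nonneg_right hs.six_div htot.le
  set A := S.Ω \ (S.nonprim ∪ (B0 ∪ (BN ∪ (BU ∪ BV)))) with hA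
  -- The losses are `1/16 + 1/8 + 3/16 = 3/8` of `tot`.
  have hcard : S.tot / 2 ≤ A.card := by
    have h2 := card_le_card_sdiff_add S.Ω S.nonprim B0 BN BU BV
    rw [← hA] at h2
    have h3 : (S.Ω.card : ℝ) ≤ A.card + (S.nonprim.card + (B0.card + ((BN \ B0).card
        + ((BU \ B0).card + (BV \ B0).card)))) := by exact_mod_cast h2
    have h4 := S.tot_le_card
    linarith
  have hcount : sonConst d K * δ ^ d * exp D ^ d ≤ A.card := by
    refine le_trans ?_ hcard
    have h1 := S.tot_ge
    rw [hδ, hE, hK] at h1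
    have h2 : sonConst d K = famConst d K ^ d / (60 * d.factorial * K.factorial) / 2 := by
      rw [sonConst, div_div]; ring
    rw [h2]
    linarith only [h1]
  refine ⟨A.image fun n => (S.num n, S.den n), ?_, ?_⟩
  · rw [Finset.card_image_of_injective _ S.num_den_injective]
    exact hcount
  · intro V hV
    obtain ⟨n, hn, rfl⟩ := Finset.mem_image.1 hV
    simp only [hA, Finset.mem_sdiff, Finset.mem_union, not_or] at hn
    obtain ⟨hnΩ, hnP, hn0, hnN, hnU, hnV⟩ := hn
    obtain ⟨hden1, hden2⟩ := S.den_bounds hnΩ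
    rw [hX] at hden1 hden2
    have hdiv : ∀ y i, y / S.T i = y * exp (w i * (t + D)) := fun y i => by
      rw [hT, div_eq_mul_inv, ← exp_neg, neg_neg]
    have a0 := avoid_of_not_mem_bad hnΩ hn0
    have aN := avoid_of_not_mem_bad hnΩ hnN
    have aU := avoid_of_not_mem_bad hnΩ hnU
    have aV := avoid_of_not_mem_bad hnΩ hnV
    simp only [hdiv, mul_assoc, ← exp_add, hδ] at a0 aN aU aV
    have hexp := exp_pos (t + D)
    refine ⟨⟨S.den_pos hnΩ, ?_, by dsimp only; linarith, hden2, a0, ?_, ?_⟩, hden1, fun i => ?_, ?_⟩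
    · by_contra hc
      exact hnP (by unfold StepData.nonprim; exact Finset.mem_filter.2 ⟨hnΩ, hc⟩)
    · exact aU.mono fun i => by rw [add_comm]
    · exact aN.mono fun i => le_of_eq (by ring_nf)
    · have h1 := S.abs_sub_le hnΩ i
      rw [hP, hQ, hδ, hE, hX, hT] at h1
      refine h1.trans_le ?_
      have h2 : δ * exp D * exp (-(w i * (t + D))) / (2 * exp (t + D))
          = δ * exp (-w i * (t + D) - t) / 2 := by
        have h3 : exp (-w i * (t + D) - t) = exp D * exp (-(w i * (t + D))) / exp (t + D) := by
          rw [← exp_add, ← exp_sub]; ring_nf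
        rw [h3]; ring
      rw [h2]
      have h3 : 0 < δ * exp (-w i * (t + D) - t) := by positivity
      linarith
    · exact aV.mono fun i => by rw [add_comm]
end WeightedSingular
end

/-! ### Choice of the parameters and the vertices of the tree. -/

noncomputable section
namespace WeightedSingular
open Matrix Real Filter

/-- As `N ^ p ≤ e^{pN}`, the exponential wins for all `N` at once when `t` is large. This is what
allows one `t` to serve all heights, although `ε_N = ε / N` decreases. -/
theorem eventually_mul_exp_le (C : ℝ) (p : ℕ) {κ ε : ℝ} (hκ : 0 < κ) (hε : 0 < ε) :
    ∀ᶠ t : ℝ in atTop, ∀ N : ℕ, 1 ≤ N → C * exp (-(κ * N * t)) ≤ (ε / N) ^ p := by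
  have h1 : Tendsto (fun t : ℝ => |C| * exp ((p : ℝ) - κ * t)) atTop (nhds (|C| * 0)) := by
    refine Tendsto.const_mul _ (tendsto_exp_atBot.comp ?_)
    exact tendsto_atBot_add_const_left _ _ (tendsto_neg_atTop_atBot.comp
      (tendsto_id.const_mul_atTop hκ))
  rw [mul_zero] at h1
  filter_upwards [h1.eventually (gt_mem_nhds (by positivity : 0 < ε ^ p)),
    eventually_ge_atTop ((p : ℝ) / κ)] with t h2 h3 N hN
  have hN0 : (1 : ℝ) ≤ N := by exact_mod_cast hN
  rw [div_le_iff₀ hκ] at h3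
  rw [div_pow, le_div_iff₀ (by positivity)]
  have h4 : (N : ℝ) ^ p ≤ exp (p * N) := by
    rw [← rpow_natCast, mul_comm, exp_mul]
    have := add_one_le_exp (N : ℝ)
    rw [rpow_natCast, rpow_natCast]
    exact pow_le_pow_left₀ (by positivity) (by linarith) _
  calc C * exp (-(κ * N * t)) * (N : ℝ) ^ p
      ≤ |C| * exp (-(κ * N * t)) * exp (p * N) := by
        gcongr
        exact le_abs_self C
    _ = |C| * exp ((p - κ * t) * N) := by rw [mul_assoc, ← exp_add]; ring_nf
    _ ≤ |C| * exp (p - κ * t) := by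
        gcongr
        nlinarith
    _ ≤ ε ^ p := h2.le

theorem rho_mul_le {d : ℕ} (hd : 2 ≤ d) {δ z C : ℝ} {k : ℕ} (hδ : 0 < δ) (hδ1 : δ ≤ 1)
    (h : C * d ^ d * z ≤ δ ^ (2 * d + k)) : C * (rho d δ * z) ≤ δ ^ k := by
  have h1 : rho d δ = d ^ d / δ ^ (2 * (d - 1)) := by rw [rho, pow_mul]
  rw [h1, div_mul_eq_mul_div, mul_div_assoc', div_le_iff₀ (by positivity), ← pow_add]
  rw [← mul_assoc]
  exact h.trans (pow_le_pow_of_le_one hδ.le hδ1 (by omega))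

/-- Every condition that involves the exponential reduces to the form `C e^{-κNt} ≤ (ε / N)^p`; the
others concern `ε`, `r` and `K` only. -/
theorem eventually_stepSmall {d K : ℕ} (hd : 2 ≤ d) {κ ε r : ℝ} (hκ : 0 < κ) (hε : 0 < ε)
    (hdε : d * ε ≤ 1) (hr : 0 < r) (hdr : d * r ≤ 1) (hK : redConst d ≤ K)
    (hK' : 6 / (K : ℝ) ≤ 1 / 16) (hcube : cubeConst d K * ε ≤ 1 / 16)
    (hcube0 : 0 ≤ cubeConst d K)
    (hhyp : boxConst d * hypConst d K * (r ^ d * (42 * d)) ≤ 1 / 32) :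
    ∀ᶠ t : ℝ in atTop, ∀ N : ℕ, 1 ≤ N → StepSmall d K (ε / N) r (exp (-(κ * N * t))) := by
  have hd' : (2 : ℝ) ≤ d := by exact_mod_cast hd
  have hfam : 0 < famConst d K := by
    have := redConst_pos d
    unfold famConst; positivity
  filter_upwards [eventually_mul_exp_le (10 * d ^ 2 * d ^ d) (2 * d + 0) hκ hε,
    eventually_mul_exp_le (1 / (famConst d K * r)) 1 hκ hε,
    eventually_mul_exp_le (60 * K.factorial) 0 hκ hε,
    eventually_mul_exp_le (1 * d ^ d) (2 * d + 2) hκ hε,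
    eventually_mul_exp_le (1 / r * d ^ d) (2 * d + 0) hκ hε,
    eventually_mul_exp_le (d ^ d / r ^ (d - 1) / r) 0 hκ hε,
    eventually_mul_exp_le (d / famConst d K) 0 hκ hε,
    eventually_mul_exp_le (16 * cubeConst d K * d ^ d) (2 * d + 2) hκ hε,
    eventually_mul_exp_le (32 * boxConst d * hypConst d K * (d ^ d) ^ (d + 1))
      (2 * (d - 1) * (d + 1) + 3) hκ hε,
    eventually_mul_exp_le (64 * boxConst d * hypConst d K) (d + 3) hκ hε]
    with t h1 h2 h3 h4 h5 h6 h7 h8 h9 h10 N hN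
  have hN' : (1 : ℝ) ≤ N := by exact_mod_cast hN
  replace h1 := h1 N hN; replace h2 := h2 N hN; replace h3 := h3 N hN; replace h4 := h4 N hN
  replace h5 := h5 N hN; replace h6 := h6 N hN; replace h7 := h7 N hN; replace h8 := h8 N hN
  replace h9 := h9 N hN; replace h10 := h10 N hN
  set z := exp (-(κ * N * t)) with hz
  have hδε : ε / N ≤ ε := div_le_self hε.le hN'
  have hδ : 0 < ε / N := by positivity
  set δ := ε / N with hδdef
  have hδ1 : δ ≤ 1 := by nlinarith
  exact {
    δ_pos := hδ
    δ_le := le_trans (by gcongr) hdε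
    r_pos := hr
    dr_lt := hdr
    K_ge := hK
    six_div := hK'
    cube := le_trans (by gcongr) hcube
    hyp := hhyp
    lmax := by
      have := rho_mul_le hd hδ hδ1 h1
      rw [pow_zero] at this
      linarith
    lmin := by
      rw [pow_one, div_mul_eq_mul_div, div_le_iff₀ (by positivity), one_mul] at h2
      linarith
    fact := by simpa using h3
    sq := by simpa using rho_mul_le hd hδ hδ1 h4
    scale := by
      have := rho_mul_le hd hδ hδ1 h5
      rwa [pow_zero, div_mul_eq_mul_div, div_le_iff₀ hr, one_mul, one_mul] at this
    scale' := by
      rwa [pow_zero, div_mul_eq_mul_div, div_le_iff₀ hr, one_mul] at h6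
    fam := by
      rwa [pow_zero, div_mul_eq_mul_div, div_le_iff₀ hfam, one_mul] at h7
    cube' := by
      have := rho_mul_le hd hδ hδ1 h8
      rw [mul_div_assoc', div_le_iff₀ (by positivity)]
      linarith
    thin := by
      have h11 : rho d δ ^ (d + 1) = (d ^ d) ^ (d + 1) / δ ^ (2 * (d - 1) * (d + 1)) := by
        rw [rho, div_pow, ← pow_mul δ, ← pow_mul δ]
      have h12 : boxConst d * hypConst d K * ((d ^ d) ^ (d + 1) / δ ^ (2 * (d - 1) * (d + 1)) * z
          * (2 / δ ^ 3)) = 32 * boxConst d * hypConst d K * (d ^ d) ^ (d + 1) * z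
            / (δ ^ (2 * (d - 1) * (d + 1)) * δ ^ 3) / 16 := by
        rw [mul_assoc 32, mul_assoc 32, mul_assoc 32, mul_comm 32]
        ring
      rw [h11]
      rw [h12]
      gcongr
      rw [div_le_one (by positivity)]
      simpa only [pow_add] using h9
    thin' := by
      have h12 : boxConst d * hypConst d K * (z * (1 / δ) ^ d * (2 / δ ^ 3))
          = 64 * boxConst d * hypConst d K * z / (δ ^ d * δ ^ 3) / 32 := by
        rw [one_div, inv_pow]
        ring
      rw [h12]
      gcongr
      rw [div_le_one (by positivity)]
      simpa only [pow_add] using h10 }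

theorem exists_pos_le {ι : Type*} [Finite ι] (f : ι → ℝ) (hf : ∀ i, 0 < f i) :
    ∃ κ, 0 < κ ∧ ∀ i, κ ≤ f i := by
  cases nonempty_fintype ι
  rcases isEmpty_or_nonempty ι with h | h
  · exact ⟨1, one_pos, fun i => h.elim i⟩
  · obtain ⟨i, hi⟩ := Finite.exists_min f
    exact ⟨f i, hf i, hi⟩

variable {d ℓ : ℕ} {w : Fin d → ℝ} {ω : ℝ}

/-- A positive lower bound for all gaps between exponents of the construction. -/
structure IsRate (ℓ : ℕ) (w : Fin d → ℝ) (ω κ : ℝ) : Prop where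
  pos : 0 < κ
  le_one : κ ≤ 1
  le_w : ∀ i, κ ≤ w i
  le_one_sub : κ ≤ 1 - ω
  le_gap : ∀ i : Fin d, ¬ i.val < ℓ → κ ≤ ω - w i
  le_two : 2 < d → ∀ i : Fin d, ¬ i.val < ℓ → κ ≤ 1 - ω - w i
  le_theta : κ ≤ theta ℓ w
  le_diff : κ ≤ ω * xi d ℓ - theta ℓ w

/-- A minimum of finitely many positive gaps. The essential ones are `w i < ω` beyond `ℓ`, `θ < ω
ξ`, and `ω + w i < 1` there when `d > 2`. -/
theorem IsWeight.exists_rate (hw : IsWeight ℓ w ω) : ∃ κ, IsRate ℓ w ω κ := by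
  obtain ⟨κ₁, h1, h1'⟩ := exists_pos_le w hw.pos
  obtain ⟨κ₂, h2, h2'⟩ := exists_pos_le (fun i : Fin d => if i.val < ℓ then 1 else ω - w i)
    fun i => by
      split_ifs with h
      · exact one_pos
      · linarith [hw.lt_top i (not_lt.1 h)]
  obtain ⟨κ₃, h3, h3'⟩ := exists_pos_le
    (fun i : Fin d => if 2 < d ∧ ¬ i.val < ℓ then 1 - ω - w i else 1) fun i => by
      split_ifs with h
      · have := hw.add_lt_one h.1 (IsWeight.ne_of_lt_of_ge hw.i₀_lt h.2)
        rw [hw.w_i₀] at this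
        linarith
      · exact one_pos
  obtain ⟨κ₄, h4, h4'⟩ := exists_pos_le
    (![1, 1 - ω, theta ℓ w, ω * xi d ℓ - theta ℓ w]) fun i => by
      fin_cases i
      · exact one_pos
      · exact sub_pos.2 hw.omega_lt_one
      · exact hw.theta_pos
      · exact sub_pos.2 hw.theta_lt_mul_xi
  refine ⟨min (min κ₁ κ₂) (min κ₃ κ₄), by positivity, ?_, fun i => ?_, ?_, fun i hi => ?_,
    fun hd i hi => ?_, ?_, ?_⟩
  · exact ((min_le_right _ _).trans (min_le_right _ _)).trans (h4' 0)
  · exact ((min_le_left _ _).trans (min_le_left _ _)).trans (h1' i)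
  · exact ((min_le_right _ _).trans (min_le_right _ _)).trans (h4' 1)
  · have := h2' i
    rw [if_neg hi] at this
    exact ((min_le_left _ _).trans (min_le_right _ _)).trans this
  · have := h3' i
    rw [if_pos ⟨hd, hi⟩] at this
    exact ((min_le_right _ _).trans (min_le_left _ _)).trans this
  · exact ((min_le_right _ _).trans (min_le_right _ _)).trans (h4' 2)
  · exact ((min_le_right _ _).trans (min_le_right _ _)).trans (h4' 3)

/-- The time of the flow `b` for which the vertices of height `n` are controlled. -/
def scaleU (d ℓ : ℕ) (t : ℝ) (n : ℕ) : ℝ := min ((n : ℝ) * (n + 1) / 2 * t) (xi d ℓ * n * t)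

theorem one_le_xi (d ℓ : ℕ) : 1 ≤ xi d ℓ := le_max_left _ _

theorem scaleU_nonneg {t : ℝ} (ht : 0 ≤ t) (n : ℕ) : 0 ≤ scaleU d ℓ t n := by
  have := one_le_xi d ℓ
  exact le_min (by positivity) (by positivity)

theorem le_scaleU {t : ℝ} (ht : 0 ≤ t) (n : ℕ) : n * t ≤ scaleU d ℓ t n := by
  have h1 := one_le_xi d ℓ
  refine le_min ?_ ?_
  · rcases n.eq_zero_or_pos with rfl | h
    · simp
    · have h2 : (1 : ℝ) ≤ n := by exact_mod_cast h
      gcongr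
      nlinarith
  · gcongr
    have : (0 : ℝ) ≤ n := n.cast_nonneg
    nlinarith

theorem scaleU_le {t : ℝ} (n : ℕ) : scaleU d ℓ t n ≤ xi d ℓ * n * t := min_le_right _ _

/-- A step at height `n` can compensate an increment of at most `(n + 1) t`, by `θ < ω ξ`. For small
`n` the increment `ξ t` of `ξ n t` may exceed this, which is why `scaleU` starts with the slower `n
(n + 1) / 2 * t`. -/
theorem scaleU_succ_sub_le {t : ℝ} (ht : 0 ≤ t) (n : ℕ) :
    scaleU d ℓ t (n + 1) - scaleU d ℓ t n ≤ (n + 1) * t := by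
  have h1 := one_le_xi d ℓ
  have h2 : (0 : ℝ) ≤ n := n.cast_nonneg
  unfold scaleU
  rcases le_total ((n : ℝ) * (n + 1) / 2 * t) (xi d ℓ * n * t) with h | h
  · rw [min_eq_left h]
    have := min_le_left (((n + 1 : ℕ) : ℝ) * ((n + 1 : ℕ) + 1) / 2 * t) (xi d ℓ * (n + 1 : ℕ) * t)
    push_cast at this ⊢
    linarith
  · rw [min_eq_right h]
    have h3 := min_le_right (((n + 1 : ℕ) : ℝ) * ((n + 1 : ℕ) + 1) / 2 * t) (xi d ℓ * (n + 1 : ℕ) * t)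
    push_cast at h3 ⊢
    rcases n.eq_zero_or_pos with rfl | hn
    · have h4 := min_le_left (((0 : ℝ) + 1) * ((0 + 1) + 1) / 2 * t) (xi d ℓ * (0 + 1) * t)
      simp only [Nat.cast_zero] at h4 ⊢
      linarith
    · have h4 : (1 : ℝ) ≤ n := by exact_mod_cast hn
      have h5 : xi d ℓ * t ≤ (n + 1) / 2 * t := by
        have : n * (xi d ℓ * t) ≤ n * ((n + 1) / 2 * t) := by linarith
        exact le_of_mul_le_mul_left this (by linarith)
      have h6 : (n + 1) / 2 * t ≤ (n + 1) * t := by gcongr; linarith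
      linarith

/-- The rational vectors `P / Q` that can be vertices of height `n`. -/
def Vert (ℓ : ℕ) (w : Fin d → ℝ) (ω ε r t : ℝ) (n : ℕ) (P : Fin d → ℤ) (Q : ℤ) : Prop :=
  Good ℓ w ω r (tSeq d ℓ t n) (epsSeq ε (n + 1)) (scaleU d ℓ t n) (xi d ℓ * (n + 1) * t) P Q

/-- For `P = 0` and `Q = 1` the lattice is `ℤ^d`, whose nonzero vectors have a coordinate of size at
least `1`. The half sides of the boxes at time `t_0 = 1` are below `3 / 4`, as `e < 3`. -/
theorem vert_zero (hw : IsWeight ℓ w ω) {ε r t : ℝ} (hε : 0 < ε) (hεr : ε < r) (hr : r ≤ 1 / 4)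
    (ht : 0 ≤ t) : Vert ℓ w ω ε r t 0 0 1 := by
  have he := exp_one_lt_three
  have hw1 : ∀ i, exp (w i) < 3 := fun i => by
    refine (exp_le_exp.2 ?_).trans_lt he
    linarith [hw.le_omega i, hw.omega_lt_one]
  have hone : ∀ s : Fin d → ℝ, (∀ i, s i < 1) → Avoid (0 : Fin d → ℤ) 1 s := fun s hs a _ ha => by
    obtain ⟨i, hi⟩ := Function.ne_iff.1 ha
    exact ⟨i, (hs i).trans_le (by exact_mod_cast Int.one_le_abs hi)⟩
  refine ⟨one_pos, ⟨0, 1, by simp⟩, ?_, ?_, hone _ fun i => ?_, hone _ fun i => ?_,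
    hone _ fun i => ?_⟩
  · simp only [tSeq]; push_cast; linarith
  · simp only [tSeq]; push_cast; exact one_le_exp zero_le_one
  · simp only [tSeq, epsSeq, mul_one]
    have := hw1 i
    have h2 : ε ^ 2 < 1 / 16 := by nlinarith
    simp only [zero_add, Nat.cast_one, div_one]
    nlinarith [exp_pos (w i), sq_nonneg ε]
  · have := hw1 i
    have h1 : scaleU d ℓ t 0 = 0 := by simp [scaleU]
    have h2 : bet ℓ w 0 i = 0 := by simp [bet]
    rw [h1, h2]
    simp only [tSeq, mul_one, add_zero]
    nlinarith [exp_pos (w i)]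
  · have := hw1 i
    have h1 : exp (w i * tSeq d ℓ t 0 - (ω - w i) * (xi d ℓ * ((0 : ℕ) + 1) * t)) ≤ exp (w i) := by
      refine exp_le_exp.2 ?_
      have h2 := one_le_xi d ℓ
      have h3 := hw.le_omega i
      have : 0 ≤ (ω - w i) * (xi d ℓ * ((0 : ℕ) + 1) * t) := by
        have : 0 ≤ ω - w i := by linarith
        positivity
      simp only [tSeq, mul_one]; linarith
    nlinarith [exp_pos (w i)]

/-- The rational vectors that are continuations of `P / Q` in the construction. -/
structure IsSon (ℓ : ℕ) (w : Fin d → ℝ) (ω ε r t : ℝ) (n : ℕ) (P : Fin d → ℤ) (Q : ℤ)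
    (V : (Fin d → ℤ) × ℤ) : Prop where
  good : Good ℓ w ω r (tSeq d ℓ t (n + 1)) (epsSeq ε (n + 1)) (scaleU d ℓ t (n + 1))
    (xi d ℓ * (n + 2) * t) V.1 V.2
  lt_den : exp (tSeq d ℓ t (n + 1)) / 2 < V.2
  close : ∀ i, |(P i : ℝ) / Q - V.1 i / V.2| <
    epsSeq ε (n + 1) * exp (-w i * tSeq d ℓ t (n + 1) - tSeq d ℓ t n)
  avoid : Avoid V.1 V.2 fun i => r * exp (w i * tSeq d ℓ t (n + 1) + bet ℓ w ((n + 1) * t) i)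

theorem IsSon.vert {ε r t : ℝ} {n : ℕ} {P : Fin d → ℤ} {Q : ℤ} {V : (Fin d → ℤ) × ℤ} (hε : 0 < ε)
    (h : IsSon ℓ w ω ε r t n P Q V) : Vert ℓ w ω ε r t (n + 1) V.1 V.2 := by
  -- A son is constructed with `ε_{n+1}`, whereas its own continuation uses the smaller `ε_{n+2}`.
  have h1 := h.good.mono (δ' := epsSeq ε (n + 1 + 1)) (by unfold epsSeq; positivity)
    (by
      unfold epsSeq
      push_cast
      have : (0 : ℝ) ≤ n := n.cast_nonneg
      gcongr
      linarith)
  unfold Vert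
  convert h1 using 2
  push_cast; ring

/-- The order of choices matters: `K` depends on `d` only, `r₀` on the constants of `d` and `K`, and
`t` is taken large in terms of `w`, `ε` and `r`. The step from height `n` has duration `ξ (n + 1) t`
and exponent gain `κ (n + 1) t`. -/
theorem exists_many_sons (hw : IsWeight ℓ w ω) : ∃ r₀ c : ℝ, 0 < r₀ ∧ r₀ ≤ 1 / 4 ∧ 0 < c ∧
    ∀ ε r : ℝ, 0 < ε → ε < r → r < r₀ → ∃ t₀ : ℝ, 1 ≤ t₀ ∧ ∀ t, t₀ ≤ t → ∀ n P Q,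
      Vert ℓ w ω ε r t n P Q → ∃ F : Finset ((Fin d → ℤ) × ℤ),
        c * epsSeq ε (n + 1) ^ d * exp (xi d ℓ * (n + 1) * t) ^ d ≤ F.card ∧
        ∀ V ∈ F, IsSon ℓ w ω ε r t n P Q V := by
  obtain ⟨κ, hκ⟩ := hw.exists_rate
  have hd : (2 : ℝ) ≤ d := by exact_mod_cast hw.two_le
  -- `redConst d ≤ K` makes `N` a divisor of `K!`, and `96` makes the share `6 / K` of nonprimitive
  -- candidates at most `1 / 16`.
  obtain ⟨K, hK⟩ := exists_nat_ge (redConst d + 96)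
  have hred := redConst_pos d
  have hK96 : (96 : ℝ) ≤ K := by linarith
  have hfam : 0 < famConst d K := by unfold famConst; positivity
  have hsol := solConst_pos d K
  have hcube : 0 < cubeConst d K := by unfold cubeConst; positivity
  have hhyp : 0 < hypConst d K := by unfold hypConst; positivity
  have hbox := boxConst_pos d
  -- The last two entries make the share of short normals, bounded using `ε < r₀`, and the volume
  -- term `r^d` small.
  obtain ⟨r₀, hr0, hr0'⟩ := exists_pos_le (![1 / 4, 1 / (d : ℝ), 1 / (16 * cubeConst d K),
    1 / (32 * (boxConst d * hypConst d K * (42 * d)))]) fun i => by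
      fin_cases i <;> simp <;> first | positivity | (have := hw.two_le; omega)
  have hr1 : r₀ ≤ 1 / 4 := hr0' 0
  have hr2 : r₀ ≤ 1 / d := hr0' 1
  have hr3 : r₀ ≤ 1 / (16 * cubeConst d K) := hr0' 2
  have hr4 : r₀ ≤ 1 / (32 * (boxConst d * hypConst d K * (42 * d))) := hr0' 3
  refine ⟨r₀, sonConst d K, hr0, hr1, by unfold sonConst; positivity, fun ε r hε hεr hr => ?_⟩
  have hrpos : 0 < r := hε.trans hεr
  rw [le_div_iff₀ (by positivity)] at hr2 hr3 hr4
  have hsm := eventually_stepSmall (d := d) (K := K) hw.two_le hκ.pos hε (by nlinarith) hrpos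
    (by nlinarith) (by linarith)
    (by rw [div_le_div_iff₀ (by positivity) (by norm_num)]; linarith) (by nlinarith) hcube.le (by
      have h1 : r ^ d ≤ r := pow_le_of_le_one hrpos.le (by linarith) (by have := hw.two_le; omega)
      calc boxConst d * hypConst d K * (r ^ d * (42 * d))
          ≤ boxConst d * hypConst d K * (r₀ * (42 * d)) := by
            gcongr; linarith
        _ ≤ 1 / 32 := by linarith)
  have hexp := eventually_mul_exp_le (d ^ d / r ^ (d - 1)) 0 hκ.pos hε
  obtain ⟨t₁, ht₁⟩ := eventually_atTop.1 (hsm.and hexp)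
  refine ⟨max 1 t₁, le_max_left _ _, fun t ht n P Q hV => ?_⟩
  obtain ⟨h1, h2⟩ := ht₁ t ((le_max_right _ _).trans ht)
  have ht1 : 1 ≤ t := (le_max_left _ _).trans ht
  have ht0 : 0 ≤ t := by linarith
  have hξ := one_le_xi d ℓ
  have hθ := hw.theta_pos
  have hsmall := h1 (n + 1) (by omega)
  set N : ℝ := (n : ℝ) + 1 with hN
  have hNc : ((n + 1 : ℕ) : ℝ) = N := by push_cast; rfl
  have hN1 : 1 ≤ N := by rw [hN]; have : (0 : ℝ) ≤ n := n.cast_nonneg; linarith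
  have hNt : 0 < N * t := by positivity
  have hD : N * t ≤ xi d ℓ * N * t := by rw [mul_assoc]; exact le_mul_of_one_le_left hNt.le hξ
  have hcomb : ∀ a b : ℝ, κ ≤ a → N * t ≤ b → κ * N * t ≤ a * b := fun a b ha hb => by
    rw [mul_assoc]
    exact mul_le_mul ha hb hNt.le (hκ.pos.le.trans ha)
  have hx : StepExponents ℓ w ω (xi d ℓ * N * t) (xi d ℓ * (n + 2) * t) (κ * N * t) := by
    have hD' : N * t ≤ xi d ℓ * (n + 2) * t := hD.trans (by gcongr; rw [hN]; linarith)
    exact {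
      nonneg := by have := hκ.pos; positivity
      le_dur := (hcomb 1 _ hκ.le_one hD).trans_eq (one_mul _)
      le_w := fun i => hcomb _ _ (hκ.le_w i) hD
      le_one_sub := hcomb _ _ hκ.le_one_sub hD
      le_gap := fun i hi => hcomb _ _ (hκ.le_gap i hi) hD'
      le_two := fun h i hi => hcomb _ _ (hκ.le_two h i hi) hD }
  have hdiff : ∀ y : ℝ, y ≤ N * t → κ * N * t ≤ ω * (xi d ℓ * N * t) - theta ℓ w * y := by
    intro y hy
    have h3 := hcomb _ _ hκ.le_diff le_rfl
    have h4 : theta ℓ w * y ≤ theta ℓ w * (N * t) := by gcongr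
    linarith
  have hU : N * t ≤ scaleU d ℓ t (n + 1) := by
    have := le_scaleU (d := d) (ℓ := ℓ) ht0 (n + 1)
    rwa [hNc] at this
  have hUD : scaleU d ℓ t (n + 1) ≤ xi d ℓ * N * t := by
    have := scaleU_le (d := d) (ℓ := ℓ) (t := t) (n + 1)
    rwa [hNc] at this
  have hu : ScaleCond ℓ w ω (xi d ℓ * N * t) (κ * N * t) (scaleU d ℓ t (n + 1))
      (scaleU d ℓ t n) :=
    ⟨hcomb _ _ hκ.le_theta hU, fun i _ => hcomb _ _ (hκ.le_w i) hU, hUD,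
      hdiff _ (scaleU_succ_sub_le ht0 n)⟩
  have hv : ScaleCond ℓ w ω (xi d ℓ * N * t) (κ * N * t) (N * t) 0 :=
    ⟨hcomb _ _ hκ.le_theta le_rfl, fun i _ => hcomb _ _ (hκ.le_w i) le_rfl, hD,
      hdiff _ (by rw [sub_zero])⟩
  rw [hNc] at hsmall
  have heps : epsSeq ε (n + 1) = ε / N := by rw [epsSeq, hNc]
  obtain ⟨F, hF1, hF2⟩ := Good.exists_sons hw hV hx (by rw [heps]; exact hsmall)
    (scaleU_nonneg ht0 _) hNt.le hu hv (fun i hi => by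
      have h3 := h2 1 le_rfl
      rw [pow_zero] at h3
      refine le_trans ?_ h3
      have h4 := scaleU_le (d := d) (ℓ := ℓ) (t := t) n
      have h5 : t ≤ xi d ℓ * N * t - scaleU d ℓ t n := by
        rw [hN]; nlinarith
      have h6 := hκ.le_w i
      have h7 := hκ.pos
      rw [Nat.cast_one, mul_one]
      have h8 : κ * t ≤ w i * (xi d ℓ * N * t - scaleU d ℓ t n) :=
        mul_le_mul h6 h5 ht0 (h7.le.trans h6)
      gcongr)
  refine ⟨F, hF1, fun V hV => ?_⟩
  obtain ⟨g1, g2, g3, g4⟩ := hF2 V hV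
  exact ⟨g1, g2, g3, g4⟩

end WeightedSingular
end

/-! ### Lattices of rational vectors, and singularity of the points of the fractal. -/

noncomputable section
namespace WeightedSingular
open Matrix Real Filter

variable {d ℓ : ℕ} {w : Fin d → ℝ} {ω : ℝ}

/-- The rational vector `P / Q`. -/
def ratVec {d : ℕ} (P : Fin d → ℤ) (Q : ℤ) : EuclideanSpace ℝ (Fin d) :=
  WithLp.toLp 2 fun i => (P i : ℝ) / Q

@[simp] theorem ratVec_apply (P : Fin d → ℤ) (Q : ℤ) (i : Fin d) : ratVec P Q i = P i / Q := rfl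

/-- The diagonal matrix with entries `e^{c_i}` and `e^{-s}`. -/
def expDiag (c : Fin d → ℝ) (s : ℝ) : Matrix (Fin d ⊕ Unit) (Fin d ⊕ Unit) ℝ :=
  Matrix.diagonal (Sum.elim (fun i => exp (c i)) fun _ => exp (-s))

theorem det_expDiag_mul_hMat {c : Fin d → ℝ} {s : ℝ} (hc : ∑ i, c i = s)
    (x : EuclideanSpace ℝ (Fin d)) : (expDiag c s * hMat x).det = 1 := by
  rw [det_mul, expDiag, det_diagonal, hMat, det_fromBlocks_zero₂₁]
  simp [← exp_sum, hc, ← exp_add]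

theorem expDiag_mul_hMat_mulVec_inl (c : Fin d → ℝ) (s : ℝ) (x : EuclideanSpace ℝ (Fin d))
    (z : Fin d ⊕ Unit → ℝ) (i : Fin d) : ((expDiag c s * hMat x) *ᵥ z) (Sum.inl i)
      = exp (c i) * (z (Sum.inl i) + x i * z (Sum.inr ())) := by
  rw [← mulVec_mulVec, expDiag, mulVec_diagonal, hMat]
  simp [mulVec, dotProduct, Matrix.one_apply]

theorem expDiag_mul_hMat_mulVec_inr (c : Fin d → ℝ) (s : ℝ) (x : EuclideanSpace ℝ (Fin d))
    (z : Fin d ⊕ Unit → ℝ) : ((expDiag c s * hMat x) *ᵥ z) (Sum.inr ())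
      = exp (-s) * z (Sum.inr ()) := by
  rw [← mulVec_mulVec, expDiag, mulVec_diagonal, hMat]
  simp [mulVec, dotProduct]

theorem aMat_eq (s : ℝ) : aMat w s = expDiag (fun i => w i * s) s := rfl

theorem bMat_mul_aMat (s t : ℝ) (n : ℕ) :
    bMat w ℓ t n * aMat w s = expDiag (fun i => w i * s + bet ℓ w (n * t) i) s := by
  rw [bMat, aMat, diagonal_mul_diagonal, expDiag]
  congr 1
  funext k
  rcases k with i | _
  · simp only [Sum.elim_inl, bet, theta]
    rw [add_comm, exp_add]
    split_ifs
    · congr 2; ring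
    · rfl
  · simp

theorem mem_latticeOf_iff {c : Fin d → ℝ} {s : ℝ} {x : EuclideanSpace ℝ (Fin d)}
    {v : EuclideanSpace ℝ (Fin d ⊕ Unit)} : v ∈ latticeOf (expDiag c s * hMat x) ↔
      ∃ (a : Fin d → ℤ) (b : ℤ), (∀ i, v (Sum.inl i) = exp (c i) * (a i + x i * b)) ∧
        v (Sum.inr ()) = exp (-s) * b := by
  constructor
  · rintro ⟨z, rfl⟩
    exact ⟨fun i => z (Sum.inl i), z (Sum.inr ()),
      fun i => expDiag_mul_hMat_mulVec_inl c s x _ i, expDiag_mul_hMat_mulVec_inr c s x _⟩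
  · rintro ⟨a, b, h1, h2⟩
    refine ⟨Sum.elim a fun _ => b, ?_⟩
    ext k
    rcases k with i | _
    · exact (h1 i).trans (expDiag_mul_hMat_mulVec_inl c s x
        (fun k => ((Sum.elim a (fun _ => b) k : ℤ) : ℝ)) i).symm
    · exact h2.trans (expDiag_mul_hMat_mulVec_inr c s x
        (fun k => ((Sum.elim a (fun _ => b) k : ℤ) : ℝ))).symm

theorem single_mem_latticeOf {c : Fin d → ℝ} {s : ℝ} {P : Fin d → ℤ} {Q : ℤ} (hQ : 0 < Q) :
    EuclideanSpace.single (Sum.inr ()) ((Q : ℝ) * exp (-s)) ∈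
      latticeOf (expDiag c s * hMat (ratVec P Q)) := by
  have hQ' : (Q : ℝ) ≠ 0 := by exact_mod_cast hQ.ne'
  refine mem_latticeOf_iff.2 ⟨-P, Q, fun i => ?_, ?_⟩
  · simp [div_mul_cancel₀ _ hQ']
  · simp [mul_comm]

theorem mem_LPrime {s : ℝ} {c : Fin d → ℝ} (hc : ∑ i, c i = s) {P : Fin d → ℤ} {Q : ℤ}
    (hPQ : IsCoprimeVec P Q) (h1 : exp s / 2 < Q) (h2 : (Q : ℝ) ≤ exp s) :
    latticeOf (expDiag c s * hMat (ratVec P Q)) ∈ LPrime d := by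
  have hs := exp_pos s
  have hQ : (0 : ℝ) < Q := by linarith
  have hQ' : 0 < Q := by exact_mod_cast hQ
  refine ⟨⟨_, det_expDiag_mul_hMat hc _, rfl⟩, Q * exp (-s), ?_, ?_, single_mem_latticeOf hQ', ?_, ?_⟩
  · rw [Real.exp_neg, ← div_eq_mul_inv, lt_div_iff₀ hs]; linarith
  · rw [Real.exp_neg, ← div_eq_mul_inv, div_le_one hs]; exact h2
  · intro h
    have h3 := congrArg (fun v : EuclideanSpace ℝ (Fin d ⊕ Unit) => v (Sum.inr ())) h
    simp only [PiLp.single_apply, if_true, PiLp.zero_apply] at h3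
    have := mul_pos hQ (exp_pos (-s))
    linarith
  · intro n hn hmem
    obtain ⟨a, b, h3, h4⟩ := mem_latticeOf_iff.1 hmem
    have hn0 : (n : ℝ) ≠ 0 := by positivity
    simp only [PiLp.smul_apply, PiLp.single_apply, if_true, smul_eq_mul] at h4
    have h5 : (Q : ℝ) = n * b := by
      have h6 : (n : ℝ)⁻¹ * (Q : ℝ) = b := by
        refine mul_right_cancel₀ (exp_pos (-s)).ne' ?_
        linarith
      rw [← h6]; field_simp
    have h6 : ∀ i, (P i : ℝ) = n * (-a i) := fun i => by
      have h7 := h3 i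
      simp only [PiLp.smul_apply, PiLp.single_apply, reduceCtorEq, if_false, smul_zero,
        ratVec_apply] at h7
      have h8 : (a i : ℝ) + P i / Q * b = 0 := by
        rcases mul_eq_zero.1 h7.symm with h | h
        · exact absurd h (exp_pos _).ne'
        · exact h
      have h9 : (P i : ℝ) / Q * b = P i / n := by
        rw [h5]
        have hb : (b : ℝ) ≠ 0 := by
          rintro hb; rw [hb, mul_zero] at h5; exact hQ.ne' h5
        field_simp
      rw [h9] at h8
      field_simp at h8
      linarith
    have h5' : Q = n * b := by exact_mod_cast h5
    have h6' : ∀ i, P i = n * (-a i) := fun i => by exact_mod_cast h6 i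
    obtain ⟨x, y, hxy⟩ := hPQ
    have h7 : (n : ℤ) ∣ 1 := by
      rw [← hxy]
      refine dvd_add (Finset.dvd_sum fun i _ => ?_) ?_
      · rw [h6' i]; exact Dvd.dvd.mul_left (Dvd.intro _ rfl) _
      · rw [h5']; exact Dvd.dvd.mul_left (Dvd.intro _ rfl) _
    have h8 := Int.le_of_dvd one_pos h7
    omega

/-- A dual vector is determined by its integer values `a i` on the vectors `e^{c_i} e_i` and `b` on
`Q e^{-s} e_{d+1}`. If `b ≠ 0`, its last coordinate is at least `1` in absolute value since `Q ≤
e^s`. If `b = 0`, integrality on the remaining generator says `Q ∣ a · P`, and the avoided box gives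
a coordinate of size at least `η`. -/
theorem mem_KStar {s η : ℝ} {c : Fin d → ℝ} (hc : ∑ i, c i = s) {P : Fin d → ℤ} {Q : ℤ}
    (hQ : 0 < Q) (h2 : (Q : ℝ) ≤ exp s) (hη : η ≤ 1) (h : Avoid P Q fun i => η * exp (c i)) :
    latticeOf (expDiag c s * hMat (ratVec P Q)) ∈ KStar (Fin d ⊕ Unit) η := by
  have hQ' : (0 : ℝ) < Q := by exact_mod_cast hQ
  refine ⟨⟨_, det_expDiag_mul_hMat hc _, rfl⟩, fun φ hφ hφ0 => ?_⟩
  set e : Fin d ⊕ Unit → EuclideanSpace ℝ (Fin d ⊕ Unit) := fun k => EuclideanSpace.single k 1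
    with he
  have hφv : ∀ v, φ v = ∑ k, v k * φ (e k) := fun v => by
    have h3 := (EuclideanSpace.basisFun (Fin d ⊕ Unit) ℝ).sum_repr v
    conv_lhs => rw [← h3]
    rw [map_sum]
    exact Finset.sum_congr rfl fun k _ => by simp [he]
  have hle : ∀ k, |φ (e k)| ≤ ‖φ‖ := fun k => by
    have := φ.le_opNorm (e k)
    simpa [he] using this
  have hsingle : ∀ k y, φ (EuclideanSpace.single k y) = y * φ (e k) := fun k y => by
    have h3 : EuclideanSpace.single k y = y • e k := by
      ext l
      simp [he, PiLp.single_apply]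
    rw [h3, map_smul, smul_eq_mul]
  have hcoord : ∀ i, ∃ m : ℤ, exp (c i) * φ (e (Sum.inl i)) = m := fun i => by
    have hm : EuclideanSpace.single (Sum.inl i) (exp (c i)) ∈
        latticeOf (expDiag c s * hMat (ratVec P Q)) := by
      refine mem_latticeOf_iff.2 ⟨Pi.single i 1, 0, fun j => ?_, by simp⟩
      by_cases hij : j = i
      · subst hij; simp
      · simp [hij]
    obtain ⟨m, hm'⟩ := hφ _ hm
    exact ⟨m, (hsingle _ _).symm.trans hm'⟩
  choose a ha using hcoord
  obtain ⟨b, hb⟩ := hφ _ (single_mem_latticeOf (c := c) (s := s) (P := P) hQ)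
  have hb' : Q * exp (-s) * φ (e (Sum.inr ())) = b :=
    (hsingle _ _).symm.trans hb
  by_cases hb0 : b = 0
  · have hzero : φ (e (Sum.inr ())) = 0 := by
      rw [hb0, Int.cast_zero] at hb'
      exact (mul_eq_zero.1 hb').resolve_left (by have := exp_pos (-s); positivity)
    have hmem : a ∈ annLattice P Q := by
      obtain ⟨m, hm⟩ := hφ _ (mem_latticeOf_iff.2 ⟨0, 1, fun i => rfl, rfl⟩ :
        WithLp.toLp 2 (Sum.elim (fun i => exp (c i) * (((0 : Fin d → ℤ) i : ℝ)
          + ratVec P Q i * (1 : ℤ))) fun _ => exp (-s) * (1 : ℤ)) ∈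
          latticeOf (expDiag c s * hMat (ratVec P Q)))
      rw [hφv, Fintype.sum_sum_type] at hm
      simp only [Sum.elim_inl, Sum.elim_inr, Finset.univ_unique, Finset.sum_singleton,
        PUnit.default_eq_unit, hzero, mul_zero, add_zero, Pi.zero_apply, Int.cast_zero, zero_add,
        ratVec_apply, Int.cast_one, mul_one] at hm
      refine ⟨m, ?_⟩
      have h3 : ((a ⬝ᵥ P : ℤ) : ℝ) = ((Q * m : ℤ) : ℝ) := by
        rw [dotProduct]
        push_cast
        rw [← hm, Finset.mul_sum]
        refine Finset.sum_congr rfl fun i _ => ?_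
        rw [← ha i]
        field_simp
      exact_mod_cast h3
    have ha0 : a ≠ 0 := by
      rintro rfl
      refine hφ0 (ContinuousLinearMap.ext fun v => ?_)
      rw [hφv, Fintype.sum_sum_type]
      have h4 : ∀ i, φ (e (Sum.inl i)) = 0 := fun i => by
        have h5 := ha i
        simp only [Pi.zero_apply, Int.cast_zero] at h5
        exact (mul_eq_zero.1 h5).resolve_left (exp_pos _).ne'
      simp [h4, hzero]
    obtain ⟨i, hi⟩ := h a hmem ha0
    rw [← ha i, abs_mul, abs_of_pos (exp_pos _), mul_comm] at hi
    exact (lt_of_mul_lt_mul_right hi (exp_pos _).le).le.trans (hle _)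
  · have h3 : (1 : ℝ) ≤ |(b : ℝ)| := by exact_mod_cast Int.one_le_abs hb0
    rw [← hb', abs_mul, abs_of_pos (mul_pos hQ' (exp_pos _))] at h3
    have h4 : Q * exp (-s) ≤ 1 := by
      rw [Real.exp_neg, ← div_eq_mul_inv, div_le_one (exp_pos _)]; exact h2
    have h5 := hle (Sum.inr ())
    have h6 := abs_nonneg (φ (e (Sum.inr ())))
    nlinarith

theorem IsSon.mem_sons (hw : IsWeight ℓ w ω) {ε r t : ℝ} {n : ℕ} {P : Fin d → ℤ} {Q : ℤ}
    {V : (Fin d → ℤ) × ℤ} (hε : 0 < ε) (hε1 : ε ≤ 1) (hr : r ≤ 1)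
    (h : IsSon ℓ w ω ε r t n P Q V) : ratVec V.1 V.2 ∈ sons w ℓ ε r t n (ratVec P Q) := by
  have hc : ∑ i, w i * tSeq d ℓ t (n + 1) = tSeq d ℓ t (n + 1) := by
    rw [← Finset.sum_mul, hw.sum_eq, one_mul]
  have hc' : ∑ i, (w i * tSeq d ℓ t (n + 1) + bet ℓ w ((n + 1 : ℕ) * t) i) = tSeq d ℓ t (n + 1) := by
    rw [Finset.sum_add_distrib, hc, hw.sum_bet, add_zero]
  refine ⟨h.close, ?_, ?_, ?_⟩
  · rw [aMat_eq]; exact mem_LPrime hc h.good.coprime h.lt_den h.good.Q_le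
  · rw [aMat_eq]
    refine mem_KStar hc h.good.Q_pos h.good.Q_le ?_ h.good.avoid_cube
    have h1 : epsSeq ε (n + 1) ≤ 1 :=
      (div_le_self hε.le (by push_cast; linarith [(n.cast_nonneg : (0 : ℝ) ≤ n)])).trans hε1
    exact pow_le_one₀ (by unfold epsSeq; positivity) h1
  · rw [bMat_mul_aMat]
    refine mem_KStar hc' h.good.Q_pos h.good.Q_le hr ?_
    have := h.avoid
    push_cast
    exact this

theorem tSeq_mono {t : ℝ} (ht : 0 ≤ t) : Monotone (tSeq d ℓ t) :=
  monotone_nat_of_le_succ fun n => by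
    rw [tSeq]
    have := one_le_xi d ℓ
    have : 0 ≤ xi d ℓ * ((n : ℝ) + 1) * t := by positivity
    linarith

theorem one_add_le_tSeq {t : ℝ} (ht : 1 ≤ t) (n : ℕ) : 1 + n ≤ tSeq d ℓ t n := by
  induction n with
  | zero => simp [tSeq]
  | succ n ih =>
    rw [tSeq]
    have h1 := one_le_xi d ℓ
    have h2 : 1 ≤ xi d ℓ * ((n : ℝ) + 1) * t := by
      have h3 : (1 : ℝ) ≤ (n : ℝ) + 1 := by linarith [(n.cast_nonneg : (0 : ℝ) ≤ n)]
      exact one_le_mul_of_one_le_of_one_le (one_le_mul_of_one_le_of_one_le h1 h3) ht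
    push_cast; linarith

/-- Only the vectors `s e_{d+1}` and the boxes `beta` matter: the former provide a denominator `q ≤
e^{t_n}`, the latter give `|q x_i - p_i| ≤ ε_n e^{-w_i t_{n+1}}`. -/
theorem fractal_subset_sing (hw : IsWeight ℓ w ω) {ε r t : ℝ} (hε : 0 < ε) (hε1 : ε ≤ 1)
    (ht : 1 ≤ t) : fractal w ℓ ε r t ⊆ Sing w := by
  intro x hx η hη
  simp only [fractal, Set.mem_iUnion, Set.mem_iInter] at hx
  obtain ⟨τ, ⟨-, hτ⟩, hx⟩ := hx
  obtain ⟨n₀, hn₀⟩ := exists_nat_gt (ε / η)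
  have hmono := tSeq_mono (d := d) (ℓ := ℓ) (t := t) (by linarith)
  have hlow := one_add_le_tSeq (d := d) (ℓ := ℓ) ht
  refine ⟨exp (tSeq d ℓ t (n₀ + 1)), ?_, fun T hT => ?_⟩
  · refine one_lt_exp_iff.2 ?_
    have := hlow (n₀ + 1)
    have : (0 : ℝ) ≤ (n₀ + 1 : ℕ) := Nat.cast_nonneg _
    linarith
  have hT0 : 0 < T := (exp_pos _).trans hT
  have hex : ∃ m, T ≤ exp (tSeq d ℓ t m) := by
    obtain ⟨m, hm⟩ := exists_nat_gt (log T)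
    refine ⟨m, ?_⟩
    rw [← exp_log hT0]
    exact exp_le_exp.2 (by linarith [hlow m])
  classical
  -- The vertex of height `m + 1` serves for all `T` between these two consecutive exponentials.
  obtain ⟨m, hm, hm'⟩ : ∃ m, n₀ ≤ m ∧ exp (tSeq d ℓ t (m + 1)) < T ∧ T ≤ exp (tSeq d ℓ t (m + 2)) := by
    have h1 := Nat.find_spec hex
    have h2 : n₀ + 1 < Nat.find hex := by
      by_contra! h
      have := exp_le_exp.2 (hmono h)
      linarith
    refine ⟨Nat.find hex - 2, by omega, ?_, ?_⟩
    · have := Nat.find_min hex (m := Nat.find hex - 2 + 1) (by omega)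
      exact not_le.1 this
    · rwa [show Nat.find hex - 2 + 2 = Nat.find hex by omega]
  obtain ⟨hT1, hT2⟩ := hm'
  have hL := (hτ m).2.1
  rw [aMat_eq] at hL
  obtain ⟨-, s, hs1, hs2, hprim⟩ := hL
  obtain ⟨a, q, ha, hq⟩ := mem_latticeOf_iff.1 hprim.1
  simp only [PiLp.single_apply, if_true, reduceCtorEq, if_false] at ha hq
  have hqs : (q : ℝ) = s * exp (tSeq d ℓ t (m + 1)) := by
    rw [hq, Real.exp_neg]; field_simp
  have hq0 : (0 : ℝ) < q := by rw [hqs]; exact mul_pos (by linarith) (exp_pos _)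
  have hqle : (q : ℝ) ≤ exp (tSeq d ℓ t (m + 1)) := by
    rw [hqs]; exact mul_le_of_le_one_left (exp_pos _).le hs2
  refine ⟨fun i => -a i, q, fun i => ?_, by exact_mod_cast hq0, hqle.trans_lt hT1⟩
  have hai : (a i : ℝ) + τ (m + 1) i * q = 0 := by
    rcases mul_eq_zero.1 (ha i).symm with h | h
    · exact absurd h (exp_pos _).ne'
    · exact h
  have hwi := hw.pos i
  have hw1 : w i ≤ 1 := (hw.le_omega i).trans hw.omega_lt_one.le
  have hmpos : (0 : ℝ) < (m + 1 : ℕ) := by positivity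
  have heps : epsSeq ε (m + 1) < η := by
    unfold epsSeq
    rw [div_lt_iff₀ hmpos]
    rw [div_lt_iff₀ hη] at hn₀
    have : (n₀ : ℝ) ≤ (m + 1 : ℕ) := by exact_mod_cast hm.trans (Nat.le_succ m)
    nlinarith
  have heps0 : 0 < epsSeq ε (m + 1) := by unfold epsSeq; positivity
  have heps1 : epsSeq ε (m + 1) ≤ 1 :=
    (div_le_self hε.le (by push_cast; linarith [(m.cast_nonneg : (0 : ℝ) ≤ m)])).trans hε1
  have hxi : |τ (m + 1) i - x i| ≤
      epsSeq ε (m + 1) * exp (-w i * tSeq d ℓ t (m + 2) - tSeq d ℓ t (m + 1)) := hx (m + 1) i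
  have h1 : |(q : ℝ) * x i - ((-a i : ℤ) : ℝ)| ≤ epsSeq ε (m + 1) * exp (-w i * tSeq d ℓ t (m + 2)) := by
    have h2 : (q : ℝ) * x i - ((-a i : ℤ) : ℝ) = -(q * (τ (m + 1) i - x i)) := by
      push_cast; linarith
    rw [h2, abs_neg, abs_mul, abs_of_pos hq0]
    calc (q : ℝ) * |τ (m + 1) i - x i| ≤ exp (tSeq d ℓ t (m + 1)) *
          (epsSeq ε (m + 1) * exp (-w i * tSeq d ℓ t (m + 2) - tSeq d ℓ t (m + 1))) := by
          gcongr
      _ = epsSeq ε (m + 1) * exp (-w i * tSeq d ℓ t (m + 2)) := by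
          rw [mul_left_comm, ← exp_add]; ring_nf
  have h1w : 1 ≤ 1 / w i := (one_le_div hwi).2 hw1
  calc |(q : ℝ) * x i - ((-a i : ℤ) : ℝ)| ^ (1 / w i)
      ≤ (epsSeq ε (m + 1) * exp (-w i * tSeq d ℓ t (m + 2))) ^ (1 / w i) :=
        rpow_le_rpow (abs_nonneg _) h1 (by positivity)
    _ = epsSeq ε (m + 1) ^ (1 / w i) * exp (-tSeq d ℓ t (m + 2)) := by
        rw [mul_rpow heps0.le (exp_pos _).le, ← exp_mul]
        congr 2
        field_simp
    -- The base is at most `1` and the exponent `1 / w i` is at least `1`.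
    _ ≤ epsSeq ε (m + 1) ^ (1 : ℝ) * exp (-tSeq d ℓ t (m + 2)) := by
        gcongr ?_ * _
        exact rpow_le_rpow_of_exponent_ge heps0 heps1 h1w
    _ = epsSeq ε (m + 1) / exp (tSeq d ℓ t (m + 2)) := by
        rw [rpow_one, Real.exp_neg, div_eq_mul_inv]
    _ ≤ epsSeq ε (m + 1) / T := by gcongr
    _ < η / T := by gcongr

end WeightedSingular
end

/-! ### Mass distribution on the paths of a tree. -/

noncomputable section
namespace WeightedSingular
open MeasureTheory Filter Topology
open scoped ENNReal

/-- A tree in which every vertex of height `n` has at least `N n` sons contains a tree in which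
these numbers are exact. The paths of the latter are the points of a product space. -/
theorem exists_paths {α : Type*} {Vert : ℕ → α → Prop} {Son : ℕ → α → α → Prop} {root : α}
    (h0 : Vert 0 root) {N : ℕ → ℕ}
    (h : ∀ n V, Vert n V → ∃ F : Finset α, N n ≤ F.card ∧ ∀ V' ∈ F, Son n V V')
    (hson : ∀ n V V', Son n V V' → Vert (n + 1) V') :
    ∃ path : (∀ n, Fin (N n)) → ℕ → α, (∀ ω, path ω 0 = root) ∧ (∀ ω n, Vert n (path ω n)) ∧
      (∀ ω n, Son n (path ω n) (path ω (n + 1))) ∧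
      (∀ ω ω' n, (∀ k < n, ω k = ω' k) → path ω n = path ω' n) ∧
      ∀ ω n, Function.Injective fun j => path (Function.update ω n j) (n + 1) := by
  have h' : ∀ n V, Vert n V → ∃ e : Fin (N n) → α, Function.Injective e ∧ ∀ j, Son n V (e j) := by
    intro n V hV
    obtain ⟨F, hF, hF'⟩ := h n V hV
    -- Surplus sons are discarded, so that paths form a product of finite sets.
    obtain ⟨F₁, hF₁, hcard⟩ := Finset.exists_subset_card_eq hF
    have e := (F₁.equivFinOfCardEq hcard).symm
    exact ⟨fun j => e j, fun i j hij => e.injective (Subtype.ext hij),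
      fun j => hF' _ (hF₁ (e j).2)⟩
  choose e he hes using h'
  let p : (∀ n, Fin (N n)) → ∀ n, {V // Vert n V} := fun ω n =>
    Nat.rec ⟨root, h0⟩ (fun n V => ⟨e n V.1 V.2 (ω n), hson _ _ _ (hes n V.1 V.2 (ω n))⟩) n
  have hagree : ∀ (ω ω' : ∀ n, Fin (N n)) n, (∀ k < n, ω k = ω' k) → p ω n = p ω' n := by
    intro ω ω' n
    induction n with
    | zero => intro _; rfl
    | succ n ih =>
      intro hk
      have h1 := ih fun k hk' => hk k (hk'.trans (Nat.lt_succ_self n))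
      have h2 := hk n (Nat.lt_succ_self n)
      change (⟨e n (p ω n).1 (p ω n).2 (ω n), _⟩ : {V // Vert (n + 1) V})
        = ⟨e n (p ω' n).1 (p ω' n).2 (ω' n), _⟩
      simp only [h1, h2]
  refine ⟨fun ω n => (p ω n).1, fun ω => rfl, fun ω n => (p ω n).2, fun ω n => hes n _ _ _,
    fun ω ω' n hk => congrArg Subtype.val (hagree ω ω' n hk), fun ω n i j hij => ?_⟩
  have h1 : ∀ j, p (Function.update ω n j) n = p ω n := fun j =>
    hagree _ _ n fun k hk => Function.update_of_ne hk.ne _ _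
  change e n (p (Function.update ω n i) n).1 (p (Function.update ω n i) n).2
      (Function.update ω n i n) = e n (p (Function.update ω n j) n).1
      (p (Function.update ω n j) n).2 (Function.update ω n j n) at hij
  simp only [h1, Function.update_self] at hij
  exact he n _ _ hij

/-- The paths through vertices with a given property are covered by few cylinders. -/
theorem exists_finset_cylinders {α : Type*} {N : ℕ → ℕ} (hN : ∀ n, 0 < N n) (path : (∀ n, Fin (N n)) → ℕ → α)
    (hagree : ∀ ω ω' n, (∀ k < n, ω k = ω' k) → path ω n = path ω' n)
    (Meets : ℕ → α → Prop) {M : ℕ → ℝ}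
    (hM : ∀ ω n (J : Finset (Fin (N n))),
      (∀ j ∈ J, Meets (n + 1) (path (Function.update ω n j) (n + 1))) → (J.card : ℝ) ≤ M n)
    (m : ℕ) : ∃ A : Finset (∀ n, Fin (N n)), (A.card : ℝ) ≤ ∏ k ∈ Finset.range m, M k ∧
      ∀ ω, (∀ n, Meets n (path ω n)) → ∃ c ∈ A, ∀ k < m, ω k = c k := by
  classical
  induction m with
  | zero =>
    exact ⟨{fun n => ⟨0, hN n⟩}, by simp,
      fun ω _ => ⟨_, Finset.mem_singleton_self _, fun k hk => absurd hk (Nat.not_lt_zero k)⟩⟩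
  | succ m ih =>
    obtain ⟨A, hA, hA'⟩ := ih
    set J : (∀ n, Fin (N n)) → Finset (Fin (N m)) := fun c =>
      Finset.univ.filter fun j => Meets (m + 1) (path (Function.update c m j) (m + 1)) with hJ
    refine ⟨A.biUnion fun c => (J c).image (Function.update c m), ?_, fun ω hω => ?_⟩
    · rw [Finset.prod_range_succ]
      have h1 : ∀ c ∈ A, (((J c).image (Function.update c m)).card : ℝ) ≤ M m := fun c _ =>
        (Nat.cast_le.2 Finset.card_image_le).trans
          (hM c m (J c) fun j hj => (Finset.mem_filter.1 hj).2)
      have h2 : 0 ≤ M m := by simpa using hM (fun n => ⟨0, hN n⟩) m ∅ (by simp)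
      have h3 : ((A.biUnion fun c => (J c).image (Function.update c m)).card : ℝ)
          ≤ ∑ c ∈ A, M m := by
        refine le_trans ?_ (Finset.sum_le_sum h1)
        exact_mod_cast Finset.card_biUnion_le
      rw [Finset.sum_const, nsmul_eq_mul] at h3
      exact h3.trans (mul_le_mul_of_nonneg_right hA h2)
    · obtain ⟨c, hc, hck⟩ := hA' ω hω
      refine ⟨Function.update c m (ω m), ?_, fun k hk => ?_⟩
      · refine Finset.mem_biUnion.2 ⟨c, hc, Finset.mem_image_of_mem _ ?_⟩
        rw [hJ, Finset.mem_filter]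
        refine ⟨Finset.mem_univ _, ?_⟩
        rw [hagree (Function.update c m (ω m)) ω (m + 1)]
        · exact hω _
        · intro k hk
          rcases (Nat.lt_succ_iff.1 hk).lt_or_eq with h | rfl
          · rw [Function.update_of_ne h.ne, hck k h]
          · simp
      · rcases (Nat.lt_succ_iff.1 hk).lt_or_eq with h | rfl
        · rw [Function.update_of_ne h.ne, hck k h]
        · simp

/-- The mass distribution principle for the uniform measure on the paths of a tree. -/
theorem le_dimH_range {X : Type*} [MetricSpace X] [MeasurableSpace X] [BorelSpace X]
    {N : ℕ → ℕ} (hN : ∀ n, 0 < N n) {x : (∀ n, Fin (N n)) → X} (hx : Measurable x)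
    {q C ρ₀ : ℝ} (hq : 0 < q) (hC : 0 < C) (hρ₀ : 0 < ρ₀)
    (h : ∀ y ρ, 0 < ρ → ρ ≤ ρ₀ → ∃ (m : ℕ) (A : Finset (∀ n, Fin (N n))),
      (A.card : ℝ) ≤ C * ρ ^ q * ∏ k ∈ Finset.range m, (N k : ℝ) ∧
      ∀ ω, dist (x ω) y ≤ ρ → ∃ c ∈ A, ∀ k < m, ω k = c k) :
    ENNReal.ofReal q ≤ dimH (Set.range x) := by
  have hne : ∀ n, Nonempty (Fin (N n)) := fun n => ⟨⟨0, hN n⟩⟩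
  set u : ∀ n, Measure (Fin (N n)) := fun n => ProbabilityTheory.uniformOn Set.univ with hu
  have hup : ∀ n, IsProbabilityMeasure (u n) := fun n =>
    ProbabilityTheory.isProbabilityMeasure_uniformOn Set.finite_univ Set.univ_nonempty
  -- Each cylinder of length `m` has mass `∏ 1 / N k`, so the count of cylinders in the hypothesis
  -- bounds the mass of a ball.
  set μ := Measure.infinitePi u with hμ
  have hcyl : ∀ (c : ∀ n, Fin (N n)) m, μ {ω | ∀ k < m, ω k = c k}
      = ∏ k ∈ Finset.range m, ((N k : ℝ≥0∞))⁻¹ := fun c m => by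
    have h1 : {ω : ∀ n, Fin (N n) | ∀ k < m, ω k = c k}
        = Set.pi (Finset.range m) fun k => {c k} := by
      ext ω; simp [Set.mem_pi]
    rw [h1, hμ, Measure.infinitePi_pi _ fun i _ => measurableSet_singleton _]
    refine Finset.prod_congr rfl fun k _ => ?_
    rw [hu, ProbabilityTheory.uniformOn_univ]
    simp
  set ν := μ.map x with hν
  have hball : ∀ y ρ, 0 < ρ → ρ ≤ ρ₀ → ν (Metric.closedBall y ρ) ≤ ENNReal.ofReal (C * ρ ^ q) := by
    intro y ρ hρ hρ'
    obtain ⟨m, A, hA, hA'⟩ := h y ρ hρ hρ'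
    rw [hν, Measure.map_apply hx Metric.isClosed_closedBall.measurableSet]
    have h1 : x ⁻¹' Metric.closedBall y ρ ⊆ ⋃ c ∈ A, {ω | ∀ k < m, ω k = c k} := fun ω hω => by
      obtain ⟨c, hc, hk⟩ := hA' ω hω
      exact Set.mem_biUnion hc hk
    refine (measure_mono h1).trans ((measure_biUnion_finset_le _ _).trans ?_)
    simp only [hcyl]
    rw [Finset.sum_const, nsmul_eq_mul]
    have h2 : ∏ k ∈ Finset.range m, ((N k : ℝ≥0∞))⁻¹
        = ENNReal.ofReal (∏ k ∈ Finset.range m, (N k : ℝ))⁻¹ := by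
      rw [← Finset.prod_inv_distrib, ENNReal.ofReal_prod_of_nonneg fun k _ => by positivity]
      refine Finset.prod_congr rfl fun k _ => ?_
      rw [ENNReal.ofReal_inv_of_pos (by exact_mod_cast hN k), ENNReal.ofReal_natCast]
    have hpos : 0 < ∏ k ∈ Finset.range m, (N k : ℝ) :=
      Finset.prod_pos fun k _ => by exact_mod_cast hN k
    rw [h2, ← ENNReal.ofReal_natCast, ← ENNReal.ofReal_mul (Nat.cast_nonneg _)]
    refine ENNReal.ofReal_le_ofReal ?_
    rw [← div_eq_mul_inv, div_le_iff₀ hpos]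
    exact hA
  have hle : (ENNReal.ofReal C)⁻¹ • ν ≤ Measure.hausdorffMeasure q := by
    refine Measure.le_hausdorffMeasure q _ (ENNReal.ofReal ρ₀) (ENNReal.ofReal_pos.2 hρ₀)
      fun s hs => ?_
    rw [Measure.smul_apply, smul_eq_mul, mul_comm, ← div_eq_mul_inv]
    refine ENNReal.div_le_of_le_mul ?_
    rcases s.eq_empty_or_nonempty with rfl | ⟨y, hy⟩
    · simp
    set ρ := (Metric.ediam s).toReal with hρ
    have htop : Metric.ediam s ≠ ⊤ := ne_top_of_le_ne_top ENNReal.ofReal_ne_top hs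
    have hρs : ENNReal.ofReal ρ = Metric.ediam s := ENNReal.ofReal_toReal htop
    have hsub : ∀ ρ', ρ ≤ ρ' → s ⊆ Metric.closedBall y ρ' := fun ρ' h1 z hz => by
      have h2 := Metric.edist_le_ediam_of_mem hz hy
      rw [← hρs, edist_dist] at h2
      exact ((ENNReal.ofReal_le_ofReal_iff ENNReal.toReal_nonneg).1 h2).trans h1
    have hρρ₀ : ρ ≤ ρ₀ := ENNReal.toReal_le_of_le_ofReal hρ₀.le hs
    -- A set of diameter `0` lies in arbitrarily small balls, whose masses tend to `0` because `q >
    -- 0`.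
    rcases (ENNReal.toReal_nonneg : 0 ≤ ρ).eq_or_lt with h0 | h0
    · have h1 : ν s ≤ 0 := by
        have h2 : Tendsto (fun ρ' : ℝ => ENNReal.ofReal (C * ρ' ^ q)) (𝓝[>] 0)
            (𝓝 (ENNReal.ofReal (C * 0 ^ q))) := by
          refine ENNReal.tendsto_ofReal (Tendsto.const_mul _ ?_)
          exact ((Real.continuousAt_rpow_const 0 q (Or.inr hq.le)).tendsto).mono_left
            nhdsWithin_le_nhds
        rw [Real.zero_rpow hq.ne', mul_zero, ENNReal.ofReal_zero] at h2
        refine ge_of_tendsto h2 ?_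
        filter_upwards [Ioc_mem_nhdsGT hρ₀] with ρ' hρ'
        exact (measure_mono (hsub ρ' (h0.symm.le.trans hρ'.1.le))).trans (hball y ρ' hρ'.1 hρ'.2)
      exact h1.trans zero_le
    · refine (measure_mono (hsub ρ le_rfl)).trans ((hball y ρ h0 hρρ₀).trans (le_of_eq ?_))
      rw [ENNReal.ofReal_mul hC.le, mul_comm, ← hρs, ENNReal.ofReal_rpow_of_pos h0]
  have hone : 1 ≤ ν (Set.range x) := by
    refine le_trans ?_ (Measure.le_map_apply hx.aemeasurable _)
    rw [Set.preimage_range, measure_univ]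
  have hmain := hle (Set.range x)
  rw [Measure.smul_apply, smul_eq_mul] at hmain
  have hne0 : Measure.hausdorffMeasure q (Set.range x) ≠ 0 := by
    intro h0
    rw [h0] at hmain
    have h1 : (ENNReal.ofReal C)⁻¹ * ν (Set.range x) = 0 := le_antisymm hmain zero_le
    rcases mul_eq_zero.1 h1 with h2 | h2
    · exact ENNReal.ofReal_ne_top (ENNReal.inv_eq_zero.1 h2)
    · rw [h2] at hone; simp at hone
  have := le_dimH_of_hausdorffMeasure_ne_zero (d := q.toNNReal) (s := Set.range x)
    (by rwa [Real.coe_toNNReal q hq.le])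
  exact this

end WeightedSingular
end

/-! ### Vertices close to a given point. -/

noncomputable section
namespace WeightedSingular
open Matrix Real Filter

variable {d ℓ : ℕ} {w : Fin d → ℝ} {ω : ℝ}

/-- Bound for the number of vertices in a small cell. -/
def multConst (d : ℕ) (r : ℝ) : ℕ := (2 * ⌊d * (d ^ d / r ^ (d - 1) : ℝ)⌋₊ + 1) ^ d

theorem card_Icc_neg_floor (B : ℝ) (hB : 0 ≤ B) :
    (Finset.Icc (-⌊B⌋) ⌊B⌋).card = 2 * ⌊B⌋₊ + 1 := by
  rw [Int.card_Icc]
  have h1 : (⌊B⌋₊ : ℤ) = ⌊B⌋ := Int.natCast_floor_eq_floor hB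
  omega

/-- Few good rational vectors with denominators of the same size lie in a cell. -/
theorem card_le_multConst (hw : IsWeight ℓ w ω) {r t δ u D : ℝ} (hr : 0 < r)
    {F : Finset ((Fin d → ℤ) × ℤ)} (hF : ∀ V ∈ F, Good ℓ w ω r t δ u D V.1 V.2)
    (hden : ∀ V ∈ F, exp t / 2 < V.2)
    (hclose : ∀ V ∈ F, ∀ V' ∈ F, ∀ i, |(V.1 i : ℝ) / V.2 - V'.1 i / V'.2|
      ≤ exp (-((1 + w i) * t + bet ℓ w u i))) : F.card ≤ multConst d r := by
  rcases F.eq_empty_or_nonempty with rfl | ⟨V₀, hV₀⟩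
  · simp
  have hg := hF V₀ hV₀
  obtain ⟨H, hH1, hH2, hH3⟩ := hg.exists_frame_scale hw hr
  choose b hb using hH2
  set ρ : ℝ := d ^ d / r ^ (d - 1) with hρ
  have hρ0 : 0 ≤ ρ := by positivity
  -- The functionals `(H j, -b j)` vanish at `V₀`; on the vectors of a cell they take boundedly many
  -- integer values.
  set s : (Fin d → ℤ) × ℤ → Fin d → ℤ := fun V j => H j ⬝ᵥ V.1 - b j * V.2 with hs
  have hpos : ∀ V ∈ F, (0 : ℝ) < V.2 := fun V hV => by exact_mod_cast (hF V hV).Q_pos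
  have hsbound : ∀ V ∈ F, ∀ j, |(s V j : ℝ)| ≤ d * ρ := by
    intro V hV j
    have h1 : (s V j : ℝ) = V.2 * ∑ i, (H j i : ℝ) * ((V.1 i : ℝ) / V.2 - V₀.1 i / V₀.2) := by
      have h2 : (∑ i, (H j i : ℝ) * (V₀.1 i : ℝ)) = V₀.2 * b j := by
        have := hb j
        rw [dotProduct] at this
        exact_mod_cast this
      have h3 := (hpos V hV).ne'
      have h4 := (hpos V₀ hV₀).ne'
      have h5 : ∑ i, (H j i : ℝ) * ((V.1 i : ℝ) / V.2 - V₀.1 i / V₀.2)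
          = (∑ i, (H j i : ℝ) * V.1 i) / V.2 - (∑ i, (H j i : ℝ) * (V₀.1 i : ℝ)) / V₀.2 := by
        rw [Finset.sum_div, Finset.sum_div, ← Finset.sum_sub_distrib]
        exact Finset.sum_congr rfl fun i _ => by ring
      rw [h5, h2]
      simp only [hs, dotProduct]
      push_cast
      field_simp
    rw [h1, abs_mul, abs_of_pos (hpos V hV)]
    have h6 : ∀ i, |(H j i : ℝ) * ((V.1 i : ℝ) / V.2 - V₀.1 i / V₀.2)| ≤ ρ * exp (-t) := fun i => by
      have h7 := hH3 j i 0
      rw [abs_mul]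
      have h8 : |(H j i : ℝ)| ≤ ρ * exp (w i * t + bet ℓ w u i) := by
        have h9 : |(H j i : ℝ)| = exp (w i * t) * (exp (-(w i * (t + 0))) * |(H j i : ℝ)|) := by
          rw [← mul_assoc, ← exp_add]; simp
        rw [h9]
        refine (mul_le_mul_of_nonneg_left h7 (exp_pos _).le).trans (le_of_eq ?_)
        rw [mul_left_comm, ← exp_add]; ring_nf
      refine (mul_le_mul h8 (hclose V hV V₀ hV₀ i) (abs_nonneg _) (by positivity)).trans (le_of_eq ?_)
      rw [mul_assoc, ← exp_add]; ring_nf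
    calc V.2 * |∑ i, (H j i : ℝ) * ((V.1 i : ℝ) / V.2 - V₀.1 i / V₀.2)|
        ≤ exp t * ∑ _i : Fin d, ρ * exp (-t) := by
          refine mul_le_mul (hF V hV).Q_le ?_ (abs_nonneg _) (exp_pos _).le
          exact (Finset.abs_sum_le_sum_abs _ _).trans (Finset.sum_le_sum fun i _ => h6 i)
      _ = d * ρ * (exp t * exp (-t)) := by
          rw [Finset.sum_const, Finset.card_univ, Fintype.card_fin, nsmul_eq_mul]; ring
      _ = d * ρ := by rw [← exp_add]; simp
  have hinj : Set.InjOn s F := by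
    intro V hV V' hV' h
    obtain ⟨x, y, hxy⟩ := hg.coprime
    have h1 : H *ᵥ (fun i => V₀.2 * (V.1 i - V'.1 i) - (V.2 - V'.2) * V₀.1 i) = 0 := by
      funext j
      have h2 := congrFun h j
      simp only [hs] at h2
      have h3 : (H *ᵥ (fun i => V₀.2 * (V.1 i - V'.1 i) - (V.2 - V'.2) * V₀.1 i)) j
          = V₀.2 * (H j ⬝ᵥ V.1 - H j ⬝ᵥ V'.1) - (V.2 - V'.2) * (H j ⬝ᵥ V₀.1) := by
        simp only [mulVec, dotProduct, mul_sub, Finset.sum_sub_distrib, Finset.mul_sum]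
        congr 1
        · congr 1 <;> exact Finset.sum_congr rfl fun i _ => by ring
        · exact Finset.sum_congr rfl fun i _ => by ring
      rw [h3, hb j, Pi.zero_apply]
      linear_combination V₀.2 * h2
    have h4 := eq_zero_of_mulVec_eq_zero hH1 h1
    have h5 : ∀ i, V₀.2 * (V.1 i - V'.1 i) = (V.2 - V'.2) * V₀.1 i := fun i => by
      have := congrFun h4 i
      simp only [Pi.zero_apply] at this
      linarith
    have h6 : V.2 - V'.2 = V₀.2 * (∑ i, x i * (V.1 i - V'.1 i) + y * (V.2 - V'.2)) := by
      have h7 : V₀.2 * ∑ i, x i * (V.1 i - V'.1 i) = (V.2 - V'.2) * (x ⬝ᵥ V₀.1) := by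
        rw [dotProduct, Finset.mul_sum, Finset.mul_sum]
        refine Finset.sum_congr rfl fun i _ => ?_
        linear_combination x i * h5 i
      linear_combination (-(V.2 - V'.2)) * hxy - h7
    have h7 : V.2 - V'.2 = 0 := by
      -- Equal values make the difference of two vectors proportional to the primitive vector `V₀`.
      -- All denominators lie in `(e^t / 2, e^t]`, so their differences are too small for a nonzero
      -- multiple of `V₀.2`.
      refine Int.eq_zero_of_abs_lt_dvd ⟨_, h6⟩ ?_
      have h8 : |(V.2 : ℝ) - V'.2| < V₀.2 := by
        have e1 := hden V hV
        have e2 := hden V' hV'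
        have e3 := hden V₀ hV₀
        have e4 := (hF V hV).Q_le
        have e5 := (hF V' hV').Q_le
        rw [abs_lt]; constructor <;> linarith
      exact_mod_cast h8
    refine Prod.ext (funext fun i => ?_) (by linarith)
    have h9 := h5 i
    rw [h7, zero_mul] at h9
    have := (mul_eq_zero.1 h9).resolve_left hg.Q_pos.ne'
    linarith
  have hmaps : ∀ V ∈ F, s V ∈ Fintype.piFinset fun _ : Fin d => Finset.Icc (-⌊d * ρ⌋) ⌊d * ρ⌋ := by
    intro V hV
    rw [Fintype.mem_piFinset]
    intro j
    have h1 := abs_le.1 (hsbound V hV j)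
    rw [Finset.mem_Icc]
    constructor
    · have h2 : -(s V j) ≤ ⌊d * ρ⌋ := Int.le_floor.2 (by push_cast; linarith)
      linarith
    · exact Int.le_floor.2 h1.2
  refine (Finset.card_le_card_of_injOn s hmaps hinj).trans (le_of_eq ?_)
  rw [Fintype.card_piFinset, Finset.prod_const, Finset.card_univ, Fintype.card_fin,
    card_Icc_neg_floor _ (by positivity), multConst]

/-- Cut the box into cells of the size treated in `card_le_multConst` and apply that bound in each
cell. -/
theorem card_le_multConst_mul (hw : IsWeight ℓ w ω) {r t δ u D : ℝ} (hr : 0 < r)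
    {F : Finset ((Fin d → ℤ) × ℤ)} (hF : ∀ V ∈ F, Good ℓ w ω r t δ u D V.1 V.2)
    (hden : ∀ V ∈ F, exp t / 2 < V.2) {y a : Fin d → ℝ} (ha : ∀ i, 0 ≤ a i)
    (hy : ∀ V ∈ F, ∀ i, |(V.1 i : ℝ) / V.2 - y i| ≤ a i) :
    (F.card : ℝ) ≤ multConst d r *
      ∏ i, (2 * a i / exp (-((1 + w i) * t + bet ℓ w u i)) + 1) := by
  classical
  set c : Fin d → ℝ := fun i => exp (-((1 + w i) * t + bet ℓ w u i)) with hc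
  have hc0 : ∀ i, 0 < c i := fun i => exp_pos _
  set f : (Fin d → ℤ) × ℤ → Fin d → ℤ := fun V i => ⌊((V.1 i : ℝ) / V.2 - y i + a i) / c i⌋ with hf
  have hmaps : ∀ V ∈ F, f V ∈ Fintype.piFinset fun i => Finset.Icc 0 ⌊2 * a i / c i⌋ := by
    intro V hV
    rw [Fintype.mem_piFinset]
    intro i
    have h1 := abs_le.1 (hy V hV i)
    rw [Finset.mem_Icc]
    constructor
    · exact Int.floor_nonneg.2 (div_nonneg (by linarith) (hc0 i).le)
    · exact Int.floor_le_floor (div_le_div_of_nonneg_right (by linarith) (hc0 i).le)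
  have h1 := Finset.card_le_mul_card_image_of_maps_to hmaps (multConst d r) fun k _ => by
    refine card_le_multConst hw hr (fun V hV => hF V (Finset.mem_filter.1 hV).1)
      (fun V hV => hden V (Finset.mem_filter.1 hV).1) fun V hV V' hV' i => ?_
    have h2 : f V i = f V' i :=
      congrFun ((Finset.mem_filter.1 hV).2.trans (Finset.mem_filter.1 hV').2.symm) i
    have h3 := Int.abs_sub_lt_one_of_floor_eq_floor h2
    rw [← sub_div, abs_div, abs_of_pos (hc0 i), div_lt_one (hc0 i)] at h3
    have h4 : (V.1 i : ℝ) / V.2 - y i + a i - ((V'.1 i : ℝ) / V'.2 - y i + a i)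
      = (V.1 i : ℝ) / V.2 - V'.1 i / V'.2 := by ring
    rw [h4] at h3
    exact h3.le
  have h2 : ((Fintype.piFinset fun i => Finset.Icc 0 ⌊2 * a i / c i⌋).card : ℝ)
      ≤ ∏ i, (2 * a i / c i + 1) := by
    rw [Fintype.card_piFinset]
    push_cast
    refine Finset.prod_le_prod (fun i _ => Nat.cast_nonneg _) fun i _ => ?_
    rw [Int.card_Icc]
    have h3 : 0 ≤ 2 * a i / c i := div_nonneg (by linarith [ha i]) (hc0 i).le
    have h4 : 0 ≤ ⌊2 * a i / c i⌋ := Int.floor_nonneg.2 h3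
    have h5 : (((⌊2 * a i / c i⌋ + 1 - 0).toNat : ℤ) : ℝ) = ((⌊2 * a i / c i⌋ + 1 - 0 : ℤ) : ℝ) := by
      rw [Int.toNat_of_nonneg (by omega)]
    rw [Int.cast_natCast] at h5
    rw [h5]
    push_cast
    linarith [Int.floor_le (2 * a i / c i)]
  calc (F.card : ℝ) ≤ ((multConst d r * (Fintype.piFinset fun i =>
        Finset.Icc 0 ⌊2 * a i / c i⌋).card : ℕ) : ℝ) := by exact_mod_cast h1
    _ ≤ _ := by
      push_cast
      exact mul_le_mul_of_nonneg_left h2 (Nat.cast_nonneg _)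

/-- The exponent of the side of the cells of vertices of height `n + 1`. -/
def cellExp (ℓ : ℕ) (w : Fin d → ℝ) (t : ℝ) (n : ℕ) (i : Fin d) : ℝ :=
  (1 + w i) * tSeq d ℓ t (n + 1) + bet ℓ w (scaleU d ℓ t (n + 1)) i

/-- The exponent of the number of cells in a side of the box containing the sons of a vertex of
height `n`. -/
def gain (ℓ : ℕ) (w : Fin d → ℝ) (t : ℝ) (n : ℕ) (i : Fin d) : ℝ :=
  xi d ℓ * (n + 1) * t + bet ℓ w (scaleU d ℓ t (n + 1)) i

theorem gain_nonneg (hw : IsWeight ℓ w ω) {t : ℝ} (ht : 0 ≤ t) (n : ℕ) (i : Fin d) :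
    0 ≤ gain ℓ w t n i := by
  have h1 := scaleU_nonneg (d := d) (ℓ := ℓ) ht (n + 1)
  have h2 := scaleU_le (d := d) (ℓ := ℓ) (t := t) (n + 1)
  have h3 := hw.theta_pos
  have h4 := hw.theta_lt_one
  have h5 := hw.pos i
  have h6 := one_le_xi d ℓ
  push_cast at h2
  unfold gain bet
  split_ifs
  · nlinarith
  · positivity

/-- The number of sons of a vertex that are close to a given point. -/
theorem card_sons_near_le (hw : IsWeight ℓ w ω) {ε r t L : ℝ} (hε : 0 < ε) (hε1 : ε ≤ 1)
    (hr : 0 < r) (ht : 0 ≤ t) {n : ℕ} {P : Fin d → ℤ} {Q : ℤ} {F : Finset ((Fin d → ℤ) × ℤ)}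
    (hF : ∀ V ∈ F, IsSon ℓ w ω ε r t n P Q V) {y : Fin d → ℝ}
    (hy : ∀ V ∈ F, ∀ i, |(V.1 i : ℝ) / V.2 - y i| ≤ exp (-L) + exp (-cellExp ℓ w t n i)) :
    (F.card : ℝ) ≤ multConst d r * 5 ^ d * exp (xi d ℓ * (n + 1) * t) ^ d *
      exp (-∑ i, if cellExp ℓ w t n i ≤ L then gain ℓ w t n i else 0) := by
  have hε' : epsSeq ε (n + 1) ≤ 1 :=
    (div_le_self hε.le (by push_cast; linarith [(n.cast_nonneg : (0 : ℝ) ≤ n)])).trans hε1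
  have hε0 : 0 < epsSeq ε (n + 1) := by unfold epsSeq; positivity
  set T := tSeq d ℓ t (n + 1) with hT
  have hTn : T = tSeq d ℓ t n + xi d ℓ * (n + 1) * t := rfl
  set B : Fin d → ℝ := fun i => epsSeq ε (n + 1) * exp (-w i * T - tSeq d ℓ t n) with hB
  set c : Fin d → ℝ := fun i => exp (-cellExp ℓ w t n i) with hc
  have hc0 : ∀ i, 0 < c i := fun i => exp_pos _
  set small : Fin d → Prop := fun i => cellExp ℓ w t n i ≤ L with hsmall
  classical
  -- Where the cell is longer than `e^{-L}` the neighbourhood of `y` accounts for at most `5` cells,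
  -- which saves the factor `e^{gain}`; in the other coordinates the whole box of the sons is used.
  set a : Fin d → ℝ := fun i => if small i then exp (-L) + c i else B i with ha
  set z : Fin d → ℝ := fun i => if small i then y i else (P i : ℝ) / Q with hz
  have h1 := card_le_multConst_mul hw hr (fun V hV => (hF V hV).good)
    (fun V hV => (hF V hV).lt_den) (y := z) (a := a) (fun i => by
      simp only [ha]; split_ifs
      · have := hc0 i; positivity
      · positivity) (fun V hV i => by
      simp only [ha, hz]
      split_ifs
      · exact hy V hV i
      · rw [abs_sub_comm]; exact ((hF V hV).close i).le)
  replace h1 : (F.card : ℝ) ≤ multConst d r * ∏ i, (2 * a i / c i + 1) := h1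
  refine h1.trans ?_
  have h2 : ∀ i, 2 * a i / c i + 1 ≤
      5 * (exp (gain ℓ w t n i) * exp (-if small i then gain ℓ w t n i else 0)) := by
    intro i
    have hg := gain_nonneg hw ht n i
    simp only [ha]
    split_ifs with h
    · rw [← exp_add, add_neg_cancel, exp_zero]
      have h3 : exp (-L) ≤ c i := exp_le_exp.2 (neg_le_neg h)
      have h4 : 2 * (exp (-L) + c i) / c i ≤ 4 := by
        rw [div_le_iff₀ (hc0 i)]; linarith
      linarith
    · rw [neg_zero, exp_zero, mul_one]
      have h3 : B i / c i ≤ exp (gain ℓ w t n i) := by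
        rw [div_le_iff₀ (hc0 i)]
        simp only [hB, hc]
        rw [← exp_add]
        refine (mul_le_of_le_one_left (exp_pos _).le hε').trans (exp_le_exp.2 ?_)
        rw [gain, cellExp, ← hT, hTn]
        linarith
      have h4 : 1 ≤ exp (gain ℓ w t n i) := one_le_exp hg
      rw [mul_div_assoc]
      linarith
  have h3 : ∏ i, (2 * a i / c i + 1) ≤
      ∏ i, 5 * (exp (gain ℓ w t n i) * exp (-if small i then gain ℓ w t n i else 0)) := by
    refine Finset.prod_le_prod (fun i _ => ?_) fun i _ => h2 i
    have h4 : 0 ≤ a i := by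
      simp only [ha]; split_ifs
      · have := hc0 i; positivity
      · positivity
    have := hc0 i
    positivity
  rw [mul_assoc, mul_assoc]
  refine mul_le_mul_of_nonneg_left (h3.trans (le_of_eq ?_)) (Nat.cast_nonneg _)
  rw [Finset.prod_mul_distrib, Finset.prod_mul_distrib, Finset.prod_const, Finset.card_univ,
    Fintype.card_fin, ← exp_sum, ← exp_sum, Finset.sum_neg_distrib]
  congr 2
  unfold gain
  rw [Finset.sum_add_distrib, hw.sum_bet, add_zero, Finset.sum_const, Finset.card_univ,
    Fintype.card_fin, nsmul_eq_mul, exp_nat_mul]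

end WeightedSingular
end

/-! ### The exponents of the dimension. -/

noncomputable section
namespace WeightedSingular
open Real Filter

variable {d ℓ : ℕ} {w : Fin d → ℝ} {ω : ℝ}

theorem tSeq_eq_sum (t : ℝ) (n : ℕ) :
    tSeq d ℓ t n = 1 + ∑ k ∈ Finset.range n, xi d ℓ * ((k : ℝ) + 1) * t := by
  induction n with
  | zero => simp [tSeq]
  | succ n ih => rw [Finset.sum_range_succ, tSeq, ih]; ring

/-- The slow start of `scaleU` costs only an amount independent of `n`, by `2 n ξ ≤ n² + ξ²`. -/
theorem le_scaleU_add {t : ℝ} (ht : 0 ≤ t) (n : ℕ) :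
    xi d ℓ * n * t ≤ scaleU d ℓ t n + xi d ℓ ^ 2 * t := by
  have h1 := one_le_xi d ℓ
  have h2 : (0 : ℝ) ≤ n := n.cast_nonneg
  unfold scaleU
  rw [← sub_le_iff_le_add, le_min_iff]
  constructor
  · have h3 : xi d ℓ * n - xi d ℓ ^ 2 ≤ (n : ℝ) * (n + 1) / 2 := by
      nlinarith [sq_nonneg ((n : ℝ) - xi d ℓ)]
    calc xi d ℓ * n * t - xi d ℓ ^ 2 * t = (xi d ℓ * n - xi d ℓ ^ 2) * t := by ring
      _ ≤ _ := by gcongr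
  · have : 0 ≤ xi d ℓ ^ 2 * t := by positivity
    linarith

/-- The rate of growth, in the `i`-th coordinate, of the number of vertices close to a point. -/
def coordDim (ℓ : ℕ) (w : Fin d → ℝ) (ω : ℝ) (i : Fin d) : ℝ :=
  if i.val < ℓ then (1 - theta ℓ w) / (1 + ω) else 1

/-- The deficit is `ℓ (ω + θ) / (1 + ω)`, and `ℓ (ω + θ) = 1`. -/
theorem IsWeight.sum_coordDim (hw : IsWeight ℓ w ω) :
    ∑ i, coordDim ℓ w ω i = d - 1 / (1 + ω) := by
  have h1 := hw.omega_pos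
  have h2 := hw.theta_eq
  have h3 := Finset.card_filter_add_card_filter_not (s := (Finset.univ : Finset (Fin d)))
    (fun i : Fin d => i.val < ℓ)
  rw [hw.card_lt, Finset.card_univ, Fintype.card_fin] at h3
  have h4 : (ℓ : ℝ) + (Finset.univ.filter fun i : Fin d => ¬ i.val < ℓ).card = d := by
    exact_mod_cast h3
  unfold coordDim
  rw [Finset.sum_ite, Finset.sum_const, Finset.sum_const, hw.card_lt, nsmul_eq_mul, nsmul_eq_mul,
    mul_one, ← h4]
  field_simp
  linarith

/-- Let `j ≤ m` be the first level whose cells are shorter than `e^{-L}`, or `m` if there is none.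
In the first `ℓ` coordinates the gains before `j` add up to at least `(1 - θ) t_j`, up to errors
linear in `m`, while `L` is at most about `(1 + ω) t_j`. In the others both quantities are compared
with `(1 + w i) t_j`, so the ratio is `1`. -/
theorem coordDim_mul_le (hw : IsWeight ℓ w ω) {t L : ℝ} (ht : 1 ≤ t) {m : ℕ}
    (hm : L ≤ tSeq d ℓ t m) (i : Fin d) :
    coordDim ℓ w ω i * L ≤ (∑ n ∈ Finset.range m, if cellExp ℓ w t n i ≤ L then gain ℓ w t n i else 0)
      + 6 * xi d ℓ ^ 2 * (m + 1) * t := by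
  classical
  have ht0 : 0 ≤ t := by linarith
  have hξ := one_le_xi d ℓ
  obtain ⟨j, hjm, hj, hj'⟩ : ∃ j ≤ m, (∀ n < j, cellExp ℓ w t n i ≤ L) ∧
      (j = m ∨ L < cellExp ℓ w t j i) := by
    have hex : ∃ j, j = m ∨ L < cellExp ℓ w t j i := ⟨m, Or.inl rfl⟩
    refine ⟨Nat.find hex, Nat.find_min' hex (Or.inl rfl), fun n hn => ?_, Nat.find_spec hex⟩
    have := Nat.find_min hex hn
    push Not at this
    exact this.2
  have hjm' : (j : ℝ) ≤ m := by exact_mod_cast hjm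
  have hj0 : (0 : ℝ) ≤ j := j.cast_nonneg
  have hsum : ∑ n ∈ Finset.range j, gain ℓ w t n i
      ≤ ∑ n ∈ Finset.range m, if cellExp ℓ w t n i ≤ L then gain ℓ w t n i else 0 := by
    calc ∑ n ∈ Finset.range j, gain ℓ w t n i
        = ∑ n ∈ Finset.range j, if cellExp ℓ w t n i ≤ L then gain ℓ w t n i else 0 :=
          Finset.sum_congr rfl fun n hn => by rw [if_pos (hj n (Finset.mem_range.1 hn))]
      _ ≤ _ := by
          refine Finset.sum_le_sum_of_subset_of_nonneg (Finset.range_mono hjm) fun n _ _ => ?_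
          split_ifs
          · exact gain_nonneg hw ht0 n i
          · exact le_rfl
  have htj := tSeq_eq_sum (d := d) (ℓ := ℓ) t j
  have htj0 : 1 ≤ tSeq d ℓ t j := by
    have := one_add_le_tSeq (d := d) (ℓ := ℓ) ht j
    linarith
  have hsucc : tSeq d ℓ t (j + 1) = tSeq d ℓ t j + xi d ℓ * ((j : ℝ) + 1) * t := rfl
  have hstep : xi d ℓ * ((j : ℝ) + 1) * t ≤ xi d ℓ ^ 2 * (m + 1) * t := by
    have : xi d ℓ * ((j : ℝ) + 1) ≤ xi d ℓ ^ 2 * (m + 1) := by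
      refine mul_le_mul ?_ (by linarith) (by positivity) (by positivity)
      nlinarith
    gcongr
  have hone : 1 ≤ xi d ℓ ^ 2 * (m + 1) * t := by
    have : (1 : ℝ) ≤ m + 1 := by linarith
    exact one_le_mul_of_one_le_of_one_le
      (one_le_mul_of_one_le_of_one_le (one_le_pow₀ hξ) this) ht
  have hU0 : ∀ n, 0 ≤ scaleU d ℓ t n := scaleU_nonneg ht0
  have hUle : ∀ n : ℕ, scaleU d ℓ t (n + 1) ≤ xi d ℓ * ((n : ℝ) + 1) * t := fun n => by
    have := scaleU_le (d := d) (ℓ := ℓ) (t := t) (n + 1)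
    push_cast at this
    exact this
  by_cases hi : i.val < ℓ
  · have hθ := hw.theta_pos
    have hθ1 := hw.theta_lt_one
    have hω := hw.omega_pos
    have h1 : (1 - theta ℓ w) * (tSeq d ℓ t j - 1) ≤ ∑ n ∈ Finset.range j, gain ℓ w t n i := by
      rw [htj, add_sub_cancel_left, Finset.mul_sum]
      refine Finset.sum_le_sum fun n _ => ?_
      unfold gain bet
      rw [if_pos hi]
      have := hUle n
      nlinarith
    have h2 : L ≤ (1 + ω) * (tSeq d ℓ t j + xi d ℓ ^ 2 * (m + 1) * t) := by
      rcases hj' with rfl | h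
      · nlinarith
      · unfold cellExp bet at h
        rw [if_pos hi, hw.eq_top i hi, hsucc] at h
        have := mul_nonneg hθ.le (hU0 (j + 1))
        nlinarith
    have h3 : coordDim ℓ w ω i * L ≤ (1 - theta ℓ w) * (tSeq d ℓ t j + xi d ℓ ^ 2 * (m + 1) * t) := by
      rw [coordDim, if_pos hi, div_mul_eq_mul_div, div_le_iff₀ (by positivity)]
      nlinarith
    nlinarith
  · have hwi := hw.pos i
    have hwi1 : w i ≤ 1 := (hw.le_omega i).trans hw.omega_lt_one.le
    have h1 : (1 + w i) * (tSeq d ℓ t j - 1) - j * (xi d ℓ ^ 2 * t)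
        ≤ ∑ n ∈ Finset.range j, gain ℓ w t n i := by
      rw [htj, add_sub_cancel_left, Finset.mul_sum]
      have h2 : (j : ℝ) * (xi d ℓ ^ 2 * t) = ∑ _n ∈ Finset.range j, xi d ℓ ^ 2 * t := by simp
      rw [h2, ← Finset.sum_sub_distrib]
      refine Finset.sum_le_sum fun n _ => ?_
      unfold gain bet
      rw [if_neg hi]
      have h3 := le_scaleU_add (d := d) (ℓ := ℓ) ht0 (n + 1)
      push_cast at h3
      have h4 : w i * (xi d ℓ * ((n : ℝ) + 1) * t) ≤ w i * scaleU d ℓ t (n + 1) + xi d ℓ ^ 2 * t := by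
        have h5 : 0 ≤ xi d ℓ ^ 2 * t := by positivity
        nlinarith
      linarith
    have h2 : L ≤ (1 + w i) * tSeq d ℓ t j + 3 * (xi d ℓ ^ 2 * (m + 1) * t) := by
      rcases hj' with rfl | h
      · nlinarith
      · unfold cellExp bet at h
        rw [if_neg hi, hsucc] at h
        have h5 := hUle j
        have h6 : w i * scaleU d ℓ t (j + 1) ≤ xi d ℓ * ((j : ℝ) + 1) * t := by
          have := hU0 (j + 1)
          nlinarith
        have h7 : w i * (xi d ℓ * ((j : ℝ) + 1) * t) ≤ xi d ℓ * ((j : ℝ) + 1) * t :=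
          mul_le_of_le_one_left (by positivity) hwi1
        nlinarith
    rw [coordDim, if_neg hi, one_mul]
    have h3 : (j : ℝ) * (xi d ℓ ^ 2 * t) ≤ xi d ℓ ^ 2 * (m + 1) * t := by
      have : 0 ≤ xi d ℓ ^ 2 * t := by positivity
      nlinarith
    linarith

/-- Constant factors and powers of `n` lost at each level amount to `m log m` in the exponent, which
is absorbed by the quadratic growth of `t_m`. -/
theorem exists_bound_mul_log {η a b D : ℝ} (hη : 0 < η) (hD : 0 ≤ D) :
    ∃ C, ∀ m : ℕ, a * (m + 1) + b + D * ((m + 1) * log (m + 1)) ≤ η * ((m : ℝ) ^ 2 / 2) + C := by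
  set c := η / (16 * (D + 1)) with hc
  have hc0 : 0 < c := by positivity
  set a' := |a| + D * |log c| with ha'
  have ha0 : 0 ≤ a' := by positivity
  refine ⟨|b| + 16 * a' ^ 2 / η + η, fun m => ?_⟩
  set x : ℝ := (m : ℝ) + 1 with hx
  have hx0 : 0 < x := by positivity
  have h1 : log x ≤ c * x + |log c| := by
    have h2 := log_le_sub_one_of_pos (mul_pos hc0 hx0)
    rw [log_mul hc0.ne' hx0.ne'] at h2
    have := neg_abs_le (log c)
    linarith
  have h2 : D * (x * log x) ≤ D * c * x ^ 2 + D * |log c| * x := by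
    have : D * x * log x ≤ D * x * (c * x + |log c|) := by gcongr
    nlinarith
  have h3 : D * c ≤ η / 16 := by
    rw [hc, mul_div_assoc', div_le_div_iff₀ (by positivity) (by norm_num)]
    nlinarith
  have h4 : D * c * x ^ 2 ≤ η / 16 * x ^ 2 := by gcongr
  have h5 : a * x ≤ |a| * x := by gcongr; exact le_abs_self a
  have h6 : a' * x ≤ η / 16 * x ^ 2 + 16 * a' ^ 2 / η := by
    have h7 : 0 ≤ (η * x - 16 * a') ^ 2 := sq_nonneg _
    have h8 : η / 16 * x ^ 2 + 16 * a' ^ 2 / η - a' * x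
      = ((η * x - 16 * a') ^ 2 + 16 * (η * x * a')) / (16 * η) := by
      field_simp; ring
    have h9 : 0 ≤ ((η * x - 16 * a') ^ 2 + 16 * (η * x * a')) / (16 * η) := by positivity
    linarith
  have h7 : x ^ 2 ≤ 2 * (m : ℝ) ^ 2 + 2 := by
    rw [hx]; nlinarith [sq_nonneg ((m : ℝ) - 1)]
  have h8 : η / 8 * x ^ 2 ≤ η / 8 * (2 * (m : ℝ) ^ 2 + 2) := by gcongr
  have h9 := le_abs_self b
  have h10 : (|a| + D * |log c|) * x = a' * x := rfl
  nlinarith [sq_nonneg (m : ℝ)]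

theorem exists_tSeq_lt_le {t L : ℝ} (ht : 1 ≤ t) (hL : 1 < L) :
    ∃ m : ℕ, tSeq d ℓ t m < L ∧ L ≤ tSeq d ℓ t (m + 1) := by
  classical
  have hex : ∃ m, L ≤ tSeq d ℓ t m := by
    obtain ⟨m, hm⟩ := exists_nat_gt L
    exact ⟨m, by linarith [one_add_le_tSeq (d := d) (ℓ := ℓ) ht m]⟩
  have h0 : Nat.find hex ≠ 0 := fun h => by
    have := Nat.find_spec hex
    rw [h, tSeq] at this
    linarith
  obtain ⟨m, hm⟩ := Nat.exists_eq_succ_of_ne_zero h0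
  refine ⟨m, not_le.1 (Nat.find_min hex (by omega)), ?_⟩
  have := Nat.find_spec hex
  rwa [hm] at this

theorem sq_div_two_le_tSeq {t : ℝ} (ht : 1 ≤ t) (m : ℕ) : (m : ℝ) ^ 2 / 2 ≤ tSeq d ℓ t m := by
  induction m with
  | zero => simp [tSeq]
  | succ m ih =>
    rw [tSeq]
    have h1 := one_le_xi d ℓ
    have h2 : (0 : ℝ) ≤ m := m.cast_nonneg
    have h3 : (m : ℝ) + 1 ≤ xi d ℓ * ((m : ℝ) + 1) * t := by
      have : (m : ℝ) + 1 ≤ xi d ℓ * ((m : ℝ) + 1) := by nlinarith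
      nlinarith
    push_cast
    nlinarith

/-- The number of vertices near a point, compared with the number of all vertices. -/
theorem exists_prod_bound (hw : IsWeight ℓ w ω) {t : ℝ} (ht : 1 ≤ t) {A η : ℝ} (hA : 1 ≤ A)
    (hη : 0 < η) : ∃ C, ∀ L, 1 < L → ∃ m : ℕ,
      ∏ n ∈ Finset.range m, (A * ((n : ℝ) + 1) ^ d *
        exp (-∑ i, if cellExp ℓ w t n i ≤ L then gain ℓ w t n i else 0))
      ≤ exp (C - (d - 1 / (1 + ω) - η) * L) := by
  obtain ⟨C, hC⟩ := exists_bound_mul_log (η := η) (a := log A + d * (6 * xi d ℓ ^ 2 * t))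
    (b := d * (6 * xi d ℓ ^ 2 * t)) (D := d) hη d.cast_nonneg
  refine ⟨C, fun L hL => ?_⟩
  -- The level is chosen by `t_k < L ≤ t_{k+1}`, so that `L` exceeds `k² / 2` and all gains up to
  -- `L` are included.
  obtain ⟨k, hk1, hk2⟩ := exists_tSeq_lt_le (d := d) (ℓ := ℓ) ht hL
  refine ⟨k + 1, ?_⟩
  have hA0 : 0 < A := by linarith
  have h1 : ∏ n ∈ Finset.range (k + 1), (A * ((n : ℝ) + 1) ^ d) ≤
      exp ((k + 1) * (log A + d * log (k + 1))) := by
    have h2 : ∀ n ∈ Finset.range (k + 1), A * ((n : ℝ) + 1) ^ d ≤ exp (log A + d * log (k + 1)) := by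
      intro n hn
      have hn' : (n : ℝ) ≤ k := by
        exact_mod_cast Nat.lt_succ_iff.1 (Finset.mem_range.1 hn)
      rw [exp_add, exp_log hA0, ← log_pow, exp_log (by positivity)]
      gcongr
    refine (Finset.prod_le_prod (fun n _ => by positivity) h2).trans (le_of_eq ?_)
    rw [Finset.prod_const, Finset.card_range, ← exp_nat_mul]
    push_cast; rfl
  rw [Finset.prod_mul_distrib, ← exp_sum]
  refine (mul_le_mul_of_nonneg_right h1 (exp_pos _).le).trans ?_
  rw [← exp_add]
  refine exp_le_exp.2 ?_
  rw [Finset.sum_neg_distrib, Finset.sum_comm]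
  have h3 : ∑ i, coordDim ℓ w ω i * L ≤ ∑ i, ((∑ n ∈ Finset.range (k + 1),
      if cellExp ℓ w t n i ≤ L then gain ℓ w t n i else 0)
        + 6 * xi d ℓ ^ 2 * ((k + 1 : ℕ) + 1) * t) :=
    Finset.sum_le_sum fun i _ => coordDim_mul_le hw ht hk2 i
  rw [← Finset.sum_mul, hw.sum_coordDim, Finset.sum_add_distrib, Finset.sum_const,
    Finset.card_univ, Fintype.card_fin, nsmul_eq_mul] at h3
  have h4 := hC k
  have h5 := sq_div_two_le_tSeq (d := d) (ℓ := ℓ) ht k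
  have h6 : η * ((k : ℝ) ^ 2 / 2) ≤ η * L := by gcongr; linarith
  push_cast at h3
  linarith

end WeightedSingular
end

/-! ### Limit points of paths and the lower bound for the dimension. -/

noncomputable section
namespace WeightedSingular
open Real Filter Topology

variable {d ℓ : ℕ} {w : Fin d → ℝ} {ω : ℝ}

/-- The hypothesis says that the interval of radius `r (n + 1)` about `a (n + 1)` lies in that of
radius `r n` about `a n`. -/
theorem exists_limit_of_nested {a r : ℕ → ℝ} (h : ∀ n, |a n - a (n + 1)| + r (n + 1) ≤ r n)
    (hr : Tendsto r atTop (𝓝 0)) : ∃ x, Tendsto a atTop (𝓝 x) ∧ ∀ n, |a n - x| ≤ r n := by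
  have h1 : ∀ n k, |a n - a (n + k)| + r (n + k) ≤ r n := by
    intro n k
    induction k with
    | zero => simp
    | succ k ih =>
      have h2 := h (n + k)
      have h3 := abs_sub_le (a n) (a (n + k)) (a (n + k + 1))
      rw [← add_assoc]
      linarith
  have hanti : Antitone r := antitone_nat_of_succ_le fun n => by
    linarith [h n, abs_nonneg (a n - a (n + 1))]
  have hr0 : ∀ n, 0 ≤ r n := fun n => hanti.le_of_tendsto hr n
  have h2 : ∀ n m, n ≤ m → |a n - a m| ≤ r n := fun n m hnm => by
    obtain ⟨k, rfl⟩ := Nat.exists_eq_add_of_le hnm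
    linarith [h1 n k, hr0 (n + k)]
  have hcauchy : CauchySeq a := by
    refine cauchySeq_of_le_tendsto_0 (fun n => 2 * r n) (fun n m N hn hm => ?_) ?_
    · rw [dist_eq]
      have h3 := h2 N n hn
      have h4 := h2 N m hm
      have h5 := abs_sub_le (a n) (a N) (a m)
      rw [abs_sub_comm (a n) (a N)] at h5
      linarith
    · simpa using hr.const_mul 2
  obtain ⟨x, hx⟩ := cauchySeq_tendsto_of_complete hcauchy
  refine ⟨x, hx, fun n => ?_⟩
  refine le_of_tendsto ((tendsto_const_nhds.sub hx).abs) ?_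
  filter_upwards [eventually_ge_atTop n] with m hm
  exact h2 n m hm

/-- The half sides of the boxes `beta`. -/
def radius (ℓ : ℕ) (w : Fin d → ℝ) (ε t : ℝ) (i : Fin d) : ℕ → ℝ
  | 0 => exp (-w i * tSeq d ℓ t 1)
  | n + 1 => epsSeq ε (n + 1) * exp (-w i * tSeq d ℓ t (n + 2) - tSeq d ℓ t (n + 1))

theorem mem_beta_iff {ε t : ℝ} {n : ℕ} {τ x : EuclideanSpace ℝ (Fin d)} :
    x ∈ beta w ℓ ε t n τ ↔ ∀ i, |τ i - x i| ≤ radius ℓ w ε t i n := by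
  cases n <;> rfl

theorem epsSeq_le {ε : ℝ} (hε : 0 < ε) (n : ℕ) : epsSeq ε (n + 1) ≤ ε :=
  div_le_self hε.le (by push_cast; linarith [(n.cast_nonneg : (0 : ℝ) ≤ n)])

theorem epsSeq_pos {ε : ℝ} (hε : 0 < ε) (n : ℕ) : 0 < epsSeq ε (n + 1) := by
  unfold epsSeq; positivity

theorem tendsto_radius (hw : IsWeight ℓ w ω) {ε t : ℝ} (hε : 0 < ε) (hε1 : ε ≤ 1) (ht : 1 ≤ t)
    (i : Fin d) : Tendsto (radius ℓ w ε t i) atTop (𝓝 0) := by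
  rw [← tendsto_add_atTop_iff_nat 1]
  have h1 : Tendsto (fun n : ℕ => exp (-(n : ℝ))) atTop (𝓝 0) :=
    tendsto_exp_neg_atTop_nhds_zero.comp tendsto_natCast_atTop_atTop
  refine squeeze_zero (fun n => ?_) (fun n => ?_) h1
  · have := epsSeq_pos hε n
    simp only [radius]; positivity
  · simp only [radius]
    refine (mul_le_of_le_one_left (exp_pos _).le ((epsSeq_le hε n).trans hε1)).trans
      (exp_le_exp.2 ?_)
    have h2 := one_add_le_tSeq (d := d) (ℓ := ℓ) ht (n + 1)
    have h3 := one_add_le_tSeq (d := d) (ℓ := ℓ) ht (n + 2)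
    push_cast at h2 h3
    have h4 : 0 ≤ w i * tSeq d ℓ t (n + 2) :=
      mul_nonneg (hw.pos i).le (by linarith [(n.cast_nonneg : (0 : ℝ) ≤ n)])
    linarith

/-- The box of a son lies in the box of its father. For positive height this rests on `ε_{n+2} (1 +
1/(n+1)) = ε_{n+1}`, the next radius being smaller by a factor of at least `n + 1`; at the root `ε ≤
1/4` leaves room. -/
theorem epsSeq_mul_add_radius_le (hw : IsWeight ℓ w ω) {ε t : ℝ} (hε : 0 < ε) (hε1 : ε ≤ 1 / 4)
    (ht : 1 ≤ t) (i : Fin d) (n : ℕ) :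
    epsSeq ε (n + 1) * exp (-w i * tSeq d ℓ t (n + 1) - tSeq d ℓ t n) + radius ℓ w ε t i (n + 1)
      ≤ radius ℓ w ε t i n := by
  have hwi := hw.pos i
  have hξ := one_le_xi d ℓ
  have hmono := tSeq_mono (d := d) (ℓ := ℓ) (t := t) (by linarith)
  have hstep : ∀ k, tSeq d ℓ t k + (k + 1) ≤ tSeq d ℓ t (k + 1) := fun k => by
    rw [tSeq]
    have h1 : (0 : ℝ) ≤ k := k.cast_nonneg
    have : (k : ℝ) + 1 ≤ xi d ℓ * ((k : ℝ) + 1) * t := by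
      have h2 : (k : ℝ) + 1 ≤ xi d ℓ * ((k : ℝ) + 1) := by nlinarith
      nlinarith
    linarith
  have hlow := fun k => one_add_le_tSeq (d := d) (ℓ := ℓ) ht k
  cases n with
  | zero =>
    simp only [radius, zero_add]
    have h1 : epsSeq ε 1 ≤ 1 / 4 := (epsSeq_le hε 0).trans hε1
    have h0 : 0 < epsSeq ε 1 := epsSeq_pos hε 0
    have h2 : exp (-w i * tSeq d ℓ t 1 - tSeq d ℓ t 0) ≤ exp (-w i * tSeq d ℓ t 1) :=
      exp_le_exp.2 (by simp only [tSeq]; linarith)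
    have h3 : exp (-w i * tSeq d ℓ t (0 + 2) - tSeq d ℓ t 1) ≤ exp (-w i * tSeq d ℓ t 1) := by
      refine exp_le_exp.2 ?_
      have h4 := hmono (show 1 ≤ 0 + 2 by omega)
      have h5 := hlow 1
      push_cast at h5
      nlinarith
    have h6 := exp_pos (-w i * tSeq d ℓ t 1)
    nlinarith
  | succ n =>
    simp only [radius]
    set R := exp (-w i * tSeq d ℓ t (n + 2) - tSeq d ℓ t (n + 1)) with hR
    have hR0 : 0 < R := exp_pos _
    have h1 : exp (-w i * tSeq d ℓ t (n + 1 + 2) - tSeq d ℓ t (n + 1 + 1)) ≤ R / (n + 1) := by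
      rw [le_div_iff₀ (by positivity)]
      have h2 : (n : ℝ) + 1 ≤ exp n := add_one_le_exp _
      refine (mul_le_mul_of_nonneg_left h2 (exp_pos _).le).trans ?_
      rw [← exp_add, hR]
      refine exp_le_exp.2 ?_
      have h3 := hstep (n + 1)
      have h4 := mul_le_mul_of_nonneg_left (hmono (show n + 2 ≤ n + 1 + 2 by omega)) hwi.le
      push_cast at h3
      linarith
    have h0 := epsSeq_pos hε (n + 1)
    have h2 : epsSeq ε (n + 1 + 1) * (1 + 1 / ((n : ℝ) + 1)) = epsSeq ε (n + 1) := by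
      unfold epsSeq
      push_cast
      field_simp
    calc epsSeq ε (n + 1 + 1) * exp (-w i * tSeq d ℓ t (n + 1 + 1) - tSeq d ℓ t (n + 1))
          + epsSeq ε (n + 1 + 1) * exp (-w i * tSeq d ℓ t (n + 1 + 2) - tSeq d ℓ t (n + 1 + 1))
        ≤ epsSeq ε (n + 1 + 1) * R + epsSeq ε (n + 1 + 1) * (R / (n + 1)) := by
          gcongr
      _ = epsSeq ε (n + 1 + 1) * (1 + 1 / ((n : ℝ) + 1)) * R := by ring
      _ = epsSeq ε (n + 1) * R := by rw [h2]

/-- A point of the fractal lies within one cell length of its vertex in every coordinate, so a ball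
may be tested on the vertices. -/
theorem radius_succ_le (hw : IsWeight ℓ w ω) {ε t : ℝ} (hε : 0 < ε) (hε1 : ε ≤ 1) (ht : 1 ≤ t)
    (i : Fin d) (n : ℕ) : radius ℓ w ε t i (n + 1) ≤ exp (-cellExp ℓ w t n i) := by
  simp only [radius]
  refine (mul_le_of_le_one_left (exp_pos _).le ((epsSeq_le hε n).trans hε1)).trans
    (exp_le_exp.2 ?_)
  have hwi := hw.pos i
  have ht0 : 0 ≤ t := by linarith
  have hξ := one_le_xi d ℓ
  have h1 := scaleU_nonneg (d := d) (ℓ := ℓ) ht0 (n + 1)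
  have h2 := scaleU_le (d := d) (ℓ := ℓ) (t := t) (n + 1)
  have h3 : tSeq d ℓ t (n + 2) = tSeq d ℓ t (n + 1) + xi d ℓ * (((n + 1 : ℕ) : ℝ) + 1) * t := rfl
  have h4 : bet ℓ w (scaleU d ℓ t (n + 1)) i ≤ w i * (xi d ℓ * (((n + 1 : ℕ) : ℝ) + 1) * t) := by
    unfold bet
    split_ifs
    · have h5 := mul_nonneg hw.theta_pos.le h1
      have : 0 ≤ w i * (xi d ℓ * (((n + 1 : ℕ) : ℝ) + 1) * t) := by positivity
      linarith
    · refine mul_le_mul_of_nonneg_left (h2.trans ?_) hwi.le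
      have : (0 : ℝ) ≤ xi d ℓ * t := by positivity
      nlinarith
  unfold cellExp
  rw [h3]
  linarith

/-- A function of the first `n` choices factors through a finite set. Limits of such functions are
then measurable. -/
theorem measurable_of_agree {α X : Type*} [MeasurableSpace X] {N : ℕ → ℕ} (hN : ∀ n, 0 < N n)
    {f : (∀ n, Fin (N n)) → α} (g : α → X) (n : ℕ)
    (h : ∀ ω ω', (∀ k < n, ω k = ω' k) → f ω = f ω') : Measurable fun ω => g (f ω) := by
  classical
  set ext : (∀ i : Finset.range n, Fin (N i)) → ∀ n, Fin (N n) := fun c k =>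
    if hk : k ∈ Finset.range n then c ⟨k, hk⟩ else ⟨0, hN k⟩ with hext
  have h1 : (fun ω => g (f ω)) = (fun c => g (f (ext c))) ∘ (Finset.range n).restrict := by
    funext ω
    refine congrArg g (h _ _ fun k hk => ?_)
    simp [hext, hk]
  rw [h1]
  exact (measurable_of_countable _).comp (Finset.measurable_restrict _)

/-- The limit points of the paths of the exact subtree lie in the fractal. The paths with limit in a
ball are covered by cylinders, counted level by level by `card_sons_near_le`, and
`exists_prod_bound` compares the count with the number of all cylinders. -/
theorem le_dimH_fractal (hw : IsWeight ℓ w ω) {ε r t c : ℝ} (hε : 0 < ε) (hεr : ε < r)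
    (hr : r ≤ 1 / 4) (ht : 1 ≤ t) (hc : 0 < c)
    (hsons : ∀ n P Q, Vert ℓ w ω ε r t n P Q → ∃ F : Finset ((Fin d → ℤ) × ℤ),
      c * epsSeq ε (n + 1) ^ d * exp (xi d ℓ * (n + 1) * t) ^ d ≤ F.card ∧
      ∀ V ∈ F, IsSon ℓ w ω ε r t n P Q V) {q : ℝ} (hq : 0 < q) (hqd : q < d - 1 / (1 + ω)) :
    ENNReal.ofReal q ≤ dimH (fractal w ℓ ε r t) := by
  classical
  have ht0 : 0 ≤ t := by linarith
  have hr0 : 0 < r := hε.trans hεr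
  set ν : ℕ → ℝ := fun n => c * epsSeq ε (n + 1) ^ d * exp (xi d ℓ * (n + 1) * t) ^ d with hν
  have hν0 : ∀ n, 0 < ν n := fun n => by
    have := epsSeq_pos hε n
    simp only [hν]; positivity
  -- Exactly the guaranteed number of sons is kept, rounded up to a positive integer.
  set N : ℕ → ℕ := fun n => ⌈ν n⌉₊ with hNdef
  have hN : ∀ n, 0 < N n := fun n => Nat.ceil_pos.2 (hν0 n)
  obtain ⟨path, p0, p1, p2, p3, p4⟩ := exists_paths
    (Vert := fun n (V : (Fin d → ℤ) × ℤ) => Vert ℓ w ω ε r t n V.1 V.2)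
    (Son := fun n V V' => IsSon ℓ w ω ε r t n V.1 V.2 V') (root := ((0, 1) : (Fin d → ℤ) × ℤ))
    (vert_zero hw hε hεr hr ht0) (N := N)
    (fun n V hV => by
      obtain ⟨F, hF, hF'⟩ := hsons n V.1 V.2 hV
      exact ⟨F, Nat.ceil_le.2 hF, hF'⟩)
    (fun n V V' h => h.vert hε)
  have hlim : ∀ o, ∃ x : EuclideanSpace ℝ (Fin d),
      Tendsto (fun n => ratVec (path o n).1 (path o n).2) atTop (𝓝 x) ∧
      ∀ n i, |ratVec (path o n).1 (path o n).2 i - x i| ≤ radius ℓ w ε t i n := by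
    intro o
    have h1 : ∀ i, ∃ y, Tendsto (fun n => ((path o n).1 i : ℝ) / (path o n).2) atTop (𝓝 y) ∧
        ∀ n, |((path o n).1 i : ℝ) / (path o n).2 - y| ≤ radius ℓ w ε t i n := fun i => by
      refine exists_limit_of_nested (fun n => ?_) (tendsto_radius hw hε (by linarith) ht i)
      have h2 := (p2 o n).close i
      have h3 := epsSeq_mul_add_radius_le hw hε (by linarith) ht i n
      linarith
    choose y hy hy' using h1
    refine ⟨WithLp.toLp 2 y, ?_, fun n i => hy' i n⟩
    exact ((PiLp.continuous_toLp 2 _).tendsto y).comp (tendsto_pi_nhds.2 hy)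
  choose x hx hx' using hlim
  have hmeas : Measurable x := by
    refine measurable_of_tendsto_metrizable
      (f := fun n o => ratVec (path o n).1 (path o n).2) (fun n => ?_) (tendsto_pi_nhds.2 hx)
    exact measurable_of_agree hN (fun V : (Fin d → ℤ) × ℤ => ratVec V.1 V.2) n
      fun o o' h => p3 o o' n h
  have hsub : Set.range x ⊆ fractal w ℓ ε r t := by
    rintro _ ⟨o, rfl⟩
    refine Set.mem_biUnion (x := fun n => ratVec (path o n).1 (path o n).2) ⟨?_, fun n => ?_⟩
      (Set.mem_iInter.2 fun n => mem_beta_iff.2 (hx' o n))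
    · ext i; simp [p0 o]
    · exact (p2 o n).mem_sons hw hε (by linarith) (by linarith)
  refine le_trans ?_ (dimH_mono hsub)
  set A : ℝ := max 1 (multConst d r * 5 ^ d / (c * ε ^ d)) with hA
  obtain ⟨C, hC⟩ := exists_prod_bound hw ht (A := A) (η := d - 1 / (1 + ω) - q)
    (le_max_left _ _) (by linarith)
  refine le_dimH_range hN hmeas hq (C := exp C) (exp_pos _) (ρ₀ := exp (-2)) (exp_pos _)
    fun y ρ hρ hρ' => ?_
  set L := -log ρ with hL
  have hρL : ρ = exp (-L) := by rw [hL, neg_neg, exp_log hρ]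
  have hL1 : 1 < L := by
    rw [hρL] at hρ'
    linarith [exp_le_exp.1 hρ']
  obtain ⟨m, hm⟩ := hC L hL1
  set S : ℕ → ℝ := fun n => ∑ i, if cellExp ℓ w t n i ≤ L then gain ℓ w t n i else 0 with hS
  -- The condition is imposed at positive heights `k + 1` only; the root is unconstrained.
  obtain ⟨𝒜, h𝒜, h𝒜'⟩ := exists_finset_cylinders hN path p3
    (fun n (V : (Fin d → ℤ) × ℤ) => ∀ k, n = k + 1 → ∀ i, |(V.1 i : ℝ) / V.2 - y i|
      ≤ exp (-L) + exp (-cellExp ℓ w t k i))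
    (M := fun n => multConst d r * 5 ^ d * exp (xi d ℓ * (n + 1) * t) ^ d * exp (-S n))
    (fun o n J hJ => by
      have h1 : (J.image fun j => path (Function.update o n j) (n + 1)).card = J.card :=
        Finset.card_image_of_injective _ (p4 o n)
      rw [← h1]
      refine card_sons_near_le hw hε (by linarith) hr0 ht0 (P := (path o n).1) (Q := (path o n).2)
        (y := y) (fun V hV => ?_) fun V hV => ?_
      · obtain ⟨j, hj, rfl⟩ := Finset.mem_image.1 hV
        have h2 := p2 (Function.update o n j) n
        rwa [p3 (Function.update o n j) o n fun k hk => Function.update_of_ne hk.ne _ _] at h2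
      · obtain ⟨j, hj, rfl⟩ := Finset.mem_image.1 hV
        exact hJ j hj n rfl) m
  refine ⟨m, 𝒜, h𝒜.trans ?_, fun o ho => h𝒜' o fun n k hk i => ?_⟩
  · have h1 : ∀ n : ℕ, multConst d r * 5 ^ d * exp (xi d ℓ * (n + 1) * t) ^ d * exp (-S n)
        ≤ A * ((n : ℝ) + 1) ^ d * exp (-S n) * N n := by
      intro n
      have h2 : multConst d r * 5 ^ d / (c * ε ^ d) ≤ A := le_max_right _ _
      rw [div_le_iff₀ (by positivity)] at h2
      have h3 : ν n ≤ N n := Nat.le_ceil _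
      have hA0 : 0 < A := lt_of_lt_of_le one_pos (le_max_left _ _)
      calc multConst d r * 5 ^ d * exp (xi d ℓ * (n + 1) * t) ^ d * exp (-S n)
          ≤ A * (c * ε ^ d) * exp (xi d ℓ * (n + 1) * t) ^ d * exp (-S n) := by gcongr
        _ = A * ((n : ℝ) + 1) ^ d * exp (-S n) * ν n := by
            simp only [hν, epsSeq, div_pow]
            push_cast
            generalize exp (xi d ℓ * ((n : ℝ) + 1) * t) = e
            field_simp
        _ ≤ A * ((n : ℝ) + 1) ^ d * exp (-S n) * N n := by gcongr
    refine (Finset.prod_le_prod (fun n _ => by positivity) fun n _ => h1 n).trans ?_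
    rw [Finset.prod_mul_distrib]
    refine mul_le_mul_of_nonneg_right (hm.trans (le_of_eq ?_))
      (Finset.prod_nonneg fun n _ => Nat.cast_nonneg _)
    rw [hρL, ← exp_mul, ← exp_add]
    ring_nf
  · subst hk
    have h1 := hx' o (k + 1) i
    have h2 := radius_succ_le hw hε (by linarith) ht i k
    have h3 : |x o i - y i| ≤ exp (-L) := by
      rw [← hρL]
      refine le_trans ?_ ho
      rw [dist_eq_norm]
      exact PiLp.norm_apply_le (x o - y) i
    have h4 := abs_sub_le (((path o (k + 1)).1 i : ℝ) / (path o (k + 1)).2) (x o i) (y i)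
    have h5 : ratVec (path o (k + 1)).1 (path o (k + 1)).2 i
      = ((path o (k + 1)).1 i : ℝ) / (path o (k + 1)).2 := rfl
    rw [h5] at h1
    linarith

end WeightedSingular
end

open WeightedSingular in
theorem proposition4 (d ℓ : ℕ) (hℓ : 1 ≤ ℓ) (hℓd : ℓ < d) (w : Fin d → ℝ)
    (hpos : ∀ i, 0 < w i) (hsum : ∑ i, w i = 1) (hanti : Antitone w)
    (heq : ∀ i : Fin d, i.val < ℓ → w i = w ⟨0, by omega⟩)
    (hlt : ∀ i : Fin d, ℓ ≤ i.val → w i < w ⟨0, by omega⟩) :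
    (∃ r₀ : ℝ, 0 < r₀ ∧ ∀ ε r : ℝ, 0 < ε → ε < r → r < r₀ →
      ∃ t₀ : ℝ, 1 ≤ t₀ ∧ ∀ t : ℝ, t₀ ≤ t →
        fractal w ℓ ε r t ⊆ Sing w ∧
        ENNReal.ofReal ((d : ℝ) - 1 / (1 + w ⟨0, by omega⟩)) ≤ dimH (fractal w ℓ ε r t)) ∧
    ENNReal.ofReal ((d : ℝ) - 1 / (1 + w ⟨0, by omega⟩)) ≤ dimH (Sing w) := by
  have hw : IsWeight ℓ w (w ⟨0, by omega⟩) := ⟨hℓ, hℓd, hpos, hsum, hanti, heq, hlt⟩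
  obtain ⟨r₀, c, hr0, hr0', hc, hmain⟩ := exists_many_sons hw
  have key : ∀ ε r : ℝ, 0 < ε → ε < r → r < r₀ → ∃ t₀ : ℝ, 1 ≤ t₀ ∧ ∀ t : ℝ, t₀ ≤ t →
      fractal w ℓ ε r t ⊆ Sing w ∧
      ENNReal.ofReal ((d : ℝ) - 1 / (1 + w ⟨0, by omega⟩)) ≤ dimH (fractal w ℓ ε r t) := by
    intro ε r hε hεr hr
    obtain ⟨t₀, ht₀, hsons⟩ := hmain ε r hε hεr hr
    refine ⟨t₀, ht₀, fun t ht => ⟨fractal_subset_sing hw hε (by linarith) (ht₀.trans ht), ?_⟩⟩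
    -- The measure of a ball carries the factor `e^{ηL}`, so the bound is proved for every `q` below
    -- the claimed dimension.
    refine le_of_forall_lt fun b hb => ?_
    obtain ⟨q, -, hbq, hqd⟩ := ENNReal.lt_iff_exists_real_btwn.1 hb
    have hq : 0 < q := by
      by_contra! h
      rw [ENNReal.ofReal_of_nonpos h] at hbq
      exact not_lt_zero hbq
    refine hbq.trans_le (le_dimH_fractal hw hε hεr (by linarith) (ht₀.trans ht) hc
      (hsons t ht) hq ?_)
    by_contra! h
    exact absurd hqd (not_lt.2 (ENNReal.ofReal_le_ofReal h))
  refine ⟨⟨r₀, hr0, key⟩, ?_⟩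
  obtain ⟨t₀, -, h⟩ := key (r₀ / 4) (r₀ / 2) (by linarith) (by linarith) (by linarith)
  obtain ⟨h1, h2⟩ := h t₀ le_rfl
  exact h2.trans (dimH_mono h1)
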